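/- **Setup.** Let $\mathbb F$ be a field, let $e>1$, $\ell\ge 1$, $N\ge n\ge 0$ be integers and $\underline s=(s_0,\dots,s_{\ell-1})\in\mathbb Z^\ell$. Put $R=\mathbb F[[z_0,\dots,z_{\ell-1}]]$ and $K=\operatorname{Frac}(R)$. Let $\mathcal P_\ell(j)$ be the set of $\ell$-multipartitions of $j$. A box in column $x$ and row $y$ of the $k$-th diagram has content $x-y+s_k$ and residue its content modulo $e$; an $i$-box is a box of residue $i$. For boxes $b,b'$ of the same residue, lying in diagrams $k,k'$, put $b<b'$ if the content of $b$ is smaller than that of $b'$, or if the contents are equal and $k<k'$; boxes of different residues are incomparable. For $\lambda,\lambda'\in\mathcal P_\ell(j)$ put $\lambda\le\lambda'$ if the boxes $b_1,\dots,b_j$ of $\lambda$ and $b_1',\dots,b_j'$ of $\lambda'$ can be ordered so that for every $r$ either $b_r<b_r'$ or $b_r,b'_r$ have the same content and lie in the same diagram. For $i\in\mathbb Z/e\mathbb Z$ the $i$-signature of $\lambda$ is the sequence of its addable (written $+$) and removable (written $-$) $i$-boxes in decreasing order. It is reduced by repeatedly deleting consecutive pairs $-+$. Call $\lambda$ singular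 if no $-$ survives, for any $i$. A *restricted $R$-deformed highest weight categorification of the Fock space $\mathcal F^{e,\underline s}$* in degrees $\le N$ consists of $R$-linear categories $\mathcal O_R(j)$, $0\le j\le N$, each the category of finitely generated modules over an $R$-algebra that is a finitely generated $R$-module, of $R$-linear functors $E_i:\mathcal O_R(j)\to\mathcal O_R(j-1)$ and $F_i:\mathcal O_R(j-1)\to\mathcal O_R(j)$ for $i\in\mathbb Z/e\mathbb Z$, $1\le j\le N$, biadjoint to each other with a fixed adjunction $1\to E_iF_i$, $F_iE_i\to1$, and of dots $X\in\operatorname{End}(E_i)$ and crossings $T: E_aE_b\to E_bE_a$ satisfying the relations of the KLR algebras of the cyclic quiver with $e$ vertices, such that: * $\mathcal O_R(j)$ is a highest weight category over $R$ with poset $(\mathcal P_\ell(j),\le)$, standard objects $\Delta_R(\lambda)$ and indecomposable projectives $P_R(\lambda)\twoheadrightarrow\Delta_R(\lambda)$; * all $E_i,F_i$ send standard objects to standardly filtered objects; * in the Grothendieck groups of the specializations to $\mathbb F$, $[E_i]$ (resp. $[F_i]$) sends $[\Delta_{\mathbb F}(\lambda)]$ to $\sum_\mu[\Delta_{\mathbb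 F}(\mu)]$, over all $\mu$ obtained from $\lambda$ by removing (resp. adding) an $i$-box; * for all $\lambda,i$ the object $F_i\Delta_R(\lambda)$ has a filtration, with quotients the standard objects $\Delta_R(\mu)$ in decreasing order of labels, preserved by the endomorphism $X$ of $F_i$ induced via the fixed adjunction, where $X$ acts on $\Delta_R(\mu)$ by $z_k$ if the box $\mu\setminus\lambda$ lies in the $k$-th diagram. Let $\mathcal O^1_R,\mathcal O^2_R$ be two such categorifications (same $\mathbb F,e,\underline s,N$), with objects marked by a superscript $i=1,2$. Put $F=\bigoplus_{a\in\mathbb Z/e\mathbb Z}F_a$, $P^i_R=F^n\Delta^i_R(\varnothing)\in\mathcal O^i_R(n)$ and $$\bar P^i_R=P^i_R\oplus\bigoplus_{\lambda}F^{n-1}P^i_R(\lambda)\ \ (e>2),\qquad \bar P^i_R=P^i_R\oplus\bigoplus_{\lambda}F^{n-1}P^i_R(\lambda)\oplus F^{n-2}P^i_R(\nu)\ \ (e=2),$$ where $\lambda$ runs over the singular multipartitions of $1$, $\nu=(\varnothing,\dots,\varnothing,(2))$, and negative powers of $F$ are read as $0$. Let $\bar{\mathcal C}^i_R(n)$ and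 $\mathcal C^i_R(n)$ be the categories of finitely generated right modules over $\operatorname{End}(\bar P^i_R)$ and $\operatorname{End}(P^i_R)$, let $\bar\pi^i_R=\operatorname{Hom}(\bar P^i_R,-):\mathcal O^i_R(n)\to\bar{\mathcal C}^i_R(n)$, $\pi^i_R=\operatorname{Hom}(P^i_R,-)$, and let $\underline\pi^i_R=\operatorname{Hom}(\bar\pi^i_R(P^i_R),-):\bar{\mathcal C}^i_R(n)\to\mathcal C^i_R(n)$, so that $\pi^i_R=\underline\pi^i_R\circ\bar\pi^i_R$. Subscripts $\mathbb F$, $K$ denote base change. **Assumptions.** * (F$_{-1}$) For $i=1,2$, $\pi^i_{\mathbb F}$ is faithful on standardly filtered objects of $\mathcal O^i_{\mathbb F}(n)$, and faithful on costandard objects. * (F$_0$) For $i=1,2$, $\bar\pi^i_K$ is fully faithful on standardly filtered objects of $\mathcal O^i_K(n)$. * (I) There is an $R$-linear equivalence $\Psi:\bar{\mathcal C}^1_R(n)\xrightarrow{\sim}\bar{\mathcal C}^2_R(n)$ that intertwines $\underline\pi^1_R$ and $\underline\pi^2_R$, where $\mathcal C^1_R(n)$ and $\mathcal C^2_R(n)$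 are identified through some isomorphism of $R$-algebras $\operatorname{End}(P^1_R)\cong\operatorname{End}(P^2_R)$, and that preserves the labels of indecomposable projectives: for $\lambda\in\mathcal P_\ell(n)$, $P^1_R(\lambda)$ is a direct summand of $\bar P^1_R$ if and only if $P^2_R(\lambda)$ is a direct summand of $\bar P^2_R$, and then $\Psi(\bar\pi^1_R P^1_R(\lambda))\cong\bar\pi^2_R P^2_R(\lambda)$. * (S) $\Psi_K(\bar\pi^1_K(\Delta^1_K(\lambda)))\cong\bar\pi^2_K(\Delta^2_K(\lambda))$ for all $\lambda\in\mathcal P_\ell(n)$. **Theorem.** Under these assumptions there is an $R$-linear equivalence $\Phi:\mathcal O^1_R(n)\xrightarrow{\sim}\mathcal O^2_R(n)$ with $\Phi(\Delta^1_R(\lambda))\cong\Delta^2_R(\lambda)$ for all $\lambda\in\mathcal P_\ell(n)$ and $\bar\pi^2_R\circ\Phi\cong\Psi\circ\bar\pi^1_R$. Moreover $\bar\pi^2_R$ has a right adjoint $(\bar\pi^2_R)^*$, and on the full subcategory of standardly filtered objects of $\mathcal O^1_R(n)$ there is an isomorphism of functors $\Phi\cong(\bar\pi^2_R)^*\circ\Psi\circ\bar\pi^1_R$.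 -/

import Mathlib

open CategoryTheory
open scoped TensorProduct

universe u

noncomputable section

namespace FockCat

/-! ### Finitely generated modules over an algebra, hom functors, base change -/

section Algebras

variable (S : Type u) [CommRing S] {A : Type u} [Ring A] [Algebra S A]

instance scalarModule (M : FGModuleCat.{u} A) : Module S M := Module.restrictScalars S A M

instance scalarTower (M : FGModuleCat.{u} A) : IsScalarTower S A M :=
  IsScalarTower.restrictScalars S A M

/-- Multiplication by `r`, as an endomorphism of an object of `A`-mod. -/
def scalarEnd (r : S) (M : FGModuleCat.{u} A) : M ⟶ M :=
  FGModuleCat.ofHom (r • (LinearMap.id : M →ₗ[A] M))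

/-- `S`-linearity of a functor between module categories of `S`-algebras: the functor is additive
and commutes with multiplication by scalars. -/
def IsLinearFunctor {B : Type u} [Ring B] [Algebra S B]
    (F : FGModuleCat.{u} A ⥤ FGModuleCat.{u} B) : Prop :=
  F.Additive ∧ ∀ (r : S) (M : FGModuleCat.{u} A), F.map (scalarEnd S r M) = scalarEnd S r (F.obj M)

theorem finite_obj [Module.Finite S A] (M : FGModuleCat.{u} A) : Module.Finite S M :=
  Module.Finite.trans A M

theorem finite_hom [IsNoetherianRing S] [Module.Finite S A] (P M : FGModuleCat.{u} A) :
    Module.Finite S (P →ₗ[A] M) := by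
  have := finite_obj S P
  have := finite_obj S M
  exact Module.Finite.of_injective (LinearMap.restrictScalarsₗ S A P M S)
    (LinearMap.restrictScalars_injective S)

instance finite_endOp [IsNoetherianRing S] [Module.Finite S A] (P : FGModuleCat.{u} A) :
    Module.Finite S (Module.End A P)ᵐᵒᵖ := by
  have := finite_hom S P P
  exact Module.Finite.equiv (MulOpposite.opLinearEquiv S)

/-- `Hom(P, M)` as a right module over `End(P)`, via precomposition. -/
instance homModule (P M : FGModuleCat.{u} A) : Module (Module.End A P)ᵐᵒᵖ (P →ₗ[A] M) where
  smul f g := g ∘ₗ f.unop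
  one_smul _ := rfl
  mul_smul _ _ _ := rfl
  smul_zero _ := LinearMap.zero_comp _
  smul_add _ _ _ := LinearMap.add_comp _ _ _
  add_smul _ _ _ := LinearMap.comp_add _ _ _
  zero_smul _ := LinearMap.comp_zero _

theorem homModule_smul (P M : FGModuleCat.{u} A) (f : (Module.End A P)ᵐᵒᵖ) (g : P →ₗ[A] M) :
    f • g = g ∘ₗ f.unop := rfl

theorem finite_homModule [IsNoetherianRing S] [Module.Finite S A] (P M : FGModuleCat.{u} A) :
    Module.Finite (Module.End A P)ᵐᵒᵖ (P →ₗ[A] M) := by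
  have := finite_hom S P M
  have : IsScalarTower S (Module.End A P)ᵐᵒᵖ (P →ₗ[A] M) := ⟨fun r f g => by
    ext x
    simp [homModule_smul]⟩
  exact Module.Finite.of_restrictScalars_finite S (Module.End A P)ᵐᵒᵖ (P →ₗ[A] M)

/-- The functor `Hom(P, -)` from `A`-mod to the category of finitely generated right modules over
`End(P)`, that is, left modules over the opposite algebra. -/
def homFunctor [IsNoetherianRing S] [Module.Finite S A] (P : FGModuleCat.{u} A) :
    FGModuleCat.{u} A ⥤ FGModuleCat.{u} (Module.End A P)ᵐᵒᵖ where
  obj M :=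
    have := finite_homModule S P M
    FGModuleCat.of _ (P →ₗ[A] M)
  map {M M'} h :=
    have := finite_homModule S P M
    have := finite_homModule S P M'
    FGModuleCat.ofHom
      { toFun := fun g => h.hom.hom ∘ₗ g
        map_add' := fun _ _ => LinearMap.comp_add _ _ _
        map_smul' := fun _ _ => rfl }

/-- Restriction along a homomorphism of `S`-algebras that are finite over `S`. -/
def restrictFG {B B' : Type u} [Ring B] [Ring B'] [Algebra S B] [Algebra S B'] [Module.Finite S B']
    (ρ : B →ₐ[S] B') : FGModuleCat.{u} B' ⥤ FGModuleCat.{u} B where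
  obj M := ⟨(ModuleCat.restrictScalars ρ.toRingHom).obj M.obj, by
    let _ : Module B M := Module.compHom M ρ.toRingHom
    have : IsScalarTower S B M := ⟨fun r b m => by
      change ρ (r • b) • m = r • (ρ b • m)
      rw [map_smul, smul_assoc]⟩
    have := finite_obj S M
    exact Module.Finite.of_restrictScalars_finite S B M⟩
  map h := ObjectProperty.homMk ((ModuleCat.restrictScalars ρ.toRingHom).map h.hom)

/-- Postcomposition: `End(Q)` acts on the object `Hom(P, Q)`. -/
def postcomp [IsNoetherianRing S] [Module.Finite S A] (P Q : FGModuleCat.{u} A) :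
    Module.End A Q →ₐ[S] Module.End (Module.End A P)ᵐᵒᵖ ((homFunctor S P).obj Q) where
  toFun f := ((homFunctor S P).map (FGModuleCat.ofHom f : Q ⟶ Q)).hom.hom
  map_one' := rfl
  map_mul' _ _ := rfl
  map_zero' := by
    ext g
    exact LinearMap.zero_comp g
  map_add' f f' := by
    ext g
    exact LinearMap.add_comp g f' f
  commutes' r := by
    refine LinearMap.ext fun (g : P →ₗ[A] Q) => ?_
    change (algebraMap S (Module.End A Q) r) ∘ₗ g =
      algebraMap S (Module.End A P)ᵐᵒᵖ r • g
    ext x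
    simp [homModule_smul, Module.algebraMap_end_apply]

variable (S' : Type u) [CommRing S'] [Algebra S S']

/-- The action of `S' ⊗ A` on `S' ⊗ M`, `(s ⊗ a) (t ⊗ m) = st ⊗ am`. -/
def baseChangeAction (M : FGModuleCat.{u} A) :
    S' ⊗[S] A →ₐ[S'] Module.End S' (S' ⊗[S] M) :=
  (Module.endTensorEndAlgHom (R := S) (S := S') (A := S') (M := S') (N := M)).comp
    (Algebra.TensorProduct.map (Algebra.lmul S' S') (Algebra.lsmul S S M))

/-- The base change of an object of `A`-mod from `S` to `S'`, an object of `(S' ⊗ A)`-mod. -/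
def baseChange [Module.Finite S A] (M : FGModuleCat.{u} A) : FGModuleCat.{u} (S' ⊗[S] A) :=
  let _ : Module (S' ⊗[S] A) (S' ⊗[S] M) :=
    Module.compHom (S' ⊗[S] M) (baseChangeAction S S' M).toRingHom
  have : IsScalarTower S' (S' ⊗[S] A) (S' ⊗[S] M) := ⟨fun r b m => by
    change baseChangeAction S S' M (r • b) m = r • baseChangeAction S S' M b m
    rw [map_smul, LinearMap.smul_apply]⟩
  have := finite_obj S M
  have : Module.Finite (S' ⊗[S] A) (S' ⊗[S] M) :=
    Module.Finite.of_restrictScalars_finite S' (S' ⊗[S] A) (S' ⊗[S] M)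
  FGModuleCat.of (S' ⊗[S] A) (S' ⊗[S] M)

end Algebras

section Exactness

variable {A : Type u} [Ring A]

/-- `0 → M' → M → M'' → 0` is exact. -/
def IsShortExact {M' M M'' : FGModuleCat.{u} A} (f : M' →ₗ[A] M) (g : M →ₗ[A] M'') : Prop :=
  Function.Injective f ∧ Function.Surjective g ∧ LinearMap.range f = LinearMap.ker g

/-- `Q` is a direct summand of `M`. -/
def IsSummand (Q M : FGModuleCat.{u} A) : Prop :=
  ∃ (i : Q →ₗ[A] M) (p : M →ₗ[A] Q), p ∘ₗ i = LinearMap.id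

/-- The relations `[M] = [M'] + [M'']` for short exact sequences `0 → M' → M → M'' → 0`. -/
def K0Relations (A : Type u) [Ring A] : AddSubgroup (FreeAbelianGroup (FGModuleCat.{u} A)) :=
  AddSubgroup.closure {x | ∃ (M' M M'' : FGModuleCat.{u} A) (f : M' →ₗ[A] M) (g : M →ₗ[A] M''),
    IsShortExact f g ∧
      x = FreeAbelianGroup.of M - FreeAbelianGroup.of M' - FreeAbelianGroup.of M''}

/-- The Grothendieck group of the category of finitely generated `A`-modules. -/
abbrev K0 (A : Type u) [Ring A] : Type (u + 1) :=
  FreeAbelianGroup (FGModuleCat.{u} A) ⧸ K0Relations A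

/-- The class of an object in the Grothendieck group. -/
def K0.cls (M : FGModuleCat.{u} A) : K0 A :=
  QuotientAddGroup.mk (FreeAbelianGroup.of M)

variable {Λ : Type}

/-- `M` has a finite filtration whose successive quotients are objects `Δ a` with `p a`. -/
inductive StdFiltered (p : Λ → Prop) (Δ : Λ → FGModuleCat.{u} A) : FGModuleCat.{u} A → Prop
  | zero (M : FGModuleCat.{u} A) (h : Subsingleton M) : StdFiltered p Δ M
  | step (M' M : FGModuleCat.{u} A) (a : Λ) (ha : p a) (f : M' →ₗ[A] M) (g : M →ₗ[A] Δ a)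
      (h : IsShortExact f g) (h' : StdFiltered p Δ M') : StdFiltered p Δ M

/-- The full subcategory of standardly filtered objects. -/
def stdFiltered (Δ : Λ → FGModuleCat.{u} A) : ObjectProperty (FGModuleCat.{u} A) :=
  StdFiltered (fun _ => True) Δ

/-- `A`-mod is a highest weight category over the local ring `R`, with standard objects `Δ a` and
partial order `le`; the object `P a` is the indecomposable projective covering `Δ a`. -/
structure IsHighestWeight (R : Type u) [CommRing R] [Algebra R A] (le : Λ → Λ → Prop)
    (Δ P : Λ → FGModuleCat.{u} A) : Prop where
  /-- standard objects are projective over the base ring -/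
  std_projective : ∀ a, Module.Projective R (Δ a)
  /-- the endomorphism ring of a standard object is the base ring -/
  std_end : ∀ a, Function.Bijective fun r : R => r • (LinearMap.id : Δ a →ₗ[A] Δ a)
  std_hom : ∀ a b (f : Δ a →ₗ[A] Δ b), f ≠ 0 → le a b
  /-- an object receiving no nonzero map from a standard object is zero -/
  std_generate : ∀ M : FGModuleCat.{u} A, (∀ a (f : Δ a →ₗ[A] M), f = 0) → Subsingleton M
  proj_projective : ∀ a, Module.Projective A (P a)
  proj_indecomposable : ∀ a (f : Module.End A (P a)), f * f = f → f = 0 ∨ f = 1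
  /-- the kernel of the projection of `P a` onto `Δ a` is filtered by `Δ b` with `b > a` -/
  proj_cover : ∀ a, ∃ (K : FGModuleCat.{u} A) (f : K →ₗ[A] P a) (g : P a →ₗ[A] Δ a),
    IsShortExact f g ∧ StdFiltered (fun b => le a b ∧ a ≠ b) Δ K

/-- `M` is the costandard object labelled by `a`, for a highest weight category over a field `k`:
`Hom(Δ b, M)` is one-dimensional for `b = a` and zero otherwise, and every extension of a standard
object by `M` splits. -/
structure IsCostandard (k : Type u) [Field k] [Algebra k A] (Δ : Λ → FGModuleCat.{u} A) (a : Λ)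
    (M : FGModuleCat.{u} A) : Prop where
  hom_self : Module.finrank k (Δ a →ₗ[A] M) = 1
  hom_ne : ∀ b, b ≠ a → ∀ f : Δ b →ₗ[A] M, f = 0
  ext_one : ∀ (b : Λ) (X : FGModuleCat.{u} A) (f : M →ₗ[A] X) (g : X →ₗ[A] Δ b),
    IsShortExact f g → ∃ t : Δ b →ₗ[A] X, g ∘ₗ t = LinearMap.id

/-- A functor is faithful on the objects satisfying `p`. -/
def FaithfulOn {B : Type u} [Ring B] (F : FGModuleCat.{u} A ⥤ FGModuleCat.{u} B)
    (p : FGModuleCat.{u} A → Prop) : Prop :=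
  ∀ M M', p M → p M' → Function.Injective (F.map : (M ⟶ M') → _)

/-- A functor is fully faithful on the objects satisfying `p`. -/
def FullyFaithfulOn {B : Type u} [Ring B] (F : FGModuleCat.{u} A ⥤ FGModuleCat.{u} B)
    (p : FGModuleCat.{u} A → Prop) : Prop :=
  ∀ M M', p M → p M' → Function.Bijective (F.map : (M ⟶ M') → _)

end Exactness

/-! ### Multipartitions -/

section Combinatorics

/-- A box: the component, the row and the column (rows and columns are numbered from `0`). -/
abbrev Box (ℓ : ℕ) : Type := Fin ℓ × ℕ × ℕ

/-- The set of boxes of a tuple of Young diagrams. -/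
def boxes {ℓ : ℕ} (t : Fin ℓ → YoungDiagram) : Set (Box ℓ) := {b | b.2 ∈ (t b.1).cells}

/-- `ℓ`-multipartitions of `n`. -/
abbrev MP (ℓ n : ℕ) : Type := {t : Fin ℓ → YoungDiagram // ∑ k, (t k).card = n}

theorem cell_lt (y : YoungDiagram) (i j : ℕ) (h : (i, j) ∈ y.cells) :
    i < y.card ∧ j < y.card := by
  constructor
  · have : (Finset.range (i + 1)).card ≤ y.cells.card :=
      Finset.card_le_card_of_injOn (fun k => (k, j))
        (fun k hk => y.isLowerSet
          (show ((k, j) : ℕ × ℕ) ≤ (i, j) from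
            ⟨Nat.lt_succ_iff.mp (Finset.mem_range.mp hk), le_rfl⟩) h)
        (fun a _ b _ hab => (Prod.ext_iff.mp hab).1)
    simpa using this
  · have : (Finset.range (j + 1)).card ≤ y.cells.card :=
      Finset.card_le_card_of_injOn (fun k => (i, k))
        (fun k hk => y.isLowerSet
          (show ((i, k) : ℕ × ℕ) ≤ (i, j) from
            ⟨le_rfl, Nat.lt_succ_iff.mp (Finset.mem_range.mp hk)⟩) h)
        (fun a _ b _ hab => (Prod.ext_iff.mp hab).2)
    simpa using this

instance finite_MP (ℓ n : ℕ) : Finite (MP ℓ n) := by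
  let g : MP ℓ n → (Fin ℓ → {c : Finset (ℕ × ℕ) //
      c ∈ (Finset.range n ×ˢ Finset.range n).powerset}) := fun t k => ⟨(t.1 k).cells, by
    rw [Finset.mem_powerset]
    rintro ⟨i, j⟩ hij
    have h1 := cell_lt (t.1 k) i j hij
    have h2 : (t.1 k).card ≤ n :=
      (Finset.single_le_sum (f := fun k => (t.1 k).card) (fun _ _ => Nat.zero_le _)
        (Finset.mem_univ k)).trans_eq t.2
    simp only [Finset.mem_product, Finset.mem_range]
    omega⟩
  refine Finite.of_injective g fun t t' h => ?_
  apply Subtype.ext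
  funext k
  apply YoungDiagram.ext
  exact congrArg Subtype.val (congrFun h k)

instance fintype_MP (ℓ n : ℕ) : Fintype (MP ℓ n) := Fintype.ofFinite _

/-- The multipartition `t'` is obtained from `t` by adding the box `b`. -/
def Adds {ℓ : ℕ} (t t' : Fin ℓ → YoungDiagram) (b : Box ℓ) : Prop :=
  b ∉ boxes t ∧ boxes t' = insert b (boxes t)

/-- The shifted content of a box, for the multi-charge `s`. -/
def content {ℓ : ℕ} (s : Fin ℓ → ℤ) (b : Box ℓ) : ℤ := (b.2.2 : ℤ) - (b.2.1 : ℤ) + s b.1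

/-- The residue of a box. -/
def residue {ℓ : ℕ} (e : ℕ) (s : Fin ℓ → ℤ) (b : Box ℓ) : ZMod e := (content s b : ZMod e)

/-- The strict order on boxes with the same residue. -/
def boxLT {ℓ : ℕ} (e : ℕ) (s : Fin ℓ → ℤ) (b b' : Box ℓ) : Prop :=
  residue e s b = residue e s b' ∧
    (content s b < content s b' ∨ (content s b = content s b' ∧ b.1 < b'.1))

/-- The non-strict version of `boxLT`: boxes with the same content in the same component are
equivalent. -/
def boxLE {ℓ : ℕ} (e : ℕ) (s : Fin ℓ → ℤ) (b b' : Box ℓ) : Prop :=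
  residue e s b = residue e s b' ∧
    (content s b < content s b' ∨ (content s b = content s b' ∧ b.1 ≤ b'.1))

/-- The partial order on multipartitions: the boxes can be matched in such a way that every box of
the first one is at most the corresponding box of the second one. -/
def mpLE {ℓ n : ℕ} (e : ℕ) (s : Fin ℓ → ℤ) (t t' : MP ℓ n) : Prop :=
  ∃ σ : boxes t.1 ≃ boxes t'.1, ∀ b, boxLE e s b.1 (σ b).1

/-- `L` is the list of all addable and all removable `i`-boxes of `t`, in decreasing order. -/
def IsSignatureList {ℓ : ℕ} (e : ℕ) (s : Fin ℓ → ℤ) (i : ZMod e) (t : Fin ℓ → YoungDiagram)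
    (L : List (Box ℓ)) : Prop :=
  (∀ b, b ∈ L ↔ residue e s b = i ∧ ∃ t', Adds t t' b ∨ Adds t' t b) ∧
    L.Pairwise fun b b' => boxLT e s b' b

open Classical in
/-- The sign of a box in the signature: `true` (plus) for an addable box and `false` (minus) for a
removable one. -/
def sign {ℓ : ℕ} (t : Fin ℓ → YoungDiagram) (b : Box ℓ) : Bool := decide (b ∉ boxes t)

/-- Cancellation of two consecutive signs, a minus followed by a plus. -/
def Cancels (w w' : List Bool) : Prop := ∃ l r, w = l ++ [false, true] ++ r ∧ w' = l ++ r

/-- `t` is singular: for every residue, no minus survives in the reduced signature, that is, all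
crystal operators lowering the number of boxes kill `t`. -/
def IsSingular {ℓ : ℕ} (e : ℕ) (s : Fin ℓ → ℤ) (t : Fin ℓ → YoungDiagram) : Prop :=
  ∀ i : ZMod e, ∃ L, IsSignatureList e s i t L ∧
    ∃ w, Relation.ReflTransGen Cancels (L.map (sign t)) w ∧ false ∉ w

/-- The empty multipartition. -/
def emptyMP (ℓ : ℕ) : MP ℓ 0 := ⟨fun _ => ⊥, by simp⟩

/-- The Young diagram with one row of length two. -/
def rowTwo : YoungDiagram where
  cells := {(0, 0), (0, 1)}
  isLowerSet := by
    rintro ⟨i, j⟩ ⟨i', j'⟩ ⟨h1, h2⟩ h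
    simp only [Finset.coe_insert, Finset.coe_singleton, Set.mem_insert_iff,
      Set.mem_singleton_iff, Prod.mk.injEq] at h ⊢
    simp only at h1 h2
    omega

/-- The multipartition `(∅, …, ∅, (2))`. -/
def nuMP (ℓ : ℕ) [NeZero ℓ] : MP ℓ 2 :=
  ⟨fun k => if (k : ℕ) + 1 = ℓ then rowTwo else ⊥, by
    have hl : 0 < ℓ := Nat.pos_of_ne_zero (NeZero.ne ℓ)
    rw [Finset.sum_eq_single (⟨ℓ - 1, by omega⟩ : Fin ℓ)]
    · have h : ((⟨ℓ - 1, by omega⟩ : Fin ℓ) : ℕ) + 1 = ℓ := Nat.sub_add_cancel hl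
      simp only [h, if_true]
      rfl
    · intro k _ hk
      have h : ¬ (k : ℕ) + 1 = ℓ := fun h => hk (Fin.ext (Nat.eq_sub_of_add_eq h))
      simp only [h, if_false]
      rfl
    · intro h
      exact absurd (Finset.mem_univ _) h⟩

end Combinatorics

/-! ### The KLR relations for the cyclic quiver with `e` vertices -/

section KLR

variable {e : ℕ} {Z : Type*} [Ring Z]

/-- The polynomial `Q_{ab}(u, v)` of the cyclic quiver. -/
def klrQ (a b : ZMod e) (u v : Z) : Z :=
  if a = b then 0
  else if e = 2 then -((u - v) ^ 2)
  else if b = a + 1 then v - u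
  else if a = b + 1 then u - v
  else 1

/-- The divided difference `(Q_{ab}(u, v) - Q_{ab}(w, v)) / (u - w)`. -/
def klrQ' (a b : ZMod e) (u v w : Z) : Z :=
  if a = b then 0
  else if e = 2 then -(u + w - 2 * v)
  else if b = a + 1 then -1
  else if a = b + 1 then 1
  else 0

variable {A : ℕ → Type u} [∀ j, Ring (A j)]

/-- The crossing `τ` evaluated at an object. -/
def cross {E : ZMod e → ∀ j, FGModuleCat.{u} (A (j + 1)) ⥤ FGModuleCat.{u} (A j)}
    (τ : ∀ a b j, E a (j + 1) ⋙ E b j ⟶ E b (j + 1) ⋙ E a j) (a b : ZMod e) (j : ℕ)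
    (M : FGModuleCat.{u} (A (j + 2))) :
    (E b j).obj ((E a (j + 1)).obj M) ⟶ (E a j).obj ((E b (j + 1)).obj M) :=
  (τ a b j).app M

/-- The dots `x` and the crossings `τ` satisfy the KLR relations on all composites of functors `E`
between the first `N + 1` categories (relations between distant strands hold by naturality). In a
composite, the functor that is applied first is the first strand. -/
structure IsKLRAction (N : ℕ)
    (E : ZMod e → ∀ j, FGModuleCat.{u} (A (j + 1)) ⥤ FGModuleCat.{u} (A j))
    (x : ∀ i j, E i j ⟶ E i j)
    (τ : ∀ a b j, E a (j + 1) ⋙ E b j ⟶ E b (j + 1) ⋙ E a j) : Prop where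
  dot_one : ∀ a b j, j + 2 ≤ N → a ≠ b → ∀ M,
    (E b j).map ((x a (j + 1)).app M) ≫ cross τ a b j M =
      cross τ a b j M ≫ (x a j).app ((E b (j + 1)).obj M)
  dot_two : ∀ a b j, j + 2 ≤ N → a ≠ b → ∀ M,
    (x b j).app ((E a (j + 1)).obj M) ≫ cross τ a b j M =
      cross τ a b j M ≫ (E a j).map ((x b (j + 1)).app M)
  dot_one_self : ∀ a j, j + 2 ≤ N → ∀ M,
    (E a j).map ((x a (j + 1)).app M) ≫ cross τ a a j M -
      cross τ a a j M ≫ (x a j).app ((E a (j + 1)).obj M) = 𝟙 _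
  dot_two_self : ∀ a j, j + 2 ≤ N → ∀ M,
    (x a j).app ((E a (j + 1)).obj M) ≫ cross τ a a j M -
      cross τ a a j M ≫ (E a j).map ((x a (j + 1)).app M) = -𝟙 _
  quadratic : ∀ a b j, j + 2 ≤ N → ∀ M,
    cross τ a b j M ≫ cross τ b a j M =
      klrQ (Z := End ((E b j).obj ((E a (j + 1)).obj M))) a b
        ((E b j).map ((x a (j + 1)).app M)) ((x b j).app ((E a (j + 1)).obj M))
  braid_ne : ∀ a b c j, j + 3 ≤ N → a ≠ c → ∀ M,
    (E c j).map (cross τ a b (j + 1) M) ≫ cross τ a c j ((E b (j + 2)).obj M) ≫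
        (E a j).map (cross τ b c (j + 1) M) =
      cross τ b c j ((E a (j + 2)).obj M) ≫ (E b j).map (cross τ a c (j + 1) M) ≫
        cross τ a b j ((E c (j + 2)).obj M)
  braid_eq : ∀ a b j, j + 3 ≤ N → ∀ M,
    (E a j).map (cross τ a b (j + 1) M) ≫ cross τ a a j ((E b (j + 2)).obj M) ≫
        (E a j).map (cross τ b a (j + 1) M) -
      cross τ b a j ((E a (j + 2)).obj M) ≫ (E b j).map (cross τ a a (j + 1) M) ≫
        cross τ a b j ((E a (j + 2)).obj M) =
      klrQ' (Z := End ((E a j).obj ((E b (j + 1)).obj ((E a (j + 2)).obj M)))) a b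
        ((E a j).map ((E b (j + 1)).map ((x a (j + 2)).app M)))
        ((E a j).map ((x b (j + 1)).app ((E a (j + 2)).obj M)))
        ((x a j).app ((E b (j + 1)).obj ((E a (j + 2)).obj M)))

end KLR

/-! ### Restricted deformed highest weight categorifications of Fock spaces -/

/-- The ring `𝔽[[z_0, …, z_{ℓ-1}]]`. -/
abbrev DefRing (𝔽 : Type u) [Field 𝔽] (ℓ : ℕ) : Type u := MvPowerSeries (Fin ℓ) 𝔽

/-- The residue field as an algebra: all variables act by zero. -/
instance residueAlgebra (𝔽 : Type u) [Field 𝔽] (ℓ : ℕ) : Algebra (DefRing 𝔽 ℓ) 𝔽 :=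
  (MvPowerSeries.constantCoeff (σ := Fin ℓ) (R := 𝔽)).toAlgebra

/-- The fraction field of `𝔽[[z_0, …, z_{ℓ-1}]]`. -/
abbrev FracField (𝔽 : Type u) [Field 𝔽] (ℓ : ℕ) : Type u := FractionRing (DefRing 𝔽 ℓ)

open Classical in
/-- A restricted deformed highest weight categorification of the Fock space with multi-charge `s`,
in degrees `0, …, N`. The degree `j` category is the category of finitely generated modules over
`A j`; the data in degrees above `N` is irrelevant and nothing is required of it. -/
structure FockCategorification (𝔽 : Type u) [Field 𝔽] (ℓ e : ℕ) (s : Fin ℓ → ℤ) (N : ℕ) where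
  A : ℕ → Type u
  [ring : ∀ j, Ring (A j)]
  [alg : ∀ j, Algebra (DefRing 𝔽 ℓ) (A j)]
  [finite : ∀ j, Module.Finite (DefRing 𝔽 ℓ) (A j)]
  /-- standard objects -/
  Δ : ∀ j, MP ℓ j → FGModuleCat.{u} (A j)
  /-- indecomposable projective objects -/
  P : ∀ j, MP ℓ j → FGModuleCat.{u} (A j)
  highestWeight : ∀ j, j ≤ N → IsHighestWeight (DefRing 𝔽 ℓ) (mpLE e s) (Δ j) (P j)
  E : ZMod e → ∀ j, FGModuleCat.{u} (A (j + 1)) ⥤ FGModuleCat.{u} (A j)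
  F : ZMod e → ∀ j, FGModuleCat.{u} (A j) ⥤ FGModuleCat.{u} (A (j + 1))
  linear_E : ∀ i j, j < N → IsLinearFunctor (DefRing 𝔽 ℓ) (E i j)
  linear_F : ∀ i j, j < N → IsLinearFunctor (DefRing 𝔽 ℓ) (F i j)
  /-- the fixed adjunction, with unit `1 → E F` and counit `F E → 1` -/
  adj : ∀ i j, j < N → (F i j ⊣ E i j)
  biadjoint : ∀ i j, j < N → Nonempty (E i j ⊣ F i j)
  x : ∀ i j, E i j ⟶ E i j
  τ : ∀ a b j, E a (j + 1) ⋙ E b j ⟶ E b (j + 1) ⋙ E a j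
  klr : IsKLRAction N E x τ
  std_E : ∀ i j, j < N → ∀ t, stdFiltered (Δ j) ((E i j).obj (Δ (j + 1) t))
  std_F : ∀ i j, j < N → ∀ t, stdFiltered (Δ (j + 1)) ((F i j).obj (Δ j t))
  /-- On the Grothendieck group of the specialization to `𝔽`, the operator `[E_i]` removes an
  `i`-box in all possible ways. (The specialization of a right exact linear functor takes the
  specialization of an object to the specialization of its image.) -/
  K0_E : ∀ i j, j < N → ∀ t : MP ℓ (j + 1),
    K0.cls (baseChange (DefRing 𝔽 ℓ) 𝔽 ((E i j).obj (Δ (j + 1) t))) =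
      ∑ t' : MP ℓ j with ∃ b, Adds t'.1 t.1 b ∧ residue e s b = i,
        K0.cls (baseChange (DefRing 𝔽 ℓ) 𝔽 (Δ j t'))
  /-- the operator `[F_i]` adds an `i`-box in all possible ways -/
  K0_F : ∀ i j, j < N → ∀ t : MP ℓ j,
    K0.cls (baseChange (DefRing 𝔽 ℓ) 𝔽 ((F i j).obj (Δ j t))) =
      ∑ t' : MP ℓ (j + 1) with ∃ b, Adds t.1 t'.1 b ∧ residue e s b = i,
        K0.cls (baseChange (DefRing 𝔽 ℓ) 𝔽 (Δ (j + 1) t'))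
  /-- `F_i Δ(t)` has a filtration `0 = G_0 ⊆ … ⊆ G_r` with quotients `G_{m+1} / G_m ≅ Δ(t'_m)`,
  in decreasing order of the labels, such that the endomorphism of `F_i` induced by `x` preserves
  the filtration and acts on `Δ(t'_m)` by `z_k`, where the box added to `t` to get `t'_m` lies in
  the component `k`. -/
  dot_F : ∀ i j (hj : j < N) (t : MP ℓ j),
    ∃ (r : ℕ) (G : ℕ → Submodule (A (j + 1)) ((F i j).obj (Δ j t)))
      (t' : Fin r → MP ℓ (j + 1)) (b : Fin r → Box ℓ),
      G 0 = ⊥ ∧ G r = ⊤ ∧ Monotone G ∧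
      (∀ m n : Fin r, m < n → mpLE e s (t' n) (t' m) ∧ t' n ≠ t' m) ∧
      ∀ m : Fin r, Adds t.1 (t' m).1 (b m) ∧ residue e s (b m) = i ∧
        Nonempty ((G ((m : ℕ) + 1) ⧸ (G (m : ℕ)).submoduleOf (G ((m : ℕ) + 1))) ≃ₗ[A (j + 1)] Δ (j + 1) (t' m)) ∧
        ∀ v ∈ G ((m : ℕ) + 1),
          (((conjugateEquiv (adj i j hj) (adj i j hj)).symm (x i j)).app (Δ j t)).hom.hom v -
            (MvPowerSeries.X (b m).1 : DefRing 𝔽 ℓ) • v ∈ G (m : ℕ)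

attribute [instance] FockCategorification.ring FockCategorification.alg FockCategorification.finite

namespace FockCategorification

variable {𝔽 : Type u} [Field 𝔽] {ℓ e : ℕ} {s : Fin ℓ → ℤ} {N : ℕ}

section Objects

variable (O : FockCategorification 𝔽 ℓ e s N) [NeZero e]

/-- The value of the functor `F = ⨁ F_i`. -/
def Fobj {j : ℕ} (M : FGModuleCat.{u} (O.A j)) : FGModuleCat.{u} (O.A (j + 1)) :=
  FGModuleCat.of (O.A (j + 1)) (∀ i : ZMod e, (O.F i j).obj M)

/-- The zero object in degree `j`. -/
def zeroObj (j : ℕ) : FGModuleCat.{u} (O.A j) := FGModuleCat.of (O.A j) PUnit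

/-- `F^n M` for `M` in degree `0`. -/
def iterZero (M : FGModuleCat.{u} (O.A 0)) : ∀ n, FGModuleCat.{u} (O.A n)
  | 0 => M
  | n + 1 => O.Fobj (iterZero M n)

/-- `F^{n-1} M` for `M` in degree `1` (zero for `n < 1`). -/
def iterOne (M : FGModuleCat.{u} (O.A 1)) : ∀ n, FGModuleCat.{u} (O.A n)
  | 0 => O.zeroObj 0
  | 1 => M
  | n + 2 => O.Fobj (iterOne M (n + 1))

/-- `F^{n-2} M` for `M` in degree `2` (zero for `n < 2`). -/
def iterTwo (M : FGModuleCat.{u} (O.A 2)) : ∀ n, FGModuleCat.{u} (O.A n)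
  | 0 => O.zeroObj 0
  | 1 => O.zeroObj 1
  | 2 => M
  | n + 3 => O.Fobj (iterTwo M (n + 2))

/-- The projective object `F^n Δ(∅)`. -/
def proj (n : ℕ) : FGModuleCat.{u} (O.A n) := O.iterZero (O.Δ 0 (emptyMP ℓ)) n

variable [NeZero ℓ]

/-- The summand `F^{n-2} P(ν)`, `ν = (∅, …, ∅, (2))`, present only for `e = 2`. -/
def nuPart (n : ℕ) : FGModuleCat.{u} (O.A n) :=
  if e = 2 then O.iterTwo (O.P 2 (nuMP ℓ)) n else O.zeroObj n

/-- The bigger projective object: the direct sum of `F^n Δ(∅)`, of `F^{n-1} P(t)` over all singular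
multipartitions `t` of `1` and, for `e = 2`, of `F^{n-2} P(ν)`. -/
def bigProj (n : ℕ) : FGModuleCat.{u} (O.A n) :=
  FGModuleCat.of (O.A n)
    (O.proj n × (∀ t : {t : MP ℓ 1 // IsSingular e s t.1}, O.iterOne (O.P 1 t.1) n) × O.nuPart n)

/-- The algebra defining the extended quotient category. -/
abbrev BigEnd (n : ℕ) : Type u := (Module.End (O.A n) (O.bigProj n))ᵐᵒᵖ

/-- The quotient functor to the extended quotient category. -/
abbrev piBar (n : ℕ) : FGModuleCat.{u} (O.A n) ⥤ FGModuleCat.{u} (O.BigEnd n) :=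
  homFunctor (DefRing 𝔽 ℓ) (O.bigProj n)

/-- The quotient functor from the extended quotient category to the category of modules over
`End(F^n Δ(∅))ᵒᵖ`: it is `Hom` from the image of `F^n Δ(∅)`. -/
def piUnder (n : ℕ) :
    FGModuleCat.{u} (O.BigEnd n) ⥤ FGModuleCat.{u} (Module.End (O.A n) (O.proj n))ᵐᵒᵖ :=
  homFunctor (DefRing 𝔽 ℓ) ((O.piBar n).obj (O.proj n)) ⋙
    restrictFG (DefRing 𝔽 ℓ) (AlgHom.op (postcomp (DefRing 𝔽 ℓ) (O.bigProj n) (O.proj n)))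

end Objects

/-- Condition (F_{-1}): over `𝔽`, the functor `Hom(F^n Δ(∅), -)` is faithful on standardly filtered
objects and on costandard objects. -/
def FMinusOne (O : FockCategorification 𝔽 ℓ e s N) [NeZero e] (n : ℕ) : Prop :=
  FaithfulOn (homFunctor 𝔽 (baseChange (DefRing 𝔽 ℓ) 𝔽 (O.proj n)))
      (stdFiltered fun t => baseChange (DefRing 𝔽 ℓ) 𝔽 (O.Δ n t)) ∧
    FaithfulOn (homFunctor 𝔽 (baseChange (DefRing 𝔽 ℓ) 𝔽 (O.proj n)))
      (fun M => ∃ t, IsCostandard 𝔽 (fun t => baseChange (DefRing 𝔽 ℓ) 𝔽 (O.Δ n t)) t M)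

/-- Condition (F_0): over the fraction field, the functor `Hom(P̄, -)`, where `P̄` is the bigger
projective object, is fully faithful on standardly filtered objects. -/
def FZero (O : FockCategorification 𝔽 ℓ e s N) [NeZero e] [NeZero ℓ] (n : ℕ) : Prop :=
  FullyFaithfulOn
    (homFunctor (FracField 𝔽 ℓ) (baseChange (DefRing 𝔽 ℓ) (FracField 𝔽 ℓ) (O.bigProj n)))
    (stdFiltered fun t => baseChange (DefRing 𝔽 ℓ) (FracField 𝔽 ℓ) (O.Δ n t))

end FockCategorification

/-- Condition (I): an equivalence of the extended quotient categories that intertwines the quotient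
functors to the category of modules over `End(F^n Δ(∅))ᵒᵖ` (for an identification of these algebras
for the two categorifications) and preserves the labels of indecomposable projective objects. -/
structure ExtendedQuotientEquiv {𝔽 : Type u} [Field 𝔽] {ℓ e : ℕ} {s : Fin ℓ → ℤ} {N : ℕ}
    [NeZero e] [NeZero ℓ] (O₁ O₂ : FockCategorification 𝔽 ℓ e s N) (n : ℕ) where
  equiv : FGModuleCat.{u} (O₁.BigEnd n) ≌ FGModuleCat.{u} (O₂.BigEnd n)
  linear : IsLinearFunctor (DefRing 𝔽 ℓ) equiv.functor
  identify : Module.End (O₁.A n) (O₁.proj n) ≃ₐ[DefRing 𝔽 ℓ] Module.End (O₂.A n) (O₂.proj n)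
  intertwines : Nonempty (O₁.piUnder n ≅ equiv.functor ⋙ O₂.piUnder n ⋙
    restrictFG (DefRing 𝔽 ℓ) (AlgHom.op identify.toAlgHom))
  labels : ∀ t : MP ℓ n, (IsSummand (O₁.P n t) (O₁.bigProj n) ↔
      IsSummand (O₂.P n t) (O₂.bigProj n)) ∧
    (IsSummand (O₁.P n t) (O₁.bigProj n) →
      Nonempty (equiv.functor.obj ((O₁.piBar n).obj (O₁.P n t)) ≅ (O₂.piBar n).obj (O₂.P n t)))

/-- Condition (S): over the fraction field, the equivalence identifies the images of the standard
objects with the same label in the extended quotient categories. (The quotient functors and the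
equivalence over the fraction field take the base change of an object to the base change of its
image, and the standard objects over the fraction field are base changes.) -/
def ExtendedQuotientEquiv.MatchesStandards {𝔽 : Type u} [Field 𝔽] {ℓ e : ℕ} {s : Fin ℓ → ℤ} {N : ℕ}
    [NeZero e] [NeZero ℓ] {O₁ O₂ : FockCategorification 𝔽 ℓ e s N} {n : ℕ}
    (I : ExtendedQuotientEquiv O₁ O₂ n) : Prop :=
  ∀ t : MP ℓ n, Nonempty
    (baseChange (DefRing 𝔽 ℓ) (FracField 𝔽 ℓ)
        (I.equiv.functor.obj ((O₁.piBar n).obj (O₁.Δ n t))) ≅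
      baseChange (DefRing 𝔽 ℓ) (FracField 𝔽 ℓ) ((O₂.piBar n).obj (O₂.Δ n t)))

end FockCat

end

/-! Write `X` for $P^i_R=F^n\Delta(\varnothing)$ and $\bar\pi$ for the functor $\mathrm{Hom}(\bar
P,-)$. The proof shows that $\bar\pi$ remembers the standardly filtered objects, that these have the
same images for both categorifications, and that a highest weight category is recovered from its
standardly filtered objects.

Full faithfulness over $R$: by (F$_{-1}$) over $\mathbb F$, `X` detects nonzero maps into
$\Delta/\mathfrak m\Delta$, hence into $N/\mathfrak mN$ for every standardly filtered $N$; Krull's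
intersection theorem and a twist by a functional extend this to $N/JN$ for every ideal $J$
(`detects_of_detects_residue`). The case $J=0$ gives faithfulness. By (F$_0$), a map $\varphi$
between images satisfies $r\varphi=\bar\pi(f)$ with $r\ne0$; since $f$ vanishes modulo $r$ on all
maps from `X`, it is divisible by $r$ (`exists_hom_ne_zero_smul`), so $\varphi$ lifts.

Faithfulness on costandard objects has two uses. Tilting objects reduce modulo the regular ideal
$\mathfrak m$ to objects with costandard filtrations, so they are quotients of powers of `X`
(`generatedBy_of_extInjective`); and every $\Delta(\lambda)$ occurs in every standard filtration of
`X` (`not_stdFiltered_ne`).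

Standard objects match: (S) gives isogenies between the images of $\Delta^1(\lambda)$ and
$\Delta^2(\lambda)$, which forbid maps against the order. The isomorphism of the images of $P^1_R$
and $P^2_R$, obtained from (I) by Yoneda, therefore respects the filtrations by rank. Its layers are
powers of standard objects, and because $R$ is local one matrix entry is an isomorphism
(`exists_std_equiv`).

Filtered objects match, by induction on rank: full faithfulness says nothing about extensions in
general, but it controls $\mathrm{Ext}^1(M,-)$ when $M$ is a quotient of a power of `X`, through a
presentation of $M$. Quotients of tilting objects are of this kind, so the tilting hull
$\Delta(\lambda)\to T\to M$ can be transported (`Pairing.exists_hull`). Every extension by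
$\Delta(\lambda)$ of an object of rank at most that of $\lambda$ is a pullback of this sequence, and
pullbacks are built in either category (`matches_succ`).

In particular the regular module of the first category has a counterpart $Y$ in the second. It is a
projective generator with the corresponding endomorphism ring, and $\Phi$ is the inverse of the
Morita functor $\mathrm{Hom}(Y,-)$. On filtered objects the unit of the adjunction for $\bar\pi^2$
is an isomorphism, by full faithfulness, which gives the last claim. -/

namespace FockCat

/-! ### Exact sequences, powers, pushouts and pullbacks of finitely generated modules -/

section ObjectConstructions

variable {A : Type u} [Ring A]

theorem IsShortExact.apply_eq_zero {M' M M'' : FGModuleCat.{u} A} {f : M' →ₗ[A] M}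
    {g : M →ₗ[A] M''} (h : IsShortExact f g) (x : M') : g (f x) = 0 := by
  have : f x ∈ LinearMap.ker g := h.2.2 ▸ LinearMap.mem_range_self f x
  exact this

theorem IsShortExact.comp_eq_zero {M' M M'' : FGModuleCat.{u} A} {f : M' →ₗ[A] M}
    {g : M →ₗ[A] M''} (h : IsShortExact f g) : g ∘ₗ f = 0 :=
  LinearMap.ext h.apply_eq_zero

theorem IsShortExact.exists_of_apply_eq_zero {M' M M'' : FGModuleCat.{u} A} {f : M' →ₗ[A] M}
    {g : M →ₗ[A] M''} (h : IsShortExact f g) {x : M} (hx : g x = 0) : ∃ y, f y = x := by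
  have : x ∈ LinearMap.range f := h.2.2 ▸ hx
  exact this

theorem isShortExact_of {M' M M'' : FGModuleCat.{u} A} {f : M' →ₗ[A] M} {g : M →ₗ[A] M''}
    (h₁ : Function.Injective f) (h₂ : Function.Surjective g) (h₃ : ∀ x, g (f x) = 0)
    (h₄ : ∀ x, g x = 0 → ∃ y, f y = x) : IsShortExact f g := by
  refine ⟨h₁, h₂, le_antisymm ?_ ?_⟩
  · rintro _ ⟨x, rfl⟩
    exact h₃ x
  · intro x hx
    exact h₄ x hx

/-- A map into an injective map's range factors through it. -/
theorem exists_factor_of_range_le {X M' M : Type*} [AddCommGroup X] [Module A X]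
    [AddCommGroup M'] [Module A M'] [AddCommGroup M] [Module A M] {f : M' →ₗ[A] M}
    (hf : Function.Injective f) (h : X →ₗ[A] M) (hh : ∀ x, ∃ y, f y = h x) :
    ∃ k : X →ₗ[A] M', f ∘ₗ k = h := by
  refine ⟨(LinearEquiv.ofInjective f hf).symm.toLinearMap ∘ₗ
    h.codRestrict (LinearMap.range f) hh, ?_⟩
  ext x
  have := congrArg Subtype.val ((LinearEquiv.ofInjective f hf).apply_symm_apply
    (h.codRestrict (LinearMap.range f) hh x))
  exact this

/-- A map killing the kernel of a surjective map factors through it. -/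
theorem exists_factor_of_ker_le {X M M'' : Type*} [AddCommGroup X] [Module A X]
    [AddCommGroup M] [Module A M] [AddCommGroup M''] [Module A M''] {g : M →ₗ[A] M''}
    (hg : Function.Surjective g) (h : M →ₗ[A] X) (hh : ∀ x, g x = 0 → h x = 0) :
    ∃ k : M'' →ₗ[A] X, k ∘ₗ g = h := by
  refine ⟨(LinearMap.ker g).liftQ h hh ∘ₗ
    (g.quotKerEquivOfSurjective hg).symm.toLinearMap, ?_⟩
  ext x
  have : (g.quotKerEquivOfSurjective hg).symm (g x) = (LinearMap.ker g).mkQ x := by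
    rw [LinearEquiv.symm_apply_eq]
    rfl
  rw [LinearMap.comp_apply, LinearMap.comp_apply, LinearEquiv.coe_coe, this]
  rfl

theorem IsShortExact.exists_lift {M' M M'' X : FGModuleCat.{u} A} {f : M' →ₗ[A] M}
    {g : M →ₗ[A] M''} (hs : IsShortExact f g) (h : X →ₗ[A] M) (hh : g ∘ₗ h = 0) :
    ∃ k : X →ₗ[A] M', f ∘ₗ k = h :=
  exists_factor_of_range_le hs.1 h fun x => hs.exists_of_apply_eq_zero (LinearMap.congr_fun hh x)

theorem IsShortExact.exists_desc {M' M M'' X : FGModuleCat.{u} A} {f : M' →ₗ[A] M}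
    {g : M →ₗ[A] M''} (hs : IsShortExact f g) (h : M →ₗ[A] X) (hh : h ∘ₗ f = 0) :
    ∃ k : M'' →ₗ[A] X, k ∘ₗ g = h := by
  refine exists_factor_of_ker_le hs.2.1 h fun x hx => ?_
  obtain ⟨y, rfl⟩ := hs.exists_of_apply_eq_zero hx
  exact LinearMap.congr_fun hh y

theorem comp_left_cancel {X M' M : Type*} [AddCommGroup X] [Module A X]
    [AddCommGroup M'] [Module A M'] [AddCommGroup M] [Module A M] {f : M' →ₗ[A] M}
    (hf : Function.Injective f) {h k : X →ₗ[A] M'} (e : f ∘ₗ h = f ∘ₗ k) : h = k :=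
  LinearMap.ext fun x => hf (LinearMap.congr_fun e x)

theorem comp_right_cancel {X M M'' : Type*} [AddCommGroup X] [Module A X]
    [AddCommGroup M] [Module A M] [AddCommGroup M''] [Module A M''] {g : M →ₗ[A] M''}
    (hg : Function.Surjective g) {h k : M'' →ₗ[A] X} (e : h ∘ₗ g = k ∘ₗ g) : h = k := by
  ext x
  obtain ⟨y, rfl⟩ := hg x
  exact LinearMap.congr_fun e y

theorem exists_quotient (M : FGModuleCat.{u} A) (S : Submodule A M) :
    ∃ (Q : FGModuleCat.{u} A) (q : M →ₗ[A] Q), Function.Surjective q ∧ LinearMap.ker q = S :=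
  ⟨FGModuleCat.of A (M ⧸ S), S.mkQ, S.mkQ_surjective, S.ker_mkQ⟩

theorem exists_cokernel {M' M : FGModuleCat.{u} A} (f : M' →ₗ[A] M) (hf : Function.Injective f) :
    ∃ (Q : FGModuleCat.{u} A) (q : M →ₗ[A] Q), IsShortExact f q := by
  obtain ⟨Q, q, h₁, h₂⟩ := exists_quotient M (LinearMap.range f)
  exact ⟨Q, q, hf, h₁, h₂.symm⟩

/-- The direct sum of two objects. -/
theorem exists_prod (M N : FGModuleCat.{u} A) :
    ∃ (X : FGModuleCat.{u} A) (i : M →ₗ[A] X) (j : N →ₗ[A] X) (p : X →ₗ[A] M) (q : X →ₗ[A] N),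
      p ∘ₗ i = LinearMap.id ∧ q ∘ₗ j = LinearMap.id ∧ q ∘ₗ i = 0 ∧ p ∘ₗ j = 0 ∧
        i ∘ₗ p + j ∘ₗ q = LinearMap.id :=
  ⟨FGModuleCat.of A (M × N), LinearMap.inl A M N, LinearMap.inr A M N, LinearMap.fst A M N,
    LinearMap.snd A M N, LinearMap.fst_comp_inl _ _ _, LinearMap.snd_comp_inr _ _ _,
    LinearMap.snd_comp_inl _ _ _, LinearMap.fst_comp_inr _ _ _, by ext <;> simp⟩

/-- `M` is the direct sum of `n` copies of `X`, with the given inclusions and projections. -/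
structure IsPow {X M : FGModuleCat.{u} A} {n : ℕ} (i : Fin n → (X →ₗ[A] M))
    (p : Fin n → (M →ₗ[A] X)) : Prop where
  proj_comp_incl : ∀ a b, p a ∘ₗ i b = if a = b then LinearMap.id else 0
  sum_eq : ∑ a, i a ∘ₗ p a = LinearMap.id

theorem exists_pow (M : FGModuleCat.{u} A) (n : ℕ) :
    ∃ (X : FGModuleCat.{u} A) (i : Fin n → (M →ₗ[A] X)) (p : Fin n → (X →ₗ[A] M)),
      IsPow i p := by
  refine ⟨FGModuleCat.of A (Fin n → M), fun a => LinearMap.single A (fun _ => M) a,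
    fun a => LinearMap.proj a, fun a b => ?_, ?_⟩
  · split_ifs with h
    · subst h
      exact LinearMap.proj_comp_single_same A (fun _ => M) a
    · exact LinearMap.proj_comp_single_ne A (fun _ => M) a b h
  · refine LinearMap.ext fun v => ?_
    change (∑ a, LinearMap.single A (fun _ => M) a ∘ₗ LinearMap.proj a) v = v
    simp only [LinearMap.coe_sum, Finset.sum_apply, LinearMap.comp_apply]
    exact Finset.univ_sum_single v

theorem pow_eq_sum {M X : FGModuleCat.{u} A} {n : ℕ} {i : Fin n → (M →ₗ[A] X)}
    {p : Fin n → (X →ₗ[A] M)} (h : ∑ a, i a ∘ₗ p a = LinearMap.id) (x : X) :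
    ∑ a, i a (p a x) = x := by
  simpa using LinearMap.congr_fun h x

theorem IsPow.proj_incl_apply {M X : FGModuleCat.{u} A} {n : ℕ} {i : Fin n → (M →ₗ[A] X)}
    {p : Fin n → (X →ₗ[A] M)} (h : IsPow i p) (a b : Fin n) (x : M) :
    p a (i b x) = if a = b then x else 0 := by
  have := LinearMap.congr_fun (h.proj_comp_incl a b) x
  split_ifs at this ⊢ with hab <;> exact this

theorem IsPow.sum_apply {M X : FGModuleCat.{u} A} {n : ℕ} {i : Fin n → (M →ₗ[A] X)}
    {p : Fin n → (X →ₗ[A] M)} (h : IsPow i p) (x : X) : ∑ a, i a (p a x) = x :=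
  pow_eq_sum h.sum_eq x

theorem IsPow.sum_proj {M X : FGModuleCat.{u} A} {n : ℕ} {i : Fin n → (M →ₗ[A] X)}
    {p : Fin n → (X →ₗ[A] M)} (h : IsPow i p) (a : Fin n) (x : Fin n → M) :
    p a (∑ b, i b (x b)) = x a := by
  simp [map_sum, h.proj_incl_apply]

theorem IsPow.ext {M X : FGModuleCat.{u} A} {n : ℕ} {i : Fin n → (M →ₗ[A] X)}
    {p : Fin n → (X →ₗ[A] M)} (h : IsPow i p) {x y : X} (hxy : ∀ a, p a x = p a y) : x = y := by
  rw [← h.sum_apply x, ← h.sum_apply y]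
  simp [hxy]

theorem exists_pushout {A' B X N : FGModuleCat.{u} A} {f : A' →ₗ[A] B} {g : B →ₗ[A] X}
    (hs : IsShortExact f g) (h : A' →ₗ[A] N) :
    ∃ (Y : FGModuleCat.{u} A) (f' : N →ₗ[A] Y) (h' : B →ₗ[A] Y) (g' : Y →ₗ[A] X),
      IsShortExact f' g' ∧ h' ∘ₗ f = f' ∘ₗ h ∧ g' ∘ₗ h' = g := by
  obtain ⟨Z, i, j, p, q, h₁, h₂, h₃, h₄, h₅⟩ := exists_prod N B
  have e₁ := LinearMap.congr_fun h₁
  have e₂ := LinearMap.congr_fun h₂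
  have e₃ := LinearMap.congr_fun h₃
  have e₄ := LinearMap.congr_fun h₄
  have e₅ := LinearMap.congr_fun h₅
  simp only [LinearMap.comp_apply, LinearMap.id_apply, LinearMap.zero_apply,
    LinearMap.add_apply] at e₁ e₂ e₃ e₄ e₅
  obtain ⟨Y, π, hπ, hk⟩ := exists_quotient Z (LinearMap.range (j ∘ₗ f - i ∘ₗ h))
  have hz : ∀ a, π (j (f a)) = π (i (h a)) := fun a => by
    have : (j ∘ₗ f - i ∘ₗ h) a ∈ LinearMap.ker π := hk ▸ LinearMap.mem_range_self _ a
    rw [LinearMap.mem_ker] at this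
    simpa [sub_eq_zero] using this
  have hker : ∀ z, π z = 0 → ∃ a, j (f a) - i (h a) = z := fun z hz => by
    have : z ∈ LinearMap.range (j ∘ₗ f - i ∘ₗ h) := hk ▸ hz
    simpa using this
  obtain ⟨g', hg'⟩ := exists_factor_of_ker_le hπ (g ∘ₗ q) fun z hz => by
    obtain ⟨a, rfl⟩ := hker z hz
    simp [e₂, e₃, hs.apply_eq_zero]
  have eg := LinearMap.congr_fun hg'
  simp only [LinearMap.comp_apply] at eg
  refine ⟨Y, π ∘ₗ i, π ∘ₗ j, g', isShortExact_of ?_ ?_ ?_ ?_, ?_, ?_⟩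
  · rw [injective_iff_map_eq_zero]
    intro x hx
    obtain ⟨a, ha⟩ := hker (i x) hx
    have h0 : f a = 0 := by
      have := congrArg q ha
      simpa [e₂, e₃] using this
    have h0' : a = 0 := hs.1 (by simpa using h0)
    have := congrArg p ha
    simpa [e₁, e₄, h0'] using this.symm
  · intro x
    obtain ⟨b, rfl⟩ := hs.2.1 x
    exact ⟨π (j b), by rw [eg, e₂]⟩
  · intro x
    change g' (π (i x)) = 0
    rw [eg, e₃, map_zero]
  · intro y hy
    obtain ⟨z, rfl⟩ := hπ y
    rw [eg] at hy
    obtain ⟨a, ha⟩ := hs.exists_of_apply_eq_zero hy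
    refine ⟨p z + h a, ?_⟩
    change π (i (p z + h a)) = π z
    conv_rhs => rw [← e₅ z, map_add, ← ha, hz]
    rw [map_add, map_add]
  · ext a
    exact hz a
  · ext b
    change g' (π (j b)) = g b
    rw [eg, e₂]

/-- Pushing out an extension of `X` by `N` to a quotient of `N`. -/
theorem exists_pushout_of_shortExact {N' N N'' Y X : FGModuleCat.{u} A} {f : N' →ₗ[A] N}
    {g : N →ₗ[A] N''} (hs : IsShortExact f g) {i : N →ₗ[A] Y} {q : Y →ₗ[A] X}
    (hiq : IsShortExact i q) :
    ∃ (Z : FGModuleCat.{u} A) (i' : N'' →ₗ[A] Z) (π : Y →ₗ[A] Z) (q' : Z →ₗ[A] X),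
      IsShortExact i' q' ∧ IsShortExact (i ∘ₗ f) π ∧ π ∘ₗ i = i' ∘ₗ g ∧ q' ∘ₗ π = q := by
  obtain ⟨Z, i', π, q', hs', h₁, h₂⟩ := exists_pushout hiq g
  have e₁ := LinearMap.congr_fun h₁
  have e₂ := LinearMap.congr_fun h₂
  simp only [LinearMap.comp_apply] at e₁ e₂
  refine ⟨Z, i', π, q', hs', ?_, h₁, h₂⟩
  refine isShortExact_of (hiq.1.comp hs.1) (fun z => ?_) (fun x => ?_) fun y hy => ?_
  · obtain ⟨y, hy⟩ := hiq.2.1 (q' z)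
    obtain ⟨n, hn⟩ := hs'.exists_of_apply_eq_zero (x := z - π y) (by rw [map_sub, e₂, hy, sub_self])
    obtain ⟨m, rfl⟩ := hs.2.1 n
    exact ⟨y + i m, by rw [map_add, e₁, hn, add_sub_cancel]⟩
  · change π (i (f x)) = 0
    rw [e₁, hs.apply_eq_zero, map_zero]
  · have := e₂ y
    rw [hy, map_zero] at this
    obtain ⟨n, rfl⟩ := hiq.exists_of_apply_eq_zero this.symm
    rw [e₁] at hy
    obtain ⟨x, rfl⟩ := hs.exists_of_apply_eq_zero (hs'.1 (by rw [hy, map_zero]))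
    exact ⟨x, rfl⟩

variable [IsNoetherianRing A]

theorem exists_subobject (M : FGModuleCat.{u} A) (S : Submodule A M) :
    ∃ (K : FGModuleCat.{u} A) (i : K →ₗ[A] M), Function.Injective i ∧ LinearMap.range i = S := by
  have : IsNoetherian A M := isNoetherian_of_isNoetherianRing_of_finite A M
  exact ⟨FGModuleCat.of A S, S.subtype, S.injective_subtype, S.range_subtype⟩

theorem exists_kernel {M M'' : FGModuleCat.{u} A} (g : M →ₗ[A] M'') :
    ∃ (K : FGModuleCat.{u} A) (i : K →ₗ[A] M),
      Function.Injective i ∧ LinearMap.range i = LinearMap.ker g :=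
  exists_subobject M _

theorem exists_kernel_of_surjective {M M'' : FGModuleCat.{u} A} (g : M →ₗ[A] M'')
    (hg : Function.Surjective g) : ∃ (K : FGModuleCat.{u} A) (i : K →ₗ[A] M), IsShortExact i g := by
  obtain ⟨K, i, h₁, h₂⟩ := exists_kernel g
  exact ⟨K, i, h₁, hg, h₂⟩

/-- Every map factors as a surjection followed by an injection. -/
theorem exists_image {M N : FGModuleCat.{u} A} (f : M →ₗ[A] N) :
    ∃ (I : FGModuleCat.{u} A) (q : M →ₗ[A] I) (i : I →ₗ[A] N),
      Function.Surjective q ∧ Function.Injective i ∧ i ∘ₗ q = f := by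
  obtain ⟨I, i, h₁, h₂⟩ := exists_subobject N (LinearMap.range f)
  obtain ⟨q, hq⟩ := exists_factor_of_range_le h₁ f fun x => by
    have : f x ∈ LinearMap.range i := h₂ ▸ LinearMap.mem_range_self f x
    exact this
  refine ⟨I, q, i, fun y => ?_, h₁, hq⟩
  have : i y ∈ LinearMap.range f := h₂ ▸ LinearMap.mem_range_self i y
  obtain ⟨x, hx⟩ := this
  exact ⟨x, h₁ (by rw [← hx, ← hq]; rfl)⟩

theorem exists_pullback {N Y Z X : FGModuleCat.{u} A} {f : N →ₗ[A] Y} {g : Y →ₗ[A] Z}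
    (hs : IsShortExact f g) (h : X →ₗ[A] Z) :
    ∃ (W : FGModuleCat.{u} A) (f' : N →ₗ[A] W) (h' : W →ₗ[A] Y) (g' : W →ₗ[A] X),
      IsShortExact f' g' ∧ h' ∘ₗ f' = f ∧ g ∘ₗ h' = h ∘ₗ g' := by
  obtain ⟨V, i, j, p, q, h₁, h₂, h₃, h₄, h₅⟩ := exists_prod Y X
  have e₁ := LinearMap.congr_fun h₁
  have e₂ := LinearMap.congr_fun h₂
  have e₃ := LinearMap.congr_fun h₃
  have e₄ := LinearMap.congr_fun h₄
  have e₅ := LinearMap.congr_fun h₅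
  simp only [LinearMap.comp_apply, LinearMap.id_apply, LinearMap.zero_apply,
    LinearMap.add_apply] at e₁ e₂ e₃ e₄ e₅
  obtain ⟨W, ι, hι, hr⟩ := exists_subobject V (LinearMap.ker (g ∘ₗ p - h ∘ₗ q))
  have hW : ∀ w, g (p (ι w)) = h (q (ι w)) := fun w => by
    have : ι w ∈ LinearMap.ker (g ∘ₗ p - h ∘ₗ q) := hr ▸ LinearMap.mem_range_self ι w
    simpa [sub_eq_zero] using this
  have hW' : ∀ v, g (p v) = h (q v) → ∃ w, ι w = v := fun v hv => by
    have : v ∈ LinearMap.range ι := hr ▸ (by simp [hv])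
    exact this
  obtain ⟨f', hf'⟩ := exists_factor_of_range_le hι (i ∘ₗ f) fun x =>
    hW' _ (by simp [e₁, e₃, hs.apply_eq_zero])
  have ef := LinearMap.congr_fun hf'
  simp only [LinearMap.comp_apply] at ef
  refine ⟨W, f', p ∘ₗ ι, q ∘ₗ ι, isShortExact_of ?_ ?_ ?_ ?_, ?_, ?_⟩
  · rw [injective_iff_map_eq_zero]
    intro x hx
    have := ef x
    rw [hx, map_zero] at this
    have := congrArg p this
    rw [e₁, map_zero] at this
    exact hs.1 (by rw [← this, map_zero])
  · intro x
    obtain ⟨y, hy⟩ := hs.2.1 (h x)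
    obtain ⟨w, hw⟩ := hW' (i y + j x) (by simp [e₁, e₂, e₃, e₄, hy])
    exact ⟨w, by simp [hw, e₂, e₃]⟩
  · intro x
    change q (ι (f' x)) = 0
    rw [ef, e₃]
  · intro w hw
    have hw' : q (ι w) = 0 := hw
    have := hW w
    rw [hw', map_zero] at this
    obtain ⟨x, hx⟩ := hs.exists_of_apply_eq_zero this
    refine ⟨x, hι ?_⟩
    rw [ef, hx]
    conv_rhs => rw [← e₅ (ι w), hw', map_zero, add_zero]
  · ext x
    change p (ι (f' x)) = f x
    rw [ef, e₁]
  · ext w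
    exact hW w

end ObjectConstructions

/-! ### Vanishing of first extensions, phrased as extension of maps -/

section ExtZero

variable {A : Type u} [Ring A]

/-- `Ext¹(X, N) = 0`, for finitely generated modules: maps to `N` extend along injections with
cokernel `X`. -/
def ExtZero (X N : FGModuleCat.{u} A) : Prop :=
  ∀ (M' M : FGModuleCat.{u} A) (f : M' →ₗ[A] M) (g : M →ₗ[A] X), IsShortExact f g →
    ∀ h : M' →ₗ[A] N, ∃ k : M →ₗ[A] N, k ∘ₗ f = h

theorem exists_section_of_retraction {M' M M'' : FGModuleCat.{u} A} {f : M' →ₗ[A] M}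
    {g : M →ₗ[A] M''} (hs : IsShortExact f g) {k : M →ₗ[A] M'} (hk : k ∘ₗ f = LinearMap.id) :
    ∃ t : M'' →ₗ[A] M, g ∘ₗ t = LinearMap.id ∧ k ∘ₗ t = 0 ∧ f ∘ₗ k + t ∘ₗ g = LinearMap.id := by
  have ek := LinearMap.congr_fun hk
  simp only [LinearMap.comp_apply, LinearMap.id_apply] at ek
  obtain ⟨t, ht⟩ := hs.exists_desc (LinearMap.id - f ∘ₗ k) (by ext x; simp [ek])
  have et := LinearMap.congr_fun ht
  simp only [LinearMap.comp_apply, LinearMap.id_apply, LinearMap.sub_apply] at et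
  refine ⟨t, ?_, ?_, ?_⟩
  · ext x
    obtain ⟨y, rfl⟩ := hs.2.1 x
    simp [et, hs.apply_eq_zero]
  · ext x
    obtain ⟨y, rfl⟩ := hs.2.1 x
    simp [et, ek]
  · ext x
    simp [et]

theorem ExtZero.exists_section {X N Y : FGModuleCat.{u} A} (hX : ExtZero X N) {f : N →ₗ[A] Y}
    {g : Y →ₗ[A] X} (hs : IsShortExact f g) :
    ∃ (t : X →ₗ[A] Y) (k : Y →ₗ[A] N), g ∘ₗ t = LinearMap.id ∧ k ∘ₗ f = LinearMap.id ∧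
      k ∘ₗ t = 0 ∧ f ∘ₗ k + t ∘ₗ g = LinearMap.id := by
  obtain ⟨k, hk⟩ := hX _ _ f g hs LinearMap.id
  obtain ⟨t, h₁, h₂, h₃⟩ := exists_section_of_retraction hs hk
  exact ⟨t, k, h₁, hk, h₂, h₃⟩

/-- Extending `φ` along `f` amounts to splitting the pushout of the extension along `φ`. Hence the
definition by extending maps agrees with the one by splitting extensions. -/
theorem extZero_of_sections {X N : FGModuleCat.{u} A}
    (h : ∀ (Y : FGModuleCat.{u} A) (f : N →ₗ[A] Y) (g : Y →ₗ[A] X), IsShortExact f g →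
      ∃ t : X →ₗ[A] Y, g ∘ₗ t = LinearMap.id) : ExtZero X N := by
  intro M' M f g hs φ
  obtain ⟨Y, f', h', g', hs', h₁, h₂⟩ := exists_pushout hs φ
  obtain ⟨t, ht⟩ := h Y f' g' hs'
  have et := LinearMap.congr_fun ht
  simp only [LinearMap.comp_apply, LinearMap.id_apply] at et
  obtain ⟨r, hr⟩ := hs'.exists_lift (LinearMap.id - t ∘ₗ g') (by ext x; simp [et])
  have er : r ∘ₗ f' = LinearMap.id := by
    refine comp_left_cancel hs'.1 ?_
    rw [← LinearMap.comp_assoc, hr]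
    ext x
    simp [hs'.apply_eq_zero]
  refine ⟨r ∘ₗ h', ?_⟩
  rw [LinearMap.comp_assoc, h₁, ← LinearMap.comp_assoc, er, LinearMap.id_comp]

theorem ExtZero.of_retract {X N N' : FGModuleCat.{u} A} (h : ExtZero X N) (i : N' →ₗ[A] N)
    (p : N →ₗ[A] N') (hp : p ∘ₗ i = LinearMap.id) : ExtZero X N' := fun M' M f g hs φ => by
  obtain ⟨k, hk⟩ := h M' M f g hs (i ∘ₗ φ)
  exact ⟨p ∘ₗ k, by rw [LinearMap.comp_assoc, hk, ← LinearMap.comp_assoc, hp, LinearMap.id_comp]⟩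

theorem ExtZero.of_equiv_right {X N N' : FGModuleCat.{u} A} (h : ExtZero X N) (e : N ≃ₗ[A] N') :
    ExtZero X N' :=
  h.of_retract e.symm.toLinearMap e.toLinearMap (by ext; simp)

theorem extZero_of_subsingleton {X N : FGModuleCat.{u} A} (h : Subsingleton X) : ExtZero X N := by
  intro M' M f g hs φ
  have hf : Function.Bijective f := ⟨hs.1, fun y =>
    hs.exists_of_apply_eq_zero (Subsingleton.elim _ _)⟩
  refine ⟨φ ∘ₗ (LinearEquiv.ofBijective f hf).symm.toLinearMap, ?_⟩
  ext x
  have : (LinearEquiv.ofBijective f hf).symm (f x) = x :=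
    (LinearEquiv.ofBijective f hf).symm_apply_apply x
  simp [this]

theorem ExtZero.pow_right {X N M : FGModuleCat.{u} A} {n : ℕ} {i : Fin n → (N →ₗ[A] M)}
    {p : Fin n → (M →ₗ[A] N)} (hs : IsPow i p) (h : ExtZero X N) :
    ExtZero X M := by
  intro M' M'' f g hfg φ
  choose k hk using fun a => h _ _ f g hfg (p a ∘ₗ φ)
  refine ⟨∑ a, i a ∘ₗ k a, ?_⟩
  ext x
  have := fun a => LinearMap.congr_fun (hk a) x
  simp only [LinearMap.comp_apply] at this
  simp [this, hs.sum_apply]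

/-- If a projective object surjects onto `X` with kernel `K`, then `Ext¹(X, N) = 0` as soon as maps
`K → N` extend. -/
theorem extZero_of_projective {K Q X N : FGModuleCat.{u} A} [Module.Projective A Q]
    {i : K →ₗ[A] Q} {π : Q →ₗ[A] X} (hs : IsShortExact i π)
    (h : ∀ φ : K →ₗ[A] N, ∃ k : Q →ₗ[A] N, k ∘ₗ i = φ) : ExtZero X N := by
  refine extZero_of_sections fun Y f g hfg => ?_
  obtain ⟨l, hl⟩ := Module.projective_lifting_property g π hfg.2.1
  obtain ⟨φ, hφ⟩ := hfg.exists_lift (l ∘ₗ i) (by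
    rw [← LinearMap.comp_assoc, hl, hs.comp_eq_zero])
  obtain ⟨k, hk⟩ := h φ
  obtain ⟨t, ht⟩ := hs.exists_desc (l - f ∘ₗ k) (by
    rw [LinearMap.sub_comp, LinearMap.comp_assoc, hk, hφ, sub_self])
  refine ⟨t, comp_right_cancel hs.2.1 ?_⟩
  rw [LinearMap.comp_assoc, ht, LinearMap.comp_sub, hl, ← LinearMap.comp_assoc, hfg.comp_eq_zero]
  simp

variable [IsNoetherianRing A]

/-- If `Ext¹(X, N) = 0` then maps from `X` lift along surjections with kernel `N`. -/
theorem ExtZero.exists_lift {X N Y Z : FGModuleCat.{u} A} (hX : ExtZero X N) {f : N →ₗ[A] Y}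
    {g : Y →ₗ[A] Z} (hs : IsShortExact f g) (h : X →ₗ[A] Z) : ∃ k : X →ₗ[A] Y, g ∘ₗ k = h := by
  obtain ⟨W, f', h', g', hs', h₁, h₂⟩ := exists_pullback hs h
  obtain ⟨t, -, ht, -⟩ := hX.exists_section hs'
  exact ⟨h' ∘ₗ t, by rw [← LinearMap.comp_assoc, h₂, LinearMap.comp_assoc, ht, LinearMap.comp_id]⟩

/-- A map is extended in two stages: first over the preimage of `X'` in `M`, whose quotient is `X'`,
then over `M`, whose quotient by that preimage is `X''`. -/
theorem ExtZero.extension_left {X' X X'' N : FGModuleCat.{u} A} {f : X' →ₗ[A] X} {g : X →ₗ[A] X''}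
    (hs : IsShortExact f g) (h' : ExtZero X' N) (h'' : ExtZero X'' N) : ExtZero X N := by
  intro M' M i q hiq φ
  obtain ⟨B, i', j, q', hs', h₁, h₂⟩ := exists_pullback hiq f
  obtain ⟨k, hk⟩ := h' _ _ i' q' hs' φ
  have e₂ := LinearMap.congr_fun h₂
  simp only [LinearMap.comp_apply] at e₂
  obtain ⟨l, hl⟩ := h'' B M j (g ∘ₗ q) (isShortExact_of (by
      rw [injective_iff_map_eq_zero]
      intro x hx
      have := e₂ x
      rw [hx, map_zero] at this
      obtain ⟨y, rfl⟩ := hs'.exists_of_apply_eq_zero (hs.1 (by rw [← this, map_zero]))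
      have h1 := LinearMap.congr_fun h₁ y
      simp only [LinearMap.comp_apply] at h1
      rw [hx] at h1
      have : y = 0 := hiq.1 (by rw [← h1, map_zero])
      rw [this, map_zero]) (hs.2.1.comp hiq.2.1) (fun x => by
        change g (q (j x)) = 0
        rw [e₂, hs.apply_eq_zero]) (fun x hx => by
      obtain ⟨y, hy⟩ := hs.exists_of_apply_eq_zero (x := q x) hx
      obtain ⟨b, rfl⟩ := hs'.2.1 y
      obtain ⟨a, ha⟩ := hiq.exists_of_apply_eq_zero (x := x - j b) (by rw [map_sub, e₂, hy, sub_self])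
      refine ⟨b + i' a, ?_⟩
      have h1 := LinearMap.congr_fun h₁ a
      simp only [LinearMap.comp_apply] at h1
      rw [map_add, h1, ha, add_sub_cancel])) k
  exact ⟨l, by rw [← h₁, ← LinearMap.comp_assoc, hl, hk]⟩

/-- The extension splits after pushing out to `N''`, and this section lifts because the obstruction
lies in `Ext¹(X, N')`. -/
theorem ExtZero.extension_right {X N' N N'' : FGModuleCat.{u} A} {f : N' →ₗ[A] N}
    {g : N →ₗ[A] N''} (hs : IsShortExact f g) (h' : ExtZero X N') (h'' : ExtZero X N'') :
    ExtZero X N := by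
  refine extZero_of_sections fun Y i q hiq => ?_
  obtain ⟨Z, i', π, q', hs', hex, h₁, h₂⟩ := exists_pushout_of_shortExact hs hiq
  obtain ⟨t, -, ht, -⟩ := h''.exists_section hs'
  obtain ⟨k, hk⟩ := h'.exists_lift hex t
  exact ⟨k, by rw [← h₂, LinearMap.comp_assoc, hk, ht]⟩

end ExtZero

end FockCat

/-! ### Standard filtrations and ranked highest weight categories -/

namespace FockCat

section Filtered

variable {A : Type u} [Ring A] {Λ : Type} {Δ : Λ → FGModuleCat.{u} A}

theorem StdFiltered.mono {p q : Λ → Prop} (h : ∀ a, p a → q a) {M : FGModuleCat.{u} A}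
    (hM : StdFiltered p Δ M) : StdFiltered q Δ M := by
  induction hM with
  | zero M hs => exact .zero M hs
  | step M' M a ha f g hfg _ ih => exact .step M' M a (h a ha) f g hfg ih

theorem StdFiltered.of_equiv {p : Λ → Prop} {M N : FGModuleCat.{u} A} (hM : StdFiltered p Δ M)
    (e : M ≃ₗ[A] N) : StdFiltered p Δ N := by
  cases hM with
  | zero _ hs => exact .zero N e.symm.toEquiv.subsingleton
  | step M' _ a ha f g hfg h' =>
    refine .step M' N a ha (e.toLinearMap ∘ₗ f) (g ∘ₗ e.symm.toLinearMap)
      (isShortExact_of (e.injective.comp hfg.1) (hfg.2.1.comp e.symm.surjective) (fun x => ?_)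
        fun x hx => ?_) h'
    · simp [hfg.apply_eq_zero]
    · obtain ⟨y, hy⟩ := hfg.exists_of_apply_eq_zero (x := e.symm x) hx
      exact ⟨y, by simp [hy]⟩

/-- Induction on the filtration of `M''`: the preimage in `M` of the penultimate step is an
extension of that step by `M'`. -/
theorem StdFiltered.extension {p : Λ → Prop} {M' M M'' : FGModuleCat.{u} A} {f : M' →ₗ[A] M}
    {g : M →ₗ[A] M''} (hs : IsShortExact f g) (h' : StdFiltered p Δ M')
    (h'' : StdFiltered p Δ M'') [IsNoetherianRing A] : StdFiltered p Δ M := by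
  induction h'' generalizing M with
  | zero M'' hM =>
    exact h'.of_equiv (LinearEquiv.ofBijective f
      ⟨hs.1, fun y => hs.exists_of_apply_eq_zero (Subsingleton.elim _ _)⟩)
  | step N M'' a ha i q hiq _ ih =>
    obtain ⟨W, f', h', g', hs', h₁, h₂⟩ := exists_pullback hs i
    refine .step W M a ha h' (q ∘ₗ g) ?_ (ih hs')
    have e₁ := LinearMap.congr_fun h₁
    have e₂ := LinearMap.congr_fun h₂
    simp only [LinearMap.comp_apply] at e₁ e₂
    refine isShortExact_of ?_ (hiq.2.1.comp hs.2.1) (fun x => ?_) fun x hx => ?_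
    · rw [injective_iff_map_eq_zero]
      intro w hw
      have := e₂ w
      rw [hw, map_zero] at this
      obtain ⟨x, rfl⟩ := hs'.exists_of_apply_eq_zero (hiq.1 (by rw [← this, map_zero]))
      rw [e₁] at hw
      have hx : x = 0 := hs.1 (by rw [hw, map_zero])
      rw [hx, map_zero]
    · change q (g (h' x)) = 0
      rw [e₂, hiq.apply_eq_zero]
    · obtain ⟨y, hy⟩ := hiq.exists_of_apply_eq_zero (x := g x) hx
      obtain ⟨w, rfl⟩ := hs'.2.1 y
      obtain ⟨z, hz⟩ := hs.exists_of_apply_eq_zero (x := x - h' w) (by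
        rw [map_sub, e₂, hy, sub_self])
      exact ⟨w + f' z, by rw [map_add, e₁, hz, add_sub_cancel]⟩

theorem StdFiltered.single {p : Λ → Prop} {a : Λ} (ha : p a) : StdFiltered p Δ (Δ a) :=
  .step (FGModuleCat.of A PUnit) (Δ a) a ha 0 LinearMap.id
    (isShortExact_of (fun _ _ _ => rfl) (fun x => ⟨x, rfl⟩) (fun _ => rfl)
      fun x hx => ⟨0, by simpa using hx.symm⟩)
    (.zero _ (inferInstanceAs (Subsingleton PUnit)))

theorem StdFiltered.hom_eq_zero {p : Λ → Prop} {M N : FGModuleCat.{u} A}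
    (hM : StdFiltered p Δ M) (h : ∀ a, p a → ∀ f : Δ a →ₗ[A] N, f = 0) (f : M →ₗ[A] N) :
    f = 0 := by
  induction hM with
  | zero M hs => exact LinearMap.ext fun x => by rw [Subsingleton.elim x 0, map_zero, map_zero]
  | step M' M a ha i q hiq _ ih =>
    obtain ⟨k, rfl⟩ := hiq.exists_desc f (ih _)
    rw [h a ha k, LinearMap.zero_comp]

theorem StdFiltered.hom_eq_zero_right {q : Λ → Prop} {N X : FGModuleCat.{u} A}
    (hN : StdFiltered q Δ N) (h : ∀ b, q b → ∀ f : X →ₗ[A] Δ b, f = 0) (f : X →ₗ[A] N) :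
    f = 0 := by
  induction hN with
  | zero M hs => exact LinearMap.ext fun x => Subsingleton.elim _ _
  | step M' M a ha i q hiq _ ih =>
    obtain ⟨k, rfl⟩ := hiq.exists_lift f (h a ha _)
    rw [ih k, LinearMap.comp_zero]

variable [IsNoetherianRing A]

theorem StdFiltered.extZero {p : Λ → Prop} {M N : FGModuleCat.{u} A}
    (hM : StdFiltered p Δ M) (h : ∀ a, p a → ExtZero (Δ a) N) : ExtZero M N := by
  induction hM with
  | zero M hs => exact extZero_of_subsingleton hs
  | step M' M a ha i q hiq _ ih => exact ExtZero.extension_left hiq ih (h a ha)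

theorem StdFiltered.pow {p : Λ → Prop} {X : FGModuleCat.{u} A} (hX : StdFiltered p Δ X) (n : ℕ) :
    ∀ {M : FGModuleCat.{u} A} (i : Fin n → (X →ₗ[A] M)) (π : Fin n → (M →ₗ[A] X)),
      IsPow i π → StdFiltered p Δ M := by
  induction n with
  | zero =>
    intro M i π h
    refine .zero M ⟨fun x y => ?_⟩
    have e := fun x => LinearMap.congr_fun h.sum_eq x
    simp only [Finset.univ_eq_empty, Finset.sum_empty, LinearMap.zero_apply,
      LinearMap.id_apply] at e
    rw [← e x, ← e y]
  | succ n ih =>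
    intro M i π h
    have e₁ := h.proj_incl_apply
    have e₂ := h.sum_apply
    obtain ⟨K, j, hj⟩ := exists_kernel_of_surjective (π 0) fun x => ⟨i 0 x, by simp [e₁]⟩
    refine StdFiltered.extension hj ?_ hX
    choose l hl using fun a : Fin n => hj.exists_lift (i a.succ) (by
      rw [h.proj_comp_incl, if_neg (Fin.succ_ne_zero a).symm])
    refine ih l (fun a => π a.succ ∘ₗ j) ⟨fun a b => ?_, comp_left_cancel hj.1 ?_⟩
    · rw [LinearMap.comp_assoc, hl, h.proj_comp_incl]
      simp
    · ext x
      have hx := e₂ (j x)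
      rw [Fin.sum_univ_succ, hj.apply_eq_zero, map_zero, zero_add] at hx
      have e := fun a y => LinearMap.congr_fun (hl a) y
      simp only [LinearMap.comp_apply] at e
      simp [e, hx]

end Filtered

/-- The properties of a highest weight category over a local ring that are used below, with the
order replaced by an injective rank function. -/
structure RankedHW (R : Type u) [CommRing R] {A : Type u} [Ring A] [Algebra R A] {Λ : Type}
    (ρ : Λ → ℕ) (Δ P : Λ → FGModuleCat.{u} A) : Prop where
  rank_injective : Function.Injective ρ
  std_projective : ∀ a, Module.Projective R (Δ a)
  std_end : ∀ a, Function.Bijective fun r : R => r • (LinearMap.id : Δ a →ₗ[A] Δ a)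
  std_hom : ∀ a b (f : Δ a →ₗ[A] Δ b), f ≠ 0 → ρ a ≤ ρ b
  std_generate : ∀ M : FGModuleCat.{u} A, (∀ a (f : Δ a →ₗ[A] M), f = 0) → Subsingleton M
  proj_projective : ∀ a, Module.Projective A (P a)
  proj_cover : ∀ a, ∃ (K : FGModuleCat.{u} A) (f : K →ₗ[A] P a) (g : P a →ₗ[A] Δ a),
    IsShortExact f g ∧ StdFiltered (fun b => ρ a < ρ b) Δ K

namespace RankedHW

variable {R : Type u} [CommRing R] {A : Type u} [Ring A] [Algebra R A] {Λ : Type}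
  {ρ : Λ → ℕ} {Δ P : Λ → FGModuleCat.{u} A}

theorem hom_eq_zero (H : RankedHW R ρ Δ P) {a b : Λ} (hab : ρ b < ρ a) (f : Δ a →ₗ[A] Δ b) :
    f = 0 := by
  by_contra h
  exact absurd (H.std_hom a b f h) (not_le.mpr hab)

theorem filt_hom_eq_zero (H : RankedHW R ρ Δ P) {p q : Λ → Prop} {M N : FGModuleCat.{u} A}
    (hM : StdFiltered p Δ M) (hN : StdFiltered q Δ N) (hpq : ∀ a b, p a → q b → ρ b < ρ a)
    (f : M →ₗ[A] N) : f = 0 :=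
  hM.hom_eq_zero (fun a ha => hN.hom_eq_zero_right fun b hb => H.hom_eq_zero (hpq a b ha hb)) f

/-- Standard objects are projective over `R`, so each step of the filtration splits `R`-linearly. -/
theorem projective_of_filt (H : RankedHW R ρ Δ P) {p : Λ → Prop} {M : FGModuleCat.{u} A}
    (hM : StdFiltered p Δ M) : Module.Projective R M := by
  induction hM with
  | zero M hs => infer_instance
  | step M' M a ha f g hfg _ ih =>
    have := H.std_projective a
    obtain ⟨s, hs⟩ := Module.projective_lifting_property (g.restrictScalars R) LinearMap.id hfg.2.1
    have es := LinearMap.congr_fun hs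
    simp only [LinearMap.comp_apply, LinearMap.id_apply, LinearMap.coe_restrictScalars] at es
    refine Module.Projective.of_equiv (LinearEquiv.ofBijective
      ((f.restrictScalars R).coprod s) ⟨?_, fun x => ?_⟩)
    · rw [injective_iff_map_eq_zero]
      rintro ⟨x, y⟩ hxy
      simp only [LinearMap.coprod_apply, LinearMap.coe_restrictScalars] at hxy
      have h0 := congrArg g hxy
      rw [map_add, hfg.apply_eq_zero, zero_add, es, map_zero] at h0
      rw [h0, map_zero, add_zero] at hxy
      rw [Prod.mk_eq_zero]
      exact ⟨hfg.1 (by rw [hxy, map_zero]), h0⟩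
    · obtain ⟨y, hy⟩ := hfg.exists_of_apply_eq_zero (x := x - s (g x)) (by
        rw [map_sub, es, sub_self])
      exact ⟨(y, g x), by simp [hy]⟩

/-- Maps to `N` from the kernel of `P a → Δ a` vanish, since that kernel is filtered by standard
objects of rank above `ρ a`. It follows that nonzero extensions of `Δ a` by a standard object
require the latter to have larger rank. -/
theorem extZero_std (H : RankedHW R ρ Δ P) {a : Λ} {N : FGModuleCat.{u} A}
    (h : ∀ c, ρ a < ρ c → ∀ f : Δ c →ₗ[A] N, f = 0) : ExtZero (Δ a) N := by
  obtain ⟨K, f, g, hs, hK⟩ := H.proj_cover a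
  have := H.proj_projective a
  exact extZero_of_projective hs fun φ => ⟨0, by rw [hK.hom_eq_zero h φ, LinearMap.zero_comp]⟩

theorem extZero_std_filt (H : RankedHW R ρ Δ P) {a : Λ} {q : Λ → Prop} {N : FGModuleCat.{u} A}
    (hN : StdFiltered q Δ N) (h : ∀ b, q b → ρ b ≤ ρ a) : ExtZero (Δ a) N :=
  H.extZero_std fun _ hc => hN.hom_eq_zero_right fun b hb =>
    H.hom_eq_zero ((h b hb).trans_lt hc)

variable [IsNoetherianRing A]

theorem filt_extZero_filt (H : RankedHW R ρ Δ P) {p q : Λ → Prop} {M N : FGModuleCat.{u} A}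
    (hM : StdFiltered p Δ M) (hN : StdFiltered q Δ N) (hpq : ∀ a b, p a → q b → ρ b ≤ ρ a) :
    ExtZero M N :=
  hM.extZero fun a ha => H.extZero_std_filt hN (hpq a · ha)

/-- A standardly filtered object is an extension of one with labels of small rank by one with
labels of large rank. -/
theorem exists_split (H : RankedHW R ρ Δ P) (k : ℕ) {p : Λ → Prop} {M : FGModuleCat.{u} A}
    (hM : StdFiltered p Δ M) :
    ∃ (U L : FGModuleCat.{u} A) (f : U →ₗ[A] M) (g : M →ₗ[A] L), IsShortExact f g ∧
      StdFiltered (fun a => p a ∧ k ≤ ρ a) Δ U ∧ StdFiltered (fun a => p a ∧ ρ a < k) Δ L := by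
  induction hM with
  | zero M hs =>
    refine ⟨M, M, LinearMap.id, LinearMap.id, isShortExact_of (fun _ _ h => h) (fun x => ⟨x, rfl⟩)
      (fun x => Subsingleton.elim _ _) (fun x _ => ⟨x, rfl⟩), .zero M hs, .zero M hs⟩
  | step M' M a ha i q hiq _ ih =>
    obtain ⟨U, L, f, g, hfg, hU, hL⟩ := ih
    obtain ⟨Z, i', π, q', hZ, hex, h₁, h₂⟩ := exists_pushout_of_shortExact hfg hiq
    by_cases hk : k ≤ ρ a
    -- The new top factor belongs to the upper part. Its extension by `L` splits, so `L` is a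
    -- quotient of all of `M`, and `Δ a` slides down into the kernel `V`.
    · have hE : ExtZero (Δ a) L := H.extZero_std_filt hL fun b hb => (hb.2.trans_le hk).le
      obtain ⟨t, r, ht, hr, hrt, hsum⟩ := hE.exists_section hZ
      have er := LinearMap.congr_fun hr
      have et := LinearMap.congr_fun ht
      have ert := LinearMap.congr_fun hrt
      have es := LinearMap.congr_fun hsum
      simp only [LinearMap.comp_apply, LinearMap.id_apply, LinearMap.add_apply,
        LinearMap.zero_apply] at er et ert es
      have e₂ := LinearMap.congr_fun h₂
      simp only [LinearMap.comp_apply] at e₂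
      have hsurj : Function.Surjective (r ∘ₗ π) := fun x => by
        obtain ⟨y, hy⟩ := hex.2.1 (i' x)
        exact ⟨y, by simp [hy, er]⟩
      obtain ⟨V, j, hj⟩ := exists_kernel_of_surjective (r ∘ₗ π) hsurj
      refine ⟨V, L, j, r ∘ₗ π, hj, ?_, hL⟩
      obtain ⟨m, hm⟩ := hj.exists_lift (i ∘ₗ f) (by
        rw [LinearMap.comp_assoc, hex.comp_eq_zero, LinearMap.comp_zero])
      have em := LinearMap.congr_fun hm
      simp only [LinearMap.comp_apply] at em
      refine .step U V a ⟨ha, hk⟩ m (q ∘ₗ j) (isShortExact_of ?_ (fun x => ?_) (fun x => ?_)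
        fun x hx => ?_) hU
      · rw [injective_iff_map_eq_zero]
        intro x hx
        have := em x
        rw [hx, map_zero] at this
        exact hex.1 (by rw [map_zero, LinearMap.comp_apply, ← this])
      · obtain ⟨y, hy⟩ := hex.2.1 (t x)
        obtain ⟨v, rfl⟩ := hj.exists_of_apply_eq_zero (x := y) (by simp [hy, ert])
        refine ⟨v, ?_⟩
        rw [LinearMap.comp_apply, ← e₂, hy, et]
      · rw [LinearMap.comp_apply, em, hiq.apply_eq_zero]
      · have hx' : q (j x) = 0 := hx
        have h0 := hj.apply_eq_zero x
        rw [LinearMap.comp_apply] at h0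
        have hz := es (π (j x))
        rw [h0, map_zero, e₂, hx', map_zero, add_zero] at hz
        obtain ⟨y, hy⟩ := hex.exists_of_apply_eq_zero hz.symm
        exact ⟨y, hj.1 (by rw [em]; exact hy)⟩
    · exact ⟨U, Z, i ∘ₗ f, π, hex, hU.mono fun b hb => hb,
        .step L Z a ⟨ha, not_le.mp hk⟩ i' q' hZ hL⟩

end RankedHW

end FockCat

/-! ### Powers of standard objects; kernels and summands of filtered objects -/

namespace FockCat

section Powers

variable {R : Type u} [CommRing R] {A : Type u} [Ring A] [Algebra R A]

theorem sum_comp {ι : Type*} (t : Finset ι) {M N K : Type*} [AddCommGroup M] [Module A M]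
    [AddCommGroup N] [Module A N] [AddCommGroup K] [Module A K] (f : ι → (N →ₗ[A] K))
    (g : M →ₗ[A] N) : (∑ i ∈ t, f i) ∘ₗ g = ∑ i ∈ t, f i ∘ₗ g := by
  ext x
  simp

theorem comp_sum {ι : Type*} (t : Finset ι) {M N K : Type*} [AddCommGroup M] [Module A M]
    [AddCommGroup N] [Module A N] [AddCommGroup K] [Module A K] (f : N →ₗ[A] K)
    (g : ι → (M →ₗ[A] N)) : f ∘ₗ (∑ i ∈ t, g i) = ∑ i ∈ t, f ∘ₗ g i := by
  ext x
  simp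

/-- The identity of `M` factors through a finite power of `X`, that is, `M` is a direct summand of
a finite power of `X`. -/
def InAdd (X M : FGModuleCat.{u} A) : Prop :=
  ∃ (n : ℕ) (u : Fin n → (X →ₗ[A] M)) (v : Fin n → (M →ₗ[A] X)), ∑ a, u a ∘ₗ v a = LinearMap.id

theorem inAdd_of_subsingleton {X M : FGModuleCat.{u} A} (h : Subsingleton M) : InAdd X M :=
  ⟨0, fun _ => 0, fun _ => 0, LinearMap.ext fun _ => Subsingleton.elim _ _⟩

theorem InAdd.of_retract {X M N : FGModuleCat.{u} A} (h : InAdd X M) {i : N →ₗ[A] M}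
    {p : M →ₗ[A] N} (hp : p ∘ₗ i = LinearMap.id) : InAdd X N := by
  obtain ⟨n, u, v, huv⟩ := h
  refine ⟨n, fun a => p ∘ₗ u a, fun a => v a ∘ₗ i, ?_⟩
  ext x
  have := pow_eq_sum huv (i x)
  have e := LinearMap.congr_fun hp x
  simp only [LinearMap.comp_apply, LinearMap.id_apply] at e
  simp only [LinearMap.coe_sum, Finset.sum_apply, LinearMap.comp_apply, LinearMap.id_apply]
  rw [← map_sum, this, e]

theorem InAdd.extension {X M' M : FGModuleCat.{u} A} {f : M' →ₗ[A] M} {g : M →ₗ[A] X}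
    (h : InAdd X M') {k : M →ₗ[A] M'} {t : X →ₗ[A] M}
    (hs : f ∘ₗ k + t ∘ₗ g = LinearMap.id) : InAdd X M := by
  obtain ⟨n, u, v, huv⟩ := h
  refine ⟨n + 1, Fin.cons t fun a => f ∘ₗ u a, Fin.cons g fun a => v a ∘ₗ k, ?_⟩
  ext x
  have := pow_eq_sum huv (k x)
  have e := LinearMap.congr_fun hs x
  simp only [LinearMap.add_apply, LinearMap.comp_apply, LinearMap.id_apply] at e
  simp only [Fin.sum_univ_succ, Fin.cons_zero, Fin.cons_succ, LinearMap.add_apply,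
    LinearMap.coe_sum, Finset.sum_apply, LinearMap.comp_apply, LinearMap.id_apply]
  rw [← map_sum, this, add_comm, e]

/-- If the endomorphism ring of `X` is the local ring `R`, then direct summands of powers of `X`
are powers of `X`. -/
theorem InAdd.exists_pow [IsLocalRing R] {X M : FGModuleCat.{u} A} (h : InAdd X M)
    (hX : Function.Bijective fun r : R => r • (LinearMap.id : X →ₗ[A] X)) :
    ∃ (n : ℕ) (i : Fin n → (X →ₗ[A] M)) (p : Fin n → (M →ₗ[A] X)),
      IsPow i p := by
  obtain ⟨n, u, v, huv⟩ := h
  let s : R ≃ₗ[R] (X →ₗ[A] X) := LinearEquiv.ofBijective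
    ((LinearMap.id : R →ₗ[R] R).smulRight (LinearMap.id : X →ₗ[A] X)) hX
  have hs : ∀ r, s r = r • LinearMap.id := fun r => rfl
  let ι : (X →ₗ[A] M) →ₗ[R] (Fin n → R) :=
    LinearMap.pi fun a => s.symm.toLinearMap ∘ₗ
      { toFun := fun h => v a ∘ₗ h
        map_add' := fun h h' => LinearMap.comp_add _ _ _
        map_smul' := fun r h => LinearMap.comp_smul _ _ _ }
  let π : (Fin n → R) →ₗ[R] (X →ₗ[A] M) :=
    ∑ a, (LinearMap.proj a : (Fin n → R) →ₗ[R] R).smulRight (u a)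
  have hr : ∀ (w : X →ₗ[A] X), s.symm w • (LinearMap.id : X →ₗ[A] X) = w := fun w =>
    s.apply_symm_apply w
  have hπι : π ∘ₗ ι = LinearMap.id := by
    ext h x
    have e : ∀ a, s.symm (v a ∘ₗ h) • u a = (u a ∘ₗ v a) ∘ₗ h := fun a => by
      have := hr (v a ∘ₗ h)
      calc s.symm (v a ∘ₗ h) • u a = u a ∘ₗ (s.symm (v a ∘ₗ h) • LinearMap.id) := by
            rw [LinearMap.comp_smul, LinearMap.comp_id]
        _ = _ := by rw [this, LinearMap.comp_assoc]
    have e2 : π (ι h) = ∑ a, s.symm (v a ∘ₗ h) • u a := by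
      simp [π, ι]
    rw [LinearMap.comp_apply, e2, Finset.sum_congr rfl fun a _ => e a, ← sum_comp, huv]
    rfl
  -- Since `End X = R`, composing with the `v a` embeds `Hom(X, M)` in `R^n` as a direct summand. It
  -- is thus projective, hence free over a local ring, and a basis of it serves as the family of
  -- inclusions.
  have : Module.Projective R (X →ₗ[A] M) := Module.Projective.of_split ι π hπι
  have : Module.Finite R (X →ₗ[A] M) := Module.Finite.of_surjective π fun h =>
    ⟨ι h, LinearMap.congr_fun hπι h⟩
  have : Module.Free R (X →ₗ[A] M) := Module.free_of_flat_of_isLocalRing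
  let b := Module.finBasis R (X →ₗ[A] M)
  have hsum : ∑ j, b j ∘ₗ (∑ a, b.repr (u a) j • v a) = LinearMap.id := by
    calc ∑ j, b j ∘ₗ (∑ a, b.repr (u a) j • v a)
        = ∑ j, ∑ a, (b.repr (u a) j • b j) ∘ₗ v a := by
          refine Finset.sum_congr rfl fun j _ => ?_
          rw [comp_sum]
          refine Finset.sum_congr rfl fun a _ => ?_
          rw [LinearMap.comp_smul, LinearMap.smul_comp]
      _ = ∑ a, u a ∘ₗ v a := by
          rw [Finset.sum_comm]
          refine Finset.sum_congr rfl fun a _ => ?_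
          rw [← sum_comp, b.sum_repr]
      _ = _ := huv
  refine ⟨_, b, fun j => ∑ a, b.repr (u a) j • v a, fun j k => ?_, hsum⟩
  -- The composites of projections with inclusions are scalars `c j`; expanding `b k` through the
  -- identity of `M` and comparing basis coordinates shows that they are Kronecker deltas.
  let c : Fin _ → R := fun j => s.symm ((∑ a, b.repr (u a) j • v a) ∘ₗ b k)
  have hc : ∑ j, c j • b j = b k := by
    have h1 : ∀ j, c j • b j = (b j ∘ₗ ∑ a, b.repr (u a) j • v a) ∘ₗ b k := fun j => by
      calc c j • b j = b j ∘ₗ (c j • LinearMap.id) := by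
            rw [LinearMap.comp_smul, LinearMap.comp_id]
        _ = _ := by rw [hr, LinearMap.comp_assoc]
    rw [Finset.sum_congr rfl fun j _ => h1 j, ← sum_comp, hsum, LinearMap.id_comp]
  have hcj : c j = if j = k then 1 else 0 := by
    have h2 := congrArg (fun z => b.repr z j) hc
    simp only [b.repr_sum_self, b.repr_self, Finsupp.single_apply] at h2
    rw [h2]
    simp [eq_comm]
  have h3 : c j • (LinearMap.id : X →ₗ[A] X) = (∑ a, b.repr (u a) j • v a) ∘ₗ b k := hr _
  rw [← h3, hcj]
  split_ifs <;> simp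


theorem IsPow.isShortExact {K Q X K' Q' X' : FGModuleCat.{u} A} {f : K →ₗ[A] Q} {g : Q →ₗ[A] X}
    (hs : IsShortExact f g) {n : ℕ}
    {iK : Fin n → (K →ₗ[A] K')} {pK : Fin n → (K' →ₗ[A] K)} (hK : IsPow iK pK)
    {iQ : Fin n → (Q →ₗ[A] Q')} {pQ : Fin n → (Q' →ₗ[A] Q)} (hQ : IsPow iQ pQ)
    {iX : Fin n → (X →ₗ[A] X')} {pX : Fin n → (X' →ₗ[A] X)} (hX : IsPow iX pX) :
    IsShortExact (∑ a, iQ a ∘ₗ f ∘ₗ pK a) (∑ a, iX a ∘ₗ g ∘ₗ pQ a) := by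
  have c₁ : ∀ a x, pQ a ((∑ b, iQ b ∘ₗ f ∘ₗ pK b) x) = f (pK a x) := fun a x => by
    simp [map_sum, hQ.proj_incl_apply]
  have c₂ : ∀ a x, pX a ((∑ b, iX b ∘ₗ g ∘ₗ pQ b) x) = g (pQ a x) := fun a x => by
    simp [map_sum, hX.proj_incl_apply]
  refine isShortExact_of (fun x y hxy => hK.ext fun a => hs.1 ?_) (fun y => ?_)
    (fun x => hX.ext fun a => ?_) fun y hy => ?_
  · rw [← c₁, ← c₁, hxy]
  · choose q hq using fun a => hs.2.1 (pX a y)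
    exact ⟨∑ a, iQ a (q a), hX.ext fun a => by rw [c₂, hQ.sum_proj, hq]⟩
  · rw [c₂, c₁, hs.apply_eq_zero, map_zero]
  · have h0 : ∀ a, g (pQ a y) = 0 := fun a => by rw [← c₂, hy, map_zero]
    choose k hk using fun a => hs.exists_of_apply_eq_zero (h0 a)
    exact ⟨∑ a, iK a (k a), hQ.ext fun a => by rw [c₁, hK.sum_proj, hk]⟩

theorem IsPow.projective {Q Q' : FGModuleCat.{u} A} [Module.Projective A Q] {n : ℕ}
    {i : Fin n → (Q →ₗ[A] Q')} {p : Fin n → (Q' →ₗ[A] Q)} (h : IsPow i p) :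
    Module.Projective A Q' := by
  refine Module.Projective.of_lifting_property'' fun f hf => ?_
  choose k hk using fun a => Module.projective_lifting_property f (i a) hf
  refine ⟨∑ a, k a ∘ₗ p a, ?_⟩
  rw [comp_sum, ← h.sum_eq]
  exact Finset.sum_congr rfl fun a _ => by rw [← LinearMap.comp_assoc, hk]

end Powers

namespace RankedHW

variable {R : Type u} [CommRing R] {A : Type u} [Ring A] [Algebra R A] {Λ : Type}
  {ρ : Λ → ℕ} {Δ P : Λ → FGModuleCat.{u} A}

/-- Extensions of `Δ a` by objects filtered by copies of `Δ a` split, so such an object is a sum of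
copies. -/
theorem inAdd_of_filt (H : RankedHW R ρ Δ P) {p : Λ → Prop} {a : Λ} (hp : ∀ b, p b → b = a)
    {M : FGModuleCat.{u} A} (hM : StdFiltered p Δ M) : InAdd (Δ a) M := by
  induction hM with
  | zero M hs => exact inAdd_of_subsingleton hs
  | step M' M b hb f g hfg hM' ih =>
    obtain rfl := hp b hb
    obtain ⟨t, k, -, -, -, h⟩ :=
      (H.extZero_std_filt hM' fun c hc => (congrArg ρ (hp c hc)).le).exists_section hfg
    exact ih.extension h

variable [IsNoetherianRing A]

theorem filt_of_inAdd [IsLocalRing R] (H : RankedHW R ρ Δ P) {p : Λ → Prop} {a : Λ} (ha : p a)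
    {M : FGModuleCat.{u} A} (hM : InAdd (Δ a) M) : StdFiltered p Δ M := by
  obtain ⟨n, i, π, h⟩ := hM.exists_pow (H.std_end a)
  exact (StdFiltered.single ha).pow n i π h

/-- The kernel of a surjection between standardly filtered objects is standardly filtered. -/
theorem filt_kernel_aux [IsLocalRing R] (H : RankedHW R ρ Δ P) (k : ℕ) :
    ∀ {K M N : FGModuleCat.{u} A} {i : K →ₗ[A] M} {π : M →ₗ[A] N}, IsShortExact i π →
      StdFiltered (fun a => ρ a < k) Δ M → StdFiltered (fun a => ρ a < k) Δ N →
        StdFiltered (fun a => ρ a < k) Δ K := by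
  induction k with
  | zero =>
    intro K M N i π hs hM _
    cases hM with
    | zero _ h => exact .zero K hs.1.subsingleton
    | step _ _ _ h => exact absurd h (Nat.not_lt_zero _)
  | succ k ih =>
    intro K M N i π hs hM hN
    by_cases hk : ∃ a, ρ a = k
    swap
    · have hlt : ∀ a, ρ a < k + 1 → ρ a < k := fun a ha =>
        lt_of_le_of_ne (Nat.lt_succ_iff.mp ha) fun h => hk ⟨a, h⟩
      exact (ih hs (hM.mono hlt) (hN.mono hlt)).mono fun a ha => Nat.lt_succ_of_lt ha
    obtain ⟨a, rfl⟩ := hk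
    have hone : ∀ b, ρ b < ρ a + 1 ∧ ρ a ≤ ρ b → b = a := fun b hb =>
      H.rank_injective (le_antisymm (Nat.lt_succ_iff.mp hb.1) hb.2)
    obtain ⟨U, L, f, g, hfg, hU, hL⟩ := H.exists_split (ρ a) hM
    obtain ⟨U', L', f', g', hfg', hU', hL'⟩ := H.exists_split (ρ a) hN
    -- the induced maps on the two parts
    obtain ⟨πU, hπU⟩ := hfg'.exists_lift (π ∘ₗ f)
      (H.filt_hom_eq_zero hU hL' (fun _ _ h h' => h'.2.trans_le h.2) _)
    obtain ⟨πL, hπL⟩ := hfg.exists_desc (g' ∘ₗ π) (by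
      rw [LinearMap.comp_assoc, ← hπU, ← LinearMap.comp_assoc, hfg'.comp_eq_zero,
        LinearMap.zero_comp])
    -- a section on the upper part
    have hEK : ExtZero U' K := hU'.extZero fun b hb => H.extZero_std fun c hc φ =>
      comp_left_cancel hs.1 (by
        rw [LinearMap.comp_zero]
        exact hM.hom_eq_zero_right (fun d hd => H.hom_eq_zero
          ((Nat.lt_succ_iff.mp hd).trans_lt (hb.2.trans_lt hc))) _)
    obtain ⟨s₀, hs₀⟩ := hEK.exists_lift hs f'
    obtain ⟨s, hs₁⟩ := hfg.exists_lift s₀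
      (H.filt_hom_eq_zero hU' hL (fun _ _ h h' => h'.2.trans_le h.2) _)
    have hsec : πU ∘ₗ s = LinearMap.id := comp_left_cancel hfg'.1 (by
      rw [← LinearMap.comp_assoc, hπU, LinearMap.comp_assoc, hs₁, hs₀, LinearMap.comp_id])
    have e₁ := LinearMap.congr_fun hπU
    have e₂ := LinearMap.congr_fun hπL
    have e₃ := LinearMap.congr_fun hsec
    simp only [LinearMap.comp_apply, LinearMap.id_apply] at e₁ e₂ e₃
    have hUs : Function.Surjective πU := fun x => ⟨s x, e₃ x⟩
    have hLs : Function.Surjective πL := fun x => by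
      obtain ⟨y, rfl⟩ := hfg'.2.1 x
      obtain ⟨z, rfl⟩ := hs.2.1 y
      exact ⟨g z, e₂ z⟩
    obtain ⟨KU, iU, hKU⟩ := exists_kernel_of_surjective πU hUs
    obtain ⟨KL, iL, hKL⟩ := exists_kernel_of_surjective πL hLs
    have hKLf := (ih hKL (hL.mono fun b hb => hb.2) (hL'.mono fun b hb => hb.2)).mono
      fun b (hb : ρ b < ρ a) => Nat.lt_succ_of_lt hb
    -- The section `s` makes `KU` a direct summand of `U`. The only label in `U` is `a`, so `U` and
    -- its summands are powers of `Δ a`.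
    have hKUf : StdFiltered (fun b => ρ b < ρ a + 1) Δ KU := by
      obtain ⟨r, hr⟩ := hKU.exists_lift (LinearMap.id - s ∘ₗ πU) (by
        ext x
        simp [e₃])
      refine H.filt_of_inAdd (Nat.lt_succ_self _)
        ((H.inAdd_of_filt hone hU).of_retract (i := iU) (p := r) (comp_left_cancel hKU.1 ?_))
      rw [← LinearMap.comp_assoc, hr]
      ext x
      simp [hKU.apply_eq_zero]
    obtain ⟨j, hj⟩ := hs.exists_lift (f ∘ₗ iU) (by
      ext x
      simp [← e₁, hKU.apply_eq_zero])
    obtain ⟨q, hq⟩ := hKL.exists_lift (g ∘ₗ i) (by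
      ext x
      simp [e₂, hs.apply_eq_zero])
    have ej := LinearMap.congr_fun hj
    have eq := LinearMap.congr_fun hq
    simp only [LinearMap.comp_apply] at ej eq
    refine StdFiltered.extension (f := j) (g := q) (isShortExact_of ?_ (fun y => ?_) (fun x => ?_)
      fun y hy => ?_) hKUf hKLf
    · refine Function.Injective.of_comp (f := i) ?_
      have : i ∘ j = f ∘ iU := funext ej
      rw [this]
      exact hfg.1.comp hKU.1
    · obtain ⟨m, hm⟩ := hfg.2.1 (iL y)
      have h1 : g' (π m) = 0 := by rw [← e₂, hm, hKL.apply_eq_zero]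
      obtain ⟨u, hu⟩ := hfg'.exists_of_apply_eq_zero h1
      obtain ⟨w, hw⟩ := hs.exists_of_apply_eq_zero (x := m - f (s u)) (by
        rw [map_sub, ← e₁, e₃, hu, sub_self])
      refine ⟨w, hKL.1 ?_⟩
      rw [eq, hw, map_sub, hfg.apply_eq_zero, hm, sub_zero]
    · refine hKL.1 ?_
      rw [eq, ej, hfg.apply_eq_zero, map_zero]
    · have h1 : g (i y) = 0 := by rw [← eq, hy, map_zero]
      obtain ⟨u, hu⟩ := hfg.exists_of_apply_eq_zero h1
      obtain ⟨w, hw⟩ := hKU.exists_of_apply_eq_zero (x := u) (hfg'.1 (by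
        rw [e₁, hu, hs.apply_eq_zero, map_zero]))
      exact ⟨w, hs.1 (by rw [ej, hw, hu])⟩

/-- Direct summands of standardly filtered objects are standardly filtered. -/
theorem filt_retract_aux [IsLocalRing R] (H : RankedHW R ρ Δ P) (k : ℕ) :
    ∀ {M S : FGModuleCat.{u} A} {i : S →ₗ[A] M} {π : M →ₗ[A] S}, π ∘ₗ i = LinearMap.id →
      StdFiltered (fun a => ρ a < k) Δ M → StdFiltered (fun a => ρ a < k) Δ S := by
  induction k with
  | zero =>
    intro M S i π hs hM
    have hi : Function.Injective i :=
      Function.LeftInverse.injective fun x => LinearMap.congr_fun hs x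
    cases hM with
    | zero _ h => exact .zero S hi.subsingleton
    | step _ _ _ h => exact absurd h (Nat.not_lt_zero _)
  | succ k ih =>
    intro M S ι π hs hM
    have es := LinearMap.congr_fun hs
    simp only [LinearMap.comp_apply, LinearMap.id_apply] at es
    by_cases hk : ∃ a, ρ a = k
    swap
    · have hlt : ∀ a, ρ a < k + 1 → ρ a < k := fun a ha =>
        lt_of_le_of_ne (Nat.lt_succ_iff.mp ha) fun h => hk ⟨a, h⟩
      exact (ih hs (hM.mono hlt)).mono fun a ha => Nat.lt_succ_of_lt ha
    obtain ⟨a, rfl⟩ := hk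
    have hone : ∀ b, ρ b < ρ a + 1 ∧ ρ a ≤ ρ b → b = a := fun b hb =>
      H.rank_injective (le_antisymm (Nat.lt_succ_iff.mp hb.1) hb.2)
    obtain ⟨U, L, f, g, hfg, hU, hL⟩ := H.exists_split (ρ a) hM
    -- The idempotent `ι ∘ π` preserves `U` because `Hom(U, L) = 0`, so it acts on `L` too. Then `S`
    -- is an extension of its image on `L` by its image on `U`.
    obtain ⟨eU, heU⟩ := hfg.exists_lift ((ι ∘ₗ π) ∘ₗ f)
      (H.filt_hom_eq_zero hU hL (fun _ _ h h' => h'.2.trans_le h.2) _)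
    obtain ⟨eL, heL⟩ := hfg.exists_desc (g ∘ₗ (ι ∘ₗ π)) (by
      rw [LinearMap.comp_assoc, ← heU, ← LinearMap.comp_assoc, hfg.comp_eq_zero,
        LinearMap.zero_comp])
    obtain ⟨SU, qU, iU, hqU, hiU, hUU⟩ := exists_image eU
    obtain ⟨SL, qL, iL, hqL, hiL, hLL⟩ := exists_image eL
    have e₁ := LinearMap.congr_fun heU
    have e₂ := LinearMap.congr_fun heL
    have e₃ := LinearMap.congr_fun hUU
    have e₄ := LinearMap.congr_fun hLL
    simp only [LinearMap.comp_apply] at e₁ e₂ e₃ e₄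
    have hUi : ∀ x, eU (eU x) = eU x := fun x => hfg.1 (by rw [e₁, e₁, es])
    have hLi : ∀ x, eL (eL x) = eL x := fun x => by
      obtain ⟨y, rfl⟩ := hfg.2.1 x
      rw [e₂, e₂, es]
    have rU : qU ∘ₗ iU = LinearMap.id := LinearMap.ext fun x => by
      obtain ⟨y, rfl⟩ := hqU x
      exact hiU (by simp [e₃, hUi])
    have rL : qL ∘ₗ iL = LinearMap.id := LinearMap.ext fun x => by
      obtain ⟨y, rfl⟩ := hqL x
      exact hiL (by simp [e₄, hLi])
    have hSU : StdFiltered (fun b => ρ b < ρ a + 1) Δ SU :=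
      H.filt_of_inAdd (Nat.lt_succ_self _) ((H.inAdd_of_filt hone hU).of_retract rU)
    have hSL := (ih rL (hL.mono fun b hb => hb.2)).mono
      fun b (hb : ρ b < ρ a) => Nat.lt_succ_of_lt hb
    have rU' := LinearMap.congr_fun rU
    have rL' := LinearMap.congr_fun rL
    simp only [LinearMap.comp_apply, LinearMap.id_apply] at rU' rL'
    have hUf : ∀ x, eU (iU x) = iU x := fun x => by rw [← e₃, rU']
    refine StdFiltered.extension (f := π ∘ₗ f ∘ₗ iU) (g := qL ∘ₗ g ∘ₗ ι)
      (isShortExact_of ?_ (fun z => ?_) (fun x => ?_) fun x hx => ?_) hSU hSL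
    · rw [injective_iff_map_eq_zero]
      intro x hx
      have h1 : π (f (iU x)) = 0 := hx
      have h2 := e₁ (iU x)
      rw [h1, map_zero, hUf] at h2
      exact hiU (hfg.1 (by rw [h2, map_zero, map_zero]))
    · obtain ⟨l, rfl⟩ := hqL z
      obtain ⟨m, rfl⟩ := hfg.2.1 l
      refine ⟨π m, hiL ?_⟩
      change iL (qL (g (ι (π m)))) = iL (qL (g m))
      rw [e₄, e₄, ← e₂, hLi]
    · change qL (g (ι (π (f (iU x))))) = 0
      rw [← e₁, hfg.apply_eq_zero, map_zero]
    · have h1 : qL (g (ι x)) = 0 := hx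
      have h2 : g (ι x) = 0 := by
        have h3 := e₂ (ι x)
        rw [es] at h3
        rw [← h3, ← e₄, h1, map_zero]
      obtain ⟨u, hu⟩ := hfg.exists_of_apply_eq_zero h2
      refine ⟨qU u, ?_⟩
      change π (f (iU (qU u))) = x
      rw [e₃, e₁, es, hu, es]

end RankedHW

end FockCat

namespace FockCat

/-- `Ext¹(Δ b, N) = 0` for all `b`. -/
def ExtInjective {A : Type u} [Ring A] {Λ : Type} (Δ : Λ → FGModuleCat.{u} A)
    (N : FGModuleCat.{u} A) : Prop :=
  ∀ b, ExtZero (Δ b) N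

/-! ### Enough filtered projectives; tilting hulls of standard objects -/

namespace RankedHW

variable {R : Type u} [CommRing R] {A : Type u} [Ring A] [Algebra R A] {Λ : Type}
  {ρ : Λ → ℕ} {Δ P : Λ → FGModuleCat.{u} A} [IsNoetherianRing A]

theorem exists_bound [Finite Λ] (ρ : Λ → ℕ) : ∃ k, ∀ a, ρ a < k := by
  obtain ⟨k, hk⟩ := (Set.finite_range ρ).bddAbove
  exact ⟨k + 1, fun a => Nat.lt_succ_of_le (hk ⟨a, rfl⟩)⟩

theorem filt_kernel [IsLocalRing R] [Finite Λ] (H : RankedHW R ρ Δ P)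
    {K M N : FGModuleCat.{u} A} {i : K →ₗ[A] M} {π : M →ₗ[A] N} (hs : IsShortExact i π)
    (hM : stdFiltered Δ M) (hN : stdFiltered Δ N) : stdFiltered Δ K := by
  obtain ⟨k, hk⟩ := exists_bound ρ
  exact (H.filt_kernel_aux k hs (StdFiltered.mono (fun a _ => hk a) hM)
    (StdFiltered.mono (fun a _ => hk a) hN)).mono fun _ _ => trivial

theorem filt_retract [IsLocalRing R] [Finite Λ] (H : RankedHW R ρ Δ P)
    {M S : FGModuleCat.{u} A} {i : S →ₗ[A] M} {π : M →ₗ[A] S} (hs : π ∘ₗ i = LinearMap.id)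
    (hM : stdFiltered Δ M) : stdFiltered Δ S := by
  obtain ⟨k, hk⟩ := exists_bound ρ
  exact (H.filt_retract_aux k hs (StdFiltered.mono (fun a _ => hk a) hM)).mono fun _ _ => trivial

theorem filt_proj (H : RankedHW R ρ Δ P) (a : Λ) : stdFiltered Δ (P a) := by
  obtain ⟨K, f, g, hs, hK⟩ := H.proj_cover a
  exact StdFiltered.extension hs (hK.mono fun _ _ => trivial) (StdFiltered.single trivial)

/-- There are enough standardly filtered projective objects. -/
theorem exists_cover (H : RankedHW R ρ Δ P) (M : FGModuleCat.{u} A) :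
    ∃ (Q : FGModuleCat.{u} A) (π : Q →ₗ[A] M), Module.Projective A Q ∧ stdFiltered Δ Q ∧
      Function.Surjective π := by
  have hM : IsNoetherian A M := isNoetherian_of_isNoetherianRing_of_finite A M
  let 𝒮 : Set (Submodule A M) := {S | ∃ (Q : FGModuleCat.{u} A) (π : Q →ₗ[A] M),
    Module.Projective A Q ∧ stdFiltered Δ Q ∧ LinearMap.range π = S}
  have h0 : 𝒮.Nonempty := ⟨⊥, FGModuleCat.of A PUnit, 0,
    inferInstanceAs (Module.Projective A PUnit.{u + 1}),
    .zero _ (inferInstanceAs (Subsingleton PUnit)), LinearMap.range_zero⟩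
  -- An image that is maximal must be `M`: a nonzero cokernel would receive a nonzero map from some
  -- `Δ a`, and lifting the composite `P a → Δ a → N` to `M` would enlarge the image.
  obtain ⟨S, hS, hmax⟩ := set_has_maximal_iff_noetherian.mpr hM 𝒮 h0
  obtain ⟨Q, π, hQ, hQf, rfl⟩ := hS
  refine ⟨Q, π, hQ, hQf, ?_⟩
  obtain ⟨N, q, hq, hk⟩ := exists_quotient M (LinearMap.range π)
  suffices hN : Subsingleton N by
    rw [← LinearMap.range_eq_top, ← hk, LinearMap.ker_eq_top]
    exact LinearMap.ext fun x => Subsingleton.elim _ _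
  refine H.std_generate N fun a φ => ?_
  obtain ⟨K, f, g, hs, -⟩ := H.proj_cover a
  have := H.proj_projective a
  obtain ⟨l, hl⟩ := Module.projective_lifting_property q (φ ∘ₗ g) hq
  obtain ⟨Z, i, j, p, r, h₁, h₂, h₃, h₄, h₅⟩ := exists_prod Q (P a)
  have e₁ := LinearMap.congr_fun h₁
  have e₂ := LinearMap.congr_fun h₂
  have e₃ := LinearMap.congr_fun h₃
  have e₄ := LinearMap.congr_fun h₄
  have e₅ := LinearMap.congr_fun h₅
  simp only [LinearMap.comp_apply, LinearMap.id_apply, LinearMap.zero_apply,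
    LinearMap.add_apply] at e₁ e₂ e₃ e₄ e₅
  have hZs : IsShortExact i r := isShortExact_of
    (Function.LeftInverse.injective e₁) (fun x => ⟨j x, e₂ x⟩) e₃ fun x hx => ⟨p x, by
      conv_rhs => rw [← e₅ x, hx, map_zero, add_zero]⟩
  have hZ : LinearMap.range (π ∘ₗ p + l ∘ₗ r) ∈ 𝒮 := by
    refine ⟨Z, _, ?_, StdFiltered.extension hZs hQf (H.filt_proj a), rfl⟩
    refine Module.Projective.of_split (p.prod r) (i.coprod j) ?_
    ext x
    exact e₅ x
  have hle : LinearMap.range π ≤ LinearMap.range (π ∘ₗ p + l ∘ₗ r) := by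
    rintro _ ⟨x, rfl⟩
    exact ⟨i x, by simp [e₁, e₃]⟩
  have hle' : LinearMap.range l ≤ LinearMap.range π := by
    rw [eq_of_le_of_not_lt hle (hmax _ hZ)]
    rintro _ ⟨x, rfl⟩
    exact ⟨j x, by simp [e₂, e₄]⟩
  refine comp_right_cancel hs.2.1 ?_
  rw [← hl, LinearMap.zero_comp]
  ext x
  have : l x ∈ LinearMap.ker q := hk ▸ hle' (LinearMap.mem_range_self l x)
  exact this

theorem filt_of_projective [IsLocalRing R] [Finite Λ] (H : RankedHW R ρ Δ P)
    (Q : FGModuleCat.{u} A) [Module.Projective A Q] : stdFiltered Δ Q := by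
  obtain ⟨Q', π, -, hQ', hπ⟩ := H.exists_cover Q
  obtain ⟨s, hs⟩ := Module.projective_lifting_property π LinearMap.id hπ
  exact H.filt_retract hs hQ'

/-- The class of `ExtInjective` objects is closed under cokernels of injective maps. -/
theorem extInjective_cokernel (H : RankedHW R ρ Δ P) {N' N N'' : FGModuleCat.{u} A}
    {f : N' →ₗ[A] N} {g : N →ₗ[A] N''} (hs : IsShortExact f g) (h' : ExtInjective Δ N')
    (h : ExtInjective Δ N) : ExtInjective Δ N'' := fun b => by
  obtain ⟨K, i, π, hK, hKf⟩ := H.proj_cover b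
  have := H.proj_projective b
  -- Dimension shift: `Ext¹(K, N') = 0`, for the kernel `K` of the projective cover, replaces the
  -- vanishing of `Ext²(Δ b, N')`.
  refine extZero_of_projective hK fun φ => ?_
  obtain ⟨l, hl⟩ := (hKf.extZero fun a _ => h' a).exists_lift hs φ
  obtain ⟨k, hk⟩ := h b _ _ i π hK l
  exact ⟨g ∘ₗ k, by rw [LinearMap.comp_assoc, hk, hl]⟩

/-- Ringel's universal extensions: starting from `Δ a` and descending in rank, `Ext¹(Δ b, T)` is
killed by adding copies of `Δ b` on top. The number `j` records how far below `ρ a` this has been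
done. -/
theorem exists_hull_aux [IsNoetherianRing R] [Module.Finite R A] (H : RankedHW R ρ Δ P) (a : Λ)
    (j : ℕ) :
    ∃ (T M : FGModuleCat.{u} A) (i : Δ a →ₗ[A] T) (q : T →ₗ[A] M), IsShortExact i q ∧
      StdFiltered (fun b => ρ b < ρ a) Δ M ∧ ∀ b, ρ a ≤ ρ b + j → ExtZero (Δ b) T := by
  induction j with
  | zero =>
    refine ⟨Δ a, FGModuleCat.of A PUnit, LinearMap.id, 0,
      isShortExact_of (fun _ _ h => h) (fun _ => ⟨0, rfl⟩) (fun _ => rfl) (fun x _ => ⟨x, rfl⟩),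
      .zero _ (inferInstanceAs (Subsingleton PUnit)), fun b hb => ?_⟩
    exact H.extZero_std fun c hc => H.hom_eq_zero (lt_of_le_of_lt hb hc)
  | succ j ih =>
    obtain ⟨T, M, i, q, hiq, hM, hT⟩ := ih
    by_cases hex : ∃ b, ρ a = ρ b + (j + 1)
    swap
    · refine ⟨T, M, i, q, hiq, hM, fun b hb => hT b ?_⟩
      by_contra h
      exact hex ⟨b, by omega⟩
    obtain ⟨b, hb⟩ := hex
    obtain ⟨K, f, g, hfg, hK⟩ := H.proj_cover b
    have := H.proj_projective b
    have := finite_hom R K T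
    -- Generators of `Hom(K, T)` over `R` represent generators of `Ext¹(Δ b, T)`; the pushout along
    -- all of them at once is the universal extension.
    obtain ⟨n, h, hh⟩ := Module.Finite.exists_fin (R := R) (M := K →ₗ[A] T)
    obtain ⟨K', iK, pK, hKp⟩ := exists_pow K n
    obtain ⟨Q', iQ, pQ, hQp⟩ := exists_pow (P b) n
    obtain ⟨X', iX, pX, hXp⟩ := exists_pow (Δ b) n
    obtain ⟨Y, f', h', g', hs', h₁, h₂⟩ := exists_pushout (hKp.isShortExact hfg hQp hXp)
      (∑ c, h c ∘ₗ pK c)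
    obtain ⟨Z, i', π, q', hZ, hex, h₃, h₄⟩ := exists_pushout_of_shortExact hiq hs'
    refine ⟨Y, Z, f' ∘ₗ i, π, hex, StdFiltered.extension hZ hM
      ((StdFiltered.single (by omega)).pow n iX pX hXp), fun c hc => ?_⟩
    have e₁ := LinearMap.congr_fun h₁
    simp only [LinearMap.comp_apply] at e₁
    by_cases hcb : c = b
    swap
    · have hc' : ρ a ≤ ρ c + j := by
        have : ρ c ≠ ρ b := fun h => hcb (H.rank_injective h)
        omega
      exact ExtZero.extension_right hs' (hT c hc') (ExtZero.pow_right hXp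
        (H.extZero_std fun d hd => H.hom_eq_zero (by omega)))
    subst hcb
    refine extZero_of_projective hfg fun φ => ?_
    -- `K` involves only ranks above that of the label in question, so it has no maps to the added
    -- copies. Hence `φ` lands in `T`, is a combination of the chosen generators, and each of these
    -- extends to the projective cover by construction of the pushout.
    have hφ : g' ∘ₗ φ = 0 := by
      ext x
      refine hXp.ext fun d => ?_
      have := hK.hom_eq_zero (fun d hd => H.hom_eq_zero hd) (pX d ∘ₗ g' ∘ₗ φ)
      simpa using LinearMap.congr_fun this x
    obtain ⟨ψ, hψ⟩ := hs'.exists_lift φ hφ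
    have hmem : ψ ∈ Submodule.span R (Set.range h) := hh ▸ Submodule.mem_top
    obtain ⟨r, hr⟩ := (Submodule.mem_span_range_iff_exists_fun R).mp hmem
    refine ⟨∑ d, r d • (h' ∘ₗ iQ d), ?_⟩
    have key : ∀ d x, h' (iQ d (f x)) = f' (h d x) := fun d x => by
      have e := e₁ (iK d x)
      have e1 : (∑ a, iQ a ∘ₗ f ∘ₗ pK a) (iK d x) = iQ d (f x) := by
        refine hQp.ext fun c' => ?_
        simp [map_sum, hQp.proj_incl_apply, hKp.proj_incl_apply, apply_ite f]
      have e2 : (∑ a, h a ∘ₗ pK a) (iK d x) = h d x := by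
        simp only [LinearMap.coe_sum, Finset.sum_apply, LinearMap.comp_apply, hKp.proj_incl_apply]
        rw [Finset.sum_eq_single d]
        · simp
        · intro c' _ hc'
          simp [hc']
        · simp
      rw [e1, e2] at e
      exact e
    rw [← hψ, ← hr]
    ext x
    simp [key]

/-- Every standard object embeds into an `ExtInjective` object, with cokernel filtered by standard
objects of smaller rank. -/
theorem exists_hull [IsNoetherianRing R] [Module.Finite R A] (H : RankedHW R ρ Δ P) (a : Λ) :
    ∃ (T M : FGModuleCat.{u} A) (i : Δ a →ₗ[A] T) (q : T →ₗ[A] M), IsShortExact i q ∧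
      StdFiltered (fun b => ρ b < ρ a) Δ M ∧ ExtInjective Δ T := by
  obtain ⟨T, M, i, q, h₁, h₂, h₃⟩ := H.exists_hull_aux a (ρ a)
  exact ⟨T, M, i, q, h₁, h₂, fun b => h₃ b (Nat.le_add_left _ _)⟩

end RankedHW

end FockCat

/-! ### Costandard filtrations over the residue field -/

namespace FockCat

/-- Such a module is a vector space over `𝔽`, and linear functionals separate its points. -/
theorem exists_functional_of_killed {R 𝔽 M : Type*} [CommRing R] [Field 𝔽] [Algebra R 𝔽]
    [AddCommGroup M] [Module R M] (h𝔽 : Function.Surjective (algebraMap R 𝔽))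
    (hM : ∀ r : R, algebraMap R 𝔽 r = 0 → ∀ x : M, r • x = 0) {x : M} (hx : x ≠ 0) :
    ∃ c : M →ₗ[R] 𝔽, c x ≠ 0 := by
  let _ : SMul 𝔽 M := ⟨fun t m => Function.surjInv h𝔽 t • m⟩
  have hsmul : ∀ (r : R) (m : M), algebraMap R 𝔽 r • m = r • m := fun r m => by
    change Function.surjInv h𝔽 (algebraMap R 𝔽 r) • m = r • m
    rw [← sub_eq_zero, ← sub_smul]
    exact hM _ (by rw [map_sub, Function.surjInv_eq h𝔽, sub_self]) m
  let _ : Module 𝔽 M := Function.Surjective.moduleLeft (algebraMap R 𝔽) h𝔽 hsmul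
  by_contra hcon
  push Not at hcon
  refine hx ((Module.forall_dual_apply_eq_zero_iff 𝔽 x).mp fun f => ?_)
  exact hcon
    { toFun := f
      map_add' := f.map_add
      map_smul' := fun r m => by
        rw [← hsmul, map_smul, smul_eq_mul, RingHom.id_apply, Algebra.smul_def] }

section Coinduced

variable (R : Type u) [CommRing R] (A : Type u) [Ring A] [Algebra R A] (𝔽 : Type u) [Field 𝔽]
  [Algebra R 𝔽]

/-- `M` is annihilated by the kernel of `R → 𝔽`. -/
def IsKilled {A : Type u} [Ring A] [Algebra R A] (M : FGModuleCat.{u} A) : Prop :=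
  ∀ r : R, algebraMap R 𝔽 r = 0 → ∀ x : M, r • x = 0

/-- The `A`-module `Hom_R(A, 𝔽)`. -/
def Coinduced : Type u := A →ₗ[R] 𝔽

instance : AddCommGroup (Coinduced R A 𝔽) := inferInstanceAs (AddCommGroup (A →ₗ[R] 𝔽))

instance : Module R (Coinduced R A 𝔽) := inferInstanceAs (Module R (A →ₗ[R] 𝔽))

instance : Module A (Coinduced R A 𝔽) where
  smul a φ := (show A →ₗ[R] 𝔽 from φ) ∘ₗ LinearMap.mulRight R a
  one_smul φ := LinearMap.ext fun x : A => congrArg (show A →ₗ[R] 𝔽 from φ) (mul_one x)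
  mul_smul a b φ := LinearMap.ext fun x : A =>
    congrArg (show A →ₗ[R] 𝔽 from φ) (mul_assoc x a b).symm
  smul_zero _ := rfl
  smul_add _ _ _ := rfl
  add_smul a b φ := LinearMap.ext fun x : A =>
    (congrArg (show A →ₗ[R] 𝔽 from φ) (mul_add x a b)).trans (map_add (show A →ₗ[R] 𝔽 from φ) _ _)
  zero_smul φ := LinearMap.ext fun x : A =>
    (congrArg (show A →ₗ[R] 𝔽 from φ) (mul_zero x)).trans (map_zero (show A →ₗ[R] 𝔽 from φ))

theorem Coinduced.algebraMap_smul (r : R) (φ : Coinduced R A 𝔽) : algebraMap R A r • φ = r • φ :=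
  LinearMap.ext fun x : A => by
    change (show A →ₗ[R] 𝔽 from φ) (x * algebraMap R A r) = r • (show A →ₗ[R] 𝔽 from φ) x
    rw [← Algebra.commutes, ← Algebra.smul_def, map_smul]

instance : IsScalarTower R A (Coinduced R A 𝔽) :=
  ⟨fun r a φ => by rw [Algebra.smul_def, mul_smul, Coinduced.algebraMap_smul]⟩

theorem Coinduced.finite [IsNoetherianRing R] [Module.Finite R A] [Module.Finite R 𝔽] :
    Module.Finite A (Coinduced R A 𝔽) :=
  have : Module.Finite R (Coinduced R A 𝔽) := inferInstanceAs (Module.Finite R (A →ₗ[R] 𝔽))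
  Module.Finite.of_restrictScalars_finite R A _

/-- The coinduced module as an object of `A`-mod. -/
def coinducedObj [IsNoetherianRing R] [Module.Finite R A] [Module.Finite R 𝔽] : FGModuleCat.{u} A :=
  have := Coinduced.finite R A 𝔽
  FGModuleCat.of A (Coinduced R A 𝔽)

/-- There is an object `D` representing the functor `Hom_R(-, 𝔽)`. -/
theorem exists_coinduced [IsNoetherianRing R] [Module.Finite R A] [Module.Finite R 𝔽] :
    ∃ (D : FGModuleCat.{u} A) (ev : D →ₗ[R] 𝔽),
      (∀ (M : FGModuleCat.{u} A) (c : M →ₗ[R] 𝔽),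
        ∃ k : M →ₗ[A] D, ev ∘ₗ k.restrictScalars R = c) ∧
      ∀ d : D, (∀ a : A, ev (a • d) = 0) → d = 0 := by
  let ev : coinducedObj R A 𝔽 →ₗ[R] 𝔽 :=
    { toFun := fun φ => (show A →ₗ[R] 𝔽 from φ) 1
      map_add' := fun φ ψ => rfl
      map_smul' := fun r φ => by
        have h := Coinduced.algebraMap_smul R A 𝔽 r φ
        exact LinearMap.congr_fun (show (show A →ₗ[R] 𝔽 from _) = (show A →ₗ[R] 𝔽 from _) from h) 1 }
  refine ⟨coinducedObj R A 𝔽, ev, fun M c => ?_, fun d hd => ?_⟩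
  · let k : M →ₗ[A] Coinduced R A 𝔽 :=
      { toFun := fun m => c ∘ₗ (LinearMap.toSpanSingleton A M m).restrictScalars R
        map_add' := fun m m' => LinearMap.ext fun x : A => by
          change c (x • (m + m')) = c (x • m) + c (x • m')
          rw [smul_add, map_add]
        map_smul' := fun a m => LinearMap.ext fun x : A => by
          change c (x • a • m) = c ((x * a) • m)
          rw [mul_smul] }
    refine ⟨k, ?_⟩
    ext m
    change c ((1 : A) • m) = c m
    rw [one_smul]
  · refine LinearMap.ext fun a : A => ?_
    have h : (show A →ₗ[R] 𝔽 from d) (1 * a) = 0 := hd a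
    rwa [one_mul] at h

variable {R A}

theorem isArtinian_of_isKilled [Module.Finite R A] (h𝔽 : Function.Surjective (algebraMap R 𝔽))
    {M : FGModuleCat.{u} A} (hM : IsKilled R 𝔽 M) : IsArtinian R M := by
  have := finite_obj R M
  have : IsArtinian R 𝔽 := isArtinian_of_surjective_algebraMap (R := 𝔽) h𝔽
  obtain ⟨n, f, hf⟩ := Module.Finite.exists_fin' R M
  let g : (Fin n → R) →ₗ[R] (Fin n → 𝔽) :=
    LinearMap.pi fun i => Algebra.linearMap R 𝔽 ∘ₗ LinearMap.proj i
  have hg : Function.Surjective g := fun x => by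
    choose y hy using fun i => h𝔽 (x i)
    exact ⟨y, funext hy⟩
  obtain ⟨k, hk⟩ := exists_factor_of_ker_le hg f fun x hx => by
    rw [← Finset.univ_sum_single x, map_sum]
    refine Finset.sum_eq_zero fun i _ => ?_
    have h0 : algebraMap R 𝔽 (x i) = 0 := congrFun hx i
    have : (Pi.single i (x i) : Fin n → R) = x i • Pi.single i 1 := by
      rw [← Pi.single_smul, smul_eq_mul, mul_one]
    rw [this, map_smul, hM _ h0]
  refine isArtinian_of_surjective (Fin n → 𝔽) k fun m => ?_
  obtain ⟨x, rfl⟩ := hf m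
  exact ⟨g x, LinearMap.congr_fun hk x⟩

end Coinduced

/-- Costandard objects over the residue field, in terms of modules over the algebra over `R`. -/
structure IsCostd (R : Type u) [CommRing R] {A : Type u} [Ring A] [Algebra R A] (𝔽 : Type u)
    [Field 𝔽] [Algebra R 𝔽] {Λ : Type} (Δ : Λ → FGModuleCat.{u} A) (a : Λ)
    (M : FGModuleCat.{u} A) : Prop where
  killed : IsKilled R 𝔽 M
  hom_self : ∃ g : Δ a →ₗ[A] M, g ≠ 0 ∧ ∀ f : Δ a →ₗ[A] M, ∃ r : R, f = r • g
  hom_ne : ∀ b, b ≠ a → ∀ f : Δ b →ₗ[A] M, f = 0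
  extInjective : ExtInjective Δ M

/-- Objects filtered by costandard objects over the residue field. -/
inductive CostdFiltered (R : Type u) [CommRing R] {A : Type u} [Ring A] [Algebra R A] (𝔽 : Type u)
    [Field 𝔽] [Algebra R 𝔽] {Λ : Type} (Δ : Λ → FGModuleCat.{u} A) : FGModuleCat.{u} A → Prop
  | zero (M : FGModuleCat.{u} A) (h : Subsingleton M) : CostdFiltered R 𝔽 Δ M
  | step (M' M N : FGModuleCat.{u} A) (a : Λ) (hN : IsCostd R 𝔽 Δ a N) (f : M' →ₗ[A] M)
      (g : M →ₗ[A] N) (h : IsShortExact f g) (h' : CostdFiltered R 𝔽 Δ M') : CostdFiltered R 𝔽 Δ M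

namespace RankedHW

variable {R : Type u} [CommRing R] {A : Type u} [Ring A] [Algebra R A] {Λ : Type}
  {ρ : Λ → ℕ} {Δ P : Λ → FGModuleCat.{u} A} [IsNoetherianRing A] {𝔽 : Type u} [Field 𝔽]
  [Algebra R 𝔽]

/-- The last step of a costandard filtration of an `ExtInjective` object. -/
theorem exists_costd_quotient [Module.Finite R A] [IsNoetherianRing R] (H : RankedHW R ρ Δ P)
    {M : FGModuleCat.{u} A} (hM : ExtInjective Δ M) (hMk : IsKilled R 𝔽 M) (a : Λ)
    (ha : ∃ f : Δ a →ₗ[A] M, f ≠ 0) (hmax : ∀ c, ρ a < ρ c → ∀ f : Δ c →ₗ[A] M, f = 0) :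
    ∃ (M' N : FGModuleCat.{u} A) (f : M' →ₗ[A] M) (q : M →ₗ[A] N), IsShortExact f q ∧
      ExtInjective Δ M' ∧ IsCostd R 𝔽 Δ a N := by
  obtain ⟨f₀, hf₀⟩ := ha
  have := finite_hom R (Δ a) M
  have : Nontrivial (Δ a →ₗ[A] M) := ⟨f₀, 0, hf₀⟩
  -- The costandard quotient will be `M / S`, where `S` is the largest submodule receiving from `Δ
  -- a` only maps that belong to the hyperplane `h`.
  obtain ⟨h, hcoatom⟩ := IsCoatomic.exists_coatom (Submodule R (Δ a →ₗ[A] M))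
  obtain ⟨K, i, π, hK, hKf⟩ := H.proj_cover a
  have := H.proj_projective a
  -- maps out of the projective cover
  have hP : ∀ {X : FGModuleCat.{u} A}, (∀ c, ρ a < ρ c → ∀ f : Δ c →ₗ[A] X, f = 0) →
      ∀ g : P a →ₗ[A] X, ∃ g' : Δ a →ₗ[A] X, g' ∘ₗ π = g := fun hX g =>
    hK.exists_desc g (hKf.hom_eq_zero hX _)
  have hPb : ∀ b, ρ b < ρ a → ∀ g : P a →ₗ[A] Δ b, g = 0 := fun b hb g => by
    obtain ⟨g', rfl⟩ := hP (fun c hc f => H.hom_eq_zero (hb.trans hc) f) g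
    rw [H.hom_eq_zero hb g', LinearMap.zero_comp]
  let Pr : Submodule A M → Prop := fun S =>
    ∀ g : Δ a →ₗ[A] M, LinearMap.range g ≤ S → g ∈ h
  have hN : IsNoetherian A M := isNoetherian_of_isNoetherianRing_of_finite A M
  obtain ⟨S, hS, hSmax⟩ := set_has_maximal_iff_noetherian.mpr hN {S | Pr S} ⟨⊥, fun g hg => by
    rw [le_bot_iff, LinearMap.range_eq_bot] at hg
    exact hg ▸ h.zero_mem⟩
  -- The property is stable under sums, so a maximal `S` is the largest: by maximality of the rank
  -- of `a`, maps `Δ a → M` are the same as maps from the projective `P a`, and these decompose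
  -- along `S × S' → S ⊔ S'`.
  have hsup : ∀ S', Pr S' → S' ≤ S := fun S' hS' => by
    have hPr : Pr (S ⊔ S') := fun g hg => by
      let c : (S × S') →ₗ[A] (S ⊔ S' : Submodule A M) :=
        ((S.subtype.comp (LinearMap.fst A S S')) + S'.subtype.comp (LinearMap.snd A S S')).codRestrict
          (S ⊔ S') fun x => Submodule.add_mem_sup x.1.2 x.2.2
      have hc : Function.Surjective c := fun x => by
        obtain ⟨y, hy, z, hz, hyz⟩ := Submodule.mem_sup.mp x.2
        exact ⟨(⟨y, hy⟩, ⟨z, hz⟩), Subtype.ext hyz⟩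
      obtain ⟨l, hl⟩ := Module.projective_lifting_property c
        ((g ∘ₗ π).codRestrict (S ⊔ S') fun x => hg (LinearMap.mem_range_self g _)) hc
      obtain ⟨g₁, hg₁⟩ := hP hmax (S.subtype ∘ₗ LinearMap.fst A S S' ∘ₗ l)
      obtain ⟨g₂, hg₂⟩ := hP hmax (S'.subtype ∘ₗ LinearMap.snd A S S' ∘ₗ l)
      have hsum : g = g₁ + g₂ := comp_right_cancel hK.2.1 (by
        rw [LinearMap.add_comp, hg₁, hg₂]
        ext x
        exact (congrArg Subtype.val (LinearMap.congr_fun hl x)).symm)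
      have m₁ : g₁ ∈ h := hS g₁ (by
        rintro _ ⟨x, rfl⟩
        obtain ⟨y, rfl⟩ := hK.2.1 x
        have := LinearMap.congr_fun hg₁ y
        simp only [LinearMap.comp_apply] at this
        rw [this]
        exact (l y).1.2)
      have m₂ : g₂ ∈ h := hS' g₂ (by
        rintro _ ⟨x, rfl⟩
        obtain ⟨y, rfl⟩ := hK.2.1 x
        have := LinearMap.congr_fun hg₂ y
        simp only [LinearMap.comp_apply] at this
        rw [this]
        exact (l y).2.2)
      exact hsum ▸ h.add_mem m₁ m₂
    have := eq_of_le_of_not_lt (le_sup_left : S ≤ S ⊔ S') (hSmax _ hPr)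
    rw [this]
    exact le_sup_right
  obtain ⟨M', j, hj, hjr⟩ := exists_subobject M S
  obtain ⟨N, q, hs⟩ := exists_cokernel j hj
  have hqS : ∀ x ∈ S, q x = 0 := fun x hx => by
    rw [← hjr] at hx
    obtain ⟨y, rfl⟩ := hx
    exact hs.apply_eq_zero y
  have hM'0 : ∀ c, ρ a < ρ c → ∀ f : Δ c →ₗ[A] M', f = 0 := fun c hc f =>
    comp_left_cancel hj (by rw [hmax c hc (j ∘ₗ f), LinearMap.comp_zero])
  -- images of standard objects of smaller rank
  have hlow : ∀ b, ρ b < ρ a → ∀ f : Δ b →ₗ[A] M, LinearMap.range f ≤ S := fun b hb f =>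
    hsup _ fun g hg => by
      obtain ⟨l, hl⟩ := Module.projective_lifting_property f.rangeRestrict
        ((g ∘ₗ π).codRestrict (LinearMap.range f) fun x => hg (LinearMap.mem_range_self g _))
        f.surjective_rangeRestrict
      rw [hPb b hb l, LinearMap.comp_zero] at hl
      have : g = 0 := comp_right_cancel hK.2.1 (by
        ext x
        exact (congrArg Subtype.val (LinearMap.congr_fun hl x)).symm)
      exact this ▸ h.zero_mem
  -- For labels of rank at least `ρ a` there are no maps from higher standard objects. For lower
  -- `b`, a map is extended into `M`; maps from `P a` to the extension vanish in `Δ b`, hence come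
  -- from the given subobject, and so the extended map still lands in `S`.
  have hM' : ExtInjective Δ M' := fun b => by
    by_cases hb : ρ a ≤ ρ b
    · exact H.extZero_std fun c hc => hM'0 c (hb.trans_lt hc)
    rw [not_le] at hb
    intro X Y f g hfg φ
    obtain ⟨k, hk⟩ := hM b X Y f g hfg (j ∘ₗ φ)
    have hkS : LinearMap.range k ≤ S := hsup _ fun w hw => by
      obtain ⟨l, hl⟩ := Module.projective_lifting_property k.rangeRestrict
        ((w ∘ₗ π).codRestrict (LinearMap.range k) fun x => hw (LinearMap.mem_range_self w _))
        k.surjective_rangeRestrict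
      obtain ⟨l', rfl⟩ := hfg.exists_lift l (hPb b hb _)
      refine hS w ?_
      rintro _ ⟨x, rfl⟩
      obtain ⟨y, rfl⟩ := hK.2.1 x
      have e := congrArg Subtype.val (LinearMap.congr_fun hl y)
      have e' : k (f (l' y)) = w (π y) := e
      have e₂ : k (f (l' y)) = j (φ (l' y)) := LinearMap.congr_fun hk (l' y)
      rw [← e', e₂, ← hjr]
      exact LinearMap.mem_range_self j _
    obtain ⟨k', hk'⟩ := exists_factor_of_range_le hj k fun x => by
      have : k x ∈ LinearMap.range j := hjr ▸ hkS (LinearMap.mem_range_self k x)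
      exact this
    exact ⟨k', comp_left_cancel hj (by rw [← LinearMap.comp_assoc, hk', hk])⟩
  obtain ⟨g₀, hg₀⟩ : ∃ g₀, g₀ ∉ h := by
    by_contra hcon
    push Not at hcon
    exact hcoatom.1 (eq_top_iff.mpr fun x _ => hcon x)
  refine ⟨M', N, j, q, hs, hM', fun r hr x => ?_, ⟨q ∘ₗ g₀, fun h0 => hg₀ (hS g₀ ?_), fun f => ?_⟩,
    fun b hb f => ?_, H.extInjective_cokernel hs hM' hM⟩
  · obtain ⟨y, rfl⟩ := hs.2.1 x
    rw [← LinearMap.map_smul_of_tower, hMk r hr, map_zero]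
  · rintro _ ⟨x, rfl⟩
    obtain ⟨y, hy⟩ := hs.exists_of_apply_eq_zero (x := g₀ x) (LinearMap.congr_fun h0 x)
    rw [← hy, ← hjr]
    exact LinearMap.mem_range_self j y
  · obtain ⟨f', rfl⟩ := (hM' a).exists_lift hs f
    have htop : f' ∈ h ⊔ Submodule.span R {g₀} := by
      rw [hcoatom.2 _ (lt_of_le_of_ne le_sup_left fun he => hg₀ (by
        rw [he]
        exact Submodule.mem_sup_right (Submodule.mem_span_singleton_self g₀)))]
      exact Submodule.mem_top
    obtain ⟨w, hw, z, hz, rfl⟩ := Submodule.mem_sup.mp htop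
    obtain ⟨r, rfl⟩ := Submodule.mem_span_singleton.mp hz
    refine ⟨r, ?_⟩
    -- Because `End(Δ a) = R`, every map from `Δ a` to the range of `w` is a multiple of `w` and so
    -- lies in `h`.
    have hwS : LinearMap.range w ≤ S := hsup _ fun g hg => by
      obtain ⟨l, hl⟩ := Module.projective_lifting_property w.rangeRestrict
        ((g ∘ₗ π).codRestrict (LinearMap.range w) fun x => hg (LinearMap.mem_range_self g _))
        w.surjective_rangeRestrict
      obtain ⟨l', rfl⟩ := hP (fun c hc f => H.hom_eq_zero hc f) l
      obtain ⟨t, rfl⟩ := (H.std_end a).2 l'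
      have : g = t • w := comp_right_cancel hK.2.1 (by
        ext x
        have e := congrArg Subtype.val (LinearMap.congr_fun hl x)
        have e' : w (t • π x) = g (π x) := e
        rw [LinearMap.comp_apply, ← e', LinearMap.map_smul_of_tower]
        rfl)
      exact this ▸ h.smul_mem t hw
    rw [LinearMap.comp_add, LinearMap.comp_smul]
    rw [show q ∘ₗ w = 0 from LinearMap.ext fun x => hqS _ (hwS (LinearMap.mem_range_self w x)),
      zero_add]
  · obtain ⟨f', rfl⟩ := (hM' b).exists_lift hs f
    rcases lt_trichotomy (ρ b) (ρ a) with hlt | heq | hgt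
    · exact LinearMap.ext fun x => hqS _ (hlow b hlt f' (LinearMap.mem_range_self f' x))
    · exact absurd (H.rank_injective heq) hb
    · rw [hmax b hgt f', LinearMap.comp_zero]

/-- `ExtInjective` objects over the residue field have costandard filtrations. -/
theorem costdFiltered [Finite Λ] [Module.Finite R A] [IsNoetherianRing R] (H : RankedHW R ρ Δ P)
    (h𝔽 : Function.Surjective (algebraMap R 𝔽)) {M : FGModuleCat.{u} A} (hM : ExtInjective Δ M)
    (hMk : IsKilled R 𝔽 M) : CostdFiltered R 𝔽 Δ M := by
  induction hn : Module.length R M using WellFoundedLT.induction generalizing M with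
  | ind n ih =>
    subst hn
    by_cases h0 : ∀ a (f : Δ a →ₗ[A] M), f = 0
    · exact .zero M (H.std_generate M h0)
    push Not at h0
    obtain ⟨a, ha, hamax⟩ := Set.exists_max_image {a | ∃ f : Δ a →ₗ[A] M, f ≠ 0} ρ
      (Set.toFinite _) h0
    obtain ⟨M', N, f, q, hs, hM', hN⟩ := H.exists_costd_quotient hM hMk a ha fun c hc f => by
      by_contra hf
      exact absurd (hamax c ⟨f, hf⟩) (not_le.mpr hc)
    have hM'k : IsKilled R 𝔽 M' := fun r hr x => hs.1 (by
      rw [LinearMap.map_smul_of_tower, hMk r hr, map_zero])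
    refine .step M' M N a hN f q hs (ih _ ?_ hM' hM'k rfl)
    have := isArtinian_of_isKilled 𝔽 h𝔽 hM'k
    have := finite_obj R M'
    have hlen := Module.length_eq_add_of_exact (f.restrictScalars R) (q.restrictScalars R) hs.1
      hs.2.1 (fun x => ⟨fun hx => hs.exists_of_apply_eq_zero hx, by
        rintro ⟨y, rfl⟩
        exact hs.apply_eq_zero y⟩)
    rw [hlen]
    obtain ⟨g, hg, -⟩ := hN.hom_self
    have : Nontrivial N := by
      by_contra hcon
      rw [not_nontrivial_iff_subsingleton] at hcon
      exact hg (LinearMap.ext fun x => Subsingleton.elim _ _)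
    simpa using ENat.add_lt_add_of_le_of_lt (Module.length_ne_top (R := R) (M := M')) le_rfl
      (Module.length_pos (R := R) (M := N))

/-- If `Hom(X, -)` is faithful on costandard objects, then it detects maps out of `ExtInjective`
objects over the residue field. -/
theorem exists_comp_ne_zero [Finite Λ] [Module.Finite R A] [IsNoetherianRing R]
    (H : RankedHW R ρ Δ P) (h𝔽 : Function.Surjective (algebraMap R 𝔽)) (X : FGModuleCat.{u} A)
    [Module.Projective A X]
    (hX : ∀ a b (N N' : FGModuleCat.{u} A), IsCostd R 𝔽 Δ a N → IsCostd R 𝔽 Δ b N' →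
      ∀ f : N →ₗ[A] N', f ≠ 0 → ∃ g : X →ₗ[A] N, f ∘ₗ g ≠ 0)
    {M : FGModuleCat.{u} A} (hM : ExtInjective Δ M) (hMk : IsKilled R 𝔽 M)
    {Q : FGModuleCat.{u} A} (hQ : IsKilled R 𝔽 Q) (φ : M →ₗ[A] Q) (hφ : φ ≠ 0) :
    ∃ g : X →ₗ[A] M, φ ∘ₗ g ≠ 0 := by
  have hMc := H.costdFiltered h𝔽 hM hMk
  clear hM hMk
  have hfin : Module.Finite R 𝔽 := Module.Finite.of_surjective (Algebra.linearMap R 𝔽) h𝔽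
  -- reduction to maps into an injective object
  obtain ⟨D, ev, hD, hD0⟩ := exists_coinduced R A 𝔽
  have hDk : IsKilled R 𝔽 D := fun r hr d => hD0 _ fun a => by
    rw [smul_comm a r d, map_smul, Algebra.smul_def, hr, zero_mul]
  -- An extension of `Δ b` splits over `R`, so functionals on the subobject extend; and maps to `D`
  -- are the same as functionals.
  have hDe : ExtInjective Δ D := fun b M' M f g hs h => by
    have := H.std_projective b
    obtain ⟨s, hs'⟩ := Module.projective_lifting_property (g.restrictScalars R) LinearMap.id hs.2.1
    have es := LinearMap.congr_fun hs'
    simp only [LinearMap.comp_apply, LinearMap.id_apply, LinearMap.coe_restrictScalars] at es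
    obtain ⟨r, hr⟩ := exists_factor_of_range_le (f := f.restrictScalars R) hs.1
      (LinearMap.id - s ∘ₗ g.restrictScalars R) fun x => hs.exists_of_apply_eq_zero (by simp [es])
    have er : ∀ x, r (f x) = x := fun x => hs.1 (by
      have := LinearMap.congr_fun hr (f x)
      simpa [hs.apply_eq_zero] using this)
    obtain ⟨k, hk⟩ := hD M (ev ∘ₗ h.restrictScalars R ∘ₗ r)
    have ek := LinearMap.congr_fun hk
    simp only [LinearMap.comp_apply, LinearMap.coe_restrictScalars] at ek
    refine ⟨k, LinearMap.ext fun x => ?_⟩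
    rw [← sub_eq_zero]
    refine hD0 _ fun a => ?_
    rw [smul_sub, map_sub, LinearMap.comp_apply, ← map_smul, ← map_smul, ← map_smul, ek, er,
      sub_self]
  have hDc := H.costdFiltered h𝔽 hDe hDk
  suffices hgoal : ∀ θ : M →ₗ[A] D, θ ≠ 0 → ∃ g : X →ₗ[A] M, θ ∘ₗ g ≠ 0 by
    obtain ⟨x, hx⟩ : ∃ x, φ x ≠ 0 := by
      by_contra hcon
      push Not at hcon
      exact hφ (LinearMap.ext hcon)
    obtain ⟨c, hc⟩ := exists_functional_of_killed h𝔽 hQ hx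
    obtain ⟨k, hk⟩ := hD Q c
    obtain ⟨g, hg⟩ := hgoal (k ∘ₗ φ) fun h0 => hc (by
      rw [← hk, LinearMap.comp_apply]
      have : k (φ x) = 0 := LinearMap.congr_fun h0 x
      rw [LinearMap.coe_restrictScalars, this, map_zero])
    exact ⟨g, fun h0 => hg (by rw [LinearMap.comp_assoc, h0, LinearMap.comp_zero])⟩
  clear hD hD0 hDk hDe ev
  -- Dévissage on both sides: costandard filtrations of the target and then of the source reduce the
  -- claim to maps between two costandard objects.
  induction hDc with
  | zero D h => exact fun θ hθ => absurd (LinearMap.ext fun x => Subsingleton.elim _ _) hθ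
  | step D' D N b hN i q hs _ ihD =>
    intro θ hθ
    by_cases h0 : q ∘ₗ θ = 0
    · obtain ⟨k, rfl⟩ := hs.exists_lift θ h0
      obtain ⟨g, hg⟩ := ihD k fun h => hθ (by rw [h, LinearMap.comp_zero])
      exact ⟨g, fun h => hg (comp_left_cancel hs.1 (by
        rw [← LinearMap.comp_assoc, h, LinearMap.comp_zero]))⟩
    suffices hgoal : ∀ θ : M →ₗ[A] N, θ ≠ 0 → ∃ g : X →ₗ[A] M, θ ∘ₗ g ≠ 0 by
      obtain ⟨g, hg⟩ := hgoal _ h0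
      exact ⟨g, fun h => hg (by rw [LinearMap.comp_assoc, h, LinearMap.comp_zero])⟩
    clear hφ φ ihD hθ h0 θ
    induction hMc with
    | zero M h =>
      exact fun θ hθ => absurd (LinearMap.ext fun x => by
        rw [Subsingleton.elim x 0, map_zero, map_zero]) hθ
    | step M' M N' a hN' f p hfp _ ihM =>
      intro θ hθ
      by_cases h0 : θ ∘ₗ f = 0
      · obtain ⟨k, rfl⟩ := hfp.exists_desc θ h0
        obtain ⟨g, hg⟩ := hX a b N' N hN' hN k fun h => hθ (by rw [h, LinearMap.zero_comp])
        obtain ⟨l, rfl⟩ := Module.projective_lifting_property p g hfp.2.1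
        exact ⟨l, hg⟩
      · obtain ⟨g, hg⟩ := ihM _ h0
        exact ⟨f ∘ₗ g, hg⟩

end RankedHW

end FockCat

/-! ### Reduction modulo ideals and detection of nonzero maps -/

namespace FockCat

section Reduction

variable {R : Type u} [CommRing R] {A : Type u} [Ring A] [Algebra R A]

/-- The elements of `M` on which all functionals take values in the ideal `J`; this is `J M` when
`M` is projective over `R`. -/
def dualSub (J : Ideal R) (M : FGModuleCat.{u} A) : Submodule A M where
  carrier := {x | ∀ φ : M →ₗ[R] R, φ x ∈ J}
  add_mem' hx hy φ := by
    rw [map_add]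
    exact J.add_mem (hx φ) (hy φ)
  zero_mem' φ := by
    rw [map_zero]
    exact J.zero_mem
  smul_mem' a _ hx φ := hx (φ ∘ₗ Algebra.lsmul R R M a)

theorem mem_dualSub {J : Ideal R} {M : FGModuleCat.{u} A} {x : M} :
    x ∈ dualSub J M ↔ ∀ φ : M →ₗ[R] R, φ x ∈ J := Iff.rfl

theorem dualSub_mono {J J' : Ideal R} (h : J ≤ J') (M : FGModuleCat.{u} A) :
    dualSub J M ≤ dualSub J' M := fun _ hx φ => h (hx φ)

theorem smul_mem_dualSub {J : Ideal R} {M : FGModuleCat.{u} A} {r : R} (hr : r ∈ J) (x : M) :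
    r • x ∈ dualSub J M := fun φ => by
  rw [map_smul, smul_eq_mul]
  exact J.mul_mem_right _ hr

theorem map_mem_dualSub {J : Ideal R} {M N : FGModuleCat.{u} A} (f : M →ₗ[A] N) {x : M}
    (hx : x ∈ dualSub J M) : f x ∈ dualSub J N := fun φ => hx (φ ∘ₗ f.restrictScalars R)

theorem exists_dualBasis [Module.Finite R A] (M : FGModuleCat.{u} A) [Module.Projective R M] :
    ∃ (n : ℕ) (e : Fin n → M) (φ : Fin n → (M →ₗ[R] R)), ∀ x, ∑ j, φ j x • e j = x := by
  have := finite_obj R M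
  obtain ⟨n, f, g, -, -, hfg⟩ := Module.Finite.exists_comp_eq_id_of_projective R M
  refine ⟨n, fun j => f (Pi.single j 1), fun j => LinearMap.proj j ∘ₗ g, fun x => ?_⟩
  have h : f (g x) = x := LinearMap.congr_fun hfg x
  conv_rhs => rw [← h, ← Finset.univ_sum_single (g x), map_sum]
  refine Finset.sum_congr rfl fun j _ => ?_
  rw [← map_smul, ← Pi.single_smul, smul_eq_mul, mul_one]
  rfl

theorem eq_zero_of_mem_dualSub_bot [Module.Finite R A] {M : FGModuleCat.{u} A}
    [Module.Projective R M] {x : M} (hx : x ∈ dualSub (⊥ : Ideal R) M) : x = 0 := by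
  obtain ⟨n, e, φ, h⟩ := exists_dualBasis (R := R) M
  rw [← h x]
  refine Finset.sum_eq_zero fun j _ => ?_
  have : φ j x = 0 := hx (φ j)
  rw [this, zero_smul]

/-- Expand `x` in a dual basis: its coordinates lie in `J`, which acts by zero on the target. -/
theorem eq_zero_of_mem_dualSub [Module.Finite R A] {M N : FGModuleCat.{u} A}
    [Module.Projective R M] {J : Ideal R} (f : M →ₗ[A] N) (hN : ∀ r ∈ J, ∀ y : N, r • y = 0)
    {x : M} (hx : x ∈ dualSub J M) : f x = 0 := by
  obtain ⟨n, e, φ, h⟩ := exists_dualBasis (R := R) M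
  rw [← h x, map_sum]
  refine Finset.sum_eq_zero fun j _ => ?_
  rw [LinearMap.map_smul_of_tower, hN _ (hx (φ j))]

/-- Ideals generated by regular sequences. -/
inductive IsRegularIdeal : Ideal R → Prop
  | bot : IsRegularIdeal ⊥
  | step (J J' : Ideal R) (z : R) (hz : ∀ x, z * x ∈ J → x ∈ J)
      (hJ : ∀ x, x ∈ J' ↔ ∃ u, x - z * u ∈ J) (h : IsRegularIdeal J) : IsRegularIdeal J'

/-- `q` is the projection of `M` onto `M / J M`. -/
def IsReduction (J : Ideal R) {M M' : FGModuleCat.{u} A} (q : M →ₗ[A] M') : Prop :=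
  Function.Surjective q ∧ LinearMap.ker q = dualSub J M

theorem IsReduction.eq_zero_iff {J : Ideal R} {M M' : FGModuleCat.{u} A} {q : M →ₗ[A] M'}
    (h : IsReduction J q) {x : M} : q x = 0 ↔ x ∈ dualSub J M := by
  rw [← h.2, LinearMap.mem_ker]

theorem exists_reduction (J : Ideal R) (M : FGModuleCat.{u} A) :
    ∃ (M' : FGModuleCat.{u} A) (q : M →ₗ[A] M'), IsReduction J q :=
  exists_quotient M (dualSub J M)

theorem IsReduction.smul_eq_zero {J : Ideal R} {M M' : FGModuleCat.{u} A} {q : M →ₗ[A] M'}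
    (h : IsReduction J q) {r : R} (hr : r ∈ J) (y : M') : r • y = 0 := by
  obtain ⟨x, rfl⟩ := h.1 y
  rw [← LinearMap.map_smul_of_tower, h.eq_zero_iff]
  exact smul_mem_dualSub hr x

/-- Here `J' = J + (z)`, so this says `J'M = JM + zM`; coordinates in a dual basis reduce it to the
ring. -/
theorem mem_regular_step {J J' : Ideal R} {z : R} (hJ : ∀ x, x ∈ J' ↔ ∃ u, x - z * u ∈ J)
    [Module.Finite R A] {M : FGModuleCat.{u} A} [Module.Projective R M] {x : M} :
    x ∈ dualSub J' M ↔ ∃ y, x - z • y ∈ dualSub J M := by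
  constructor
  · intro hx
    obtain ⟨n, e, φ, h⟩ := exists_dualBasis (R := R) M
    choose u hu using fun j => (hJ _).mp (hx (φ j))
    refine ⟨∑ j, u j • e j, ?_⟩
    have : x - z • ∑ j, u j • e j = ∑ j, (φ j x - z * u j) • e j := by
      conv_lhs => rw [← h x]
      rw [Finset.smul_sum, ← Finset.sum_sub_distrib]
      exact Finset.sum_congr rfl fun j _ => by rw [sub_smul, mul_smul]
    rw [this]
    exact Submodule.sum_mem _ fun j _ => smul_mem_dualSub (hu j) _
  · rintro ⟨y, hy⟩ φ
    refine (hJ _).mpr ⟨φ y, ?_⟩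
    have := hy φ
    rwa [map_sub, map_smul, smul_eq_mul] at this

end Reduction

namespace RankedHW

variable {R : Type u} [CommRing R] {A : Type u} [Ring A] [Algebra R A] {Λ : Type}
  {ρ : Λ → ℕ} {Δ P : Λ → FGModuleCat.{u} A} [IsNoetherianRing A]

/-- Reducing an `ExtInjective` object modulo a regular sequence gives an `ExtInjective` object. -/
theorem extInjective_reduction [Module.Finite R A] (H : RankedHW R ρ Δ P) {J : Ideal R}
    (hJ : IsRegularIdeal J) {T : FGModuleCat.{u} A} [Module.Projective R T]
    (hT : ExtInjective Δ T) :
    ∀ {T' : FGModuleCat.{u} A} {q : T →ₗ[A] T'}, IsReduction J q → ExtInjective Δ T' := by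
  induction hJ with
  | bot =>
    intro T' q hq b
    refine (hT b).of_equiv_right (LinearEquiv.ofBijective q ⟨?_, hq.1⟩)
    rw [injective_iff_map_eq_zero]
    exact fun x hx => eq_zero_of_mem_dualSub_bot (hq.eq_zero_iff.mp hx)
  | step J J' z hz hJ _ ih =>
    intro T' q' hq'
    obtain ⟨T₀, q, hq⟩ := exists_reduction J T
    obtain ⟨f, hf⟩ := exists_factor_of_ker_le hq.1 (z • q) fun x hx => by
      rw [LinearMap.smul_apply, hx, smul_zero]
    have hle : J ≤ J' := fun x hx => (hJ x).mpr ⟨0, by rwa [mul_zero, sub_zero]⟩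
    obtain ⟨g, hg⟩ := exists_factor_of_ker_le hq.1 q' fun x hx =>
      hq'.eq_zero_iff.mpr (dualSub_mono hle _ (hq.eq_zero_iff.mp hx))
    have ef := LinearMap.congr_fun hf
    have eg := LinearMap.congr_fun hg
    simp only [LinearMap.comp_apply, LinearMap.smul_apply] at ef eg
    -- This is `0 → T/JT → T/JT → T/J'T → 0`, the first map being multiplication by `z`, which is
    -- injective by regularity. The right-hand term is `ExtInjective` as a cokernel of
    -- `ExtInjective` objects.
    have hs : IsShortExact f g := by
      refine isShortExact_of ?_ (fun y => ?_) (fun x => ?_) fun x hx => ?_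
      · rw [injective_iff_map_eq_zero]
        intro y hy
        obtain ⟨x, rfl⟩ := hq.1 y
        rw [ef, ← LinearMap.map_smul_of_tower, hq.eq_zero_iff] at hy
        refine hq.eq_zero_iff.mpr fun φ => hz _ ?_
        have := hy φ
        rwa [map_smul, smul_eq_mul] at this
      · obtain ⟨x, rfl⟩ := hq'.1 y
        exact ⟨q x, eg x⟩
      · obtain ⟨y, rfl⟩ := hq.1 x
        rw [ef, ← LinearMap.map_smul_of_tower, eg, hq'.eq_zero_iff, mem_regular_step hJ]
        exact ⟨y, by rw [sub_self]; exact Submodule.zero_mem _⟩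
      · obtain ⟨y, rfl⟩ := hq.1 x
        rw [eg, hq'.eq_zero_iff, mem_regular_step hJ] at hx
        obtain ⟨w, hw⟩ := hx
        refine ⟨q w, ?_⟩
        rw [ef, eq_comm, ← sub_eq_zero, ← LinearMap.map_smul_of_tower, ← map_sub, hq.eq_zero_iff]
        exact hw
    exact H.extInjective_cokernel hs (ih hq) (ih hq)

end RankedHW

section Nakayama

variable {R : Type u} [CommRing R] [IsLocalRing R] {A : Type u} [Ring A] [Algebra R A]
  [Module.Finite R A]

/-- A nonzero object has a nonzero quotient annihilated by a given proper ideal. -/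
theorem exists_quotient_of_nontrivial {J : Ideal R} (hJ : J ≠ ⊤) (M : FGModuleCat.{u} A)
    [Nontrivial M] : ∃ (M' : FGModuleCat.{u} A) (q : M →ₗ[A] M'), Function.Surjective q ∧
      Nontrivial M' ∧ ∀ r ∈ J, ∀ y : M', r • y = 0 := by
  let S : Submodule A M :=
    { carrier := (J • ⊤ : Submodule R M)
      add_mem' := (J • ⊤ : Submodule R M).add_mem
      zero_mem' := (J • ⊤ : Submodule R M).zero_mem
      smul_mem' := fun a x hx => by
        refine Submodule.smul_induction_on (p := fun x => a • x ∈ (J • ⊤ : Submodule R M)) hx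
          (fun r hr m _ => ?_) fun x y hx hy => ?_
        · rw [smul_comm]
          exact Submodule.smul_mem_smul hr trivial
        · rw [smul_add]
          exact Submodule.add_mem _ hx hy }
  obtain ⟨M', q, hq, hk⟩ := exists_quotient M S
  refine ⟨M', q, hq, ?_, fun r hr y => ?_⟩
  · by_contra hcon
    rw [not_nontrivial_iff_subsingleton] at hcon
    have htop : (J • ⊤ : Submodule R M) = ⊤ := by
      rw [eq_top_iff]
      intro x _
      have : x ∈ S := hk ▸ (Subsingleton.elim (q x) 0)
      exact this
    have := finite_obj R M
    have h0 := Submodule.eq_bot_of_le_smul_of_le_jacobson_bot J (⊤ : Submodule R M)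
      Module.Finite.fg_top htop.ge
      ((IsLocalRing.le_maximalIdeal hJ).trans (IsLocalRing.maximalIdeal_le_jacobson _))
    obtain ⟨x, hx⟩ := exists_ne (0 : M)
    exact hx ((Submodule.mem_bot R).mp (h0 ▸ Submodule.mem_top))
  · obtain ⟨x, rfl⟩ := hq y
    rw [← LinearMap.map_smul_of_tower]
    have h : r • x ∈ S :=
      (Submodule.smul_mem_smul hr trivial : r • x ∈ (J • ⊤ : Submodule R M))
    rw [← hk] at h
    exact h

theorem exists_not_mem_dualSub {J : Ideal R} (hJ : J ≠ ⊤) (M : FGModuleCat.{u} A)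
    [Module.Projective R M] [Nontrivial M] : ∃ x, x ∉ dualSub J M := by
  obtain ⟨M', q, hq, hM', hk⟩ := exists_quotient_of_nontrivial hJ M
  obtain ⟨y, hy⟩ := exists_ne (0 : M')
  obtain ⟨x, rfl⟩ := hq y
  exact ⟨x, fun hx => hy (eq_zero_of_mem_dualSub q hk hx)⟩

end Nakayama

/-- A map out of `X` detects every nonzero map into `V`. -/
def Detects {A : Type u} [Ring A] (X V : FGModuleCat.{u} A) : Prop :=
  ∀ (M : FGModuleCat.{u} A) (f : M →ₗ[A] V), f ≠ 0 → ∃ g : X →ₗ[A] M, f ∘ₗ g ≠ 0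

section Detects

variable {A : Type u} [Ring A]

theorem Detects.of_retract {X X' V : FGModuleCat.{u} A} (h : Detects X V) {i : X →ₗ[A] X'}
    {p : X' →ₗ[A] X} (hp : p ∘ₗ i = LinearMap.id) : Detects X' V := fun M f hf => by
  obtain ⟨g, hg⟩ := h M f hf
  refine ⟨g ∘ₗ p, fun h0 => hg ?_⟩
  have := congrArg (· ∘ₗ i) h0
  simpa only [LinearMap.comp_assoc, hp, LinearMap.comp_id, LinearMap.zero_comp] using this

theorem Detects.extension {X V' V V'' : FGModuleCat.{u} A} {i : V' →ₗ[A] V} {q : V →ₗ[A] V''}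
    (hs : IsShortExact i q) (h' : Detects X V') (h'' : Detects X V'') : Detects X V :=
  fun M f hf => by
    by_cases h0 : q ∘ₗ f = 0
    · obtain ⟨k, rfl⟩ := hs.exists_lift f h0
      obtain ⟨g, hg⟩ := h' M k fun h => hf (by rw [h, LinearMap.comp_zero])
      exact ⟨g, fun h => hg (comp_left_cancel hs.1 (by
        rw [← LinearMap.comp_assoc, h, LinearMap.comp_zero]))⟩
    · obtain ⟨g, hg⟩ := h'' M _ h0
      exact ⟨g, fun h => hg (by rw [LinearMap.comp_assoc, h, LinearMap.comp_zero])⟩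

end Detects

namespace RankedHW

variable {R : Type u} [CommRing R] {A : Type u} [Ring A] [Algebra R A] {Λ : Type}
  {ρ : Λ → ℕ} {Δ P : Λ → FGModuleCat.{u} A}

/-- It suffices to detect nonzero maps out of standard objects. -/
theorem detects_of_std [IsNoetherianRing A] (H : RankedHW R ρ Δ P) {X V : FGModuleCat.{u} A}
    [Module.Projective A X]
    (h : ∀ a (f : Δ a →ₗ[A] V), f ≠ 0 → ∃ g : X →ₗ[A] Δ a, f ∘ₗ g ≠ 0) : Detects X V := by
  intro M f hf
  obtain ⟨I, q, i, hq, hi, rfl⟩ := exists_image f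
  by_contra hcon
  push Not at hcon
  have hI : ∀ g : X →ₗ[A] I, g = 0 := fun g => by
    obtain ⟨l, rfl⟩ := Module.projective_lifting_property q g hq
    exact comp_left_cancel hi (by rw [← LinearMap.comp_assoc, hcon, LinearMap.comp_zero])
  have hsub : Subsingleton I := H.std_generate I fun a k => by
    by_contra hk
    obtain ⟨g, hg⟩ := h a (i ∘ₗ k) fun h0 => hk (comp_left_cancel hi (by rw [h0,
      LinearMap.comp_zero]))
    exact hg (by rw [LinearMap.comp_assoc, hI (k ∘ₗ g), LinearMap.comp_zero])
  exact hf (LinearMap.ext fun x => by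
    rw [LinearMap.comp_apply, Subsingleton.elim (q x) 0, map_zero, LinearMap.zero_apply])


/-- Standard filtrations split over `R`, so they stay exact modulo `J`, and detection is stable
under extensions of the target. -/
theorem detects_reduction (H : RankedHW R ρ Δ P) {J : Ideal R} {X : FGModuleCat.{u} A}
    (h : ∀ b (V : FGModuleCat.{u} A) (q : Δ b →ₗ[A] V), IsReduction J q → Detects X V)
    {p : Λ → Prop} {N : FGModuleCat.{u} A} (hN : StdFiltered p Δ N) :
    ∀ {V : FGModuleCat.{u} A} {q : N →ₗ[A] V}, IsReduction J q → Detects X V := by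
  induction hN with
  | zero N hN =>
    intro V q hq M f hf
    refine absurd (LinearMap.ext fun x => ?_) hf
    obtain ⟨y, hy⟩ := hq.1 (f x)
    rw [← hy, Subsingleton.elim y 0, map_zero, LinearMap.zero_apply]
  | step N' N b hb f g hs hN' ih =>
    intro V q hq
    obtain ⟨V', q', hq'⟩ := exists_reduction J N'
    obtain ⟨V'', q'', hq''⟩ := exists_reduction J (Δ b)
    obtain ⟨i, hi⟩ := exists_factor_of_ker_le hq'.1 (q ∘ₗ f) fun x hx =>
      hq.eq_zero_iff.mpr (map_mem_dualSub f (hq'.eq_zero_iff.mp hx))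
    obtain ⟨k, hk⟩ := exists_factor_of_ker_le hq.1 (q'' ∘ₗ g) fun x hx =>
      hq''.eq_zero_iff.mpr (map_mem_dualSub g (hq.eq_zero_iff.mp hx))
    have ei := LinearMap.congr_fun hi
    have ek := LinearMap.congr_fun hk
    simp only [LinearMap.comp_apply] at ei ek
    have := H.std_projective b
    obtain ⟨s, hs'⟩ := Module.projective_lifting_property (g.restrictScalars R) LinearMap.id hs.2.1
    have es := LinearMap.congr_fun hs'
    simp only [LinearMap.comp_apply, LinearMap.id_apply, LinearMap.coe_restrictScalars] at es
    obtain ⟨r, hr⟩ := exists_factor_of_range_le (f := f.restrictScalars R) hs.1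
      (LinearMap.id - s ∘ₗ g.restrictScalars R) fun x => hs.exists_of_apply_eq_zero (by simp [es])
    have er : ∀ x, r (f x) = x := fun x => hs.1 (by
      have := LinearMap.congr_fun hr (f x)
      simpa [hs.apply_eq_zero] using this)
    have er' : ∀ x, f (r x) + s (g x) = x := fun x => by
      have := LinearMap.congr_fun hr x
      simp only [LinearMap.comp_apply, LinearMap.coe_restrictScalars, LinearMap.sub_apply,
        LinearMap.id_apply] at this
      rw [this, sub_add_cancel]
    refine Detects.extension (i := i) (q := k) (isShortExact_of ?_ (fun y => ?_) (fun x => ?_)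
      fun x hx => ?_) (ih hq') (h b V'' q'' hq'')
    · rw [injective_iff_map_eq_zero]
      intro y hy
      obtain ⟨x, rfl⟩ := hq'.1 y
      rw [ei, hq.eq_zero_iff] at hy
      refine hq'.eq_zero_iff.mpr fun φ => ?_
      have := hy (φ ∘ₗ r)
      rwa [LinearMap.comp_apply, er] at this
    · obtain ⟨x, rfl⟩ := hq''.1 y
      obtain ⟨z, rfl⟩ := hs.2.1 x
      exact ⟨q z, ek z⟩
    · obtain ⟨y, rfl⟩ := hq'.1 x
      rw [ei, ek, hs.apply_eq_zero, map_zero]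
    · obtain ⟨y, rfl⟩ := hq.1 x
      rw [ek, hq''.eq_zero_iff] at hx
      refine ⟨q' (r y), ?_⟩
      rw [ei, ← sub_eq_zero, ← map_sub, hq.eq_zero_iff]
      have : f (r y) - y = - s (g y) := by
        rw [eq_neg_iff_add_eq_zero, sub_add_eq_add_sub, er', sub_self]
      rw [this]
      intro φ
      have := hx (φ ∘ₗ s)
      rw [map_neg]
      exact J.neg_mem this

end RankedHW

end FockCat

/-! ### From the residue field to arbitrary ideals; what tilting objects gain from this -/

namespace FockCat

/-- `M` is a quotient of a finite power of `X`. -/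
def GeneratedBy {A : Type u} [Ring A] (X M : FGModuleCat.{u} A) : Prop :=
  ∃ (n : ℕ) (Q : FGModuleCat.{u} A) (i : Fin n → (X →ₗ[A] Q)) (p : Fin n → (Q →ₗ[A] X))
    (π : Q →ₗ[A] M), IsPow i p ∧ Function.Surjective π

section Twist

variable {R : Type u} [CommRing R] {A : Type u} [Ring A] [Algebra R A] [Module.Finite R A]
  {𝔽 : Type u} [Field 𝔽] [Algebra R 𝔽]

/-- A functional on an ideal `I` with values in the residue field induces a morphism from `I N` to
the reduction of `N`. -/
theorem exists_twist (h𝔽 : Function.Surjective (algebraMap R 𝔽)) {N N' S : FGModuleCat.{u} A}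
    [Module.Projective R N] {q : N →ₗ[A] N'} (hq : IsReduction (RingHom.ker (algebraMap R 𝔽)) q)
    {I : Ideal R} (c : I →ₗ[R] 𝔽) (i : S →ₗ[A] N) (hi : ∀ s, i s ∈ dualSub I N) :
    ∃ h : S →ₗ[A] N', ∀ s n, q n = h s → ∀ ψ : N →ₗ[R] R,
      algebraMap R 𝔽 (ψ n) = c ⟨ψ (i s), hi s ψ⟩ := by
  -- The map is `c ⊗ N : I ⊗ N → 𝔽 ⊗ N` restricted to `S`, with `I N = I ⊗ N` by projectivity. Here
  -- `T s n` says, by testing against functionals, that `n` represents the value at `s`; this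
  -- determines `n` modulo the maximal ideal.
  let T : S → N → Prop := fun s n =>
    ∀ ψ : N →ₗ[R] R, algebraMap R 𝔽 (ψ n) = c ⟨ψ (i s), hi s ψ⟩
  have hex : ∀ s, ∃ n, T s n := by
    intro s
    obtain ⟨k, e, φ, h⟩ := exists_dualBasis (R := R) N
    refine ⟨∑ j, Function.surjInv h𝔽 (c ⟨φ j (i s), hi s (φ j)⟩) • e j, fun ψ => ?_⟩
    rw [map_sum, map_sum]
    have : (⟨ψ (i s), hi s ψ⟩ : I) = ∑ j, ψ (e j) • (⟨φ j (i s), hi s (φ j)⟩ : I) := by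
      apply Subtype.ext
      change ψ (i s) = _
      conv_lhs => rw [← h (i s), map_sum]
      rw [Submodule.coe_sum]
      refine Finset.sum_congr rfl fun j _ => ?_
      rw [map_smul, smul_eq_mul, mul_comm]
      rfl
    rw [this, map_sum]
    refine Finset.sum_congr rfl fun j _ => ?_
    rw [map_smul, smul_eq_mul, map_mul, Function.surjInv_eq h𝔽, map_smul, Algebra.smul_def,
      mul_comm]
  have huniq : ∀ s n n', T s n → T s n' → q n = q n' := by
    intro s n n' h h'
    rw [← sub_eq_zero, ← map_sub, hq.eq_zero_iff]
    intro ψ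
    rw [RingHom.mem_ker, map_sub, map_sub, h ψ, h' ψ, sub_self]
  have hresp : ∀ s n n', T s n → q n' = q n → T s n' := by
    intro s n n' h h' ψ
    rw [← sub_eq_zero, ← map_sub, hq.eq_zero_iff] at h'
    have := h' ψ
    rw [RingHom.mem_ker, map_sub, map_sub, sub_eq_zero] at this
    rw [this, h ψ]
  choose n hn using hex
  refine ⟨{ toFun := fun s => q (n s), map_add' := fun s s' => ?_, map_smul' := fun a s => ?_ },
    fun s m hm => hresp s (n s) m (hn s) hm⟩
  · rw [← map_add]
    refine huniq _ _ _ (hn _) fun ψ => ?_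
    rw [map_add, map_add, hn s ψ, hn s' ψ, ← map_add]
    have h : ψ (i s) + ψ (i s') = ψ (i (s + s')) := by rw [map_add, map_add]
    exact congrArg c (Subtype.ext h)
  · rw [RingHom.id_apply, ← map_smul]
    refine huniq _ _ _ (hn _) fun ψ => ?_
    refine (hn s (ψ ∘ₗ Algebra.lsmul R R N a)).trans (congrArg c (Subtype.ext ?_))
    exact congrArg ψ (map_smul i a s).symm

variable [IsNoetherianRing R] [IsLocalRing R]

/-- Krull's intersection theorem in `R ⧸ J`. -/
theorem exists_pow_sup_not_mem {m J : Ideal R} (hm : m ≠ ⊤) {x : R} (hx : x ∉ J) :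
    ∃ k, x ∉ m ^ k ⊔ J := by
  by_contra hcon
  push Not at hcon
  have h := Ideal.iInf_pow_smul_eq_bot_of_isLocalRing (M := R ⧸ J) m hm
  have hmem : (Ideal.Quotient.mk J x) ∈ (⨅ k : ℕ, m ^ k • ⊤ : Submodule R (R ⧸ J)) := by
    rw [Submodule.mem_iInf]
    intro k
    obtain ⟨y, hy, z, hz, rfl⟩ := Submodule.mem_sup.mp (hcon k)
    rw [map_add, Ideal.Quotient.eq_zero_iff_mem.mpr hz, add_zero]
    have : Ideal.Quotient.mk J y = y • (1 : R ⧸ J) := by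
      rw [Algebra.smul_def, mul_one]
      rfl
    rw [this]
    exact Submodule.smul_mem_smul hy trivial
  rw [h, Submodule.mem_bot] at hmem
  exact hx (Ideal.Quotient.eq_zero_iff_mem.mp hmem)

/-- Detection modulo the maximal ideal implies detection modulo every ideal. -/
theorem detects_of_detects_residue [IsNoetherianRing A]
    (h𝔽 : Function.Surjective (algebraMap R 𝔽)) {X N N' : FGModuleCat.{u} A}
    [Module.Projective R N] {q : N →ₗ[A] N'} (hq : IsReduction (RingHom.ker (algebraMap R 𝔽)) q)
    (hX : Detects X N') {J : Ideal R} {V : FGModuleCat.{u} A} {p : N →ₗ[A] V}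
    (hp : IsReduction J p) : Detects X V := by
  intro M f hf
  by_contra hcon
  push Not at hcon
  set m := RingHom.ker (algebraMap R 𝔽) with hmdef
  have hm : m ≠ ⊤ := RingHom.ker_ne_top _
  obtain ⟨K, κ, hκ⟩ := exists_kernel_of_surjective p hp.1
  obtain ⟨W, κ', w, g', hs, -, hw⟩ := exists_pullback hκ f
  have hw' := LinearMap.congr_fun hw
  simp only [LinearMap.comp_apply] at hw'
  -- The image of `W` in `N` is not contained in `J N`, so some power of `m` separates it from `J
  -- N`. The least such power is `k + 1`: the image lies in `(m ^ k + J) N` but not in `(m ^ (k + 1)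
  -- + J) N`.
  have hex : ∃ k, ∃ x, w x ∉ dualSub (m ^ k ⊔ J) N := by
    obtain ⟨y, hy⟩ : ∃ y, f y ≠ 0 := by
      by_contra h
      push Not at h
      exact hf (LinearMap.ext h)
    obtain ⟨x, rfl⟩ := hs.2.1 y
    rw [← hw', ne_eq, hp.eq_zero_iff, mem_dualSub] at hy
    push Not at hy
    obtain ⟨φ, hφ⟩ := hy
    obtain ⟨k, hk⟩ := exists_pow_sup_not_mem hm hφ
    exact ⟨k, x, fun h => hk (h φ)⟩
  classical
  obtain ⟨k, hk⟩ : ∃ k, Nat.find hex = k + 1 := by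
    refine Nat.exists_eq_succ_of_ne_zero fun h0 => ?_
    obtain ⟨x, hx⟩ := Nat.find_spec hex
    rw [h0] at hx
    refine hx fun φ => ?_
    rw [pow_zero, Ideal.one_eq_top, top_sup_eq]
    trivial
  have hI : ∀ x, w x ∈ dualSub (m ^ k ⊔ J) N := fun x => by
    have := Nat.find_min hex (m := k) (by omega)
    push Not at this
    exact this x
  obtain ⟨x₀, hx₀⟩ := Nat.find_spec hex
  rw [hk, mem_dualSub] at hx₀
  push Not at hx₀
  obtain ⟨φ, hφ⟩ := hx₀
  set I := m ^ k ⊔ J with hIdef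
  set I' := m ^ (k + 1) ⊔ J with hI'def
  have hmI : ∀ r ∈ m, ∀ x ∈ I, r * x ∈ I' := fun r hr x hx => by
    obtain ⟨y, hy, z, hz, rfl⟩ := Submodule.mem_sup.mp hx
    rw [mul_add]
    refine I'.add_mem (le_sup_left (a := m ^ (k + 1)) ?_)
      (le_sup_right (a := m ^ (k + 1)) (J.mul_mem_left _ hz))
    rw [pow_succ']
    exact Ideal.mul_mem_mul hr hy
  let I₀ : Submodule R I := Submodule.comap I.subtype I'
  obtain ⟨c, hc⟩ := exists_functional_of_killed (R := R) (𝔽 := 𝔽) (M := I ⧸ I₀) h𝔽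
    (fun r hr x => by
      obtain ⟨y, rfl⟩ := Submodule.Quotient.mk_surjective _ x
      rw [← Submodule.Quotient.mk_smul, Submodule.Quotient.mk_eq_zero]
      exact hmI r hr y.1 y.2)
    (x := Submodule.Quotient.mk ⟨φ (w x₀), hI x₀ φ⟩)
    (fun h => hφ ((Submodule.Quotient.mk_eq_zero I₀).mp h))
  -- The twist of `w` by a functional on `I / I'` is a nonzero map `W → N / mN`, so some map from
  -- `X` detects it. That map goes to `J N` under `w`, since its composite with `f` vanishes, and `J
  -- ⊆ I'` is killed by the functional: a contradiction.
  obtain ⟨h, hh⟩ := exists_twist h𝔽 hq (c ∘ₗ I₀.mkQ) w hI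
  obtain ⟨g, hg⟩ := hX W h (by
    rintro rfl
    have := hh x₀ 0 (by rw [map_zero, LinearMap.zero_apply]) φ
    rw [map_zero, map_zero] at this
    exact hc this.symm)
  refine hg (LinearMap.ext fun x => ?_)
  obtain ⟨n, hn⟩ := hq.1 (h (g x))
  rw [LinearMap.comp_apply, ← hn, LinearMap.zero_apply, hq.eq_zero_iff]
  intro ψ
  rw [RingHom.mem_ker, hh (g x) n hn ψ]
  change c (Submodule.Quotient.mk _) = 0
  rw [(Submodule.Quotient.mk_eq_zero I₀).mpr, map_zero]
  have h1 : p (w (g x)) = 0 := by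
    rw [hw']
    exact LinearMap.congr_fun (hcon (g' ∘ₗ g)) x
  rw [hp.eq_zero_iff] at h1
  exact le_sup_right (a := m ^ (k + 1)) (h1 ψ)

end Twist

theorem RankedHW.std_nontrivial {R : Type u} [CommRing R] [Nontrivial R] {A : Type u} [Ring A]
    [Algebra R A] {Λ : Type} {ρ : Λ → ℕ} {Δ P : Λ → FGModuleCat.{u} A} (H : RankedHW R ρ Δ P)
    (a : Λ) : Nontrivial (Δ a) := by
  by_contra hcon
  rw [not_nontrivial_iff_subsingleton] at hcon
  exact one_ne_zero ((H.std_end a).1 (LinearMap.ext fun x => Subsingleton.elim _ _) : (1 : R) = 0)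

namespace RankedHW

variable {R : Type u} [CommRing R] {A : Type u} [Ring A] [Algebra R A] [Module.Finite R A]
  {Λ : Type} {ρ : Λ → ℕ} {Δ P : Λ → FGModuleCat.{u} A} {𝔽 : Type u} [Field 𝔽] [Algebra R 𝔽]

/-- Denominators can be removed. Modulo `r` the map `f` vanishes on everything coming from `Y`, and
`Y` detects maps into `N / rN`, so `f` has values in `rN`; as `N` is torsion free, `f` can be
divided by `r`. -/
theorem exists_hom_ne_zero_smul [IsNoetherianRing A] [IsDomain R] (H : RankedHW R ρ Δ P)
    {Y M N : FGModuleCat.{u} A} (hN : stdFiltered Δ N)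
    (hY : ∀ (J : Ideal R) (V : FGModuleCat.{u} A) (q : N →ₗ[A] V), IsReduction J q → Detects Y V)
    {φ : (Y →ₗ[A] M) → (Y →ₗ[A] N)} {r : R} (hr : r ≠ 0) {f : M →ₗ[A] N}
    (hf : ∀ g, r • φ g = f ∘ₗ g) : ∃ f' : M →ₗ[A] N, ∀ g, φ g = f' ∘ₗ g := by
  have := H.projective_of_filt hN
  have htf : Function.Injective (r • LinearMap.id : N →ₗ[A] N) := by
    rw [injective_iff_map_eq_zero]
    intro x hx
    refine eq_zero_of_mem_dualSub_bot (R := R) fun ψ => ?_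
    rw [LinearMap.smul_apply, LinearMap.id_apply] at hx
    have h := map_smul ψ r x
    rw [hx, map_zero, smul_eq_mul, zero_eq_mul] at h
    exact h.resolve_left hr
  obtain ⟨V, p, hp⟩ := exists_reduction (Ideal.span {r}) N
  have hpf : p ∘ₗ f = 0 := by
    by_contra hne
    obtain ⟨g, hg⟩ := hY _ V p hp M _ hne
    refine hg ?_
    rw [LinearMap.comp_assoc, ← hf]
    ext x
    rw [LinearMap.comp_apply, LinearMap.smul_apply, LinearMap.map_smul_of_tower]
    exact hp.smul_eq_zero (Ideal.mem_span_singleton_self r) _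
  obtain ⟨f', hf'⟩ := exists_factor_of_range_le htf f fun x => by
    have h1 := hp.eq_zero_iff.mp (LinearMap.congr_fun hpf x)
    rw [mem_regular_step (J := ⊥) (z := r)] at h1
    · obtain ⟨y, hy⟩ := h1
      exact ⟨y, (sub_eq_zero.mp (eq_zero_of_mem_dualSub_bot hy)).symm⟩
    · intro x
      simp only [Ideal.mem_span_singleton, Ideal.mem_bot, sub_eq_zero]
      rfl
  refine ⟨f', fun g => comp_left_cancel htf ?_⟩
  rw [← LinearMap.comp_assoc, hf', ← hf]
  rfl

variable [IsNoetherianRing A] [IsNoetherianRing R] [IsLocalRing R] [Finite Λ]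

/-- If the maps from `X` did not span `T`, Nakayama would give a nonzero map from the reduction of
`T` modulo the maximal ideal to a quotient of the cokernel. That reduction is `ExtInjective`, so a
map from `X` detects it; lifting this map to `T` contradicts the definition of the cokernel. -/
theorem generatedBy_of_extInjective (H : RankedHW R ρ Δ P)
    (h𝔽 : Function.Surjective (algebraMap R 𝔽))
    (hreg : IsRegularIdeal (RingHom.ker (algebraMap R 𝔽))) (X : FGModuleCat.{u} A)
    [Module.Projective A X]
    (hX : ∀ a b (N N' : FGModuleCat.{u} A), IsCostd R 𝔽 Δ a N → IsCostd R 𝔽 Δ b N' →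
      ∀ f : N →ₗ[A] N', f ≠ 0 → ∃ g : X →ₗ[A] N, f ∘ₗ g ≠ 0)
    {T : FGModuleCat.{u} A} [Module.Projective R T] (hT : ExtInjective Δ T) : GeneratedBy X T := by
  have := finite_hom R X T
  obtain ⟨n, v, hv⟩ := Module.Finite.exists_fin (R := R) (M := X →ₗ[A] T)
  obtain ⟨Q, i, p, hip⟩ := exists_pow X n
  refine ⟨n, Q, i, p, ∑ j, v j ∘ₗ p j, hip, ?_⟩
  set π : Q →ₗ[A] T := ∑ j, v j ∘ₗ p j with hπ
  have hπi : ∀ j, π ∘ₗ i j = v j := fun j => by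
    rw [hπ, sum_comp, Finset.sum_eq_single j]
    · rw [LinearMap.comp_assoc, hip.proj_comp_incl, if_pos rfl, LinearMap.comp_id]
    · intro b _ hb
      rw [LinearMap.comp_assoc, hip.proj_comp_incl, if_neg hb, LinearMap.comp_zero]
    · exact fun h => absurd (Finset.mem_univ j) h
  obtain ⟨C, c, hc, hck⟩ := exists_quotient T (LinearMap.range π)
  have hcg : ∀ g : X →ₗ[A] T, c ∘ₗ g = 0 := fun g => by
    have hg : g ∈ Submodule.span R (Set.range v) := hv ▸ trivial
    induction hg using Submodule.span_induction with
    | mem g hg =>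
      obtain ⟨j, rfl⟩ := hg
      ext x
      have : v j x ∈ LinearMap.ker c := by
        rw [hck, ← hπi j]
        exact ⟨i j x, rfl⟩
      exact this
    | zero => exact LinearMap.comp_zero c
    | add g g' _ _ h h' => rw [LinearMap.comp_add, h, h', add_zero]
    | smul r g _ h => rw [LinearMap.comp_smul, h, smul_zero]
  by_cases hC : Subsingleton C
  · intro x
    have : x ∈ LinearMap.ker c := Subsingleton.elim (c x) 0
    rw [hck] at this
    exact this
  exfalso
  rw [not_subsingleton_iff_nontrivial] at hC
  obtain ⟨C', q', hq', hC', hk⟩ := exists_quotient_of_nontrivial (RingHom.ker_ne_top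
    (algebraMap R 𝔽)) C
  obtain ⟨T', q, hq⟩ := exists_reduction (RingHom.ker (algebraMap R 𝔽)) T
  obtain ⟨φ, hφ⟩ := exists_factor_of_ker_le hq.1 (q' ∘ₗ c) fun x hx =>
    eq_zero_of_mem_dualSub (q' ∘ₗ c) hk (hq.eq_zero_iff.mp hx)
  obtain ⟨g, hg⟩ := H.exists_comp_ne_zero h𝔽 X hX (H.extInjective_reduction hreg hT hq)
    (fun r hr x => hq.smul_eq_zero hr x) (Q := C') hk φ (by
      rintro rfl
      obtain ⟨y, hy⟩ := exists_ne (0 : C')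
      obtain ⟨z, rfl⟩ := hq' y
      obtain ⟨x, rfl⟩ := hc z
      exact hy (LinearMap.congr_fun hφ x).symm)
  obtain ⟨g', rfl⟩ := Module.projective_lifting_property q g hq.1
  refine hg ?_
  rw [← LinearMap.comp_assoc, hφ, LinearMap.comp_assoc, hcg, LinearMap.comp_zero]

/-- The reduced hull of `Δ a` has a costandard quotient with label `a`. `X` maps to it nontrivially,
whereas `Δ b` with `b ≠ a` does not, so `Δ a` must occur in any standard filtration of `X`. -/
theorem not_stdFiltered_ne (H : RankedHW R ρ Δ P)
    (hreg : IsRegularIdeal (RingHom.ker (algebraMap R 𝔽))) (X : FGModuleCat.{u} A)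
    (hX : ∀ a b (N N' : FGModuleCat.{u} A), IsCostd R 𝔽 Δ a N → IsCostd R 𝔽 Δ b N' →
      ∀ f : N →ₗ[A] N', f ≠ 0 → ∃ g : X →ₗ[A] N, f ∘ₗ g ≠ 0) (a : Λ) :
    ¬ StdFiltered (fun b => b ≠ a) Δ X := by
  intro hfilt
  obtain ⟨T, M, i, t, hs, hM, hT⟩ := H.exists_hull a
  have := H.projective_of_filt hM
  have hTf : StdFiltered (fun b => ρ b ≤ ρ a) Δ T :=
    StdFiltered.extension hs (.single le_rfl) (hM.mono fun b hb => le_of_lt hb)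
  have := H.projective_of_filt hTf
  have := H.std_projective a
  have := H.std_nontrivial a
  obtain ⟨T', q, hq⟩ := exists_reduction (RingHom.ker (algebraMap R 𝔽)) T
  obtain ⟨s, hs'⟩ := Module.projective_lifting_property (t.restrictScalars R) LinearMap.id hs.2.1
  have es := LinearMap.congr_fun hs'
  simp only [LinearMap.comp_apply, LinearMap.id_apply, LinearMap.coe_restrictScalars] at es
  obtain ⟨r, hr⟩ := exists_factor_of_range_le (f := i.restrictScalars R) hs.1
    (LinearMap.id - s ∘ₗ t.restrictScalars R) fun x => hs.exists_of_apply_eq_zero (by simp [es])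
  have er : ∀ x, r (i x) = x := fun x => hs.1 (by
    have := LinearMap.congr_fun hr (i x)
    simpa [hs.apply_eq_zero] using this)
  obtain ⟨x, hx⟩ := exists_not_mem_dualSub (RingHom.ker_ne_top (algebraMap R 𝔽)) (Δ a)
  obtain ⟨M', N, f, π, -, -, hN⟩ := H.exists_costd_quotient (𝔽 := 𝔽)
    (H.extInjective_reduction hreg hT hq) (fun r hr x => hq.smul_eq_zero hr x) a
    ⟨q ∘ₗ i, fun h0 => hx fun φ => by
      have h1 : q (i x) = 0 := LinearMap.congr_fun h0 x
      have h2 := hq.eq_zero_iff.mp h1 (φ ∘ₗ r)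
      rwa [LinearMap.comp_apply, er] at h2⟩
    -- Above rank `ρ a` the reduced hull receives no maps: precomposed with `P c → Δ c`, such a map
    -- lifts to `T`, where it vanishes for reasons of rank.
    (fun c hc f => by
      obtain ⟨K, k, g, hkg, hK⟩ := H.proj_cover c
      have := H.proj_projective c
      obtain ⟨f', hf'⟩ := Module.projective_lifting_property q (f ∘ₗ g) hq.1
      have hP : StdFiltered (fun b => ρ c ≤ ρ b) Δ (P c) :=
        StdFiltered.extension hkg (hK.mono fun b hb => le_of_lt hb) (.single le_rfl)
      have h0 : f' = 0 := H.filt_hom_eq_zero hP hTf (fun b d hb hd => by omega) f'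
      refine comp_right_cancel hkg.2.1 ?_
      rw [← hf', h0, LinearMap.comp_zero, LinearMap.zero_comp])
  obtain ⟨g₀, hg₀, -⟩ := hN.hom_self
  obtain ⟨g, hg⟩ := hX a a N N hN hN LinearMap.id fun h0 => hg₀ (by
    rw [← LinearMap.id_comp g₀, h0, LinearMap.zero_comp])
  exact hg (by rw [hfilt.hom_eq_zero (fun b hb f => hN.hom_ne b hb f) g, LinearMap.comp_zero])

end RankedHW

end FockCat

/-! ### Base change of objects and morphisms -/

namespace FockCat

section BaseChange

variable {S : Type u} [CommRing S] {A : Type u} [Ring A] [Algebra S A] [Module.Finite S A]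
  {S' : Type u} [CommRing S'] [Algebra S S']

theorem baseChangeAction_tmul (M : FGModuleCat.{u} A) (s r : S') (a : A) (m : M) :
    baseChangeAction S S' M (s ⊗ₜ a) (r ⊗ₜ m) = (s * r) ⊗ₜ (a • m) := by
  rfl

variable (S S') in
/-- The canonical map from an object to its base change. -/
def toBaseChange (M : FGModuleCat.{u} A) : M →ₗ[S] baseChange S S' M :=
  { toFun := fun m => (1 : S') ⊗ₜ[S] m
    map_add' := fun x y => TensorProduct.tmul_add _ x y
    map_smul' := fun r x => by
      change (1 : S') ⊗ₜ[S] (r • x) = baseChangeAction S S' M (algebraMap S S' r ⊗ₜ[S] (1 : A))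
        ((1 : S') ⊗ₜ[S] x)
      rw [baseChangeAction_tmul, one_smul, mul_one, Algebra.algebraMap_eq_smul_one,
        TensorProduct.smul_tmul] }

theorem tmul_smul_toBaseChange {M : FGModuleCat.{u} A} (a : A) (m : M) :
    ((1 : S') ⊗ₜ[S] a : S' ⊗[S] A) • toBaseChange S S' M m = toBaseChange S S' M (a • m) := by
  change baseChangeAction S S' M (1 ⊗ₜ a) ((1 : S') ⊗ₜ[S] m) = (1 : S') ⊗ₜ[S] (a • m)
  rw [baseChangeAction_tmul, one_mul]

theorem smul_baseChange {M : FGModuleCat.{u} A} (r : S') (t : S') (m : M) :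
    r • (show baseChange S S' M from t ⊗ₜ[S] m) =
      (show baseChange S S' M from (r * t) ⊗ₜ[S] m) := by
  change baseChangeAction S S' M (r ⊗ₜ[S] (1 : A)) (t ⊗ₜ[S] m) = (r * t) ⊗ₜ[S] m
  rw [baseChangeAction_tmul, one_smul]

theorem baseChange_induction {M : FGModuleCat.{u} A} {C : baseChange S S' M → Prop}
    (h : ∀ (r : S') m, C (r • toBaseChange S S' M m)) (h' : ∀ x y, C x → C y → C (x + y))
    (x : baseChange S S' M) : C x := by
  have h0 : ∀ (t : S') (m : M), C (show baseChange S S' M from t ⊗ₜ[S] m) := fun t m => by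
    have := h t m
    rwa [show toBaseChange S S' M m = (show baseChange S S' M from (1 : S') ⊗ₜ[S] m) from rfl,
      smul_baseChange, mul_one] at this
  induction x using TensorProduct.induction_on with
  | zero =>
    have := h0 0 0
    rwa [TensorProduct.zero_tmul] at this
  | tmul t m => exact h0 t m
  | add x y hx hy => exact h' x y hx hy

theorem baseChange_hom_ext {M : FGModuleCat.{u} A} {V : FGModuleCat.{u} (S' ⊗[S] A)}
    {f g : baseChange S S' M →ₗ[S' ⊗[S] A] V}
    (h : ∀ m, f (toBaseChange S S' M m) = g (toBaseChange S S' M m)) : f = g := by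
  ext x
  induction x using baseChange_induction with
  | h r m => rw [LinearMap.map_smul_of_tower, LinearMap.map_smul_of_tower, h]
  | h' x y hx hy => rw [map_add, map_add, hx, hy]

theorem algebraMap_smul_object (V : FGModuleCat.{u} (S' ⊗[S] A)) (r : S) (x : V) :
    algebraMap S S' r • x = r • x := by
  change algebraMap S' (S' ⊗[S] A) (algebraMap S S' r) • x = algebraMap S (S' ⊗[S] A) r • x
  rw [← IsScalarTower.algebraMap_apply]

/-- A morphism out of a base change is determined by a semilinear map. -/
theorem exists_baseChange_desc {M : FGModuleCat.{u} A} {V : FGModuleCat.{u} (S' ⊗[S] A)}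
    (t : M →+ V) (ht : ∀ (a : A) m, t (a • m) = ((1 : S') ⊗ₜ[S] a : S' ⊗[S] A) • t m) :
    ∃ f : baseChange S S' M →ₗ[S' ⊗[S] A] V, ∀ m, f (toBaseChange S S' M m) = t m := by
  have : IsScalarTower S S' V := ⟨fun r s x => by
    rw [Algebra.smul_def, mul_smul, algebraMap_smul_object]⟩
  let t' : M →ₗ[S] V :=
    { t with
      map_smul' := fun r m => by
        have h := ht (algebraMap S A r) m
        rw [algebraMap_smul] at h
        refine h.trans ?_
        change _ = algebraMap S (S' ⊗[S] A) r • t m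
        congr 1
        rw [Algebra.TensorProduct.algebraMap_apply, Algebra.algebraMap_eq_smul_one (A := A),
          TensorProduct.tmul_smul, TensorProduct.smul_tmul', Algebra.algebraMap_eq_smul_one] }
  let F : S' ⊗[S] M →ₗ[S'] V := LinearMap.liftBaseChange S' t'
  have hF : ∀ (s : S') m, F (s ⊗ₜ m) = s • t m := fun s m => LinearMap.liftBaseChange_tmul _ _ _ _
  refine ⟨{ toFun := F, map_add' := fun x y => map_add F x y, map_smul' := fun b x => ?_ },
    fun m => (hF 1 m).trans (one_smul _ _)⟩
  rw [RingHom.id_apply]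
  suffices h : ∀ y : S' ⊗[S] M, F (baseChangeAction S S' M b y) = b • F y from h x
  intro x
  induction b using TensorProduct.induction_on with
  | zero => rw [map_zero, LinearMap.zero_apply, map_zero, zero_smul]
  | add b c hb hc => rw [map_add, LinearMap.add_apply, map_add, hb, hc, add_smul]
  | tmul s a =>
    induction x using TensorProduct.induction_on with
    | zero => rw [map_zero, map_zero, smul_zero]
    | add x y hx hy => rw [map_add, map_add, map_add, hx, hy, smul_add]
    | tmul r m =>
      rw [baseChangeAction_tmul, hF, hF, ht, ← algebraMap_smul (S' ⊗[S] A) (s * r), ← algebraMap_smul (S' ⊗[S] A) r,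
        smul_smul, smul_smul]
      congr 1
      simp [Algebra.TensorProduct.algebraMap_apply]

theorem exists_baseChangeMap {M N : FGModuleCat.{u} A} (f : M →ₗ[A] N) :
    ∃ F : baseChange S S' M →ₗ[S' ⊗[S] A] baseChange S S' N,
      ∀ m, F (toBaseChange S S' M m) = toBaseChange S S' N (f m) :=
  exists_baseChange_desc ((toBaseChange S S' N).toAddMonoidHom.comp f.toAddMonoidHom) fun a m => by
    change toBaseChange S S' N (f (a • m)) = _ • toBaseChange S S' N (f m)
    rw [map_smul, tmul_smul_toBaseChange]

variable (S S') in
/-- The base change of a morphism. -/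
noncomputable def baseChangeMap {M N : FGModuleCat.{u} A} (f : M →ₗ[A] N) :
    baseChange S S' M →ₗ[S' ⊗[S] A] baseChange S S' N :=
  (exists_baseChangeMap f).choose

theorem baseChangeMap_apply {M N : FGModuleCat.{u} A} (f : M →ₗ[A] N) (m : M) :
    baseChangeMap S S' f (toBaseChange S S' M m) = toBaseChange S S' N (f m) :=
  (exists_baseChangeMap f).choose_spec m

theorem baseChangeMap_comp {M N K : FGModuleCat.{u} A} (f : M →ₗ[A] N) (g : N →ₗ[A] K) :
    baseChangeMap S S' (g ∘ₗ f) = baseChangeMap S S' g ∘ₗ baseChangeMap S S' f :=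
  baseChange_hom_ext fun m => by
    rw [LinearMap.comp_apply, baseChangeMap_apply, baseChangeMap_apply, baseChangeMap_apply,
      LinearMap.comp_apply]

theorem baseChangeMap_add {M N : FGModuleCat.{u} A} (f g : M →ₗ[A] N) :
    baseChangeMap S S' (f + g) = baseChangeMap S S' f + baseChangeMap S S' g :=
  baseChange_hom_ext fun m => by
    rw [LinearMap.add_apply, baseChangeMap_apply, baseChangeMap_apply, baseChangeMap_apply,
      LinearMap.add_apply, map_add]

theorem baseChangeMap_zero {M N : FGModuleCat.{u} A} :
    baseChangeMap S S' (0 : M →ₗ[A] N) = 0 :=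
  baseChange_hom_ext fun m => by
    rw [baseChangeMap_apply, LinearMap.zero_apply, LinearMap.zero_apply, map_zero]

theorem baseChangeMap_smul {M N : FGModuleCat.{u} A} (r : S) (f : M →ₗ[A] N) :
    baseChangeMap S S' (r • f) = algebraMap S S' r • baseChangeMap S S' f :=
  baseChange_hom_ext fun m => by
    rw [baseChangeMap_apply, LinearMap.smul_apply, LinearMap.smul_apply, baseChangeMap_apply,
      algebraMap_smul_object, map_smul]

theorem baseChangeMap_id {M : FGModuleCat.{u} A} :
    baseChangeMap S S' (LinearMap.id : M →ₗ[A] M) = LinearMap.id :=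
  baseChange_hom_ext fun m => by rw [baseChangeMap_apply]; rfl

/-- A functional on `M` extends to the base change. -/
theorem exists_baseChange_functional {M : FGModuleCat.{u} A} (c : M →ₗ[S] S') :
    ∃ F : baseChange S S' M →+ S', ∀ m, F (toBaseChange S S' M m) = c m :=
  ⟨(LinearMap.liftBaseChange S' c).toAddMonoidHom, fun m =>
    (LinearMap.liftBaseChange_tmul S' c (1 : S') m).trans (one_smul _ _)⟩

end BaseChange

section Residue

variable {R : Type u} [CommRing R] {A : Type u} [Ring A] [Algebra R A] [Module.Finite R A]
  {𝔽 : Type u} [Field 𝔽] [Algebra R 𝔽]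

theorem toBaseChange_surjective (h𝔽 : Function.Surjective (algebraMap R 𝔽))
    (M : FGModuleCat.{u} A) : Function.Surjective (toBaseChange R 𝔽 M) := fun x => by
  induction x using baseChange_induction with
  | h r m =>
    obtain ⟨s, rfl⟩ := h𝔽 r
    exact ⟨s • m, by rw [map_smul, algebraMap_smul_object]⟩
  | h' x y hx hy =>
    obtain ⟨m, rfl⟩ := hx
    obtain ⟨m', rfl⟩ := hy
    exact ⟨m + m', map_add _ _ _⟩

theorem toBaseChange_injective (h𝔽 : Function.Surjective (algebraMap R 𝔽))
    {V : FGModuleCat.{u} A} (hV : IsKilled R 𝔽 V) : Function.Injective (toBaseChange R 𝔽 V) := by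
  rw [injective_iff_map_eq_zero]
  intro x hx
  by_contra h0
  obtain ⟨c, hc⟩ := exists_functional_of_killed h𝔽 hV h0
  obtain ⟨F, hF⟩ := exists_baseChange_functional c
  exact hc (by rw [← hF, hx, map_zero])

/-- Tensoring with the residue field does not see the passage from `M` to `M / mM`. -/
theorem baseChangeMap_bijective_of_isReduction (h𝔽 : Function.Surjective (algebraMap R 𝔽))
    {M V : FGModuleCat.{u} A} [Module.Projective R M] {q : M →ₗ[A] V}
    (hq : IsReduction (RingHom.ker (algebraMap R 𝔽)) q) :
    Function.Bijective (baseChangeMap R 𝔽 q) := by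
  constructor
  · rw [injective_iff_map_eq_zero]
    intro x hx
    obtain ⟨m, rfl⟩ := toBaseChange_surjective h𝔽 M x
    rw [baseChangeMap_apply] at hx
    have h0 : q m = 0 := toBaseChange_injective h𝔽 (fun r hr y => hq.smul_eq_zero hr y)
      (hx.trans (map_zero _).symm)
    rw [hq.eq_zero_iff] at h0
    obtain ⟨n, e, φ, h⟩ := exists_dualBasis (R := R) M
    rw [← h m, map_sum]
    refine Finset.sum_eq_zero fun j _ => ?_
    have h1 : algebraMap R 𝔽 (φ j m) = 0 := h0 (φ j)
    rw [map_smul, ← algebraMap_smul_object, h1, zero_smul]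
  · intro y
    obtain ⟨v, rfl⟩ := toBaseChange_surjective h𝔽 V y
    obtain ⟨m, rfl⟩ := hq.1 v
    exact ⟨_, baseChangeMap_apply q m⟩

theorem baseChangeMap_injective (h𝔽 : Function.Surjective (algebraMap R 𝔽))
    {M V : FGModuleCat.{u} A} (hV : IsKilled R 𝔽 V) {f : M →ₗ[A] V} (hf : f ≠ 0) :
    baseChangeMap R 𝔽 f ≠ 0 := fun h => hf (LinearMap.ext fun m =>
  toBaseChange_injective h𝔽 hV (by
    rw [← baseChangeMap_apply, h, LinearMap.zero_apply, LinearMap.zero_apply, map_zero]))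

/-- An object killed by the maximal ideal is its own base change to `𝔽`, so `F` restricts to `M`. -/
theorem exists_baseChangeMap_eq (h𝔽 : Function.Surjective (algebraMap R 𝔽))
    {M V : FGModuleCat.{u} A} (hV : IsKilled R 𝔽 V)
    (F : baseChange R 𝔽 M →ₗ[𝔽 ⊗[R] A] baseChange R 𝔽 V) :
    ∃ f : M →ₗ[A] V, baseChangeMap R 𝔽 f = F := by
  have hinj := toBaseChange_injective h𝔽 hV
  choose k hk using toBaseChange_surjective (A := A) h𝔽 V
  refine ⟨{ toFun := fun m => k (F (toBaseChange R 𝔽 M m))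
            map_add' := fun x y => hinj ?_
            map_smul' := fun a x => hinj ?_ }, baseChange_hom_ext fun m => ?_⟩
  · rw [hk, map_add, map_add, map_add, hk, hk]
  · rw [RingHom.id_apply, hk, ← tmul_smul_toBaseChange, ← tmul_smul_toBaseChange, map_smul, hk]
  · rw [baseChangeMap_apply]
    exact hk _

end Residue

end FockCat

/-! ### Translating the assumptions over the residue field -/

namespace FockCat

theorem FaithfulOn.eq_zero {S : Type u} [CommRing S] [IsNoetherianRing S] {A : Type u} [Ring A]
    [Algebra S A] [Module.Finite S A] {X : FGModuleCat.{u} A} {p : FGModuleCat.{u} A → Prop}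
    (hF : FaithfulOn (homFunctor S X) p) {M M' : FGModuleCat.{u} A} (hM : p M) (hM' : p M')
    {φ : M →ₗ[A] M'} (hφ : ∀ g : X →ₗ[A] M, φ ∘ₗ g = 0) : φ = 0 := by
  have h := @hF M M' hM hM' (FGModuleCat.ofHom φ) (FGModuleCat.ofHom 0) (by
    ext g
    exact (hφ g).trans (LinearMap.zero_comp g).symm)
  exact congrArg (fun f : M ⟶ M' => f.hom.hom) h

section ScalarExtension

variable {R : Type u} [CommRing R] {A : Type u} [Ring A] [Algebra R A] [Module.Finite R A]
  {𝔽 : Type u} [Field 𝔽] [Algebra R 𝔽]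

theorem baseChangeMap_eq_lTensor {S' : Type u} [CommRing S'] [Algebra R S']
    {M N : FGModuleCat.{u} A} (f : M →ₗ[A] N) (x : S' ⊗[R] M) :
    baseChangeMap R S' f x = LinearMap.lTensor S' (f.restrictScalars R) x := by
  induction x using TensorProduct.induction_on with
  | zero => exact (map_zero (baseChangeMap R S' f)).trans (map_zero _).symm
  | add x y hx hy =>
    refine (map_add (baseChangeMap R S' f) _ _).trans ?_
    rw [hx, hy]
    exact (map_add _ _ _).symm
  | tmul t m =>
    have h : (show FockCat.baseChange R S' M from t ⊗ₜ[R] m) = t • toBaseChange R S' M m :=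
      ((smul_baseChange t 1 m).trans (by rw [mul_one])).symm
    have h' : (show FockCat.baseChange R S' N from t ⊗ₜ[R] (f m)) = t • toBaseChange R S' N (f m) :=
      ((smul_baseChange t 1 (f m)).trans (by rw [mul_one])).symm
    change baseChangeMap R S' f (show FockCat.baseChange R S' M from t ⊗ₜ[R] m) =
      (show FockCat.baseChange R S' N from t ⊗ₜ[R] (f m))
    rw [h, h', LinearMap.map_smul_of_tower, baseChangeMap_apply]

theorem IsShortExact.baseChange {S' : Type u} [CommRing S'] [Algebra R S'] [Module.Flat R S']
    {M' M M'' : FGModuleCat.{u} A} {f : M' →ₗ[A] M} {g : M →ₗ[A] M''} (hs : IsShortExact f g) :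
    IsShortExact (baseChangeMap R S' f) (baseChangeMap R S' g) := by
  have hex : Function.Exact (f.restrictScalars R) (g.restrictScalars R) := fun x =>
    ⟨fun h => hs.exists_of_apply_eq_zero h, by rintro ⟨y, rfl⟩; exact hs.apply_eq_zero y⟩
  have hT := lTensor_exact S' hex hs.2.1
  refine isShortExact_of ?_ ?_ ?_ ?_
  · intro x y h
    exact Module.Flat.lTensor_preserves_injective_linearMap (f.restrictScalars R) hs.1
      ((baseChangeMap_eq_lTensor f x).symm.trans (h.trans (baseChangeMap_eq_lTensor f y)))
  · intro y
    obtain ⟨x, hx⟩ := LinearMap.lTensor_surjective S' (g := g.restrictScalars R) hs.2.1 y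
    exact ⟨x, (baseChangeMap_eq_lTensor g x).trans hx⟩
  · intro x
    exact (baseChangeMap_eq_lTensor g _).trans
      ((hT _).mpr ⟨x, (baseChangeMap_eq_lTensor f x).symm⟩)
  · intro x hx
    obtain ⟨y, hy⟩ := (hT x).mp ((baseChangeMap_eq_lTensor g x).symm.trans hx)
    exact ⟨y, (baseChangeMap_eq_lTensor f y).trans hy⟩

theorem StdFiltered.baseChange {S' : Type u} [CommRing S'] [Algebra R S'] [Module.Flat R S']
    {Λ : Type} {p : Λ → Prop} {Δ : Λ → FGModuleCat.{u} A} {M : FGModuleCat.{u} A}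
    (hM : StdFiltered p Δ M) :
    StdFiltered p (fun a => FockCat.baseChange R S' (Δ a)) (FockCat.baseChange R S' M) := by
  induction hM with
  | zero M h =>
    refine .zero _ ⟨fun x y => ?_⟩
    have h0 : ∀ x : FockCat.baseChange R S' M, x = 0 := fun x => by
      induction x using baseChange_induction with
      | h r m => rw [Subsingleton.elim m 0, map_zero, smul_zero]
      | h' x y hx hy => rw [hx, hy, add_zero]
    rw [h0 x, h0 y]
  | step M' M a ha f g h h' ih => exact .step _ _ a ha _ _ h.baseChange ih

end ScalarExtension

section Residue

variable {R : Type u} [CommRing R] {A : Type u} [Ring A] [Algebra R A] [Module.Finite R A]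
  {𝔽 : Type u} [Field 𝔽] [Algebra R 𝔽] {Λ : Type} {ρ : Λ → ℕ} {Δ P : Λ → FGModuleCat.{u} A}

/-- Maps `Δ a → V` are maps between base changes of standard objects. Since `X` is projective, every
map from its base change to that of `Δ a` lifts to `X → Δ a`, so faithfulness over `𝔽` can be tested
by morphisms over `A`. -/
theorem RankedHW.detects_of_faithfulOn [IsNoetherianRing A] (H : RankedHW R ρ Δ P)
    (h𝔽 : Function.Surjective (algebraMap R 𝔽)) {X : FGModuleCat.{u} A} [Module.Projective A X]
    (hF : FaithfulOn (homFunctor 𝔽 (baseChange R 𝔽 X)) (stdFiltered fun a => baseChange R 𝔽 (Δ a)))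
    (b : Λ) {V : FGModuleCat.{u} A} {q : Δ b →ₗ[A] V}
    (hq : IsReduction (RingHom.ker (algebraMap R 𝔽)) q) : Detects X V := by
  refine H.detects_of_std fun a f hf => ?_
  have := H.std_projective a
  have := H.std_projective b
  have hV : IsKilled R 𝔽 V := fun r hr y => hq.smul_eq_zero hr y
  obtain ⟨W, q', hq'⟩ := exists_reduction (RingHom.ker (algebraMap R 𝔽)) (Δ a)
  let e := LinearEquiv.ofBijective _ (baseChangeMap_bijective_of_isReduction h𝔽 hq)
  have he : baseChangeMap R 𝔽 q ∘ₗ e.symm.toLinearMap = LinearMap.id :=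
    LinearMap.ext fun x => e.apply_symm_apply x
  set φ := e.symm.toLinearMap ∘ₗ baseChangeMap R 𝔽 f with hφ
  have hqφ : baseChangeMap R 𝔽 q ∘ₗ φ = baseChangeMap R 𝔽 f := by
    rw [hφ, ← LinearMap.comp_assoc, he, LinearMap.id_comp]
  by_contra hcon
  push Not at hcon
  refine baseChangeMap_injective h𝔽 hV hf ?_
  rw [← hqφ, hF.eq_zero (StdFiltered.single trivial) (StdFiltered.single trivial) (φ := φ)
    fun g => ?_, LinearMap.comp_zero]
  obtain ⟨g', hg'⟩ := exists_baseChangeMap_eq h𝔽 (fun r hr y => hq'.smul_eq_zero hr y)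
    (baseChangeMap R 𝔽 q' ∘ₗ g)
  obtain ⟨g'', rfl⟩ := Module.projective_lifting_property q' g' hq'.1
  rw [baseChangeMap_comp] at hg'
  have := comp_left_cancel (baseChangeMap_bijective_of_isReduction h𝔽 hq').1 hg'
  subst this
  refine comp_left_cancel (baseChangeMap_bijective_of_isReduction h𝔽 hq).1 ?_
  rw [← LinearMap.comp_assoc, hqφ, ← baseChangeMap_comp, hcon, baseChangeMap_zero,
    LinearMap.comp_zero]

/-- Extensions of a base change by the base change of a killed object split if they do so before
base change. -/
theorem exists_section_baseChange [IsNoetherianRing A] (h𝔽 : Function.Surjective (algebraMap R 𝔽))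
    {M N : FGModuleCat.{u} A} (hN : IsKilled R 𝔽 N) (hMN : ExtZero M N)
    {X : FGModuleCat.{u} (𝔽 ⊗[R] A)} {f : baseChange R 𝔽 N →ₗ[𝔽 ⊗[R] A] X}
    {g : X →ₗ[𝔽 ⊗[R] A] baseChange R 𝔽 M} (hs : IsShortExact f g) :
    ∃ t : baseChange R 𝔽 M →ₗ[𝔽 ⊗[R] A] X, g ∘ₗ t = LinearMap.id := by
  have : Module.Finite R 𝔽 := Module.Finite.of_surjective (Algebra.linearMap R 𝔽) h𝔽
  let Res := restrictFG R (Algebra.TensorProduct.includeRight : A →ₐ[R] 𝔽 ⊗[R] A)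
  have hsm : ∀ (V : FGModuleCat.{u} (𝔽 ⊗[R] A)) (a : A) (x : V),
      (a • (show Res.obj V from x)) = (show Res.obj V from ((1 : 𝔽) ⊗ₜ[R] a : 𝔽 ⊗[R] A) • x) :=
    fun V a x => rfl
  let ι : ∀ V : FGModuleCat.{u} A, V →ₗ[A] Res.obj (baseChange R 𝔽 V) := fun V =>
    { toFun := toBaseChange R 𝔽 V
      map_add' := map_add _
      map_smul' := fun a x => (tmul_smul_toBaseChange a x).symm }
  let f' : Res.obj (baseChange R 𝔽 N) →ₗ[A] Res.obj X := (Res.map (FGModuleCat.ofHom f)).hom.hom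
  let g' : Res.obj X →ₗ[A] Res.obj (baseChange R 𝔽 M) := (Res.map (FGModuleCat.ofHom g)).hom.hom
  have hs' : IsShortExact (f' ∘ₗ ι N) g' := by
    refine isShortExact_of ?_ hs.2.1 (fun x => hs.apply_eq_zero _) fun x hx => ?_
    · exact hs.1.comp (toBaseChange_injective h𝔽 hN)
    · obtain ⟨y, hy⟩ := hs.exists_of_apply_eq_zero hx
      obtain ⟨n, rfl⟩ := toBaseChange_surjective h𝔽 N y
      exact ⟨n, hy⟩
  -- Regarded over `A`, the sequence ends in the base change of `M`, not in `M`; lifting the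
  -- canonical map out of `M` is enough, because the lift extends to the base change.
  obtain ⟨k, hk⟩ := hMN.exists_lift hs' (ι M)
  obtain ⟨t, ht⟩ := exists_baseChange_desc (V := X) k.toAddMonoidHom fun a m => map_smul k a m
  refine ⟨t, baseChange_hom_ext fun m => ?_⟩
  rw [LinearMap.comp_apply, ht]
  exact LinearMap.congr_fun hk m

theorem IsCostd.isCostandard [IsNoetherianRing A] (h𝔽 : Function.Surjective (algebraMap R 𝔽))
    {a : Λ} {N : FGModuleCat.{u} A} (h : IsCostd R 𝔽 Δ a N) :
    IsCostandard 𝔽 (fun a => baseChange R 𝔽 (Δ a)) a (baseChange R 𝔽 N) where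
  hom_self := by
    obtain ⟨g, hg, hg'⟩ := h.hom_self
    refine (finrank_eq_one_iff_of_nonzero' (baseChangeMap R 𝔽 g)
      (baseChangeMap_injective h𝔽 h.killed hg)).mpr fun w => ?_
    obtain ⟨f, rfl⟩ := exists_baseChangeMap_eq h𝔽 h.killed w
    obtain ⟨r, rfl⟩ := hg' f
    exact ⟨algebraMap R 𝔽 r, (baseChangeMap_smul r g).symm⟩
  hom_ne b hb f := by
    obtain ⟨f, rfl⟩ := exists_baseChangeMap_eq h𝔽 h.killed f
    rw [h.hom_ne b hb f, baseChangeMap_zero]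
  ext_one b _ _ _ hs := exists_section_baseChange h𝔽 h.killed (h.extInjective b) hs

/-- This puts faithfulness on costandard objects over `𝔽` in the form required by
`RankedHW.exists_comp_ne_zero`. -/
theorem IsCostd.exists_comp_ne_zero [IsNoetherianRing A]
    (h𝔽 : Function.Surjective (algebraMap R 𝔽)) {X : FGModuleCat.{u} A}
    (hF : FaithfulOn (homFunctor 𝔽 (baseChange R 𝔽 X))
      (fun M => ∃ a, IsCostandard 𝔽 (fun a => baseChange R 𝔽 (Δ a)) a M))
    {a b : Λ} {N N' : FGModuleCat.{u} A} (hN : IsCostd R 𝔽 Δ a N) (hN' : IsCostd R 𝔽 Δ b N')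
    {f : N →ₗ[A] N'} (hf : f ≠ 0) : ∃ g : X →ₗ[A] N, f ∘ₗ g ≠ 0 := by
  by_contra hcon
  push Not at hcon
  refine baseChangeMap_injective h𝔽 hN'.killed hf
    (hF.eq_zero ⟨a, hN.isCostandard h𝔽⟩ ⟨b, hN'.isCostandard h𝔽⟩ fun g => ?_)
  obtain ⟨g, rfl⟩ := exists_baseChangeMap_eq h𝔽 hN.killed g
  rw [← baseChangeMap_comp, hcon, baseChangeMap_zero]

end Residue

end FockCat

/-! ### Clearing denominators over the fraction field -/

namespace FockCat

section FractionField

variable {R : Type u} [CommRing R] {A : Type u} [Ring A] [Algebra R A]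

variable (R) in
/-- The object has no torsion over the base ring. -/
def TorsionFree (M : FGModuleCat.{u} A) : Prop :=
  ∀ (r : R) (x : M), r ≠ 0 → r • x = 0 → x = 0

theorem torsionFree_of_projective [IsDomain R] [Module.Finite R A] (M : FGModuleCat.{u} A)
    [Module.Projective R M] : TorsionFree R M := fun r x hr hx =>
  eq_zero_of_mem_dualSub_bot (R := R) fun ψ => by
    have h := map_smul ψ r x
    rw [hx, map_zero, smul_eq_mul, zero_eq_mul] at h
    exact h.resolve_left hr

theorem TorsionFree.smul_cancel {M N : FGModuleCat.{u} A} (hN : TorsionFree R N) {r : R}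
    (hr : r ≠ 0) {f g : M →ₗ[A] N} (h : r • f = r • g) : f = g := LinearMap.ext fun x => by
  have := LinearMap.congr_fun h x
  rw [LinearMap.smul_apply, LinearMap.smul_apply, ← sub_eq_zero, ← smul_sub] at this
  exact sub_eq_zero.mp (hN r _ hr this)

variable [Module.Finite R A] (K : Type u) [Field K] [Algebra R K] [IsFractionRing R K]

theorem exists_smul_eq_toBaseChange {M : FGModuleCat.{u} A} (x : baseChange R K M) :
    ∃ (s : nonZeroDivisors R) (m : M), (s : R) • x = toBaseChange R K M m := by
  induction x using baseChange_induction with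
  | h r m =>
    obtain ⟨⟨a, s⟩, h⟩ := IsLocalization.surj (nonZeroDivisors R) r
    refine ⟨s, a • m, ?_⟩
    change r * algebraMap R K s = algebraMap R K a at h
    rw [map_smul, ← algebraMap_smul_object, ← algebraMap_smul_object, ← h, smul_smul, mul_comm]
  | h' x y hx hy =>
    obtain ⟨s, m, hx⟩ := hx
    obtain ⟨t, n, hy⟩ := hy
    refine ⟨s * t, (t : R) • m + (s : R) • n, ?_⟩
    rw [map_add, map_smul, map_smul, ← hx, ← hy, smul_smul, smul_smul, smul_add,
      Submonoid.coe_mul, mul_comm]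

variable [IsDomain R]

theorem TorsionFree.toBaseChange_injective {M : FGModuleCat.{u} A} (hM : TorsionFree R M) :
    Function.Injective (toBaseChange R K M) := by
  rw [injective_iff_map_eq_zero]
  intro x hx
  obtain ⟨c, hc⟩ := (IsLocalizedModule.eq_zero_iff (nonZeroDivisors R) (TensorProduct.mk R K M 1)).mp hx
  exact hM c x (nonZeroDivisors.coe_ne_zero c) hc

theorem TorsionFree.baseChangeMap_injective {M N : FGModuleCat.{u} A} (hN : TorsionFree R N)
    {f g : M →ₗ[A] N} (h : baseChangeMap R K f = baseChangeMap R K g) : f = g :=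
  LinearMap.ext fun m => hN.toBaseChange_injective K (by
    rw [← baseChangeMap_apply, h, baseChangeMap_apply])

theorem exists_smul_mem_toBaseChange (M : FGModuleCat.{u} A) (t : Finset (baseChange R K M)) :
    ∃ r : R, r ≠ 0 ∧ ∀ x ∈ t, ∃ m, toBaseChange R K M m = r • x := by
  classical
  induction t using Finset.induction_on with
  | empty => exact ⟨1, one_ne_zero, by simp⟩
  | insert y t _ ih =>
    obtain ⟨r, hr, h⟩ := ih
    obtain ⟨s, m, hs'⟩ := exists_smul_eq_toBaseChange K y
    refine ⟨s * r, mul_ne_zero (nonZeroDivisors.coe_ne_zero s) hr, fun x hx => ?_⟩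
    rcases Finset.mem_insert.mp hx with rfl | hx
    · exact ⟨r • m, by rw [map_smul, ← hs', smul_smul, mul_comm]⟩
    · obtain ⟨n, hn⟩ := h x hx
      exact ⟨(s : R) • n, by rw [map_smul, hn, smul_smul]⟩

/-- Clearing denominators of a morphism over the fraction field. -/
theorem TorsionFree.exists_baseChangeMap_eq_smul {M N : FGModuleCat.{u} A} (hN : TorsionFree R N)
    (F : baseChange R K M →ₗ[K ⊗[R] A] baseChange R K N) :
    ∃ (r : R) (f : M →ₗ[A] N), r ≠ 0 ∧ baseChangeMap R K f = algebraMap R K r • F := by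
  classical
  obtain ⟨t, ht⟩ := (inferInstance : Module.Finite A M).fg_top
  obtain ⟨r, hr, h⟩ := exists_smul_mem_toBaseChange K N (t.image fun m => F (toBaseChange R K M m))
  have hinj := hN.toBaseChange_injective K
  have hex : ∀ m, ∃ n, toBaseChange R K N n = r • F (toBaseChange R K M m) := fun m => by
    have hm : m ∈ Submodule.span A (t : Set M) := ht ▸ Submodule.mem_top
    induction hm using Submodule.span_induction with
    | mem m hm => exact h _ (Finset.mem_image_of_mem _ hm)
    | zero => exact ⟨0, by rw [map_zero, map_zero, map_zero, smul_zero]⟩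
    | add x y _ _ hx hy =>
      obtain ⟨n, hn⟩ := hx
      obtain ⟨n', hn'⟩ := hy
      exact ⟨n + n', by rw [map_add, hn, hn', map_add, map_add, smul_add]⟩
    | smul a x _ hx =>
      obtain ⟨n, hn⟩ := hx
      refine ⟨a • n, ?_⟩
      rw [← tmul_smul_toBaseChange, ← tmul_smul_toBaseChange, hn, map_smul, smul_comm]
  choose k hk using hex
  refine ⟨r, { toFun := k, map_add' := fun x y => hinj ?_, map_smul' := fun a x => hinj ?_ }, hr,
    baseChange_hom_ext fun m => ?_⟩
  · rw [hk, map_add, map_add, map_add, hk, hk, smul_add]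
  · rw [RingHom.id_apply, hk, ← tmul_smul_toBaseChange, ← tmul_smul_toBaseChange, map_smul, hk,
      smul_comm]
  · rw [baseChangeMap_apply, LinearMap.smul_apply, algebraMap_smul_object]
    exact hk m

/-- Full faithfulness over the fraction field, in terms of morphisms over the base ring. -/
theorem FullyFaithfulOn.exists_smul_eq [IsNoetherianRing R] {Y : FGModuleCat.{u} A}
    {p : FGModuleCat.{u} (K ⊗[R] A) → Prop}
    (hF : FullyFaithfulOn (homFunctor K (baseChange R K Y)) p) {M N : FGModuleCat.{u} A}
    (hY : TorsionFree R Y) (hM : TorsionFree R M) (hN : TorsionFree R N)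
    (hpM : p (baseChange R K M)) (hpN : p (baseChange R K N))
    (φ : (Y →ₗ[A] M) →ₗ[(Module.End A Y)ᵐᵒᵖ] (Y →ₗ[A] N)) :
    ∃ (r : R) (f : M →ₗ[A] N), r ≠ 0 ∧ ∀ g, r • φ g = f ∘ₗ g := by
  have hφ : ∀ g (e : Module.End A Y), φ (g ∘ₗ e) = φ g ∘ₗ e := fun g e =>
    map_smul φ (MulOpposite.op e) g
  have hφr : ∀ (r : R) g, φ (r • g) = r • φ g := fun r g => by
    have h : ∀ {V : FGModuleCat.{u} A} (k : Y →ₗ[A] V), r • k =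
        k ∘ₗ (r • LinearMap.id : Module.End A Y) := fun k => by
      rw [LinearMap.comp_smul, LinearMap.comp_id]
    rw [h, h (φ g), hφ]
  have hne : ∀ r : R, r ≠ 0 → algebraMap R K r ≠ 0 := fun r hr =>
    (map_ne_zero_iff _ (IsFractionRing.injective R K)).mpr hr
  choose d c hd hc using fun G : baseChange R K Y →ₗ[K ⊗[R] A] baseChange R K M =>
    hM.exists_baseChangeMap_eq_smul K G
  -- The extension of `φ` to morphisms over `K`: multiply `G` by a denominator `d G`, apply `φ`, and
  -- divide again. `hψ` shows that any other denominator gives the same result, whence additivity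
  -- and equivariance.
  let ψ : (baseChange R K Y →ₗ[K ⊗[R] A] baseChange R K M) →
      (baseChange R K Y →ₗ[K ⊗[R] A] baseChange R K N) := fun G =>
    (algebraMap R K (d G))⁻¹ • baseChangeMap R K (φ (c G))
  have hψ : ∀ G r g, r ≠ 0 → baseChangeMap R K g = algebraMap R K r • G →
      algebraMap R K r • ψ G = baseChangeMap R K (φ g) := by
    intro G r g hr hg
    have h1 : d G • g = r • c G := hM.baseChangeMap_injective K (by
      rw [baseChangeMap_smul, baseChangeMap_smul, hc, hg, smul_comm])
    have h2 := congrArg (fun k => baseChangeMap R K (φ k)) h1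
    simp only [hφr, baseChangeMap_smul] at h2
    change algebraMap R K r • (algebraMap R K (d G))⁻¹ • baseChangeMap R K (φ (c G)) = _
    rw [smul_comm, ← h2, smul_smul, inv_mul_cancel₀ (hne _ (hd G)), one_smul]
  have hcancel : ∀ (r : R), r ≠ 0 → ∀ {G G' : baseChange R K Y →ₗ[K ⊗[R] A] baseChange R K N},
      algebraMap R K r • G = algebraMap R K r • G' → G = G' := fun r hr G G' h => by
    have := congrArg ((algebraMap R K r)⁻¹ • ·) h
    simpa only [smul_smul, inv_mul_cancel₀ (hne r hr), one_smul] using this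
  have hψ_add : ∀ G G', ψ (G + G') = ψ G + ψ G' := by
    intro G G'
    refine hcancel _ (mul_ne_zero (hd G) (hd G')) ?_
    rw [hψ (G + G') (d G * d G') (d G' • c G + d G • c G') (mul_ne_zero (hd G) (hd G')) ?_,
      map_add, hφr, hφr, baseChangeMap_add, baseChangeMap_smul, baseChangeMap_smul,
      ← hψ G _ _ (hd G) (hc G), ← hψ G' _ _ (hd G') (hc G'), smul_add, map_mul, smul_smul (algebraMap R K (d G')),
      smul_smul _ _ (ψ G'), mul_comm (algebraMap R K (d G'))]
    rw [baseChangeMap_add, baseChangeMap_smul, baseChangeMap_smul, hc, hc, smul_add, map_mul,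
      smul_smul, smul_smul, mul_comm (algebraMap R K (d G'))]
  have hψ_comp : ∀ G (E : Module.End (K ⊗[R] A) (baseChange R K Y)), ψ (G ∘ₗ E) = ψ G ∘ₗ E := by
    intro G E
    obtain ⟨s, e, hs, he⟩ := hY.exists_baseChangeMap_eq_smul K E
    refine hcancel _ (mul_ne_zero (hd G) hs) ?_
    rw [hψ (G ∘ₗ E) (d G * s) (c G ∘ₗ e) (mul_ne_zero (hd G) hs) ?_, hφ, baseChangeMap_comp, he,
      ← hψ G _ _ (hd G) (hc G), LinearMap.comp_smul, LinearMap.smul_comp, smul_smul, map_mul,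
      mul_comm]
    rw [baseChangeMap_comp, he, hc, LinearMap.comp_smul, LinearMap.smul_comp, smul_smul, map_mul,
      mul_comm]
  let Ψ : (homFunctor K (baseChange R K Y)).obj (baseChange R K M) ⟶
      (homFunctor K (baseChange R K Y)).obj (baseChange R K N) :=
    ObjectProperty.homMk (ModuleCat.ofHom (X := baseChange R K Y →ₗ[K ⊗[R] A] baseChange R K M)
      (Y := baseChange R K Y →ₗ[K ⊗[R] A] baseChange R K N)
      { toFun := ψ
        map_add' := hψ_add
        map_smul' := fun E G => hψ_comp G E.unop })
  obtain ⟨F, hF'⟩ := (hF _ _ hpM hpN).2 Ψ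
  have hF'' : ∀ G, F.hom.hom ∘ₗ G = ψ G := fun G =>
    LinearMap.congr_fun (congrArg (fun k => k.hom.hom) hF') G
  obtain ⟨r, f, hr, hf⟩ := hN.exists_baseChangeMap_eq_smul K F.hom.hom
  refine ⟨r, f, hr, fun g => hN.baseChangeMap_injective K ?_⟩
  rw [baseChangeMap_smul, baseChangeMap_comp, hf, LinearMap.smul_comp, hF'',
    ← hψ (baseChangeMap R K g) 1 g one_ne_zero (by rw [map_one, one_smul]), map_one, one_smul]

end FractionField

end FockCat

/-! ### Quotient functors and the matching of standard objects -/

namespace FockCat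

section MapL

variable {A B : Type u} [Ring A] [Ring B]

/-- The action of a functor on linear maps. -/
def mapL (F : FGModuleCat.{u} A ⥤ FGModuleCat.{u} B) {M N : FGModuleCat.{u} A} (f : M →ₗ[A] N) :
    F.obj M →ₗ[B] F.obj N :=
  (F.map (FGModuleCat.ofHom f)).hom.hom

variable (F : FGModuleCat.{u} A ⥤ FGModuleCat.{u} B)

theorem mapL_id (M : FGModuleCat.{u} A) : mapL F (LinearMap.id : M →ₗ[A] M) = LinearMap.id :=
  congrArg (fun f : F.obj M ⟶ F.obj M => f.hom.hom) (F.map_id M)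

theorem mapL_comp {M N K : FGModuleCat.{u} A} (f : M →ₗ[A] N) (g : N →ₗ[A] K) :
    mapL F (g ∘ₗ f) = mapL F g ∘ₗ mapL F f :=
  congrArg (fun f : F.obj M ⟶ F.obj K => f.hom.hom)
    (F.map_comp (FGModuleCat.ofHom f : M ⟶ N) (FGModuleCat.ofHom g : N ⟶ K))

/-- The action of a functor on linear equivalences. -/
def mapEquiv {M N : FGModuleCat.{u} A} (e : M ≃ₗ[A] N) : F.obj M ≃ₗ[B] F.obj N :=
  LinearEquiv.ofLinearMap (mapL F e.toLinearMap) (mapL F e.symm.toLinearMap)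
    (by rw [← mapL_comp, LinearEquiv.comp_symm, mapL_id])
    (by rw [← mapL_comp, LinearEquiv.symm_comp, mapL_id])

variable {F}

theorem mapL_add (hF : F.Additive) {M N : FGModuleCat.{u} A} (f g : M →ₗ[A] N) :
    mapL F (f + g) = mapL F f + mapL F g :=
  congrArg (fun f : F.obj M ⟶ F.obj N => f.hom.hom)
    (F.map_add (f := (FGModuleCat.ofHom f : M ⟶ N)) (g := (FGModuleCat.ofHom g : M ⟶ N)))

theorem mapL_zero (hF : F.Additive) {M N : FGModuleCat.{u} A} :
    mapL F (0 : M →ₗ[A] N) = 0 := by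
  have h := mapL_add hF (0 : M →ₗ[A] N) 0
  rwa [add_zero, left_eq_add] at h

theorem mapL_sum (hF : F.Additive) {M N : FGModuleCat.{u} A} {ι : Type*} (t : Finset ι)
    (f : ι → (M →ₗ[A] N)) : mapL F (∑ j ∈ t, f j) = ∑ j ∈ t, mapL F (f j) := by
  classical
  induction t using Finset.induction_on with
  | empty => rw [Finset.sum_empty, Finset.sum_empty, mapL_zero hF]
  | insert j t hj ih => rw [Finset.sum_insert hj, Finset.sum_insert hj, mapL_add hF, ih]

theorem mapL_smul {R : Type u} [CommRing R] [Algebra R A] [Algebra R B]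
    (hF : IsLinearFunctor R F) (r : R) {M N : FGModuleCat.{u} A} (f : M →ₗ[A] N) :
    mapL F (r • f) = r • mapL F f := by
  have h : mapL F (r • (LinearMap.id : N →ₗ[A] N)) = r • LinearMap.id :=
    congrArg (fun f : F.obj N ⟶ F.obj N => f.hom.hom) (hF.2 r N)
  rw [← LinearMap.id_comp f, ← LinearMap.smul_comp, mapL_comp, h, LinearMap.smul_comp,
    LinearMap.id_comp, LinearMap.id_comp]

variable (F) in
/-- The functor preserves short exact sequences. -/
def IsExactFunctor : Prop :=
  ∀ ⦃M' M M'' : FGModuleCat.{u} A⦄ ⦃f : M' →ₗ[A] M⦄ ⦃g : M →ₗ[A] M''⦄, IsShortExact f g →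
    IsShortExact (mapL F f) (mapL F g)

theorem IsExactFunctor.subsingleton (hF : F.Additive) {M : FGModuleCat.{u} A} (h : Subsingleton M) :
    Subsingleton (F.obj M) := by
  have h0 : (LinearMap.id : F.obj M →ₗ[B] F.obj M) = 0 := by
    rw [← mapL_id, ← mapL_zero hF]
    exact congrArg _ (LinearMap.ext fun x => Subsingleton.elim _ _)
  exact ⟨fun x y => (LinearMap.congr_fun h0 x).trans (LinearMap.congr_fun h0 y).symm⟩

theorem IsExactFunctor.stdFiltered (hE : IsExactFunctor F) (hF : F.Additive) {Λ : Type}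
    {p : Λ → Prop} {Δ : Λ → FGModuleCat.{u} A} {M : FGModuleCat.{u} A} (hM : StdFiltered p Δ M) :
    StdFiltered p (fun a => F.obj (Δ a)) (F.obj M) := by
  induction hM with
  | zero M h => exact .zero _ (subsingleton hF h)
  | step M' M a ha f g h h' ih => exact .step _ _ a ha _ _ (hE h) ih

theorem IsExactFunctor.surjective [IsNoetherianRing A] (hE : IsExactFunctor F)
    {M N : FGModuleCat.{u} A} {g : M →ₗ[A] N} (hg : Function.Surjective g) :
    Function.Surjective (mapL F g) := by
  obtain ⟨K, i, hi⟩ := exists_kernel_of_surjective g hg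
  exact (hE hi).2.1

theorem IsExactFunctor.injective (hE : IsExactFunctor F) {M N : FGModuleCat.{u} A}
    {f : M →ₗ[A] N} (hf : Function.Injective f) : Function.Injective (mapL F f) := by
  obtain ⟨Q, q, hq⟩ := exists_cokernel f hf
  exact (hE hq).1

theorem IsExactFunctor.torsionFree {R : Type u} [CommRing R] [Algebra R A] [Algebra R B]
    (hE : IsExactFunctor F) (hF : IsLinearFunctor R F) {M : FGModuleCat.{u} A}
    (hM : TorsionFree R M) : TorsionFree R (F.obj M) := fun r x hr hx => by
  have hinj : Function.Injective (r • LinearMap.id : M →ₗ[A] M) := by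
    rw [injective_iff_map_eq_zero]
    exact fun x hx => hM r x hr hx
  have h := hE.injective hinj
  rw [mapL_smul hF, mapL_id] at h
  exact h (hx.trans (map_zero _).symm)

end MapL

section Split

variable {B : Type u} [Ring B]

theorem exists_restrict_of_comp_eq_zero {U M L U' M' L' : FGModuleCat.{u} B} {f : U →ₗ[B] M}
    {g : M →ₗ[B] L} (hs : IsShortExact f g) {f' : U' →ₗ[B] M'} {g' : M' →ₗ[B] L'}
    (hs' : IsShortExact f' g') (h : M →ₗ[B] M') (h0 : g' ∘ₗ h ∘ₗ f = 0) :
    ∃ (hU : U →ₗ[B] U') (hL : L →ₗ[B] L'), f' ∘ₗ hU = h ∘ₗ f ∧ hL ∘ₗ g = g' ∘ₗ h := by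
  obtain ⟨hU, h1⟩ := hs'.exists_lift (h ∘ₗ f) h0
  obtain ⟨hL, h2⟩ := hs.exists_desc (g' ∘ₗ h) h0
  exact ⟨hU, hL, h1, h2⟩

/-- Once the composites from sub to quotient vanish in both directions, the isomorphism and its
inverse restrict to the subobjects and descend to the quotients, where they remain mutually inverse.
-/
theorem exists_equiv_of_comp_eq_zero {U M L U' M' L' : FGModuleCat.{u} B} {f : U →ₗ[B] M}
    {g : M →ₗ[B] L} (hs : IsShortExact f g) {f' : U' →ₗ[B] M'} {g' : M' →ₗ[B] L'}
    (hs' : IsShortExact f' g') (e : M ≃ₗ[B] M') (h0 : g' ∘ₗ e.toLinearMap ∘ₗ f = 0)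
    (h0' : g ∘ₗ e.symm.toLinearMap ∘ₗ f' = 0) :
    ∃ (eU : U ≃ₗ[B] U') (eL : L ≃ₗ[B] L'), f' ∘ₗ eU.toLinearMap = e.toLinearMap ∘ₗ f ∧
      eL.toLinearMap ∘ₗ g = g' ∘ₗ e.toLinearMap := by
  obtain ⟨hU, hL, h1, h2⟩ := exists_restrict_of_comp_eq_zero hs hs' e.toLinearMap h0
  obtain ⟨hU', hL', h1', h2'⟩ := exists_restrict_of_comp_eq_zero hs' hs e.symm.toLinearMap h0'
  refine ⟨.ofLinearMap hU hU' (comp_left_cancel hs'.1 ?_) (comp_left_cancel hs.1 ?_),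
    .ofLinearMap hL hL' (comp_right_cancel hs'.2.1 ?_) (comp_right_cancel hs.2.1 ?_), h1, h2⟩
  · rw [← LinearMap.comp_assoc, h1, LinearMap.comp_assoc, h1', ← LinearMap.comp_assoc,
      LinearEquiv.comp_symm, LinearMap.id_comp, LinearMap.comp_id]
  · rw [← LinearMap.comp_assoc, h1', LinearMap.comp_assoc, h1, ← LinearMap.comp_assoc,
      LinearEquiv.symm_comp, LinearMap.id_comp, LinearMap.comp_id]
  · rw [LinearMap.comp_assoc, h2', ← LinearMap.comp_assoc, h2, LinearMap.comp_assoc,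
      LinearEquiv.comp_symm, LinearMap.comp_id, LinearMap.id_comp]
  · rw [LinearMap.comp_assoc, h2, ← LinearMap.comp_assoc, h2', LinearMap.comp_assoc,
      LinearEquiv.symm_comp, LinearMap.comp_id, LinearMap.id_comp]

end Split

/-- The properties of the quotient functor defined by an object `X` that are used to reconstruct
a highest weight category from the quotient category. -/
structure IsQuotientFunctor (R : Type u) [CommRing R] {A B : Type u} [Ring A] [Ring B]
    [Algebra R A] [Algebra R B] {Λ : Type} (Δ : Λ → FGModuleCat.{u} A)
    (F : FGModuleCat.{u} A ⥤ FGModuleCat.{u} B) (X : FGModuleCat.{u} A) : Prop where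
  linear : IsLinearFunctor R F
  exact : IsExactFunctor F
  full : ∀ {M N : FGModuleCat.{u} A}, stdFiltered Δ M → stdFiltered Δ N →
    ∀ φ : F.obj M →ₗ[B] F.obj N, ∃ f : M →ₗ[A] N, mapL F f = φ
  faithful : ∀ {M N : FGModuleCat.{u} A}, stdFiltered Δ M → stdFiltered Δ N →
    ∀ {f g : M →ₗ[A] N}, mapL F f = mapL F g → f = g
  projective : Module.Projective A X
  generates : ∀ T : FGModuleCat.{u} A, stdFiltered Δ T → ExtInjective Δ T → GeneratedBy X T
  not_filt : ∀ a, ¬ StdFiltered (fun b => b ≠ a) Δ X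

namespace IsQuotientFunctor

variable {R : Type u} [CommRing R] {A B : Type u} [Ring A] [Ring B]
    [Algebra R A] [Algebra R B] {Λ : Type} {Δ : Λ → FGModuleCat.{u} A}
    {F : FGModuleCat.{u} A ⥤ FGModuleCat.{u} B} {X : FGModuleCat.{u} A}

theorem subsingleton (Q : IsQuotientFunctor R Δ F X) {M : FGModuleCat.{u} A}
    (hM : stdFiltered Δ M) (h : Subsingleton (F.obj M)) : Subsingleton M := by
  have h0 : (LinearMap.id : M →ₗ[A] M) = 0 := Q.faithful hM hM
    (LinearMap.ext fun x => Subsingleton.elim _ _)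
  exact ⟨fun x y => (LinearMap.congr_fun h0 x).trans (LinearMap.congr_fun h0 y).symm⟩

theorem std_end {P : Λ → FGModuleCat.{u} A} {ρ : Λ → ℕ} (H : RankedHW R ρ Δ P)
    (Q : IsQuotientFunctor R Δ F X) (a : Λ) (φ : F.obj (Δ a) →ₗ[B] F.obj (Δ a)) :
    ∃ r : R, φ = r • LinearMap.id := by
  obtain ⟨f, rfl⟩ := Q.full (.single trivial) (.single trivial) φ
  obtain ⟨r, rfl⟩ := (H.std_end a).2 f
  exact ⟨r, by rw [mapL_smul Q.linear, mapL_id]⟩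

theorem std_nontrivial [Nontrivial R] {P : Λ → FGModuleCat.{u} A} {ρ : Λ → ℕ}
    (H : RankedHW R ρ Δ P) (Q : IsQuotientFunctor R Δ F X) (a : Λ) :
    Nontrivial (F.obj (Δ a)) := by
  by_contra h
  rw [not_nontrivial_iff_subsingleton] at h
  exact not_subsingleton_iff_nontrivial.mpr (H.std_nontrivial a)
    (Q.subsingleton (.single trivial) h)

theorem std_torsionFree [IsDomain R] [Module.Finite R A] {P : Λ → FGModuleCat.{u} A} {ρ : Λ → ℕ}
    (H : RankedHW R ρ Δ P) (Q : IsQuotientFunctor R Δ F X) (a : Λ) :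
    TorsionFree R (F.obj (Δ a)) :=
  have := H.std_projective a
  Q.exact.torsionFree Q.linear (torsionFree_of_projective (Δ a))

end IsQuotientFunctor

section Matching

variable {R : Type u} [CommRing R] {A₁ A₂ B : Type u} [Ring A₁] [Ring A₂] [Ring B]
  [Algebra R A₁] [Algebra R A₂] [Algebra R B] {Λ : Type} {ρ : Λ → ℕ}
  {Δ₁ P₁ : Λ → FGModuleCat.{u} A₁} {Δ₂ P₂ : Λ → FGModuleCat.{u} A₂}
  {F₁ : FGModuleCat.{u} A₁ ⥤ FGModuleCat.{u} B} {F₂ : FGModuleCat.{u} A₂ ⥤ FGModuleCat.{u} B}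
  {X₁ : FGModuleCat.{u} A₁} {X₂ : FGModuleCat.{u} A₂}

/-- Composing `φ` with `β` gives a map between images of standard objects of the first category,
zero by fullness and rank. Applying `α` recovers `r • φ`, and the target has no torsion. -/
theorem hom_eq_zero_of_isogeny [IsDomain R] [Module.Finite R A₂] (H₁ : RankedHW R ρ Δ₁ P₁)
    (H₂ : RankedHW R ρ Δ₂ P₂)
    (Q₁ : IsQuotientFunctor R Δ₁ F₁ X₁) (Q₂ : IsQuotientFunctor R Δ₂ F₂ X₂)
    {a b : Λ} (hab : ρ b < ρ a) {α : F₁.obj (Δ₁ b) →ₗ[B] F₂.obj (Δ₂ b)}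
    {β : F₂.obj (Δ₂ b) →ₗ[B] F₁.obj (Δ₁ b)} {r : R} (hr : r ≠ 0)
    (hαβ : α ∘ₗ β = r • LinearMap.id) (φ : F₁.obj (Δ₁ a) →ₗ[B] F₂.obj (Δ₂ b)) : φ = 0 := by
  obtain ⟨f, hf⟩ := Q₁.full (.single trivial) (.single trivial) (β ∘ₗ φ)
  rw [H₁.hom_eq_zero hab f, mapL_zero Q₁.linear.1] at hf
  refine (Q₂.std_torsionFree H₂ b).smul_cancel hr ?_
  rw [smul_zero, ← LinearMap.id_comp φ, ← LinearMap.smul_comp, ← hαβ, LinearMap.comp_assoc, ← hf,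
    LinearMap.comp_zero]

/-- There are no nonzero morphisms from the image of a standard object to the image of a standard
object of lower rank. -/
def Vanish (ρ : Λ → ℕ) (D₁ D₂ : Λ → FGModuleCat.{u} B) : Prop :=
  ∀ a b, ρ b < ρ a → ∀ φ : D₁ a →ₗ[B] D₂ b, φ = 0

theorem Vanish.filt {D₁ D₂ : Λ → FGModuleCat.{u} B} (h : Vanish ρ D₁ D₂) {p q : Λ → Prop}
    (hpq : ∀ a b, p a → q b → ρ b < ρ a) {M N : FGModuleCat.{u} B} (hM : StdFiltered p D₁ M)
    (hN : StdFiltered q D₂ N) (φ : M →ₗ[B] N) : φ = 0 :=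
  hM.hom_eq_zero (fun a ha f => hN.hom_eq_zero_right (fun b hb g => h a b (hpq a b ha hb) g) f) φ

/-- Vanishing of maps against the order forces `e` to respect the filtrations of `X₁` and `X₂` by
rank, so the layers of rank `ρ a`, powers of the two standard objects, have isomorphic images. Some
matrix entry of that isomorphism is invertible because `R` is local. -/
theorem IsQuotientFunctor.exists_std_equiv [IsLocalRing R] [IsDomain R] [Module.Finite R A₁]
    [Module.Finite R A₂] [IsNoetherianRing A₁] [IsNoetherianRing A₂] [Finite Λ]
    (H₁ : RankedHW R ρ Δ₁ P₁) (H₂ : RankedHW R ρ Δ₂ P₂)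
    (Q₁ : IsQuotientFunctor R Δ₁ F₁ X₁) (Q₂ : IsQuotientFunctor R Δ₂ F₂ X₂)
    (h₁₂ : Vanish ρ (fun a => F₁.obj (Δ₁ a)) (fun a => F₂.obj (Δ₂ a)))
    (h₂₁ : Vanish ρ (fun a => F₂.obj (Δ₂ a)) (fun a => F₁.obj (Δ₁ a)))
    (e : F₁.obj X₁ ≃ₗ[B] F₂.obj X₂) (a : Λ) :
    Nonempty (F₁.obj (Δ₁ a) ≃ₗ[B] F₂.obj (Δ₂ a)) := by
  have := Q₁.projective
  have := Q₂.projective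
  obtain ⟨U₁, L₁, i₁, p₁, hs₁, hU₁, hL₁⟩ := H₁.exists_split (ρ a) (H₁.filt_of_projective X₁)
  obtain ⟨U₂, L₂, i₂, p₂, hs₂, hU₂, hL₂⟩ := H₂.exists_split (ρ a) (H₂.filt_of_projective X₂)
  obtain ⟨eU, -, -, -⟩ := exists_equiv_of_comp_eq_zero (Q₁.exact hs₁) (Q₂.exact hs₂) e
    (by
      rw [← LinearMap.comp_assoc]
      exact h₁₂.filt (fun a b ha hb => hb.2.trans_le ha.2) (Q₁.exact.stdFiltered Q₁.linear.1 hU₁)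
        (Q₂.exact.stdFiltered Q₂.linear.1 hL₂) _)
    (by
      rw [← LinearMap.comp_assoc]
      exact h₂₁.filt (fun a b ha hb => hb.2.trans_le ha.2) (Q₂.exact.stdFiltered Q₂.linear.1 hU₂)
        (Q₁.exact.stdFiltered Q₁.linear.1 hL₁) _)
  -- A second cut, at `ρ a + 1`, isolates in `D₁` and `D₂` the layer of rank exactly `ρ a`.
  obtain ⟨V₁, D₁, j₁, q₁, ht₁, hV₁, hD₁⟩ := H₁.exists_split (ρ a + 1) hU₁
  obtain ⟨V₂, D₂, j₂, q₂, ht₂, hV₂, hD₂⟩ := H₂.exists_split (ρ a + 1) hU₂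
  obtain ⟨-, eD, -, -⟩ := exists_equiv_of_comp_eq_zero (Q₁.exact ht₁) (Q₂.exact ht₂) eU
    (by
      rw [← LinearMap.comp_assoc]
      exact h₁₂.filt (fun a b ha hb => hb.2.trans_le ha.2) (Q₁.exact.stdFiltered Q₁.linear.1 hV₁)
        (Q₂.exact.stdFiltered Q₂.linear.1 hD₂) _)
    (by
      rw [← LinearMap.comp_assoc]
      exact h₂₁.filt (fun a b ha hb => hb.2.trans_le ha.2) (Q₂.exact.stdFiltered Q₂.linear.1 hV₂)
        (Q₁.exact.stdFiltered Q₁.linear.1 hD₁) _)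
  have hcond : ∀ b, ((True ∧ ρ a ≤ ρ b) ∧ ρ b < ρ a + 1) → b = a := fun b hb =>
    H₁.rank_injective (by omega)
  obtain ⟨n₁, k₁, l₁, hk₁⟩ := (H₁.inAdd_of_filt hcond hD₁).exists_pow (H₁.std_end a)
  obtain ⟨n₂, k₂, l₂, hk₂⟩ := (H₂.inAdd_of_filt hcond hD₂).exists_pow (H₂.std_end a)
  -- An empty layer would give a standard filtration of `X₁` avoiding `Δ₁ a`.
  have hn₁ : 0 < n₁ := by
    refine Nat.pos_of_ne_zero ?_
    rintro rfl
    have hD₀ : Subsingleton D₁ := ⟨fun x y => hk₁.ext fun c => c.elim0⟩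
    refine Q₁.not_filt a (StdFiltered.extension hs₁ (StdFiltered.extension ht₁ (hV₁.mono ?_)
      (.zero _ hD₀)) (hL₁.mono ?_))
    · rintro b hb rfl
      omega
    · rintro b hb rfl
      omega
  let c₀ : Fin n₁ := ⟨0, hn₁⟩
  let φ : Fin n₂ → (F₁.obj (Δ₁ a) →ₗ[B] F₂.obj (Δ₂ a)) := fun c =>
    mapL F₂ (l₂ c) ∘ₗ eD.toLinearMap ∘ₗ mapL F₁ (k₁ c₀)
  let ψ : Fin n₂ → (F₂.obj (Δ₂ a) →ₗ[B] F₁.obj (Δ₁ a)) := fun c =>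
    mapL F₁ (l₁ c₀) ∘ₗ eD.symm.toLinearMap ∘ₗ mapL F₂ (k₂ c)
  -- The identity of one copy in the first layer is decomposed along the `n₂` copies in the second.
  -- The summands are scalars adding up to `1`, so one of them is a unit.
  have hsum : ∑ c, ψ c ∘ₗ φ c = LinearMap.id := by
    have h1 : ∀ c, ψ c ∘ₗ φ c = mapL F₁ (l₁ c₀) ∘ₗ eD.symm.toLinearMap ∘ₗ
        mapL F₂ (k₂ c ∘ₗ l₂ c) ∘ₗ eD.toLinearMap ∘ₗ mapL F₁ (k₁ c₀) := fun c => by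
      rw [mapL_comp]
      rfl
    simp only [h1]
    rw [← comp_sum, ← comp_sum, ← sum_comp, ← mapL_sum Q₂.linear.1, hk₂.sum_eq, mapL_id,
      LinearMap.id_comp, ← LinearMap.comp_assoc _ eD.toLinearMap eD.symm.toLinearMap, LinearEquiv.symm_comp,
      LinearMap.id_comp, ← mapL_comp, hk₁.proj_comp_incl, if_pos rfl, mapL_id]
  choose r hr using fun c => Q₁.std_end H₁ a (ψ c ∘ₗ φ c)
  have hr1 : ∑ c, r c = 1 := by
    refine (H₁.std_end a).1 (Q₁.faithful (.single trivial) (.single trivial) ?_)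
    rw [mapL_smul Q₁.linear, mapL_smul Q₁.linear, mapL_id, one_smul, Finset.sum_smul]
    exact (Finset.sum_congr rfl fun c _ => (hr c).symm).trans hsum
  obtain ⟨c, hc⟩ : ∃ c, IsUnit (r c) := by
    by_contra hcon
    push Not at hcon
    have : ∑ c, r c ∈ IsLocalRing.maximalIdeal R := Ideal.sum_mem _ fun c _ =>
      (IsLocalRing.mem_maximalIdeal _).mpr (hcon c)
    rw [hr1] at this
    exact (IsLocalRing.maximalIdeal.isMaximal R).ne_top ((Ideal.eq_top_iff_one _).mpr this)
  obtain ⟨s, hs⟩ := Q₂.std_end H₂ a (φ c ∘ₗ ψ c)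
  have hne : φ c ≠ 0 := fun h => by
    have h1 := hr c
    rw [h, LinearMap.comp_zero] at h1
    have := Q₁.std_nontrivial H₁ a
    obtain ⟨x, hx⟩ := exists_ne (0 : F₁.obj (Δ₁ a))
    exact hx (Q₁.std_torsionFree H₁ a (r c) x hc.ne_zero (LinearMap.congr_fun h1 x).symm)
  -- Evaluating `φ c ∘ ψ c ∘ φ c` in two ways gives `s • φ c = r c • φ c`, and a nonzero map to a
  -- torsion free object permits cancellation.
  have hsr : s = r c := by
    by_contra hne'
    refine hne ((Q₂.std_torsionFree H₂ a).smul_cancel (sub_ne_zero.mpr hne') ?_)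
    have h1 : s • φ c = r c • φ c := by
      rw [← LinearMap.id_comp (φ c), ← LinearMap.smul_comp, ← hs, LinearMap.comp_assoc, hr,
        LinearMap.comp_smul, LinearMap.comp_id, LinearMap.id_comp]
    rw [smul_zero, sub_smul, h1, sub_self]
  obtain ⟨v, hv⟩ := hc.exists_left_inv
  refine ⟨.ofLinearMap (φ c) (v • ψ c) ?_ ?_⟩
  · rw [LinearMap.comp_smul, hs, hsr, smul_smul, hv, one_smul]
  · rw [LinearMap.smul_comp, hr, smul_smul, hv, one_smul]

end Matching

end FockCat

/-! ### Pairings: transport of morphisms and exact sequences -/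

namespace FockCat

section Diagrams

variable {A : Type u} [Ring A]

/-- An extension together with a lift `l` of `π` is the pushout of the presentation along `φ`. Being
stated for short exact sequences, this applies to the image of such a diagram under an exact
functor. -/
theorem exists_pushout_desc {K Q M N E V : FGModuleCat.{u} A} {i : K →ₗ[A] Q} {π : Q →ₗ[A] M}
    (hs : IsShortExact i π) {f : N →ₗ[A] E} {g : E →ₗ[A] M} (hs' : IsShortExact f g)
    {l : Q →ₗ[A] E} (hl : g ∘ₗ l = π) {φ : K →ₗ[A] N} (hφ : f ∘ₗ φ = l ∘ₗ i) (a : N →ₗ[A] V)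
    (b : Q →ₗ[A] V) (hab : a ∘ₗ φ = b ∘ₗ i) : ∃ c : E →ₗ[A] V, c ∘ₗ f = a ∧ c ∘ₗ l = b := by
  have el := LinearMap.congr_fun hl
  have eφ := LinearMap.congr_fun hφ
  have eab := LinearMap.congr_fun hab
  simp only [LinearMap.comp_apply] at el eφ eab
  have hsurj : Function.Surjective (f.coprod l) := fun x => by
    obtain ⟨q, hq⟩ := hs.2.1 (g x)
    obtain ⟨n, hn⟩ := hs'.exists_of_apply_eq_zero (x := x - l q) (by
      rw [map_sub, el, hq, sub_self])
    exact ⟨(n, q), by rw [LinearMap.coprod_apply, hn, sub_add_cancel]⟩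
  obtain ⟨c, hc⟩ := exists_factor_of_ker_le hsurj (a.coprod b) fun x hx => by
    rw [LinearMap.coprod_apply] at hx ⊢
    have h1 : g (f x.1 + l x.2) = 0 := by rw [hx, map_zero]
    rw [map_add, hs'.apply_eq_zero, zero_add, el] at h1
    obtain ⟨k, hk⟩ := hs.exists_of_apply_eq_zero h1
    rw [← hk, ← eφ, ← map_add] at hx
    have h2 : x.1 + φ k = 0 := hs'.1 (hx.trans (map_zero f).symm)
    rw [← hk, ← eab, ← map_add, h2, map_zero]
  refine ⟨c, LinearMap.ext fun x => ?_, LinearMap.ext fun x => ?_⟩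
  · have := LinearMap.congr_fun hc (x, 0)
    simpa using this
  · have := LinearMap.congr_fun hc (0, x)
    simpa using this

theorem pushout_hom_ext {Q M N E V : FGModuleCat.{u} A} {π : Q →ₗ[A] M}
    (hπ : Function.Surjective π) {f : N →ₗ[A] E} {g : E →ₗ[A] M} (hs' : IsShortExact f g)
    {l : Q →ₗ[A] E} (hl : g ∘ₗ l = π) {c c' : E →ₗ[A] V} (h : c ∘ₗ f = c' ∘ₗ f)
    (h' : c ∘ₗ l = c' ∘ₗ l) : c = c' := LinearMap.ext fun x => by
  have el := LinearMap.congr_fun hl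
  simp only [LinearMap.comp_apply] at el
  obtain ⟨q, hq⟩ := hπ (g x)
  obtain ⟨n, hn⟩ := hs'.exists_of_apply_eq_zero (x := x - l q) (by
    rw [map_sub, el, hq, sub_self])
  have h1 : x = f n + l q := by rw [hn, sub_add_cancel]
  rw [h1, map_add, map_add]
  exact congrArg₂ (· + ·) (LinearMap.congr_fun h n) (LinearMap.congr_fun h' q)

theorem surjective_of_shortExact {U M L U' M' L' : FGModuleCat.{u} A} {f : U →ₗ[A] M}
    {g : M →ₗ[A] L} (hs : IsShortExact f g) {f' : U' →ₗ[A] M'} {g' : M' →ₗ[A] L'}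
    (hs' : IsShortExact f' g') {a : U →ₗ[A] U'} {b : M →ₗ[A] M'} {c : L →ₗ[A] L'}
    (h : f' ∘ₗ a = b ∘ₗ f) (h' : c ∘ₗ g = g' ∘ₗ b) (ha : Function.Surjective a)
    (hc : Function.Surjective c) : Function.Surjective b := fun y => by
  have e := LinearMap.congr_fun h
  have e' := LinearMap.congr_fun h'
  simp only [LinearMap.comp_apply] at e e'
  obtain ⟨l, hl⟩ := hc (g' y)
  obtain ⟨x, rfl⟩ := hs.2.1 l
  obtain ⟨u', hu'⟩ := hs'.exists_of_apply_eq_zero (x := y - b x) (by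
    rw [map_sub, ← e', hl, sub_self])
  obtain ⟨u, rfl⟩ := ha u'
  exact ⟨f u + x, by rw [map_add, ← e, hu', sub_add_cancel]⟩

theorem injective_of_shortExact {U M L U' M' L' : FGModuleCat.{u} A} {f : U →ₗ[A] M}
    {g : M →ₗ[A] L} (hs : IsShortExact f g) {f' : U' →ₗ[A] M'} {g' : M' →ₗ[A] L'}
    (hs' : IsShortExact f' g') {a : U →ₗ[A] U'} {b : M →ₗ[A] M'} {c : L →ₗ[A] L'}
    (h : f' ∘ₗ a = b ∘ₗ f) (h' : c ∘ₗ g = g' ∘ₗ b) (ha : Function.Injective a)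
    (hc : Function.Injective c) : Function.Injective b := by
  have e := LinearMap.congr_fun h
  have e' := LinearMap.congr_fun h'
  simp only [LinearMap.comp_apply] at e e'
  rw [injective_iff_map_eq_zero]
  intro x hx
  have h1 : g x = 0 := hc (by rw [e', hx, map_zero, map_zero])
  obtain ⟨u, rfl⟩ := hs.exists_of_apply_eq_zero h1
  rw [← e] at hx
  rw [ha (hs'.1 (hx.trans (map_zero f').symm) |>.trans (map_zero a).symm), map_zero]

theorem IsPow.exists_equiv {B : Type u} [Ring B] {X M X' M' : FGModuleCat.{u} B} {n : ℕ}
    {i : Fin n → (X →ₗ[B] M)} {p : Fin n → (M →ₗ[B] X)} (h : IsPow i p)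
    {i' : Fin n → (X' →ₗ[B] M')} {p' : Fin n → (M' →ₗ[B] X')} (h' : IsPow i' p')
    (e : X ≃ₗ[B] X') : Nonempty (M ≃ₗ[B] M') := by
  refine ⟨.ofLinearMap (∑ a, i' a ∘ₗ e.toLinearMap ∘ₗ p a)
    (∑ a, i a ∘ₗ e.symm.toLinearMap ∘ₗ p' a) ?_ ?_⟩
  · refine LinearMap.ext fun x => h'.ext fun a => ?_
    simp only [LinearMap.comp_apply, LinearMap.sum_apply, LinearMap.id_apply,
      LinearEquiv.coe_coe]
    rw [h'.sum_proj a fun b => _, h.sum_proj a fun b => _, LinearEquiv.apply_symm_apply]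
  · refine LinearMap.ext fun x => h.ext fun a => ?_
    simp only [LinearMap.comp_apply, LinearMap.sum_apply, LinearMap.id_apply,
      LinearEquiv.coe_coe]
    rw [h.sum_proj a fun b => _, h'.sum_proj a fun b => _, LinearEquiv.symm_apply_apply]

theorem IsPow.mapL {B : Type u} [Ring B] {F : FGModuleCat.{u} A ⥤ FGModuleCat.{u} B}
    (hF : F.Additive) {X M : FGModuleCat.{u} A} {n : ℕ} {i : Fin n → (X →ₗ[A] M)}
    {p : Fin n → (M →ₗ[A] X)} (h : IsPow i p) :
    IsPow (fun a => FockCat.mapL F (i a)) (fun a => FockCat.mapL F (p a)) where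
  proj_comp_incl a b := by
    rw [← mapL_comp, h.proj_comp_incl]
    split_ifs
    · exact mapL_id F X
    · exact mapL_zero hF
  sum_eq := by
    simp only [← mapL_comp]
    rw [← mapL_sum hF, h.sum_eq, mapL_id]

theorem StdFiltered.subsingleton {Λ : Type} {Δ : Λ → FGModuleCat.{u} A} {p : Λ → Prop}
    (hp : ∀ a, ¬ p a) {M : FGModuleCat.{u} A} (hM : StdFiltered p Δ M) : Subsingleton M := by
  have h0 : (LinearMap.id : M →ₗ[A] M) = 0 :=
    hM.hom_eq_zero (fun a ha => absurd ha (hp a)) _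
  exact ⟨fun x y => (LinearMap.congr_fun h0 x).trans (LinearMap.congr_fun h0 y).symm⟩

end Diagrams

/-- Two highest weight categories with functors to a common category having the same image on
standard objects. -/
structure Pairing (R : Type u) [CommRing R] {A₁ A₂ B : Type u} [Ring A₁] [Ring A₂] [Ring B]
    [Algebra R A₁] [Algebra R A₂] [Algebra R B] {Λ : Type} (ρ : Λ → ℕ)
    (Δ₁ P₁ : Λ → FGModuleCat.{u} A₁) (F₁ : FGModuleCat.{u} A₁ ⥤ FGModuleCat.{u} B)
    (X₁ : FGModuleCat.{u} A₁)
    (Δ₂ P₂ : Λ → FGModuleCat.{u} A₂) (F₂ : FGModuleCat.{u} A₂ ⥤ FGModuleCat.{u} B)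
    (X₂ : FGModuleCat.{u} A₂) : Prop where
  hw₁ : RankedHW R ρ Δ₁ P₁
  hw₂ : RankedHW R ρ Δ₂ P₂
  quot₁ : IsQuotientFunctor R Δ₁ F₁ X₁
  quot₂ : IsQuotientFunctor R Δ₂ F₂ X₂
  vanish₁ : Vanish ρ (fun a => F₁.obj (Δ₁ a)) (fun a => F₂.obj (Δ₂ a))
  vanish₂ : Vanish ρ (fun a => F₂.obj (Δ₂ a)) (fun a => F₁.obj (Δ₁ a))
  std : ∀ a, Nonempty (F₁.obj (Δ₁ a) ≃ₗ[B] F₂.obj (Δ₂ a))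
  obj : Nonempty (F₁.obj X₁ ≃ₗ[B] F₂.obj X₂)

/-- Every object of the first category filtered by standard objects of rank less than `k` has a
counterpart in the second one. -/
def Matches {A₁ A₂ B : Type u} [Ring A₁] [Ring A₂] [Ring B] {Λ : Type} (ρ : Λ → ℕ)
    (Δ₁ : Λ → FGModuleCat.{u} A₁) (F₁ : FGModuleCat.{u} A₁ ⥤ FGModuleCat.{u} B)
    (Δ₂ : Λ → FGModuleCat.{u} A₂) (F₂ : FGModuleCat.{u} A₂ ⥤ FGModuleCat.{u} B) (k : ℕ) : Prop :=
  ∀ M : FGModuleCat.{u} A₁, StdFiltered (fun a => ρ a < k) Δ₁ M →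
    ∃ M' : FGModuleCat.{u} A₂, StdFiltered (fun a => ρ a < k) Δ₂ M' ∧
      Nonempty (F₁.obj M ≃ₗ[B] F₂.obj M')

namespace Pairing

variable {R : Type u} [CommRing R] {A₁ A₂ B : Type u} [Ring A₁] [Ring A₂] [Ring B]
  [Algebra R A₁] [Algebra R A₂] [Algebra R B] {Λ : Type} {ρ : Λ → ℕ}
  {Δ₁ P₁ : Λ → FGModuleCat.{u} A₁} {Δ₂ P₂ : Λ → FGModuleCat.{u} A₂}
  {F₁ : FGModuleCat.{u} A₁ ⥤ FGModuleCat.{u} B} {F₂ : FGModuleCat.{u} A₂ ⥤ FGModuleCat.{u} B}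
  {X₁ : FGModuleCat.{u} A₁} {X₂ : FGModuleCat.{u} A₂}

theorem symm (S : Pairing R ρ Δ₁ P₁ F₁ X₁ Δ₂ P₂ F₂ X₂) : Pairing R ρ Δ₂ P₂ F₂ X₂ Δ₁ P₁ F₁ X₁ :=
  ⟨S.hw₂, S.hw₁, S.quot₂, S.quot₁, S.vanish₂, S.vanish₁, fun a => (S.std a).map .symm,
    S.obj.map .symm⟩

/-- Transport of morphisms. -/
theorem exists_map (S : Pairing R ρ Δ₁ P₁ F₁ X₁ Δ₂ P₂ F₂ X₂) {M N : FGModuleCat.{u} A₁}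
    {M' N' : FGModuleCat.{u} A₂} (hM' : stdFiltered Δ₂ M') (hN' : stdFiltered Δ₂ N')
    (eM : F₁.obj M ≃ₗ[B] F₂.obj M') (eN : F₁.obj N ≃ₗ[B] F₂.obj N') (f : M →ₗ[A₁] N) :
    ∃ f' : M' →ₗ[A₂] N', mapL F₂ f' ∘ₗ eM.toLinearMap = eN.toLinearMap ∘ₗ mapL F₁ f := by
  obtain ⟨f', hf'⟩ := S.quot₂.full hM' hN'
    (eN.toLinearMap ∘ₗ mapL F₁ f ∘ₗ eM.symm.toLinearMap)
  refine ⟨f', ?_⟩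
  rw [hf', LinearMap.comp_assoc, LinearMap.comp_assoc, LinearEquiv.symm_comp, LinearMap.comp_id]

theorem map_ext (S : Pairing R ρ Δ₁ P₁ F₁ X₁ Δ₂ P₂ F₂ X₂) {M : FGModuleCat.{u} A₁}
    {M' N' : FGModuleCat.{u} A₂} (hM' : stdFiltered Δ₂ M') (hN' : stdFiltered Δ₂ N')
    (eM : F₁.obj M ≃ₗ[B] F₂.obj M') {f g : M' →ₗ[A₂] N'}
    (h : mapL F₂ f ∘ₗ eM.toLinearMap = mapL F₂ g ∘ₗ eM.toLinearMap) : f = g :=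
  S.quot₂.faithful hM' hN' (comp_right_cancel eM.surjective h)

variable [IsNoetherianRing A₁] [IsNoetherianRing A₂]

/-- The images have no maps from labels of rank at least `k` to labels of rank below `k`, even
across the two categories, so every isomorphism preserves the two parts. -/
theorem exists_split_equiv (S : Pairing R ρ Δ₁ P₁ F₁ X₁ Δ₂ P₂ F₂ X₂) (k : ℕ)
    {p₁ q₁ p₂ q₂ : Λ → Prop}
    {U M L : FGModuleCat.{u} A₁} {i : U →ₗ[A₁] M} {p : M →ₗ[A₁] L} (hs : IsShortExact i p)
    (hU : StdFiltered (fun a => p₁ a ∧ k ≤ ρ a) Δ₁ U)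
    (hL : StdFiltered (fun a => q₁ a ∧ ρ a < k) Δ₁ L)
    {U' M' L' : FGModuleCat.{u} A₂} {i' : U' →ₗ[A₂] M'} {p' : M' →ₗ[A₂] L'}
    (hs' : IsShortExact i' p') (hU' : StdFiltered (fun a => p₂ a ∧ k ≤ ρ a) Δ₂ U')
    (hL' : StdFiltered (fun a => q₂ a ∧ ρ a < k) Δ₂ L') (e : F₁.obj M ≃ₗ[B] F₂.obj M') :
    ∃ (eU : F₁.obj U ≃ₗ[B] F₂.obj U') (eL : F₁.obj L ≃ₗ[B] F₂.obj L'),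
      mapL F₂ i' ∘ₗ eU.toLinearMap = e.toLinearMap ∘ₗ mapL F₁ i ∧
      eL.toLinearMap ∘ₗ mapL F₁ p = mapL F₂ p' ∘ₗ e.toLinearMap := by
  refine exists_equiv_of_comp_eq_zero (S.quot₁.exact hs) (S.quot₂.exact hs') e ?_ ?_
  · rw [← LinearMap.comp_assoc]
    exact S.vanish₁.filt (fun a b ha hb => hb.2.trans_le ha.2)
      (S.quot₁.exact.stdFiltered S.quot₁.linear.1 hU)
      (S.quot₂.exact.stdFiltered S.quot₂.linear.1 hL') _
  · rw [← LinearMap.comp_assoc]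
    exact S.vanish₂.filt (fun a b ha hb => hb.2.trans_le ha.2)
      (S.quot₂.exact.stdFiltered S.quot₂.linear.1 hU')
      (S.quot₁.exact.stdFiltered S.quot₁.linear.1 hL) _

variable [IsLocalRing R]

/-- Full faithfulness reflects split surjections, not all surjections. In the top rank the
surjection splits, as extensions by its kernel vanish, so that part is transported by its section;
the lower part is covered by induction. -/
theorem surjective_aux (S : Pairing R ρ Δ₁ P₁ F₁ X₁ Δ₂ P₂ F₂ X₂) (k : ℕ) :
    ∀ {M N : FGModuleCat.{u} A₁} {g : M →ₗ[A₁] N}, StdFiltered (fun a => ρ a < k) Δ₁ M →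
      StdFiltered (fun a => ρ a < k) Δ₁ N → Function.Surjective g →
      ∀ {M' N' : FGModuleCat.{u} A₂} {h : M' →ₗ[A₂] N'}, stdFiltered Δ₂ M' → stdFiltered Δ₂ N' →
      ∀ (eM : F₁.obj M ≃ₗ[B] F₂.obj M') (eN : F₁.obj N ≃ₗ[B] F₂.obj N'),
      mapL F₂ h ∘ₗ eM.toLinearMap = eN.toLinearMap ∘ₗ mapL F₁ g → Function.Surjective h := by
  induction k with
  | zero =>
    intro M N g hM hN hg M' N' h hM' hN' eM eN hc
    have h1 := hN.subsingleton fun a => by omega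
    have h2 := IsExactFunctor.subsingleton S.quot₁.linear.1 h1
    have := S.quot₂.subsingleton hN' eN.symm.injective.subsingleton
    exact fun y => ⟨0, Subsingleton.elim _ _⟩
  | succ k ih =>
    intro M N g hM hN hg M' N' h hM' hN' eM eN hc
    obtain ⟨U, L, i, p, hs, hU, hL⟩ := S.hw₁.exists_split k hM
    obtain ⟨V, K, j, q, ht, hV, hK⟩ := S.hw₁.exists_split k hN
    obtain ⟨U', L', i', p', hs', hU', hL'⟩ := S.hw₂.exists_split k hM'
    obtain ⟨V', K', j', q', ht', hV', hK'⟩ := S.hw₂.exists_split k hN'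
    obtain ⟨eU, eL, h1, h2⟩ := S.exists_split_equiv k hs hU hL hs' hU' hL' eM
    obtain ⟨eV, eK, h3, h4⟩ := S.exists_split_equiv k ht hV hK ht' hV' hK' eN
    obtain ⟨gU, gL, h5, h6⟩ := exists_restrict_of_comp_eq_zero hs ht g (by
      rw [← LinearMap.comp_assoc]
      exact S.hw₁.filt_hom_eq_zero hU hK (fun a b ha hb => hb.2.trans_le ha.2) _)
    obtain ⟨hU₂, hL₂, h7, h8⟩ := exists_restrict_of_comp_eq_zero hs' ht' h (by
      rw [← LinearMap.comp_assoc]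
      exact S.hw₂.filt_hom_eq_zero hU' hK' (fun a b ha hb => hb.2.trans_le ha.2) _)
    have cU : mapL F₂ hU₂ ∘ₗ eU.toLinearMap = eV.toLinearMap ∘ₗ mapL F₁ gU := by
      refine comp_left_cancel (S.quot₂.exact.injective ht'.1) ?_
      rw [← LinearMap.comp_assoc, ← mapL_comp, h7, mapL_comp, LinearMap.comp_assoc, h1,
        ← LinearMap.comp_assoc, hc, LinearMap.comp_assoc, ← mapL_comp, ← h5, mapL_comp,
        ← LinearMap.comp_assoc, ← h3, LinearMap.comp_assoc]
    have cL : mapL F₂ hL₂ ∘ₗ eL.toLinearMap = eK.toLinearMap ∘ₗ mapL F₁ gL := by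
      refine comp_right_cancel (S.quot₁.exact.surjective hs.2.1) ?_
      rw [LinearMap.comp_assoc, h2, ← LinearMap.comp_assoc, ← mapL_comp, h8, mapL_comp,
        LinearMap.comp_assoc, hc, ← LinearMap.comp_assoc, ← h4, LinearMap.comp_assoc, ← mapL_comp,
        ← h6, mapL_comp, LinearMap.comp_assoc]
    have sL : Function.Surjective hL₂ := by
      refine ih (hL.mono fun a ha => ha.2) (hK.mono fun a ha => ha.2) ?_
        (hL'.mono fun _ _ => trivial) (hK'.mono fun _ _ => trivial) eL eK cL
      have : Function.Surjective (gL ∘ₗ p) := by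
        rw [h6]
        exact ht.2.1.comp hg
      exact Function.Surjective.of_comp this
    have sU : Function.Surjective hU₂ := by
      obtain ⟨W, w, hw⟩ := exists_kernel_of_surjective g hg
      have hW := S.hw₁.filt_kernel_aux (k + 1) hw hM hN
      obtain ⟨s, hs₀⟩ := (S.hw₁.filt_extZero_filt hV hW fun a b ha hb => by omega).exists_lift hw j
      obtain ⟨t, rfl⟩ := hs.exists_lift s
        (S.hw₁.filt_hom_eq_zero hV hL (fun a b ha hb => hb.2.trans_le ha.2) _)
      have hgt : gU ∘ₗ t = LinearMap.id := by
        refine comp_left_cancel ht.1 ?_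
        rw [← LinearMap.comp_assoc, h5, LinearMap.comp_assoc, hs₀, LinearMap.comp_id]
      have hV'' : stdFiltered Δ₂ V' := hV'.mono fun _ _ => trivial
      have hU'' : stdFiltered Δ₂ U' := hU'.mono fun _ _ => trivial
      obtain ⟨t', ht''⟩ := S.exists_map hV'' hU'' eV eU t
      have : hU₂ ∘ₗ t' = LinearMap.id := S.map_ext hV'' hV'' eV (by
        rw [mapL_comp, LinearMap.comp_assoc, ht'', ← LinearMap.comp_assoc, cU,
          LinearMap.comp_assoc, ← mapL_comp, hgt, mapL_id, mapL_id]
        rfl)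
      exact fun y => ⟨t' y, LinearMap.congr_fun this y⟩
    exact surjective_of_shortExact hs' ht' h7 h8 sU sL

variable [Finite Λ]

/-- Transport of short exact sequences. -/
theorem exists_shortExact (S : Pairing R ρ Δ₁ P₁ F₁ X₁ Δ₂ P₂ F₂ X₂) {K M N : FGModuleCat.{u} A₁}
    {i : K →ₗ[A₁] M} {g : M →ₗ[A₁] N} (hs : IsShortExact i g) (hM : stdFiltered Δ₁ M)
    (hN : stdFiltered Δ₁ N) {M' N' : FGModuleCat.{u} A₂} (hM' : stdFiltered Δ₂ M')
    (hN' : stdFiltered Δ₂ N') (eM : F₁.obj M ≃ₗ[B] F₂.obj M') (eN : F₁.obj N ≃ₗ[B] F₂.obj N') :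
    ∃ (K' : FGModuleCat.{u} A₂) (i' : K' →ₗ[A₂] M') (g' : M' →ₗ[A₂] N')
      (eK : F₁.obj K ≃ₗ[B] F₂.obj K'), IsShortExact i' g' ∧ stdFiltered Δ₂ K' ∧
      mapL F₂ i' ∘ₗ eK.toLinearMap = eM.toLinearMap ∘ₗ mapL F₁ i ∧
      mapL F₂ g' ∘ₗ eM.toLinearMap = eN.toLinearMap ∘ₗ mapL F₁ g := by
  obtain ⟨k, hk⟩ := RankedHW.exists_bound ρ
  obtain ⟨g', hg'⟩ := S.exists_map hM' hN' eM eN g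
  have hsurj := S.surjective_aux k (hM.mono fun a _ => hk a) (hN.mono fun a _ => hk a) hs.2.1
    hM' hN' eM eN hg'
  obtain ⟨K', i', hs'⟩ := exists_kernel_of_surjective g' hsurj
  obtain ⟨eK, -, h1, -⟩ := exists_equiv_of_comp_eq_zero (S.quot₁.exact hs) (S.quot₂.exact hs') eM
    (by
      rw [← LinearMap.comp_assoc, hg', LinearMap.comp_assoc, (S.quot₁.exact hs).comp_eq_zero,
        LinearMap.comp_zero])
    (by
      refine comp_left_cancel eN.injective ?_
      rw [LinearMap.comp_zero, ← LinearMap.comp_assoc, ← hg', LinearMap.comp_assoc,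
        ← LinearMap.comp_assoc _ eM.symm.toLinearMap, LinearEquiv.comp_symm, LinearMap.id_comp,
        (S.quot₂.exact hs').comp_eq_zero])
  exact ⟨K', i', g', eK, hs', S.hw₂.filt_kernel hs' hM' hN', h1, hg'⟩

end Pairing

end FockCat

/-! ### Transport of extensions and matching of filtered objects -/

namespace FockCat

/-- The universal property of the pullback depends only on the map of extensions, so it holds after
applying an exact functor. -/
theorem exists_pullback_lift {A : Type u} [Ring A] {N W X Y Z V : FGModuleCat.{u} A}
    {f' : N →ₗ[A] W} {g' : W →ₗ[A] X} (hs : IsShortExact f' g') {f : N →ₗ[A] Y} {g : Y →ₗ[A] Z}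
    (ht : IsShortExact f g) {h : X →ₗ[A] Z} {h' : W →ₗ[A] Y} (hf : h' ∘ₗ f' = f)
    (hh : g ∘ₗ h' = h ∘ₗ g') (a : V →ₗ[A] Y) (b : V →ₗ[A] X) (hab : g ∘ₗ a = h ∘ₗ b) :
    ∃ c : V →ₗ[A] W, h' ∘ₗ c = a ∧ g' ∘ₗ c = b := by
  have ef := LinearMap.congr_fun hf
  have eh := LinearMap.congr_fun hh
  have eab := LinearMap.congr_fun hab
  simp only [LinearMap.comp_apply] at ef eh eab
  have hinj : Function.Injective (h'.prod g') := by
    rw [injective_iff_map_eq_zero]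
    intro x hx
    have h1 : h' x = 0 := (Prod.ext_iff.mp hx).1
    have h2 : g' x = 0 := (Prod.ext_iff.mp hx).2
    obtain ⟨n, rfl⟩ := hs.exists_of_apply_eq_zero h2
    rw [ef] at h1
    rw [ht.1 (h1.trans (map_zero f).symm), map_zero]
  obtain ⟨c, hc⟩ := exists_factor_of_range_le hinj (a.prod b) fun x => by
    obtain ⟨w, hw⟩ := hs.2.1 (b x)
    obtain ⟨n, hn⟩ := ht.exists_of_apply_eq_zero (x := a x - h' w) (by
      rw [map_sub, eab, eh, hw, sub_self])
    refine ⟨f' n + w, Prod.ext ?_ ?_⟩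
    · change h' (f' n + w) = a x
      rw [map_add, ef, hn, sub_add_cancel]
    · change g' (f' n + w) = b x
      rw [map_add, hs.apply_eq_zero, zero_add, hw]
  exact ⟨c, LinearMap.ext fun x => congrArg Prod.fst (LinearMap.congr_fun hc x),
    LinearMap.ext fun x => congrArg Prod.snd (LinearMap.congr_fun hc x)⟩

theorem pullback_hom_ext {A : Type u} [Ring A] {N W X Y V : FGModuleCat.{u} A}
    {f' : N →ₗ[A] W} {g' : W →ₗ[A] X} (hs : IsShortExact f' g') {f : N →ₗ[A] Y}
    (hfi : Function.Injective f) {h' : W →ₗ[A] Y} (hf : h' ∘ₗ f' = f) {c c' : V →ₗ[A] W}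
    (h₁ : h' ∘ₗ c = h' ∘ₗ c') (h₂ : g' ∘ₗ c = g' ∘ₗ c') : c = c' := LinearMap.ext fun x => by
  rw [← sub_eq_zero]
  obtain ⟨n, hn⟩ := hs.exists_of_apply_eq_zero (x := c x - c' x) (by
    rw [map_sub, sub_eq_zero]
    exact LinearMap.congr_fun h₂ x)
  have h3 : f n = 0 := by
    rw [← hf, LinearMap.comp_apply, hn, map_sub, sub_eq_zero]
    exact LinearMap.congr_fun h₁ x
  rw [← hn, hfi (h3.trans (map_zero f).symm), map_zero]

theorem GeneratedBy.of_surjective {A : Type u} [Ring A] {X M N : FGModuleCat.{u} A}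
    (h : GeneratedBy X M) {g : M →ₗ[A] N} (hg : Function.Surjective g) : GeneratedBy X N := by
  obtain ⟨n, Q, i, p, π, h, hπ⟩ := h
  exact ⟨n, Q, i, p, g ∘ₗ π, h, hg.comp hπ⟩

theorem matches_zero {A₁ A₂ B : Type u} [Ring A₁] [Ring A₂] [Ring B] {Λ : Type} (ρ : Λ → ℕ)
    (Δ₁ : Λ → FGModuleCat.{u} A₁) {F₁ : FGModuleCat.{u} A₁ ⥤ FGModuleCat.{u} B}
    (Δ₂ : Λ → FGModuleCat.{u} A₂) {F₂ : FGModuleCat.{u} A₂ ⥤ FGModuleCat.{u} B}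
    (hF₁ : F₁.Additive) (hF₂ : F₂.Additive) : Matches ρ Δ₁ F₁ Δ₂ F₂ 0 := fun M hM => by
  have h₁ := IsExactFunctor.subsingleton hF₁ (hM.subsingleton fun a => by omega)
  have h₀ : Subsingleton (FGModuleCat.of A₂ PUnit.{u + 1}) :=
    inferInstanceAs (Subsingleton PUnit.{u + 1})
  have h₂ := IsExactFunctor.subsingleton hF₂ h₀
  exact ⟨_, .zero _ h₀, ⟨.ofLinearMap 0 0 (LinearMap.ext fun x => Subsingleton.elim _ _)
    (LinearMap.ext fun x => Subsingleton.elim _ _)⟩⟩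

namespace Pairing

variable {R : Type u} [CommRing R] {A₁ A₂ B : Type u} [Ring A₁] [Ring A₂] [Ring B]
  [Algebra R A₁] [Algebra R A₂] [Algebra R B] {Λ : Type} {ρ : Λ → ℕ}
  {Δ₁ P₁ : Λ → FGModuleCat.{u} A₁} {Δ₂ P₂ : Λ → FGModuleCat.{u} A₂}
  {F₁ : FGModuleCat.{u} A₁ ⥤ FGModuleCat.{u} B} {F₂ : FGModuleCat.{u} A₂ ⥤ FGModuleCat.{u} B}
  {X₁ : FGModuleCat.{u} A₁} {X₂ : FGModuleCat.{u} A₂}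

theorem exists_map_back (S : Pairing R ρ Δ₁ P₁ F₁ X₁ Δ₂ P₂ F₂ X₂) {M N : FGModuleCat.{u} A₁}
    {M' N' : FGModuleCat.{u} A₂} (hM : stdFiltered Δ₁ M) (hN : stdFiltered Δ₁ N)
    (eM : F₁.obj M ≃ₗ[B] F₂.obj M') (eN : F₁.obj N ≃ₗ[B] F₂.obj N') (f : M' →ₗ[A₂] N') :
    ∃ f' : M →ₗ[A₁] N, mapL F₂ f ∘ₗ eM.toLinearMap = eN.toLinearMap ∘ₗ mapL F₁ f' := by
  obtain ⟨f', hf'⟩ := S.quot₁.full hM hN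
    (eN.symm.toLinearMap ∘ₗ mapL F₂ f ∘ₗ eM.toLinearMap)
  refine ⟨f', ?_⟩
  rw [hf', ← LinearMap.comp_assoc, LinearEquiv.comp_symm, LinearMap.id_comp]

theorem map_ext_back (S : Pairing R ρ Δ₁ P₁ F₁ X₁ Δ₂ P₂ F₂ X₂) {M N : FGModuleCat.{u} A₁}
    {N' : FGModuleCat.{u} A₂} (hM : stdFiltered Δ₁ M) (hN : stdFiltered Δ₁ N)
    (eN : F₁.obj N ≃ₗ[B] F₂.obj N') {f g : M →ₗ[A₁] N}
    (h : eN.toLinearMap ∘ₗ mapL F₁ f = eN.toLinearMap ∘ₗ mapL F₁ g) : f = g :=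
  S.quot₁.faithful hM hN (comp_left_cancel eN.injective h)

variable [IsNoetherianRing A₁] [IsNoetherianRing A₂] [IsLocalRing R] [Finite Λ]

/-- For objects generated by `X₁`, a power of `X₁` begins a presentation, and its image matches that
of the same power of `X₂`. `Ext¹(M, N)` is the cokernel of `Hom(Q, N) → Hom(K, N)`, between filtered
objects, so full faithfulness controls it. -/
theorem exists_presentation (S : Pairing R ρ Δ₁ P₁ F₁ X₁ Δ₂ P₂ F₂ X₂) {M : FGModuleCat.{u} A₁}
    {M' : FGModuleCat.{u} A₂} (hM : stdFiltered Δ₁ M) (hM' : stdFiltered Δ₂ M')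
    (e : F₁.obj M ≃ₗ[B] F₂.obj M') (hg : GeneratedBy X₁ M) :
    ∃ (K Q : FGModuleCat.{u} A₁) (i : K →ₗ[A₁] Q) (π : Q →ₗ[A₁] M) (K' Q' : FGModuleCat.{u} A₂)
      (i' : K' →ₗ[A₂] Q') (π' : Q' →ₗ[A₂] M') (eK : F₁.obj K ≃ₗ[B] F₂.obj K')
      (eQ : F₁.obj Q ≃ₗ[B] F₂.obj Q'), Module.Projective A₁ Q ∧ IsShortExact i π ∧
      IsShortExact i' π' ∧ stdFiltered Δ₁ K ∧ stdFiltered Δ₁ Q ∧ stdFiltered Δ₂ K' ∧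
      stdFiltered Δ₂ Q' ∧ mapL F₂ i' ∘ₗ eK.toLinearMap = eQ.toLinearMap ∘ₗ mapL F₁ i ∧
      mapL F₂ π' ∘ₗ eQ.toLinearMap = e.toLinearMap ∘ₗ mapL F₁ π := by
  obtain ⟨n, Q, j, p, π, h, hπ⟩ := hg
  obtain ⟨Q', j', p', h'⟩ := exists_pow X₂ n
  have := S.quot₁.projective
  have := S.quot₂.projective
  have := h.projective
  have := h'.projective
  have hQ := S.hw₁.filt_of_projective Q
  have hQ' := S.hw₂.filt_of_projective Q'
  obtain ⟨eX⟩ := S.obj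
  obtain ⟨eQ⟩ := (h.mapL S.quot₁.linear.1).exists_equiv (h'.mapL S.quot₂.linear.1) eX
  obtain ⟨K, i, hs⟩ := exists_kernel_of_surjective π hπ
  obtain ⟨K', i', π', eK, hs', hK', h1, h2⟩ := S.exists_shortExact hs hQ hM hQ' hM' eQ e
  exact ⟨K, Q, i, π, K', Q', i', π', eK, eQ, ‹_›, hs, hs', S.hw₁.filt_kernel hs hQ hM, hQ, hK',
    hQ', h1, h2⟩

/-- Transport of the vanishing of extensions. -/
theorem extZero_of_extZero (S : Pairing R ρ Δ₁ P₁ F₁ X₁ Δ₂ P₂ F₂ X₂) {M N : FGModuleCat.{u} A₁}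
    {M' N' : FGModuleCat.{u} A₂} (hM : stdFiltered Δ₁ M) (hM' : stdFiltered Δ₂ M')
    (eM : F₁.obj M ≃ₗ[B] F₂.obj M') (hN : stdFiltered Δ₁ N) (hN' : stdFiltered Δ₂ N')
    (eN : F₁.obj N ≃ₗ[B] F₂.obj N') (hg : GeneratedBy X₁ M) (h : ExtZero M' N') :
    ExtZero M N := by
  obtain ⟨K, Q, i, π, K', Q', i', π', eK, eQ, hQp, hs, hs', hK, hQ, hK', hQ', h1, -⟩ :=
    S.exists_presentation hM hM' eM hg
  refine extZero_of_projective hs fun φ => ?_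
  obtain ⟨φ', hφ'⟩ := S.exists_map hK' hN' eK eN φ
  obtain ⟨k', rfl⟩ := h _ _ i' π' hs' φ'
  obtain ⟨k, hk⟩ := S.exists_map_back hQ hN eQ eN k'
  refine ⟨k, S.map_ext_back hK hN eN ?_⟩
  rw [← hφ', mapL_comp, ← LinearMap.comp_assoc, ← hk, LinearMap.comp_assoc, ← h1, mapL_comp,
    LinearMap.comp_assoc]

/-- Transport of extensions. -/
theorem exists_extension (S : Pairing R ρ Δ₁ P₁ F₁ X₁ Δ₂ P₂ F₂ X₂) {M N E : FGModuleCat.{u} A₁}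
    {f : N →ₗ[A₁] E} {g : E →ₗ[A₁] M} (hs : IsShortExact f g)
    {M' N' : FGModuleCat.{u} A₂} (hM : stdFiltered Δ₁ M) (hM' : stdFiltered Δ₂ M')
    (eM : F₁.obj M ≃ₗ[B] F₂.obj M') (hN' : stdFiltered Δ₂ N')
    (eN : F₁.obj N ≃ₗ[B] F₂.obj N') (hg : GeneratedBy X₁ M) :
    ∃ (E' : FGModuleCat.{u} A₂) (f' : N' →ₗ[A₂] E') (g' : E' →ₗ[A₂] M')
      (eE : F₁.obj E ≃ₗ[B] F₂.obj E'), IsShortExact f' g' ∧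
      mapL F₂ f' ∘ₗ eN.toLinearMap = eE.toLinearMap ∘ₗ mapL F₁ f ∧
      mapL F₂ g' ∘ₗ eE.toLinearMap = eM.toLinearMap ∘ₗ mapL F₁ g := by
  obtain ⟨K, Q, i, π, K', Q', i', π', eK, eQ, hQp, ht, ht', hK, hQ, hK', hQ', h1, h2⟩ :=
    S.exists_presentation hM hM' eM hg
  obtain ⟨l, hl⟩ := Module.projective_lifting_property g π hs.2.1
  obtain ⟨φ, hφ⟩ := hs.exists_lift (l ∘ₗ i) (by
    rw [← LinearMap.comp_assoc, hl, ht.comp_eq_zero])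
  obtain ⟨φ', hφ'⟩ := S.exists_map hK' hN' eK eN φ
  -- The extension `E` is the pushout of the presentation of `M` along `φ`; its counterpart is the
  -- pushout along the transported `φ'`, and both images have the same universal property.
  obtain ⟨E', f', l', g', hs', h3, h4⟩ := exists_pushout ht' φ'
  have h4' : mapL F₂ g' ∘ₗ mapL F₂ l' = mapL F₂ π' := by rw [← mapL_comp, h4]
  have hl' : mapL F₁ g ∘ₗ mapL F₁ l = mapL F₁ π := by rw [← mapL_comp, hl]
  obtain ⟨c, hc1, hc2⟩ := exists_pushout_desc (S.quot₁.exact ht) (S.quot₁.exact hs) hl'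
    (φ := mapL F₁ φ) (by rw [← mapL_comp, ← mapL_comp, hφ])
    (mapL F₂ f' ∘ₗ eN.toLinearMap) (mapL F₂ l' ∘ₗ eQ.toLinearMap) (by
      rw [LinearMap.comp_assoc, ← hφ', ← LinearMap.comp_assoc, ← mapL_comp, ← h3, mapL_comp,
        LinearMap.comp_assoc, h1, LinearMap.comp_assoc])
  have hc3 : eM.toLinearMap ∘ₗ mapL F₁ g = mapL F₂ g' ∘ₗ c := by
    refine pushout_hom_ext (S.quot₁.exact ht).2.1 (S.quot₁.exact hs) hl' ?_ ?_
    · rw [LinearMap.comp_assoc, (S.quot₁.exact hs).comp_eq_zero, LinearMap.comp_zero,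
        LinearMap.comp_assoc, hc1, ← LinearMap.comp_assoc, (S.quot₂.exact hs').comp_eq_zero,
        LinearMap.zero_comp]
    · rw [LinearMap.comp_assoc, hl', LinearMap.comp_assoc, hc2, ← LinearMap.comp_assoc, h4', h2]
  exact ⟨E', f', g', .ofBijective c
    ⟨injective_of_shortExact (S.quot₁.exact hs) (S.quot₂.exact hs') hc1.symm hc3 eN.injective
      eM.injective, surjective_of_shortExact (S.quot₁.exact hs) (S.quot₂.exact hs') hc1.symm hc3
      eN.surjective eM.surjective⟩, hs', hc1.symm, hc3.symm⟩

/-- The hull of a standard object of the second category has a counterpart in the first one. -/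
theorem exists_hull [IsNoetherianRing R] [Module.Finite R A₁] [Module.Finite R A₂]
    (S : Pairing R ρ Δ₁ P₁ F₁ X₁ Δ₂ P₂ F₂ X₂) (a : Λ)
    (h₁₂ : Matches ρ Δ₁ F₁ Δ₂ F₂ (ρ a)) (h₂₁ : Matches ρ Δ₂ F₂ Δ₁ F₁ (ρ a)) :
    ∃ (T M : FGModuleCat.{u} A₁) (i : Δ₁ a →ₗ[A₁] T) (p : T →ₗ[A₁] M)
      (T' M' : FGModuleCat.{u} A₂) (i' : Δ₂ a →ₗ[A₂] T') (p' : T' →ₗ[A₂] M')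
      (ea : F₁.obj (Δ₁ a) ≃ₗ[B] F₂.obj (Δ₂ a)) (eT : F₁.obj T ≃ₗ[B] F₂.obj T')
      (eM : F₁.obj M ≃ₗ[B] F₂.obj M'), IsShortExact i p ∧ IsShortExact i' p' ∧
      stdFiltered Δ₂ M' ∧ mapL F₂ i' ∘ₗ ea.toLinearMap = eT.toLinearMap ∘ₗ mapL F₁ i ∧
      mapL F₂ p' ∘ₗ eT.toLinearMap = eM.toLinearMap ∘ₗ mapL F₁ p ∧
      ∀ X : FGModuleCat.{u} A₁, StdFiltered (fun b => ρ b < ρ a + 1) Δ₁ X → ExtZero X T := by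
  obtain ⟨ea⟩ := S.std a
  obtain ⟨T', M', i', p', hs', hM', hT'⟩ := S.hw₂.exists_hull a
  have fM' : stdFiltered Δ₂ M' := hM'.mono fun _ _ => trivial
  have fT' : stdFiltered Δ₂ T' := StdFiltered.extension hs' (.single trivial) fM'
  obtain ⟨M, hM, ⟨eM'⟩⟩ := h₂₁ M' hM'
  have fM : stdFiltered Δ₁ M := hM.mono fun _ _ => trivial
  obtain ⟨T, i, p, eT', hs, c1, c2⟩ := S.symm.exists_extension hs' fM' fM eM'
    (.single trivial) ea.symm ((S.quot₂.generates T' fT' hT').of_surjective hs'.2.1)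
  have hT : StdFiltered (fun b => ρ b ≤ ρ a) Δ₁ T :=
    StdFiltered.extension hs (.single le_rfl) (hM.mono fun b hb => le_of_lt hb)
  have fT : stdFiltered Δ₁ T := hT.mono fun _ _ => trivial
  have c1' : mapL F₂ i' ∘ₗ ea.toLinearMap = eT'.symm.toLinearMap ∘ₗ mapL F₁ i := by
    refine comp_left_cancel eT'.injective ?_
    rw [← LinearMap.comp_assoc, ← LinearMap.comp_assoc, LinearEquiv.comp_symm, LinearMap.id_comp]
    rw [← c1, LinearMap.comp_assoc, LinearEquiv.symm_comp, LinearMap.comp_id]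
  have c2' : mapL F₂ p' ∘ₗ eT'.symm.toLinearMap = eM'.symm.toLinearMap ∘ₗ mapL F₁ p := by
    refine comp_left_cancel eM'.injective (comp_right_cancel eT'.surjective ?_)
    rw [← LinearMap.comp_assoc, LinearMap.comp_assoc, LinearEquiv.symm_comp, LinearMap.comp_id,
      ← LinearMap.comp_assoc, LinearEquiv.comp_symm, LinearMap.id_comp, ← c2]
  obtain ⟨T₁, M₁, i₁, p₁, hs₁, hM₁, hT₁⟩ := S.hw₁.exists_hull a
  have fM₁ : stdFiltered Δ₁ M₁ := hM₁.mono fun _ _ => trivial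
  have fT₁ : stdFiltered Δ₁ T₁ := StdFiltered.extension hs₁ (.single trivial) fM₁
  obtain ⟨M₁', hM₁', ⟨eM₁⟩⟩ := h₁₂ M₁ hM₁
  -- The cokernel `M₁` of the intrinsic hull is generated by `X₁`, so the vanishing of `Ext¹(-, T')`
  -- for its counterpart carries over. Thus `T` and the intrinsic hull `T₁` map to each other
  -- compatibly with `Δ₁ a`.
  have hext : ExtZero M₁ T := S.extZero_of_extZero fM₁ (hM₁'.mono fun _ _ => trivial) eM₁ fT fT'
    eT'.symm ((S.quot₁.generates T₁ fT₁ hT₁).of_surjective hs₁.2.1)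
    (hM₁'.extZero fun b _ => hT' b)
  obtain ⟨u, hu⟩ := hM.extZero (fun b _ => hT₁ b) _ _ i p hs i₁
  obtain ⟨v, hv⟩ := hext _ _ i₁ p₁ hs₁ i
  -- `v ∘ u` is the identity on `Δ₁ a`, so it differs from the identity of `T` by a map `w` out of
  -- the quotient `M`, whose rank is lower.
  obtain ⟨w, hw⟩ := hs.exists_desc (v ∘ₗ u - LinearMap.id) (by
    rw [LinearMap.sub_comp, LinearMap.comp_assoc, hu, hv, LinearMap.id_comp, sub_self])
  -- A retraction of `T → Y` is built as `v ∘ u'` minus a correction. The map `w` extends from `M`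
  -- to the pushout `Z` because `Z` has rank below `ρ a`, hence a counterpart, and maps to `T'`
  -- extend in the second category. On `T` the result is `v ∘ u - w ∘ p`, the identity.
  have hlow : ∀ X : FGModuleCat.{u} A₁, StdFiltered (fun b => ρ b < ρ a) Δ₁ X → ExtZero X T := by
    intro X hX
    refine extZero_of_sections fun Y f g hfg => ?_
    obtain ⟨u', hu'⟩ := hX.extZero (fun b _ => hT₁ b) _ _ f g hfg u
    obtain ⟨Z, f', π, g', hs₂, -, hπ, -⟩ := exists_pushout_of_shortExact hs hfg
    have hZ : StdFiltered (fun b => ρ b < ρ a) Δ₁ Z := StdFiltered.extension hs₂ hM hX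
    have fZ : stdFiltered Δ₁ Z := hZ.mono fun _ _ => trivial
    obtain ⟨Z', hZ', ⟨eZ⟩⟩ := h₁₂ Z hZ
    have fZ' : stdFiltered Δ₂ Z' := hZ'.mono fun _ _ => trivial
    obtain ⟨X', hX', ⟨eX⟩⟩ := h₁₂ X hX
    obtain ⟨K, k, g'', eK, hs₃, hK, d1, -⟩ := S.exists_shortExact hs₂ fZ
      (hX.mono fun _ _ => trivial) fZ' (hX'.mono fun _ _ => trivial) eZ eX
    obtain ⟨w', hw'⟩ := S.exists_map hK fT' eK eT'.symm w
    obtain ⟨z', rfl⟩ := hX'.extZero (fun b _ => hT' b) _ _ k g'' hs₃ w'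
    obtain ⟨z, hz⟩ := S.exists_map_back fZ fT eZ eT'.symm z'
    have hzw : z ∘ₗ f' = w := S.map_ext_back fM fT eT'.symm (by
      rw [← hw', mapL_comp, ← LinearMap.comp_assoc, ← hz, LinearMap.comp_assoc, ← d1, mapL_comp,
        LinearMap.comp_assoc])
    obtain ⟨t, ht, -⟩ := exists_section_of_retraction hfg (k := v ∘ₗ u' - z ∘ₗ π) (by
      rw [LinearMap.sub_comp, LinearMap.comp_assoc, hu', LinearMap.comp_assoc, hπ,
        ← LinearMap.comp_assoc, hzw, hw, sub_sub_cancel])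
    exact ⟨t, ht⟩
  refine ⟨T, M, i, p, T', M', i', p', ea, eT'.symm, eM'.symm, hs, hs', fM', c1', c2',
    fun X hX => hX.extZero fun b hb => ?_⟩
  rcases Nat.lt_or_ge (ρ b) (ρ a) with h | h
  · exact hlow _ (.single h)
  · obtain rfl : b = a := S.hw₁.rank_injective (by omega)
    exact S.hw₁.extZero_std_filt hT fun c hc => hc

/-- Any extension of `Y` by `Δ₁ a` with `ρ a = k` and `Y` of rank at most `k` is pulled back from
the hull sequence of `Δ₁ a`. Transporting the classifying map from `Y` to the cokernel of the hull
and pulling back in the second category gives the counterpart. -/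
theorem matches_succ [IsNoetherianRing R] [Module.Finite R A₁] [Module.Finite R A₂]
    (S : Pairing R ρ Δ₁ P₁ F₁ X₁ Δ₂ P₂ F₂ X₂) {k : ℕ} (h₁₂ : Matches ρ Δ₁ F₁ Δ₂ F₂ k)
    (h₂₁ : Matches ρ Δ₂ F₂ Δ₁ F₁ k) : Matches ρ Δ₁ F₁ Δ₂ F₂ (k + 1) := by
  have key : ∀ (a : Λ), ρ a = k → ∀ (X Y : FGModuleCat.{u} A₁) (f : Δ₁ a →ₗ[A₁] X)
      (g : X →ₗ[A₁] Y), IsShortExact f g → StdFiltered (fun b => ρ b < k + 1) Δ₁ Y →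
      (∃ Y', StdFiltered (fun b => ρ b < k + 1) Δ₂ Y' ∧ Nonempty (F₁.obj Y ≃ₗ[B] F₂.obj Y')) →
      ∃ X', StdFiltered (fun b => ρ b < k + 1) Δ₂ X' ∧ Nonempty (F₁.obj X ≃ₗ[B] F₂.obj X') := by
    rintro a rfl X Y f g hfg hY ⟨Y', hY', ⟨eY⟩⟩
    obtain ⟨T, M, i, p, T', M', i', p', ea, eT, eM, hs, hs', fM', c1, c2, hext⟩ :=
      S.exists_hull a h₁₂ h₂₁
    -- Extending `i` over `X` is possible by the vanishing of `Ext¹(Y, T)`; the induced map `q` on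
    -- quotients classifies the extension.
    obtain ⟨h, hh⟩ := hext Y hY _ _ f g hfg i
    obtain ⟨q, hq⟩ := hfg.exists_desc (p ∘ₗ h) (by
      rw [LinearMap.comp_assoc, hh, hs.comp_eq_zero])
    obtain ⟨q', hq'⟩ := S.exists_map (hY'.mono fun _ _ => trivial) fM' eY eM q
    obtain ⟨W, f', h', g', hW, d1, d2⟩ := exists_pullback hs' q'
    have d1' : mapL F₂ h' ∘ₗ mapL F₂ f' = mapL F₂ i' := by rw [← mapL_comp, d1]
    obtain ⟨c, hc1, hc2⟩ := exists_pullback_lift (S.quot₂.exact hW) (S.quot₂.exact hs')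
      (h := mapL F₂ q') d1' (by rw [← mapL_comp, ← mapL_comp, d2])
      (eT.toLinearMap ∘ₗ mapL F₁ h) (eY.toLinearMap ∘ₗ mapL F₁ g) (by
        rw [← LinearMap.comp_assoc, c2, LinearMap.comp_assoc, ← mapL_comp, ← hq, mapL_comp,
          ← LinearMap.comp_assoc, ← LinearMap.comp_assoc, hq'])
    have hc3 : mapL F₂ f' ∘ₗ ea.toLinearMap = c ∘ₗ mapL F₁ f := by
      refine pullback_hom_ext (S.quot₂.exact hW) (S.quot₂.exact hs').1 d1' ?_ ?_
      · rw [← LinearMap.comp_assoc, d1', c1, ← LinearMap.comp_assoc, hc1, LinearMap.comp_assoc,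
          ← mapL_comp, hh]
      · rw [← LinearMap.comp_assoc, (S.quot₂.exact hW).comp_eq_zero, LinearMap.zero_comp,
          ← LinearMap.comp_assoc, hc2, LinearMap.comp_assoc, (S.quot₁.exact hfg).comp_eq_zero,
          LinearMap.comp_zero]
    exact ⟨W, StdFiltered.extension hW (.single (Nat.lt_succ_self _)) hY', ⟨.ofBijective c
      ⟨injective_of_shortExact (S.quot₁.exact hfg) (S.quot₂.exact hW) hc3 hc2.symm ea.injective
        eY.injective, surjective_of_shortExact (S.quot₁.exact hfg) (S.quot₂.exact hW) hc3 hc2.symm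
        ea.surjective eY.surjective⟩⟩⟩
  -- The part of rank `k` may consist of several copies of the standard object; they are attached to
  -- the lower part one at a time.
  have key' : ∀ U : FGModuleCat.{u} A₁, StdFiltered (fun b => ρ b < k + 1 ∧ k ≤ ρ b) Δ₁ U →
      ∀ (X Y : FGModuleCat.{u} A₁) (f : U →ₗ[A₁] X) (g : X →ₗ[A₁] Y), IsShortExact f g →
      StdFiltered (fun b => ρ b < k + 1) Δ₁ Y →
      (∃ Y', StdFiltered (fun b => ρ b < k + 1) Δ₂ Y' ∧ Nonempty (F₁.obj Y ≃ₗ[B] F₂.obj Y')) →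
      ∃ X', StdFiltered (fun b => ρ b < k + 1) Δ₂ X' ∧ Nonempty (F₁.obj X ≃ₗ[B] F₂.obj X') := by
    intro U hU
    induction hU with
    | zero U hU =>
      rintro X Y f g hfg hY ⟨Y', hY', ⟨eY⟩⟩
      have hg : Function.Injective g := by
        rw [injective_iff_map_eq_zero]
        intro x hx
        obtain ⟨y, rfl⟩ := hfg.exists_of_apply_eq_zero hx
        rw [Subsingleton.elim y 0, map_zero]
      exact ⟨Y', hY', ⟨(mapEquiv F₁ (.ofBijective g ⟨hg, hfg.2.1⟩)).trans eY⟩⟩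
    | step V U a ha j q hjq hV ih =>
      intro X Y f g hfg hY hex
      obtain ⟨Z, f', π, g', hs₁, hs₂, -, -⟩ := exists_pushout_of_shortExact hjq hfg
      exact ih X Z _ π hs₂ (StdFiltered.extension hs₁ (.single ha.1) hY)
        (key a (by omega) Z Y f' g' hs₁ hY hex)
  intro X hX
  obtain ⟨U, L, f, g, hs, hU, hL⟩ := S.hw₁.exists_split k hX
  obtain ⟨L', hL', e⟩ := h₁₂ L (hL.mono fun b hb => hb.2)
  exact key' U hU X L f g hs (hL.mono fun b hb => hb.1)
    ⟨L', hL'.mono fun b hb => Nat.lt_succ_of_lt hb, e⟩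

theorem matches_all [IsNoetherianRing R] [Module.Finite R A₁] [Module.Finite R A₂]
    (S : Pairing R ρ Δ₁ P₁ F₁ X₁ Δ₂ P₂ F₂ X₂) (k : ℕ) :
    Matches ρ Δ₁ F₁ Δ₂ F₂ k ∧ Matches ρ Δ₂ F₂ Δ₁ F₁ k := by
  induction k with
  | zero =>
    exact ⟨matches_zero ρ Δ₁ Δ₂ S.quot₁.linear.1 S.quot₂.linear.1,
      matches_zero ρ Δ₂ Δ₁ S.quot₂.linear.1 S.quot₁.linear.1⟩
  | succ k ih => exact ⟨S.matches_succ ih.1 ih.2, S.symm.matches_succ ih.2 ih.1⟩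

end Pairing

end FockCat

/-! ### Projective generators and right adjoints of exact functors -/

namespace FockCat

section Generators

variable {A : Type u} [Ring A]

variable (A) in
/-- The regular module. -/
abbrev regObj : FGModuleCat.{u} A := FGModuleCat.of A A

/-- The morphism from the regular module defined by an element. -/
def evalAt {M : FGModuleCat.{u} A} (m : M) : regObj A →ₗ[A] M := LinearMap.toSpanSingleton A M m

theorem evalAt_apply {M : FGModuleCat.{u} A} (m : M) (a : A) :
    evalAt m (show regObj A from a) = a • m := rfl

theorem evalAt_one {M : FGModuleCat.{u} A} (m : M) : evalAt m (show regObj A from (1 : A)) = m :=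
  one_smul A m

theorem regObj_ext {M : FGModuleCat.{u} A} {f g : regObj A →ₗ[A] M}
    (h : f (show regObj A from (1 : A)) = g (show regObj A from (1 : A))) : f = g :=
  LinearMap.ext_ring h

theorem evalAt_of_apply_one {M : FGModuleCat.{u} A} (f : regObj A →ₗ[A] M) :
    evalAt (f (show regObj A from (1 : A))) = f := regObj_ext (evalAt_one _)

theorem comp_evalAt {M N : FGModuleCat.{u} A} (f : M →ₗ[A] N) (m : M) :
    f ∘ₗ evalAt m = evalAt (f m) := regObj_ext (by
  rw [LinearMap.comp_apply, evalAt_one, evalAt_one])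

theorem evalAt_add {M : FGModuleCat.{u} A} (m m' : M) : evalAt (m + m') = evalAt m + evalAt m' :=
  regObj_ext (by rw [LinearMap.add_apply, evalAt_one, evalAt_one, evalAt_one])

theorem evalAt_smul {M : FGModuleCat.{u} A} (a : A) (m : M) :
    evalAt (a • m) = evalAt m ∘ₗ evalAt (show regObj A from a) := regObj_ext (by
  rw [LinearMap.comp_apply, evalAt_one, evalAt_one, evalAt_apply])

theorem smul_evalAt {R : Type u} [CommRing R] [Algebra R A] (r : R) {M : FGModuleCat.{u} A} (m : M) :
    evalAt (r • m) = r • evalAt m := regObj_ext (by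
  rw [LinearMap.smul_apply, evalAt_one, evalAt_one])

theorem evalAt_injective {M : FGModuleCat.{u} A} {m m' : M} (h : evalAt m = evalAt m') : m = m' := by
  rw [← evalAt_one m, h, evalAt_one]

theorem generatedBy_of_fintype {ι : Type*} [Fintype ι] {X M : FGModuleCat.{u} A}
    (g : ι → (X →ₗ[A] M)) (h : ∀ m, ∃ x : ι → X, ∑ j, g j (x j) = m) : GeneratedBy X M := by
  obtain ⟨Q, i, p, hQ⟩ := exists_pow X (Fintype.card ι)
  let e := Fintype.equivFin ι
  refine ⟨_, Q, i, p, ∑ a, g (e.symm a) ∘ₗ p a, hQ, fun m => ?_⟩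
  obtain ⟨x, rfl⟩ := h m
  refine ⟨∑ a, i a (x (e.symm a)), ?_⟩
  rw [LinearMap.sum_apply, ← e.symm.sum_comp]
  refine Finset.sum_congr rfl fun a _ => ?_
  rw [LinearMap.comp_apply, hQ.sum_proj a fun a => x (e.symm a)]

theorem GeneratedBy.exists_sum {X M : FGModuleCat.{u} A} (h : GeneratedBy X M) :
    ∃ (n : ℕ) (g : Fin n → (X →ₗ[A] M)), ∀ m, ∃ x : Fin n → X, ∑ j, g j (x j) = m := by
  obtain ⟨n, Q, i, p, π, hQ, hπ⟩ := h
  refine ⟨n, fun a => π ∘ₗ i a, fun m => ?_⟩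
  obtain ⟨q, rfl⟩ := hπ m
  refine ⟨fun a => p a q, ?_⟩
  conv_rhs => rw [← hQ.sum_apply q, map_sum]
  rfl

theorem GeneratedBy.trans {X Y M : FGModuleCat.{u} A} (h : GeneratedBy X Y)
    (h' : GeneratedBy Y M) : GeneratedBy X M := by
  obtain ⟨n, f, hf⟩ := h.exists_sum
  obtain ⟨k, g, hg⟩ := h'.exists_sum
  refine generatedBy_of_fintype (ι := Fin k × Fin n) (fun c => g c.1 ∘ₗ f c.2) fun m => ?_
  obtain ⟨y, rfl⟩ := hg m
  choose x hx using fun j => hf (y j)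
  refine ⟨fun c => x c.1 c.2, ?_⟩
  rw [Fintype.sum_prod_type]
  refine Finset.sum_congr rfl fun j _ => ?_
  conv_rhs => rw [← hx j, map_sum]
  rfl

theorem generatedBy_regObj (M : FGModuleCat.{u} A) : GeneratedBy (regObj A) M := by
  obtain ⟨n, v, hv⟩ := Module.Finite.exists_fin (R := A) (M := M)
  refine generatedBy_of_fintype (fun j => evalAt (v j)) fun m => ?_
  have hm : m ∈ Submodule.span A (Set.range v) := hv ▸ Submodule.mem_top
  obtain ⟨c, hc⟩ := (Submodule.mem_span_range_iff_exists_fun A).mp hm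
  exact ⟨c, hc⟩

variable {B : Type u} [Ring B] {F : FGModuleCat.{u} A ⥤ FGModuleCat.{u} B}

theorem GeneratedBy.hom_ext [IsNoetherianRing A] {Y M : FGModuleCat.{u} A} (hg : GeneratedBy Y M)
    (hE : IsExactFunctor F) (hF : F.Additive) {V : FGModuleCat.{u} B} {φ ψ : F.obj M →ₗ[B] V}
    (h : ∀ g : Y →ₗ[A] M, φ ∘ₗ mapL F g = ψ ∘ₗ mapL F g) : φ = ψ := by
  obtain ⟨n, Q, i, p, π, hQ, hπ⟩ := hg
  refine comp_right_cancel (hE.surjective hπ) ?_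
  rw [← LinearMap.comp_id (φ ∘ₗ mapL F π), ← LinearMap.comp_id (ψ ∘ₗ mapL F π),
    ← (hQ.mapL hF).sum_eq, comp_sum, comp_sum]
  refine Finset.sum_congr rfl fun a _ => ?_
  have h' := h (π ∘ₗ i a)
  rw [mapL_comp, ← LinearMap.comp_assoc, ← LinearMap.comp_assoc] at h'
  rw [← LinearMap.comp_assoc, ← LinearMap.comp_assoc, h']

/-- A compatible family of morphisms indexed by `Hom(Y, M)`, where `Y` is a projective generator,
comes from a morphism. -/
theorem exists_hom_of_compatible [IsNoetherianRing A] {Y : FGModuleCat.{u} A}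
    [Module.Projective A Y] (hg : ∀ M, GeneratedBy Y M) (hE : IsExactFunctor F) (hF : F.Additive)
    {M : FGModuleCat.{u} A} {V : FGModuleCat.{u} B} (h : (Y →ₗ[A] M) →+ (F.obj Y →ₗ[B] V))
    (hh : ∀ g (e : Y →ₗ[A] Y), h (g ∘ₗ e) = h g ∘ₗ mapL F e) :
    ∃ φ : F.obj M →ₗ[B] V, ∀ g, φ ∘ₗ mapL F g = h g := by
  obtain ⟨n, Q, i, p, π, hQ, hπ⟩ := hg M
  obtain ⟨K, k, hs⟩ := exists_kernel_of_surjective π hπ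
  set ψ : F.obj Q →ₗ[B] V := ∑ a, h (π ∘ₗ i a) ∘ₗ mapL F (p a) with hψ
  have hψg : ∀ g : Y →ₗ[A] Q, ψ ∘ₗ mapL F g = h (π ∘ₗ g) := fun g => by
    have h1 : g = ∑ a, i a ∘ₗ p a ∘ₗ g := by
      have h2 := sum_comp Finset.univ (fun a => i a ∘ₗ p a) g
      rw [hQ.sum_eq, LinearMap.id_comp] at h2
      exact h2
    conv_rhs => rw [h1, comp_sum, map_sum]
    rw [hψ, sum_comp]
    refine Finset.sum_congr rfl fun a _ => ?_
    rw [LinearMap.comp_assoc, ← mapL_comp, ← LinearMap.comp_assoc, hh]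
  -- The kernel `K` is itself generated by `Y`, so vanishing can be tested on maps `Y → K`, where
  -- compatibility gives `h 0 = 0`.
  have hψk : ψ ∘ₗ mapL F k = 0 := by
    refine (hg K).hom_ext hE hF fun g => ?_
    rw [LinearMap.comp_assoc, ← mapL_comp, hψg, ← LinearMap.comp_assoc, hs.comp_eq_zero,
      LinearMap.zero_comp, LinearMap.zero_comp, map_zero]
  obtain ⟨φ, hφ⟩ := (hE hs).exists_desc ψ hψk
  refine ⟨φ, fun g => ?_⟩
  obtain ⟨g', rfl⟩ := Module.projective_lifting_property π g hπ
  rw [mapL_comp, ← LinearMap.comp_assoc, hφ, hψg]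

end Generators

section HomFunctors

variable (R : Type u) [CommRing R] [IsNoetherianRing R] {A C : Type u} [Ring A] [Ring C]
  [Algebra R A] [Algebra R C] [Module.Finite R A]

/-- The functor `Hom(P, -)`, with values in the category of modules over an algebra acting on `P`
from the right. -/
noncomputable def homRes (P : FGModuleCat.{u} A) (θ : C →ₐ[R] (Module.End A P)ᵐᵒᵖ) :
    FGModuleCat.{u} A ⥤ FGModuleCat.{u} C :=
  homFunctor R P ⋙ restrictFG R θ

variable {R} {P : FGModuleCat.{u} A} (θ : C →ₐ[R] (Module.End A P)ᵐᵒᵖ)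

/-- The identification of `(homRes R P θ).obj V` with `Hom(P, V)`. -/
noncomputable def homResEquiv (V : FGModuleCat.{u} A) : (homRes R P θ).obj V ≃+ (P →ₗ[A] V) :=
  AddEquiv.refl (P →ₗ[A] V)

variable {θ}

theorem homResEquiv_smul {V : FGModuleCat.{u} A} (c : C) (g : (homRes R P θ).obj V) :
    homResEquiv θ V (c • g) = homResEquiv θ V g ∘ₗ (θ c).unop := rfl

theorem homResEquiv_smul_base {V : FGModuleCat.{u} A} (r : R) (g : (homRes R P θ).obj V) :
    homResEquiv θ V (r • g) = r • homResEquiv θ V g := by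
  have h : r • g = algebraMap R C r • g := (algebraMap_smul C r g).symm
  rw [h, homResEquiv_smul, AlgHom.commutes]
  ext x
  change homResEquiv θ V g (r • x) = _
  rw [LinearMap.map_smul_of_tower]
  rfl

theorem homRes_linear : IsLinearFunctor R (homRes R P θ) := by
  refine ⟨⟨fun {V W f g} => ?_⟩, fun r V => ?_⟩
  · ext x
    apply (homResEquiv θ W).injective
    exact LinearMap.add_comp _ _ _
  · ext x
    apply (homResEquiv θ V).injective
    refine Eq.trans ?_ (homResEquiv_smul_base r x).symm
    exact LinearMap.smul_comp _ _ _

theorem homRes_exact [Module.Projective A P] : IsExactFunctor (homRes R P θ) := by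
  intro V' V V'' f g hs
  refine isShortExact_of (fun x y h => ?_) (fun y => ?_) (fun x => ?_) fun x hx => ?_
  · exact (homResEquiv θ V').injective (comp_left_cancel hs.1 h)
  · obtain ⟨k, hk⟩ := Module.projective_lifting_property g (homResEquiv θ V'' y) hs.2.1
    exact ⟨(homResEquiv θ V).symm k, hk⟩
  · exact LinearMap.ext fun y => hs.apply_eq_zero _
  · obtain ⟨k, hk⟩ := hs.exists_lift (homResEquiv θ V x) hx
    exact ⟨(homResEquiv θ V').symm k, hk⟩

/-- An algebra homomorphism to the opposite of an endomorphism algebra. -/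
noncomputable def algHomOfRightAction (y : C → Module.End A P) (h_one : y 1 = LinearMap.id)
    (h_mul : ∀ a b, y (a * b) = y b ∘ₗ y a) (h_add : ∀ a b, y (a + b) = y a + y b)
    (h_smul : ∀ (r : R) a, y (r • a) = r • y a) : C →ₐ[R] (Module.End A P)ᵐᵒᵖ :=
  AlgHom.ofLinearMap
    { toFun := fun a => MulOpposite.op (y a)
      map_add' := fun a b => congrArg MulOpposite.op (h_add a b)
      map_smul' := fun r a => congrArg MulOpposite.op (h_smul r a) }
    (congrArg MulOpposite.op h_one) fun a b => congrArg MulOpposite.op (h_mul a b)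

end HomFunctors

section Adjoint

variable {R : Type u} [CommRing R] [IsNoetherianRing R] {A B : Type u} [Ring A] [Ring B]
  [Algebra R A] [Algebra R B] [Module.Finite R A] [Module.Finite R B]
  {F : FGModuleCat.{u} A ⥤ FGModuleCat.{u} B}

/-- The right action of `A` on the image of the regular module. -/
noncomputable def regAction (hF : IsLinearFunctor R F) : A →ₐ[R] (Module.End B (F.obj (regObj A)))ᵐᵒᵖ :=
  algHomOfRightAction (fun a => mapL F (evalAt (show regObj A from a)))
    (by
      rw [← mapL_id]
      exact congrArg _ (regObj_ext (evalAt_one _)))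
    (fun a b => by
      rw [← mapL_comp]
      exact congrArg _ (evalAt_smul a (show regObj A from b)))
    (fun a b => by
      rw [← mapL_add hF.1]
      exact congrArg _ (evalAt_add (show regObj A from a) b))
    (fun r a => by
      rw [← mapL_smul hF]
      refine congrArg _ ?_
      rw [Algebra.smul_def]
      exact smul_evalAt r (show regObj A from a))

variable [IsNoetherianRing A]

/-- The right adjoint of an exact functor. -/
noncomputable abbrev rightAdj (hF : IsLinearFunctor R F) : FGModuleCat.{u} B ⥤ FGModuleCat.{u} A :=
  homRes R (F.obj (regObj A)) (regAction hF)

theorem exists_adj_desc (hF : IsLinearFunctor R F) (hE : IsExactFunctor F) {M : FGModuleCat.{u} A}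
    {V : FGModuleCat.{u} B} (k : M →ₗ[A] (rightAdj hF).obj V) :
    ∃ φ : F.obj M →ₗ[B] V, ∀ m, φ ∘ₗ mapL F (evalAt m) = homResEquiv (regAction hF) V (k m) := by
  have : Module.Projective A (regObj A) := inferInstanceAs (Module.Projective A A)
  obtain ⟨φ, hφ⟩ := exists_hom_of_compatible (F := F) generatedBy_regObj hE hF.1 (M := M) (V := V)
    { toFun := fun g => homResEquiv (regAction hF) V (k (g (show regObj A from (1 : A))))
      map_zero' := by
        rw [LinearMap.zero_apply, map_zero]
        exact map_zero (homResEquiv (regAction hF) V)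
      map_add' := fun g g' => by rw [LinearMap.add_apply, map_add, map_add] }
    (fun g e => by
      have h1 : e (show regObj A from (1 : A)) =
        (show A from e (show regObj A from (1 : A))) • (show regObj A from (1 : A)) :=
        (mul_one (M := A) _).symm
      change homResEquiv (regAction hF) V (k (g (e _))) = _
      rw [h1, map_smul, map_smul, homResEquiv_smul]
      change _ ∘ₗ mapL F (evalAt (e _)) = _ ∘ₗ mapL F e
      rw [evalAt_of_apply_one]
      rfl)
  exact ⟨φ, fun m => (hφ _).trans (congrArg (fun m => homResEquiv (regAction hF) V (k m))
    (evalAt_one m))⟩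

/-- The morphism to the right adjoint corresponding to a morphism. -/
noncomputable def adjLift (hF : IsLinearFunctor R F) {M : FGModuleCat.{u} A}
    {V : FGModuleCat.{u} B} (φ : F.obj M →ₗ[B] V) : M →ₗ[A] (rightAdj hF).obj V where
  toFun := fun m => (homResEquiv (regAction hF) V).symm (φ ∘ₗ mapL F (evalAt m))
  map_add' := fun m m' => by
    rw [evalAt_add, mapL_add hF.1, LinearMap.comp_add, map_add]
  map_smul' := fun a m => by
    rw [evalAt_smul, mapL_comp]
    rfl

/-- A linear map, as a morphism. -/
def toHom {C : Type u} [Ring C] {M N : FGModuleCat.{u} C} (f : M →ₗ[C] N) : M ⟶ N :=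
  FGModuleCat.ofHom f

/-- Exact functors between categories of finitely generated modules have right adjoints. -/
noncomputable def rightAdjunction (hF : IsLinearFunctor R F) (hE : IsExactFunctor F) :
    F ⊣ rightAdj hF :=
  Adjunction.mkOfHomEquiv
    { homEquiv := fun M V =>
        { toFun := fun φ => toHom (adjLift hF φ.hom.hom)
          invFun := fun k => toHom (exists_adj_desc hF hE k.hom.hom).choose
          left_inv := fun φ => by
            have h : (exists_adj_desc hF hE (adjLift hF φ.hom.hom)).choose = φ.hom.hom := by
              refine (generatedBy_regObj M).hom_ext hE hF.1 fun g => ?_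
              rw [← evalAt_of_apply_one g]
              exact (exists_adj_desc hF hE _).choose_spec _
            exact congrArg toHom h
          right_inv := fun k => by
            have h : adjLift hF (exists_adj_desc hF hE k.hom.hom).choose = k.hom.hom :=
              LinearMap.ext fun m => (exists_adj_desc hF hE k.hom.hom).choose_spec m
            exact congrArg toHom h }
      homEquiv_naturality_left_symm := fun {M' M V} f k => by
        have h : (exists_adj_desc hF hE (k.hom.hom ∘ₗ f.hom.hom)).choose =
            (exists_adj_desc hF hE k.hom.hom).choose ∘ₗ mapL F f.hom.hom := by
          refine (generatedBy_regObj M').hom_ext hE hF.1 fun g => ?_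
          rw [← evalAt_of_apply_one g]
          refine ((exists_adj_desc hF hE _).choose_spec _).trans ?_
          rw [LinearMap.comp_assoc, ← mapL_comp, comp_evalAt]
          exact ((exists_adj_desc hF hE k.hom.hom).choose_spec _).symm
        exact congrArg toHom h
      homEquiv_naturality_right := fun {M V V'} φ f => by
        have h : adjLift hF (f.hom.hom ∘ₗ φ.hom.hom) =
            mapL (rightAdj hF) f.hom.hom ∘ₗ adjLift hF φ.hom.hom := LinearMap.ext fun m => rfl
        exact congrArg toHom h }

/-- With `Hom(A, M) = M`, the unit is the action of `F` on morphisms out of the regular module. This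
is what relates it to full faithfulness. -/
theorem rightAdjunction_unit (hF : IsLinearFunctor R F) (hE : IsExactFunctor F)
    (M : FGModuleCat.{u} A) (m : M) :
    homResEquiv (regAction hF) (F.obj M) (((rightAdjunction hF hE).unit.app M).hom.hom m) =
      mapL F (evalAt m) := by
  rw [rightAdjunction, Adjunction.mkOfHomEquiv_unit_app]
  exact LinearMap.id_comp (mapL F (evalAt m))

end Adjoint

end FockCat

/-! ### The counterpart of the regular module and Morita theory -/

namespace FockCat

/-- A projective generator `Y` whose image under `F₂` is identified with the image of the regular
module under `F₁`, in such a way that `y` identifies the endomorphism rings. -/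
structure IsProgenerator {A₁ A₂ B : Type u} [Ring A₁] [Ring A₂] [Ring B]
    (F₁ : FGModuleCat.{u} A₁ ⥤ FGModuleCat.{u} B) (F₂ : FGModuleCat.{u} A₂ ⥤ FGModuleCat.{u} B)
    {Y : FGModuleCat.{u} A₂} (e : F₁.obj (regObj A₁) ≃ₗ[B] F₂.obj Y) (y : A₁ → (Y →ₗ[A₂] Y)) :
    Prop where
  projective : Module.Projective A₂ Y
  generates : ∀ V, GeneratedBy Y V
  comm : ∀ a, mapL F₂ (y a) ∘ₗ e.toLinearMap =
    e.toLinearMap ∘ₗ mapL F₁ (evalAt (show regObj A₁ from a))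
  hom_ext : ∀ {f g : Y →ₗ[A₂] Y}, mapL F₂ f = mapL F₂ g → f = g
  injective : Function.Injective y
  surjective : ∀ f, ∃ a, y a = f

namespace Pairing

variable {R : Type u} [CommRing R] {A₁ A₂ B : Type u} [Ring A₁] [Ring A₂] [Ring B]
  [Algebra R A₁] [Algebra R A₂] [Algebra R B] {Λ : Type} {ρ : Λ → ℕ}
  {Δ₁ P₁ : Λ → FGModuleCat.{u} A₁} {Δ₂ P₂ : Λ → FGModuleCat.{u} A₂}
  {F₁ : FGModuleCat.{u} A₁ ⥤ FGModuleCat.{u} B} {F₂ : FGModuleCat.{u} A₂ ⥤ FGModuleCat.{u} B}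
  {X₁ : FGModuleCat.{u} A₁} {X₂ : FGModuleCat.{u} A₂}
  [IsNoetherianRing A₁] [IsNoetherianRing A₂] [IsLocalRing R] [Finite Λ]

theorem exists_match [IsNoetherianRing R] [Module.Finite R A₁] [Module.Finite R A₂]
    (S : Pairing R ρ Δ₁ P₁ F₁ X₁ Δ₂ P₂ F₂ X₂) {M : FGModuleCat.{u} A₁} (hM : stdFiltered Δ₁ M) :
    ∃ M' : FGModuleCat.{u} A₂, stdFiltered Δ₂ M' ∧ Nonempty (F₁.obj M ≃ₗ[B] F₂.obj M') := by
  obtain ⟨k, hk⟩ := RankedHW.exists_bound ρ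
  obtain ⟨M', hM', h⟩ := (S.matches_all k).1 M (hM.mono fun a _ => hk a)
  exact ⟨M', hM'.mono fun _ _ => trivial, h⟩

theorem surjective_of_surjective (S : Pairing R ρ Δ₁ P₁ F₁ X₁ Δ₂ P₂ F₂ X₂)
    {M N : FGModuleCat.{u} A₁} {g : M →ₗ[A₁] N} (hM : stdFiltered Δ₁ M) (hN : stdFiltered Δ₁ N)
    (hg : Function.Surjective g) {M' N' : FGModuleCat.{u} A₂} {h : M' →ₗ[A₂] N'}
    (hM' : stdFiltered Δ₂ M') (hN' : stdFiltered Δ₂ N') (eM : F₁.obj M ≃ₗ[B] F₂.obj M')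
    (eN : F₁.obj N ≃ₗ[B] F₂.obj N')
    (hh : mapL F₂ h ∘ₗ eM.toLinearMap = eN.toLinearMap ∘ₗ mapL F₁ g) : Function.Surjective h := by
  obtain ⟨k, hk⟩ := RankedHW.exists_bound ρ
  exact S.surjective_aux k (hM.mono fun a _ => hk a) (hN.mono fun a _ => hk a) hg hM' hN' eM eN hh

/-- A filtered projective cover of `Y` becomes a surjection onto the projective `M`. It splits
there, and the section is transported back to split the cover of `Y`. -/
theorem projective_of_projective [IsNoetherianRing R] [Module.Finite R A₁] [Module.Finite R A₂]
    (S : Pairing R ρ Δ₁ P₁ F₁ X₁ Δ₂ P₂ F₂ X₂) {M : FGModuleCat.{u} A₁} [Module.Projective A₁ M]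
    {Y : FGModuleCat.{u} A₂} (hY : stdFiltered Δ₂ Y) (e : F₁.obj M ≃ₗ[B] F₂.obj Y) :
    Module.Projective A₂ Y := by
  have hM := S.hw₁.filt_of_projective M
  obtain ⟨Q, π, hQp, hQ, hπ⟩ := S.hw₂.exists_cover Y
  obtain ⟨Q₁, hQ₁, ⟨eQ⟩⟩ := S.symm.exists_match hQ
  obtain ⟨π₁, hπ₁⟩ := S.symm.exists_map hQ₁ hM eQ e.symm π
  have hs := S.symm.surjective_of_surjective hQ hY hπ hQ₁ hM eQ e.symm hπ₁
  obtain ⟨t, ht⟩ := Module.projective_lifting_property π₁ LinearMap.id hs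
  obtain ⟨t', ht'⟩ := S.exists_map hY hQ e eQ.symm t
  refine Module.Projective.of_split t' π (S.map_ext hY hY e ?_)
  have h1 : mapL F₂ π ∘ₗ eQ.symm.toLinearMap = e.toLinearMap ∘ₗ mapL F₁ π₁ := by
    refine LinearMap.ext fun x => ?_
    have h2 := LinearMap.congr_fun hπ₁ (eQ.symm x)
    simp only [LinearMap.comp_apply, LinearEquiv.coe_coe, LinearEquiv.apply_symm_apply] at h2 ⊢
    rw [h2, LinearEquiv.apply_symm_apply]
  rw [mapL_comp, LinearMap.comp_assoc, ht', ← LinearMap.comp_assoc, h1, LinearMap.comp_assoc,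
    ← mapL_comp, ht, mapL_id, mapL_id, LinearMap.comp_id, LinearMap.id_comp]

/-- It suffices to generate the regular module of the second category. Its counterpart is a quotient
of a power of `A₁`, and this surjection is transported to one from a power of `Y`. -/
theorem generatedBy_of_regObj [IsNoetherianRing R] [Module.Finite R A₁] [Module.Finite R A₂]
    (S : Pairing R ρ Δ₁ P₁ F₁ X₁ Δ₂ P₂ F₂ X₂)
    {Y : FGModuleCat.{u} A₂} (hY : stdFiltered Δ₂ Y) (e : F₁.obj (regObj A₁) ≃ₗ[B] F₂.obj Y)
    (V : FGModuleCat.{u} A₂) : GeneratedBy Y V := by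
  have : Module.Projective A₁ (regObj A₁) := inferInstanceAs (Module.Projective A₁ A₁)
  have : Module.Projective A₂ (regObj A₂) := inferInstanceAs (Module.Projective A₂ A₂)
  have hA₁ := S.hw₁.filt_of_projective (regObj A₁)
  have hA₂ := S.hw₂.filt_of_projective (regObj A₂)
  refine GeneratedBy.trans ?_ (generatedBy_regObj V)
  obtain ⟨V₁, hV₁, ⟨eV⟩⟩ := S.symm.exists_match hA₂
  obtain ⟨n, Q, i, p, π, hQ, hπ⟩ := generatedBy_regObj V₁
  obtain ⟨Q', i', p', hQ'⟩ := exists_pow Y n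
  obtain ⟨eQ⟩ := (hQ.mapL S.quot₁.linear.1).exists_equiv (hQ'.mapL S.quot₂.linear.1) e
  have hQf : stdFiltered Δ₁ Q := StdFiltered.pow hA₁ n i p hQ
  have hQf' : stdFiltered Δ₂ Q' := StdFiltered.pow hY n i' p' hQ'
  obtain ⟨π', hπ'⟩ := S.exists_map hQf' hA₂ eQ eV.symm π
  exact ⟨n, Q', i', p', π', hQ', S.surjective_of_surjective hQf hV₁ hπ hQf' hA₂ eQ eV.symm hπ'⟩

/-- `Y` is the object matched with the regular module of `A₁`. Full faithfulness on both sides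
identifies `End(Y)` with the endomorphisms of the regular module, that is, with `A₁` acting from the
right. -/
theorem exists_isProgenerator [IsNoetherianRing R] [Module.Finite R A₁] [Module.Finite R A₂]
    (S : Pairing R ρ Δ₁ P₁ F₁ X₁ Δ₂ P₂ F₂ X₂) :
    ∃ (Y : FGModuleCat.{u} A₂) (e : F₁.obj (regObj A₁) ≃ₗ[B] F₂.obj Y) (y : A₁ → (Y →ₗ[A₂] Y)),
      stdFiltered Δ₂ Y ∧ IsProgenerator F₁ F₂ e y := by
  have : Module.Projective A₁ (regObj A₁) := inferInstanceAs (Module.Projective A₁ A₁)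
  have hA₁ := S.hw₁.filt_of_projective (regObj A₁)
  obtain ⟨Y, hY, ⟨e⟩⟩ := S.exists_match hA₁
  choose y hy using fun a : A₁ => S.exists_map hY hY e e (evalAt (show regObj A₁ from a))
  refine ⟨Y, e, y, hY, S.projective_of_projective hY e, S.generatedBy_of_regObj hY e, hy,
    S.quot₂.faithful hY hY, fun a b hab => ?_, fun f => ?_⟩
  · refine evalAt_injective (S.map_ext_back hA₁ hA₁ e ?_)
    rw [← hy, ← hy, hab]
  · obtain ⟨f', hf'⟩ := S.exists_map_back hA₁ hA₁ e e f
    refine ⟨f' (show regObj A₁ from (1 : A₁)), S.map_ext hY hY e ?_⟩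
    rw [hy, evalAt_of_apply_one, hf']

end Pairing

theorem exists_equiv_of_ker_eq {A M N N' : Type*} [Ring A] [AddCommGroup M] [Module A M]
    [AddCommGroup N] [Module A N] [AddCommGroup N'] [Module A N'] {f : M →ₗ[A] N}
    {g : M →ₗ[A] N'} (hf : Function.Surjective f) (hg : Function.Surjective g)
    (h : ∀ x, f x = 0 ↔ g x = 0) : Nonempty (N ≃ₗ[A] N') :=
  ⟨(f.quotKerEquivOfSurjective hf).symm.trans
    ((Submodule.quotEquivOfEq _ _ (Submodule.ext h)).trans (g.quotKerEquivOfSurjective hg))⟩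

namespace IsProgenerator

section Action

variable {R : Type u} [CommRing R] {A₁ A₂ B : Type u} [Ring A₁] [Ring A₂]
  [Ring B] [Algebra R A₁] [Algebra R A₂] [Algebra R B]
  {F₁ : FGModuleCat.{u} A₁ ⥤ FGModuleCat.{u} B} {F₂ : FGModuleCat.{u} A₂ ⥤ FGModuleCat.{u} B}
  {Y : FGModuleCat.{u} A₂} {e : F₁.obj (regObj A₁) ≃ₗ[B] F₂.obj Y} {y : A₁ → (Y →ₗ[A₂] Y)}

theorem ext_of_comm (D : IsProgenerator F₁ F₂ e y) {a : A₁} {f : Y →ₗ[A₂] Y}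
    (h : mapL F₂ f ∘ₗ e.toLinearMap =
      e.toLinearMap ∘ₗ mapL F₁ (evalAt (show regObj A₁ from a))) : y a = f :=
  D.hom_ext (comp_right_cancel e.surjective ((D.comm a).trans h.symm))

theorem mul (D : IsProgenerator F₁ F₂ e y) (a b : A₁) : y (a * b) = y b ∘ₗ y a :=
  D.ext_of_comm (by
    rw [mapL_comp, LinearMap.comp_assoc, D.comm, ← LinearMap.comp_assoc, D.comm,
      LinearMap.comp_assoc, ← mapL_comp]
    exact congrArg (fun f => e.toLinearMap ∘ₗ mapL F₁ f)
      (evalAt_smul a (show regObj A₁ from b)).symm)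

theorem add (D : IsProgenerator F₁ F₂ e y) (hF₁ : F₁.Additive) (hF₂ : F₂.Additive) (a b : A₁) :
    y (a + b) = y a + y b :=
  D.ext_of_comm (by
    rw [mapL_add hF₂, LinearMap.add_comp, D.comm, D.comm, ← LinearMap.comp_add, ← mapL_add hF₁]
    exact congrArg (fun f => e.toLinearMap ∘ₗ mapL F₁ f)
      (evalAt_add (show regObj A₁ from a) (show regObj A₁ from b)).symm)

/-- The right action of `A₁` on `Y`. -/
noncomputable def action (D : IsProgenerator F₁ F₂ e y) (hF₁ : IsLinearFunctor R F₁)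
    (hF₂ : IsLinearFunctor R F₂) : A₁ →ₐ[R] (Module.End A₂ Y)ᵐᵒᵖ :=
  algHomOfRightAction y
    (D.ext_of_comm (by
      rw [mapL_id, LinearMap.id_comp]
      have h : evalAt (show regObj A₁ from (1 : A₁)) = LinearMap.id := regObj_ext (evalAt_one _)
      rw [h, mapL_id, LinearMap.comp_id]))
    D.mul (D.add hF₁.1 hF₂.1)
    (fun r a => D.ext_of_comm (by
      rw [mapL_smul hF₂, LinearMap.smul_comp, D.comm, Algebra.smul_def]
      have h := congrArg (mapL F₁) (smul_evalAt r (show regObj A₁ from a))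
      rw [mapL_smul hF₁] at h
      exact (LinearMap.comp_smul _ _ _).symm.trans
        (congrArg (fun f => e.toLinearMap ∘ₗ f) h.symm)))

end Action

section Functor

variable {R : Type u} [CommRing R] [IsNoetherianRing R] {A₁ A₂ B : Type u} [Ring A₁] [Ring A₂]
  [Ring B] [Algebra R A₁] [Algebra R A₂] [Algebra R B] [Module.Finite R A₁] [Module.Finite R A₂]
  [IsNoetherianRing A₁] [IsNoetherianRing A₂]
  {F₁ : FGModuleCat.{u} A₁ ⥤ FGModuleCat.{u} B} {F₂ : FGModuleCat.{u} A₂ ⥤ FGModuleCat.{u} B}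
  {Y : FGModuleCat.{u} A₂} {e : F₁.obj (regObj A₁) ≃ₗ[B] F₂.obj Y} {y : A₁ → (Y →ₗ[A₂] Y)}
  (D : IsProgenerator F₁ F₂ e y) (hF₁ : IsLinearFunctor R F₁) (hF₂ : IsLinearFunctor R F₂)

/-- The Morita functor defined by a projective generator. -/
noncomputable abbrev morita : FGModuleCat.{u} A₂ ⥤ FGModuleCat.{u} A₁ :=
  homRes R Y (D.action hF₁ hF₂)

/-- The identification of the value of the Morita functor with a module of homomorphisms. -/
noncomputable abbrev moritaEquiv (V : FGModuleCat.{u} A₂) :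
    (D.morita hF₁ hF₂).obj V ≃+ (Y →ₗ[A₂] V) := homResEquiv (D.action hF₁ hF₂) V

theorem moritaEquiv_smul {V : FGModuleCat.{u} A₂} (a : A₁) (g : (D.morita hF₁ hF₂).obj V) :
    D.moritaEquiv hF₁ hF₂ V (a • g) = D.moritaEquiv hF₁ hF₂ V g ∘ₗ y a := rfl

theorem exists_map_morita {V W : FGModuleCat.{u} A₂}
    (k : (D.morita hF₁ hF₂).obj V →ₗ[A₁] (D.morita hF₁ hF₂).obj W) :
    ∃ φ : V →ₗ[A₂] W, mapL (D.morita hF₁ hF₂) φ = k := by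
  have := D.projective
  obtain ⟨φ, hφ⟩ := exists_hom_of_compatible (F := 𝟭 _) D.generates (fun _ _ _ _ _ h => h)
    inferInstance (M := V) (V := W)
    { toFun := fun g => D.moritaEquiv hF₁ hF₂ W (k ((D.moritaEquiv hF₁ hF₂ V).symm g))
      map_zero' := by simp only [map_zero]
      map_add' := fun g g' => by simp only [map_add] }
    (fun g f => by
      obtain ⟨a, rfl⟩ := D.surjective f
      change D.moritaEquiv hF₁ hF₂ W (k (a • (D.moritaEquiv hF₁ hF₂ V).symm g)) = _
      rw [map_smul, moritaEquiv_smul]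
      rfl)
  refine ⟨φ, LinearMap.ext fun g => (D.moritaEquiv hF₁ hF₂ W).injective ?_⟩
  exact hφ (D.moritaEquiv hF₁ hF₂ V g)

theorem map_morita_injective {V W : FGModuleCat.{u} A₂} {φ ψ : V →ₗ[A₂] W}
    (h : mapL (D.morita hF₁ hF₂) φ = mapL (D.morita hF₁ hF₂) ψ) : φ = ψ := by
  refine (D.generates V).hom_ext (F := 𝟭 _) (fun _ _ _ _ _ h => h) inferInstance fun g => ?_
  exact LinearMap.congr_fun h ((D.moritaEquiv hF₁ hF₂ V).symm g)

/-- An object matched with `M'` under `F₁` and `F₂` is the image of `M'` under the Morita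
functor. -/
theorem exists_equiv_morita {M : FGModuleCat.{u} A₁} {M' : FGModuleCat.{u} A₂}
    (eM : F₁.obj M ≃ₗ[B] F₂.obj M')
    (hfull : ∀ f : regObj A₁ →ₗ[A₁] M, ∃ f' : Y →ₗ[A₂] M',
      mapL F₂ f' ∘ₗ e.toLinearMap = eM.toLinearMap ∘ₗ mapL F₁ f)
    (hfull' : ∀ f' : Y →ₗ[A₂] M', ∃ f : regObj A₁ →ₗ[A₁] M,
      mapL F₂ f' ∘ₗ e.toLinearMap = eM.toLinearMap ∘ₗ mapL F₁ f)
    (hext : ∀ f g : Y →ₗ[A₂] M', mapL F₂ f = mapL F₂ g → f = g)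
    (hext' : ∀ f g : regObj A₁ →ₗ[A₁] M, mapL F₁ f = mapL F₁ g → f = g) :
    Nonempty (M ≃ₗ[A₁] (D.morita hF₁ hF₂).obj M') := by
  choose k hk using fun x : M => hfull (evalAt x)
  have hext₂ : ∀ {f g : Y →ₗ[A₂] M'},
      mapL F₂ f ∘ₗ e.toLinearMap = mapL F₂ g ∘ₗ e.toLinearMap → f = g := fun {f g} h =>
    hext f g (comp_right_cancel e.surjective h)
  let K : M →ₗ[A₁] (D.morita hF₁ hF₂).obj M' :=
    { toFun := fun x => (D.moritaEquiv hF₁ hF₂ M').symm (k x)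
      map_add' := fun x x' => (D.moritaEquiv hF₁ hF₂ M').injective (by
        rw [map_add, AddEquiv.apply_symm_apply, AddEquiv.apply_symm_apply,
          AddEquiv.apply_symm_apply]
        apply hext₂
        rw [hk, evalAt_add, mapL_add hF₁.1, mapL_add hF₂.1, LinearMap.comp_add,
          LinearMap.add_comp, hk, hk])
      map_smul' := fun a x => (D.moritaEquiv hF₁ hF₂ M').injective (by
        rw [RingHom.id_apply, moritaEquiv_smul, AddEquiv.apply_symm_apply,
          AddEquiv.apply_symm_apply]
        apply hext₂
        rw [hk, evalAt_smul, mapL_comp, mapL_comp, LinearMap.comp_assoc, D.comm,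
          ← LinearMap.comp_assoc, ← LinearMap.comp_assoc, hk]) }
  refine ⟨LinearEquiv.ofBijective K ⟨fun x x' h => ?_, fun g => ?_⟩⟩
  · have h1 : k x = k x' := (D.moritaEquiv hF₁ hF₂ M').symm.injective h
    refine evalAt_injective (hext' _ _ (comp_left_cancel eM.injective ?_))
    rw [← hk, ← hk, h1]
  · obtain ⟨f, hf⟩ := hfull' (D.moritaEquiv hF₁ hF₂ M' g)
    refine ⟨f (show regObj A₁ from (1 : A₁)), (D.moritaEquiv hF₁ hF₂ M').injective ?_⟩
    refine ((D.moritaEquiv hF₁ hF₂ M').apply_symm_apply _).trans (hext₂ ?_)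
    rw [hk, evalAt_of_apply_one, hf]

/-- The Morita functor sends `Y` to the regular module, so by fullness it attains every map between
free modules, and by exactness every cokernel of such a map. -/
theorem exists_equiv_morita_obj (M : FGModuleCat.{u} A₁) :
    ∃ V : FGModuleCat.{u} A₂, Nonempty ((D.morita hF₁ hF₂).obj V ≃ₗ[A₁] M) := by
  have := D.projective
  have hE : IsExactFunctor (D.morita hF₁ hF₂) := homRes_exact
  have hL : IsLinearFunctor R (D.morita hF₁ hF₂) := homRes_linear
  obtain ⟨e₀⟩ : Nonempty (regObj A₁ ≃ₗ[A₁] (D.morita hF₁ hF₂).obj Y) := by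
    refine ⟨LinearEquiv.ofBijective
      { toFun := fun a : A₁ => (D.moritaEquiv hF₁ hF₂ Y).symm (y a)
        map_add' := fun a b => congrArg (D.moritaEquiv hF₁ hF₂ Y).symm (D.add hF₁.1 hF₂.1 a b)
        map_smul' := fun a b => congrArg (D.moritaEquiv hF₁ hF₂ Y).symm (D.mul a b) }
      ⟨fun a b h => D.injective ((D.moritaEquiv hF₁ hF₂ Y).symm.injective h), fun g => ?_⟩⟩
    obtain ⟨a, ha⟩ := D.surjective (D.moritaEquiv hF₁ hF₂ Y g)
    exact ⟨a, congrArg (D.moritaEquiv hF₁ hF₂ Y).symm ha⟩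
  obtain ⟨n, Q, i, p, π, hQ, hπ⟩ := generatedBy_regObj M
  obtain ⟨K, k, hs⟩ := exists_kernel_of_surjective π hπ
  obtain ⟨m, Q', i', p', π', hQ', hπ'⟩ := generatedBy_regObj K
  obtain ⟨W, iW, pW, hW⟩ := exists_pow Y n
  obtain ⟨W', iW', pW', hW'⟩ := exists_pow Y m
  obtain ⟨eQ⟩ := hQ.exists_equiv (hW.mapL hL.1) e₀
  obtain ⟨eQ'⟩ := hQ'.exists_equiv (hW'.mapL hL.1) e₀
  obtain ⟨f, hf⟩ := D.exists_map_morita hF₁ hF₂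
    (eQ.toLinearMap ∘ₗ k ∘ₗ π' ∘ₗ eQ'.symm.toLinearMap)
  obtain ⟨I, q, j, hq, hj, rfl⟩ := exists_image f
  obtain ⟨V, v, hv⟩ := exists_cokernel j hj
  refine ⟨V, exists_equiv_of_ker_eq (f := mapL (D.morita hF₁ hF₂) v ∘ₗ eQ.toLinearMap) (g := π)
    ((hE.surjective hv.2.1).comp eQ.surjective) hπ fun x => ⟨fun h => ?_, fun h => ?_⟩⟩
  · obtain ⟨z, hz⟩ := (hE hv).exists_of_apply_eq_zero h
    obtain ⟨w, rfl⟩ := hE.surjective hq z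
    have h2 := LinearMap.congr_fun hf w
    rw [mapL_comp, LinearMap.comp_apply, hz] at h2
    have h3 : x = k (π' (eQ'.symm w)) := eQ.injective h2
    rw [h3, hs.apply_eq_zero]
  · obtain ⟨z, rfl⟩ := hs.exists_of_apply_eq_zero h
    obtain ⟨w, rfl⟩ := hπ' z
    have h2 := LinearMap.congr_fun hf (eQ' w)
    simp only [LinearMap.comp_apply, LinearEquiv.coe_coe, LinearEquiv.symm_apply_apply] at h2 ⊢
    rw [← h2, mapL_comp]
    exact (hE hv).apply_eq_zero _

end Functor

end IsProgenerator

end FockCat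

/-! ### The equivalence and its compatibility with the quotient functors -/

namespace FockCat

theorem hom_ext_linear {A : Type u} [Ring A] {M N : FGModuleCat.{u} A} {f g : M ⟶ N}
    (h : f.hom.hom = g.hom.hom) : f = g := congrArg toHom h

theorem nonempty_iso {A : Type u} [Ring A] {M N : FGModuleCat.{u} A} (e : M ≃ₗ[A] N) :
    Nonempty (M ≅ N) := ⟨
  { hom := FGModuleCat.ofHom e.toLinearMap
    inv := FGModuleCat.ofHom e.symm.toLinearMap
    hom_inv_id := by
      refine hom_ext_linear ?_
      exact LinearMap.ext e.symm_apply_apply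
    inv_hom_id := by
      refine hom_ext_linear ?_
      exact LinearMap.ext e.apply_symm_apply }⟩

theorem isLinearFunctor_inverse {R : Type u} [CommRing R] {A B : Type u} [Ring A] [Ring B]
    [Algebra R A] [Algebra R B] (Ψ : FGModuleCat.{u} A ≌ FGModuleCat.{u} B)
    (h : IsLinearFunctor R Ψ.functor) : IsLinearFunctor R Ψ.inverse := by
  have := h.1
  refine ⟨inferInstance, fun r M => Ψ.functor.map_injective ?_⟩
  rw [h.2, Equivalence.fun_inv_map]
  have h1 : scalarEnd R r M ≫ Ψ.counitInv.app M =
      Ψ.counitInv.app M ≫ scalarEnd R r (Ψ.functor.obj (Ψ.inverse.obj M)) := by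
    refine hom_ext_linear ?_
    exact LinearMap.ext fun x => LinearMap.map_smul_of_tower _ r x
  rw [h1]
  exact (Iso.hom_inv_id_app_assoc Ψ.counitIso M _)

namespace IsProgenerator

variable {R : Type u} [CommRing R] [IsNoetherianRing R] {A₁ A₂ B : Type u} [Ring A₁] [Ring A₂]
  [Ring B] [Algebra R A₁] [Algebra R A₂] [Algebra R B] [Module.Finite R A₁] [Module.Finite R A₂]
  [IsNoetherianRing A₁] [IsNoetherianRing A₂]
  {F₁ : FGModuleCat.{u} A₁ ⥤ FGModuleCat.{u} B} {F₂ : FGModuleCat.{u} A₂ ⥤ FGModuleCat.{u} B}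
  {Y : FGModuleCat.{u} A₂} {e : F₁.obj (regObj A₁) ≃ₗ[B] F₂.obj Y} {y : A₁ → (Y →ₗ[A₂] Y)}
  (D : IsProgenerator F₁ F₂ e y) (hF₁ : IsLinearFunctor R F₁) (hF₂ : IsLinearFunctor R F₂)

theorem morita_isEquivalence : (D.morita hF₁ hF₂).IsEquivalence where
  faithful := ⟨fun {V W} f g h => by
    refine hom_ext_linear ?_
    exact D.map_morita_injective hF₁ hF₂ (congrArg (fun k => k.hom.hom) h)⟩
  full := ⟨fun {V W} k => by
    obtain ⟨φ, hφ⟩ := D.exists_map_morita hF₁ hF₂ k.hom.hom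
    refine ⟨FGModuleCat.ofHom φ, ?_⟩
    refine hom_ext_linear ?_
    exact hφ⟩
  essSurj := ⟨fun M => by
    obtain ⟨V, ⟨eV⟩⟩ := D.exists_equiv_morita_obj hF₁ hF₂ M
    exact ⟨V, nonempty_iso eV⟩⟩

/-- Both functors are exact, and they agree on the projective generator `Y` together with its
endomorphisms, which determines them. -/
theorem exists_morita_iso (hE₁ : IsExactFunctor F₁) (hE₂ : IsExactFunctor F₂) :
    Nonempty (F₂ ≅ D.morita hF₁ hF₂ ⋙ F₁) := by
  have := D.projective
  have : Module.Projective A₁ (regObj A₁) := inferInstanceAs (Module.Projective A₁ A₁)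
  have hα : ∀ V : FGModuleCat.{u} A₂, ∃ φ : F₂.obj V →ₗ[B] F₁.obj ((D.morita hF₁ hF₂).obj V),
      ∀ g : Y →ₗ[A₂] V, φ ∘ₗ mapL F₂ g =
        mapL F₁ (evalAt ((D.moritaEquiv hF₁ hF₂ V).symm g)) ∘ₗ e.symm.toLinearMap := fun V =>
    exists_hom_of_compatible D.generates hE₂ hF₂.1
      { toFun := fun g =>
          mapL F₁ (evalAt ((D.moritaEquiv hF₁ hF₂ V).symm g)) ∘ₗ e.symm.toLinearMap
        map_zero' := by
          have h0 : evalAt (0 : (D.morita hF₁ hF₂).obj V) = 0 :=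
            regObj_ext ((evalAt_one _).trans (LinearMap.zero_apply _).symm)
          rw [map_zero, h0, mapL_zero hF₁.1, LinearMap.zero_comp]
        map_add' := fun g g' => by
          rw [map_add, evalAt_add, mapL_add hF₁.1, LinearMap.add_comp] }
      (fun g f => by
        obtain ⟨a, rfl⟩ := D.surjective f
        change mapL F₁ (evalAt (a • (D.moritaEquiv hF₁ hF₂ V).symm g)) ∘ₗ e.symm.toLinearMap =
          (mapL F₁ (evalAt ((D.moritaEquiv hF₁ hF₂ V).symm g)) ∘ₗ e.symm.toLinearMap) ∘ₗ
            mapL F₂ (y a)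
        rw [evalAt_smul, mapL_comp]
        refine comp_right_cancel e.surjective ?_
        rw [LinearMap.comp_assoc, LinearMap.comp_assoc _ (mapL F₂ (y a)), D.comm]
        refine LinearMap.ext fun x => ?_
        simp only [LinearMap.comp_apply, LinearEquiv.coe_coe, LinearEquiv.symm_apply_apply])
  choose α hα using hα
  have hβ : ∀ V : FGModuleCat.{u} A₂, ∃ φ : F₁.obj ((D.morita hF₁ hF₂).obj V) →ₗ[B] F₂.obj V,
      ∀ g : regObj A₁ →ₗ[A₁] (D.morita hF₁ hF₂).obj V, φ ∘ₗ mapL F₁ g =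
        mapL F₂ (D.moritaEquiv hF₁ hF₂ V (g (show regObj A₁ from (1 : A₁)))) ∘ₗ e.toLinearMap :=
    fun V => exists_hom_of_compatible generatedBy_regObj hE₁ hF₁.1
      { toFun := fun g =>
          mapL F₂ (D.moritaEquiv hF₁ hF₂ V (g (show regObj A₁ from (1 : A₁)))) ∘ₗ e.toLinearMap
        map_zero' := by
          rw [LinearMap.zero_apply, map_zero, mapL_zero hF₂.1, LinearMap.zero_comp]
        map_add' := fun g g' => by
          rw [LinearMap.add_apply, map_add, mapL_add hF₂.1, LinearMap.add_comp] }
      (fun g f => by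
        have h1 : g (f (show regObj A₁ from (1 : A₁))) =
            (show A₁ from f (show regObj A₁ from (1 : A₁))) •
              g (show regObj A₁ from (1 : A₁)) := by
          rw [← map_smul]
          exact congrArg g (mul_one (M := A₁) _).symm
        change mapL F₂ (D.moritaEquiv hF₁ hF₂ V (g (f _))) ∘ₗ e.toLinearMap =
          (mapL F₂ (D.moritaEquiv hF₁ hF₂ V (g _)) ∘ₗ e.toLinearMap) ∘ₗ mapL F₁ f
        rw [h1, moritaEquiv_smul, mapL_comp, LinearMap.comp_assoc, D.comm, LinearMap.comp_assoc]
        exact congrArg (fun h => _ ∘ₗ _ ∘ₗ mapL F₁ h) (evalAt_of_apply_one f))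
  choose β hβ using hβ
  have hαβ : ∀ V, α V ∘ₗ β V = LinearMap.id := fun V => by
    refine (generatedBy_regObj _).hom_ext hE₁ hF₁.1 fun g => ?_
    rw [LinearMap.comp_assoc, hβ, ← LinearMap.comp_assoc, hα, AddEquiv.symm_apply_apply,
      evalAt_of_apply_one, LinearMap.comp_assoc, LinearEquiv.symm_comp]
    rfl
  have hβα : ∀ V, β V ∘ₗ α V = LinearMap.id := fun V => by
    refine (D.generates V).hom_ext hE₂ hF₂.1 fun g => ?_
    rw [LinearMap.comp_assoc, hα, ← LinearMap.comp_assoc, hβ, evalAt_one,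
      AddEquiv.apply_symm_apply, LinearMap.comp_assoc, LinearEquiv.comp_symm]
    rfl
  refine ⟨NatIso.ofComponents (fun V =>
    { hom := FGModuleCat.ofHom (α V)
      inv := FGModuleCat.ofHom (β V)
      hom_inv_id := by
        refine hom_ext_linear ?_
        exact hβα V
      inv_hom_id := by
        refine hom_ext_linear ?_
        exact hαβ V }) fun {V W} f => ?_⟩
  refine hom_ext_linear ?_
  refine (D.generates V).hom_ext hE₂ hF₂.1 fun g => ?_
  change (α W ∘ₗ mapL F₂ f.hom.hom) ∘ₗ mapL F₂ g =
    (mapL F₁ (mapL (D.morita hF₁ hF₂) f.hom.hom) ∘ₗ α V) ∘ₗ mapL F₂ g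
  rw [LinearMap.comp_assoc, ← mapL_comp, hα, LinearMap.comp_assoc, hα, ← LinearMap.comp_assoc,
    ← mapL_comp, comp_evalAt]
  rfl

end IsProgenerator

namespace Pairing

variable {R : Type u} [CommRing R] [IsNoetherianRing R] [IsLocalRing R]
  {A₁ A₂ B : Type u} [Ring A₁] [Ring A₂] [Ring B]
  [Algebra R A₁] [Algebra R A₂] [Algebra R B] {Λ : Type} [Finite Λ] {ρ : Λ → ℕ}
  {Δ₁ P₁ : Λ → FGModuleCat.{u} A₁} {Δ₂ P₂ : Λ → FGModuleCat.{u} A₂}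
  {F₁ : FGModuleCat.{u} A₁ ⥤ FGModuleCat.{u} B} {F₂ : FGModuleCat.{u} A₂ ⥤ FGModuleCat.{u} B}
  {X₁ : FGModuleCat.{u} A₁} {X₂ : FGModuleCat.{u} A₂}
  [IsNoetherianRing A₁] [IsNoetherianRing A₂] [Module.Finite R A₁] [Module.Finite R A₂]
  [Module.Finite R B]

/-- The equivalence is the inverse of the Morita functor of `Y`. It is described on all matched
pairs of filtered objects, so that it is also known to preserve standard filtrations. -/
theorem exists_equivalence_filt (S : Pairing R ρ Δ₁ P₁ F₁ X₁ Δ₂ P₂ F₂ X₂) :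
    ∃ Φ : FGModuleCat.{u} A₁ ≌ FGModuleCat.{u} A₂, IsLinearFunctor R Φ.functor ∧
      (∀ (M₁ : FGModuleCat.{u} A₁) (M₂ : FGModuleCat.{u} A₂), stdFiltered Δ₁ M₁ →
        stdFiltered Δ₂ M₂ → Nonempty (F₁.obj M₁ ≃ₗ[B] F₂.obj M₂) →
        Nonempty (Φ.functor.obj M₁ ≅ M₂)) ∧
      Nonempty (Φ.functor ⋙ F₂ ≅ F₁) := by
  have : Module.Projective A₁ (regObj A₁) := inferInstanceAs (Module.Projective A₁ A₁)
  have hA₁ := S.hw₁.filt_of_projective (regObj A₁)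
  obtain ⟨Y, e, y, hY, D⟩ := S.exists_isProgenerator
  have hF₁ := S.quot₁.linear
  have hF₂ := S.quot₂.linear
  have := D.morita_isEquivalence hF₁ hF₂
  let E := (D.morita hF₁ hF₂).asEquivalence
  refine ⟨E.symm, isLinearFunctor_inverse E homRes_linear, fun M₁ M₂ hM₁ hM₂ ⟨eM⟩ => ?_, ?_⟩
  · obtain ⟨f⟩ := D.exists_equiv_morita hF₁ hF₂ eM (S.exists_map hY hM₂ e eM)
      (S.exists_map_back hA₁ hM₁ e eM) (fun _ _ => S.quot₂.faithful hY hM₂)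
      (fun _ _ => S.quot₁.faithful hA₁ hM₁)
    obtain ⟨i⟩ := nonempty_iso f
    exact ⟨E.inverse.mapIso i ≪≫ (E.unitIso.app M₂).symm⟩
  · obtain ⟨i⟩ := D.exists_morita_iso hF₁ hF₂ S.quot₁.exact S.quot₂.exact
    exact ⟨Functor.isoWhiskerLeft E.inverse i ≪≫ (Functor.associator _ _ _).symm ≪≫
      Functor.isoWhiskerRight E.counitIso F₁ ≪≫ F₁.leftUnitor⟩

theorem exists_equivalence (S : Pairing R ρ Δ₁ P₁ F₁ X₁ Δ₂ P₂ F₂ X₂) :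
    ∃ Φ : FGModuleCat.{u} A₁ ≌ FGModuleCat.{u} A₂, IsLinearFunctor R Φ.functor ∧
      (∀ a, Nonempty (Φ.functor.obj (Δ₁ a) ≅ Δ₂ a)) ∧
      Nonempty (Φ.functor ⋙ F₂ ≅ F₁) ∧
      ∃ (G : FGModuleCat.{u} B ⥤ FGModuleCat.{u} A₂) (_ : F₂ ⊣ G),
        Nonempty ((stdFiltered Δ₁).ι ⋙ Φ.functor ≅ (stdFiltered Δ₁).ι ⋙ F₁ ⋙ G) := by
  have : Module.Projective A₂ (regObj A₂) := inferInstanceAs (Module.Projective A₂ A₂)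
  have hA₂ := S.hw₂.filt_of_projective (regObj A₂)
  obtain ⟨Φ, hΦ, hobj, ⟨i⟩⟩ := S.exists_equivalence_filt
  refine ⟨Φ, hΦ, fun a => hobj _ _ (StdFiltered.single trivial) (StdFiltered.single trivial)
    (S.std a), ⟨i⟩, rightAdj S.quot₂.linear, rightAdjunction S.quot₂.linear S.quot₂.exact, ?_⟩
  -- The unit at `M` is `Hom(A₂, M) → Hom(F₂ A₂, F₂ M)`. The regular module is projective, hence
  -- standardly filtered, so full faithfulness makes the map bijective.
  have hunit : ∀ M, stdFiltered Δ₂ M →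
      IsIso ((rightAdjunction S.quot₂.linear S.quot₂.exact).unit.app M) := fun M hM => by
    rw [← isIso_iff_of_reflects_iso _ (forget (FGModuleCat.{u} A₂)), isIso_iff_bijective]
    refine ⟨fun m m' h => ?_, fun g => ?_⟩
    · refine evalAt_injective (S.quot₂.faithful hA₂ hM ?_)
      rw [← rightAdjunction_unit S.quot₂.linear S.quot₂.exact,
        ← rightAdjunction_unit S.quot₂.linear S.quot₂.exact]
      exact congrArg _ h
    · obtain ⟨f, hf⟩ := S.quot₂.full hA₂ hM (homResEquiv (regAction S.quot₂.linear) _ g)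
      refine ⟨f (show regObj A₂ from (1 : A₂)),
        (homResEquiv (regAction S.quot₂.linear) (F₂.obj M)).injective ?_⟩
      refine (rightAdjunction_unit S.quot₂.linear S.quot₂.exact M _).trans ?_
      rw [evalAt_of_apply_one, hf]
  let η := Functor.whiskerLeft ((stdFiltered Δ₁).ι ⋙ Φ.functor)
    (rightAdjunction S.quot₂.linear S.quot₂.exact).unit
  have hη : IsIso η := by
    -- `Φ M` is standardly filtered, being isomorphic to the counterpart of `M`.
    refine @NatIso.isIso_of_isIso_app _ _ _ _ _ _ η fun M => hunit _ ?_
    obtain ⟨M₂, hM₂, h⟩ := S.exists_match M.2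
    obtain ⟨j⟩ := hobj _ _ M.2 hM₂ h
    exact hM₂.of_equiv (FGModuleCat.isoToLinearEquiv j.symm)
  exact ⟨asIso η ≪≫ Functor.isoWhiskerLeft (stdFiltered Δ₁).ι
    (Functor.isoWhiskerRight i (rightAdj S.quot₂.linear))⟩

end Pairing

end FockCat

/-! ### The functors `Hom(P̄, -)` as quotient functors -/

namespace FockCat

section Equivalence

variable {A B : Type u} [Ring A] [Ring B]

theorem exists_mapL_eq {Ψ : FGModuleCat.{u} A ⥤ FGModuleCat.{u} B} [Ψ.Full]
    {M N : FGModuleCat.{u} A} (f : Ψ.obj M →ₗ[B] Ψ.obj N) : ∃ f' : M →ₗ[A] N, mapL Ψ f' = f :=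
  ⟨(Ψ.preimage (FGModuleCat.ofHom f : Ψ.obj M ⟶ Ψ.obj N)).hom.hom,
    congrArg (fun k : Ψ.obj M ⟶ Ψ.obj N => k.hom.hom) (Ψ.map_preimage (FGModuleCat.ofHom f))⟩

theorem mapL_injective {Ψ : FGModuleCat.{u} A ⥤ FGModuleCat.{u} B} [Ψ.Faithful]
    {M N : FGModuleCat.{u} A} {f g : M →ₗ[A] N} (h : mapL Ψ f = mapL Ψ g) : f = g := by
  have h1 : (FGModuleCat.ofHom f : M ⟶ N) = FGModuleCat.ofHom g := Ψ.map_injective (by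
    refine hom_ext_linear ?_
    exact h)
  exact congrArg (fun k : M ⟶ N => k.hom.hom) h1

theorem exists_obj_equiv {Ψ : FGModuleCat.{u} A ⥤ FGModuleCat.{u} B} [Ψ.EssSurj]
    (V : FGModuleCat.{u} B) : ∃ W : FGModuleCat.{u} A, Nonempty (V ≃ₗ[B] Ψ.obj W) :=
  ⟨Ψ.objPreimage V, ⟨FGModuleCat.isoToLinearEquiv (Ψ.objObjPreimageIso V).symm⟩⟩

/-- If `Ψ W` is the regular module, then elements of `Ψ M` are maps `W → M`. This gives injectivity
and exactness in the middle. -/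
theorem isExactFunctor_of_isEquivalence (Ψ : FGModuleCat.{u} A ⥤ FGModuleCat.{u} B)
    [Ψ.IsEquivalence] (hΨ : Ψ.Additive) : IsExactFunctor Ψ := by
  obtain ⟨W, ⟨i⟩⟩ := exists_obj_equiv (Ψ := Ψ) (regObj B)
  have hev : ∀ {M : FGModuleCat.{u} A} (x : Ψ.obj M), ∃ h : W →ₗ[A] M,
      mapL Ψ h (i (show regObj B from (1 : B))) = x := fun {M} x => by
    obtain ⟨h, hh⟩ := exists_mapL_eq (evalAt x ∘ₗ i.symm.toLinearMap)
    refine ⟨h, ?_⟩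
    rw [hh, LinearMap.comp_apply, LinearEquiv.coe_coe, LinearEquiv.symm_apply_apply, evalAt_one]
  have hext : ∀ {M : FGModuleCat.{u} A} {h h' : W →ₗ[A] M},
      mapL Ψ h (i (show regObj B from (1 : B))) = mapL Ψ h' (i (show regObj B from (1 : B))) →
      h = h' := fun {M h h'} hh => by
    refine mapL_injective (comp_right_cancel i.surjective (regObj_ext hh))
  intro M' M M'' f g hs
  refine isShortExact_of (fun x x' h => ?_) ?_ (fun x => ?_) fun x hx => ?_
  · obtain ⟨k, rfl⟩ := hev x
    obtain ⟨k', rfl⟩ := hev x'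
    have h1 : f ∘ₗ k = f ∘ₗ k' := hext (by rw [mapL_comp, mapL_comp]; exact h)
    rw [comp_left_cancel hs.1 h1]
  -- For surjectivity, the cokernel of `Ψ g` is brought back to the source category, where the
  -- corresponding map kills the surjection `g` and so vanishes.
  · obtain ⟨Q, q, hq, hker⟩ := exists_quotient (Ψ.obj M'') (LinearMap.range (mapL Ψ g))
    obtain ⟨V, ⟨j⟩⟩ := exists_obj_equiv (Ψ := Ψ) Q
    obtain ⟨q', hq'⟩ := exists_mapL_eq (j.toLinearMap ∘ₗ q)
    have h0 : q ∘ₗ mapL Ψ g = 0 := LinearMap.ext fun x => by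
      have h1 : mapL Ψ g x ∈ LinearMap.ker q := hker ▸ LinearMap.mem_range_self _ x
      exact h1
    have h1 : q' ∘ₗ g = 0 := mapL_injective (Ψ := Ψ) (by
      rw [mapL_comp, hq', LinearMap.comp_assoc, h0, LinearMap.comp_zero, mapL_zero hΨ])
    have h2 : q' = 0 := comp_right_cancel hs.2.1 (h1.trans (LinearMap.zero_comp _).symm)
    have h3 : ∀ x, q x = 0 := fun x => j.injective (by
      have h4 := LinearMap.congr_fun hq' x
      rw [h2, mapL_zero hΨ] at h4
      exact h4.symm.trans (map_zero j).symm)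
    intro y
    have h4 : y ∈ LinearMap.ker q := h3 y
    rw [hker] at h4
    exact h4
  · have h1 := LinearMap.congr_fun (mapL_comp Ψ f g) x
    rw [hs.comp_eq_zero, mapL_zero hΨ] at h1
    exact h1.symm
  · obtain ⟨k, rfl⟩ := hev x
    have h1 : g ∘ₗ k = 0 := hext (by
      rw [mapL_comp, mapL_zero hΨ]
      exact hx)
    obtain ⟨k', rfl⟩ := hs.exists_lift k h1
    exact ⟨mapL Ψ k' (i (show regObj B from (1 : B))), by rw [mapL_comp]; rfl⟩

theorem IsQuotientFunctor.comp_isEquivalence {R : Type u} [CommRing R] {A B C : Type u} [Ring A]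
    [Ring B] [Ring C] [Algebra R A] [Algebra R B] [Algebra R C] {Λ : Type}
    {Δ : Λ → FGModuleCat.{u} A} {F : FGModuleCat.{u} A ⥤ FGModuleCat.{u} B}
    {X : FGModuleCat.{u} A} (Q : IsQuotientFunctor R Δ F X)
    (Ψ : FGModuleCat.{u} B ⥤ FGModuleCat.{u} C) [Ψ.IsEquivalence] (hΨ : IsLinearFunctor R Ψ) :
    IsQuotientFunctor R Δ (F ⋙ Ψ) X where
  linear := by
    have := Q.linear.1
    have := hΨ.1
    refine ⟨inferInstance, fun r M => ?_⟩
    rw [Functor.comp_map, Q.linear.2, hΨ.2]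
    rfl
  exact := fun _ _ _ _ _ hs => isExactFunctor_of_isEquivalence Ψ hΨ.1 (Q.exact hs)
  full := fun {M N} hM hN φ => by
    obtain ⟨φ', hφ'⟩ := exists_mapL_eq (Ψ := Ψ) φ
    obtain ⟨f, rfl⟩ := Q.full hM hN φ'
    exact ⟨f, hφ'⟩
  faithful := fun hM hN _ _ h => Q.faithful hM hN (mapL_injective (Ψ := Ψ) h)
  projective := Q.projective
  generates := Q.generates
  not_filt := Q.not_filt

end Equivalence

section HomFunctor

theorem homFunctor_linear {R : Type u} [CommRing R] [IsNoetherianRing R] {A : Type u} [Ring A]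
    [Algebra R A] [Module.Finite R A] (P : FGModuleCat.{u} A) :
    IsLinearFunctor R (homFunctor R P) := by
  refine ⟨⟨fun {V W f g} => ?_⟩, fun r V => ?_⟩
  · refine hom_ext_linear ?_
    exact LinearMap.ext fun (x : P →ₗ[A] V) => LinearMap.add_comp _ _ _
  · refine hom_ext_linear ?_
    refine LinearMap.ext fun (x : P →ₗ[A] V) => LinearMap.ext fun y => ?_
    exact (LinearMap.map_smul_of_tower x r y).symm

theorem homFunctor_exact {R : Type u} [CommRing R] [IsNoetherianRing R] {A : Type u} [Ring A]
    [Algebra R A] [Module.Finite R A] (P : FGModuleCat.{u} A) [Module.Projective A P] :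
    IsExactFunctor (homFunctor R P) := by
  intro V' V V'' f g hs
  refine isShortExact_of (fun x y h => ?_) (fun y => ?_) (fun x => ?_) fun x hx => ?_
  · exact comp_left_cancel (X := P) hs.1 h
  · obtain ⟨k, hk⟩ := Module.projective_lifting_property g (show P →ₗ[A] V'' from y) hs.2.1
    exact ⟨k, hk⟩
  · exact LinearMap.ext fun y => hs.apply_eq_zero _
  · obtain ⟨k, hk⟩ := hs.exists_lift (show P →ₗ[A] V from x) hx
    exact ⟨k, hk⟩

theorem isReduction_bot {R : Type u} [CommRing R] {A : Type u} [Ring A] [Algebra R A]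
    [Module.Finite R A] (N : FGModuleCat.{u} A) [Module.Projective R N] :
    IsReduction (⊥ : Ideal R) (LinearMap.id : N →ₗ[A] N) :=
  ⟨Function.surjective_id, le_antisymm (fun x hx => by
    rw [show x = 0 from hx]
    exact Submodule.zero_mem _) fun _ hx => eq_zero_of_mem_dualSub_bot hx⟩

variable {R : Type u} [CommRing R] [IsNoetherianRing R] [IsLocalRing R] [IsDomain R]
  {A : Type u} [Ring A] [Algebra R A] [Module.Finite R A] [IsNoetherianRing A]
  {Λ : Type} [Finite Λ] {ρ : Λ → ℕ} {Δ P : Λ → FGModuleCat.{u} A} {𝔽 : Type u} [Field 𝔽]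
  [Algebra R 𝔽]

/-- Detection modulo the maximal ideal passes from standard objects to filtered ones, and then from
the maximal ideal to every ideal `J`. -/
theorem RankedHW.detects_of_filt (H : RankedHW R ρ Δ P)
    (h𝔽 : Function.Surjective (algebraMap R 𝔽)) {X : FGModuleCat.{u} A} [Module.Projective A X]
    (hX : FaithfulOn (homFunctor 𝔽 (baseChange R 𝔽 X))
      (stdFiltered fun a => baseChange R 𝔽 (Δ a)))
    {N : FGModuleCat.{u} A} (hN : stdFiltered Δ N) {J : Ideal R} {V : FGModuleCat.{u} A}
    {q : N →ₗ[A] V} (hq : IsReduction J q) : Detects X V := by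
  have := H.projective_of_filt hN
  obtain ⟨N', q', hq'⟩ := exists_reduction (RingHom.ker (algebraMap R 𝔽)) N
  exact detects_of_detects_residue h𝔽 hq' (H.detects_reduction
    (fun b V q hq => H.detects_of_faithfulOn h𝔽 hX b hq) hN hq') hq

/-- Two projectives are involved: the functor is `Hom(Y, -)`, with full faithfulness known over `K`,
while the detection and generation properties come from its summand `X`. -/
theorem RankedHW.isQuotientFunctor (H : RankedHW R ρ Δ P)
    (h𝔽 : Function.Surjective (algebraMap R 𝔽))
    (hreg : IsRegularIdeal (RingHom.ker (algebraMap R 𝔽))) (K : Type u) [Field K] [Algebra R K]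
    [IsFractionRing R K] {X Y : FGModuleCat.{u} A} [Module.Projective A X] [Module.Projective A Y]
    {i : X →ₗ[A] Y} {p : Y →ₗ[A] X} (hp : p ∘ₗ i = LinearMap.id)
    (hstd : FaithfulOn (homFunctor 𝔽 (baseChange R 𝔽 X))
      (stdFiltered fun a => baseChange R 𝔽 (Δ a)))
    (hcostd : FaithfulOn (homFunctor 𝔽 (baseChange R 𝔽 X))
      fun M => ∃ a, IsCostandard 𝔽 (fun a => baseChange R 𝔽 (Δ a)) a M)
    (hK : FullyFaithfulOn (homFunctor K (baseChange R K Y))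
      (stdFiltered fun a => baseChange R K (Δ a))) :
    IsQuotientFunctor R Δ (homFunctor R Y) X where
  linear := homFunctor_linear Y
  exact := homFunctor_exact Y
  full := fun {M N} hM hN φ => by
    have : Module.Flat R K := IsLocalization.flat K (nonZeroDivisors R)
    have := H.projective_of_filt hM
    have := H.projective_of_filt hN
    have := H.projective_of_filt (H.filt_of_projective Y)
    obtain ⟨r, f, hr, hf⟩ := hK.exists_smul_eq K (torsionFree_of_projective Y)
      (torsionFree_of_projective M) (torsionFree_of_projective N) (StdFiltered.baseChange hM)
      (StdFiltered.baseChange hN) φ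
    obtain ⟨f', hf'⟩ := H.exists_hom_ne_zero_smul hN
      (fun J V q hq => (H.detects_of_filt h𝔽 hstd hN hq).of_retract hp) hr hf
    exact ⟨f', LinearMap.ext fun g => (hf' g).symm⟩
  faithful := fun {M N} hM hN f g h => by
    have := H.projective_of_filt hN
    by_contra hfg
    obtain ⟨k, hk⟩ := ((H.detects_of_filt h𝔽 hstd hN (isReduction_bot N)).of_retract hp) M (f - g)
      (sub_ne_zero.mpr hfg)
    refine hk ?_
    rw [LinearMap.sub_comp, sub_eq_zero]
    exact LinearMap.congr_fun h k
  projective := inferInstance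
  generates := fun T hT hT' => by
    have := H.projective_of_filt hT
    exact H.generatedBy_of_extInjective h𝔽 hreg X
      (fun a b N N' hN hN' f hf => hN.exists_comp_ne_zero h𝔽 hcostd hN' hf) hT'
  not_filt := H.not_stdFiltered_ne hreg X
    fun a b N N' hN hN' f hf => hN.exists_comp_ne_zero h𝔽 hcostd hN' hf

end HomFunctor

section Isogeny

variable {R : Type u} [CommRing R] [IsDomain R] {A₁ A₂ B : Type u} [Ring A₁] [Ring A₂] [Ring B]
  [Algebra R A₁] [Algebra R A₂] [Algebra R B] [Module.Finite R A₁] [Module.Finite R A₂]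
  [Module.Finite R B]
  (K : Type u) [Field K] [Algebra R K] [IsFractionRing R K]

/-- Clear denominators in the isomorphism over `K` and in its inverse; the composite is
multiplication by the product of the two denominators. -/
theorem exists_isogeny {M N : FGModuleCat.{u} B} (hM : TorsionFree R M) (hN : TorsionFree R N)
    (h : Nonempty (baseChange R K M ≅ baseChange R K N)) :
    ∃ (α : M →ₗ[B] N) (β : N →ₗ[B] M) (r : R), r ≠ 0 ∧ α ∘ₗ β = r • LinearMap.id := by
  obtain ⟨i⟩ := h
  let e := FGModuleCat.isoToLinearEquiv i
  obtain ⟨r, α, hr, hα⟩ := hN.exists_baseChangeMap_eq_smul K e.toLinearMap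
  obtain ⟨r', β, hr', hβ⟩ := hM.exists_baseChangeMap_eq_smul K e.symm.toLinearMap
  refine ⟨α, β, r * r', mul_ne_zero hr hr', hN.baseChangeMap_injective K ?_⟩
  rw [baseChangeMap_comp, hα, hβ, baseChangeMap_smul, baseChangeMap_id]
  refine LinearMap.ext fun x => ?_
  simp only [LinearMap.comp_apply, LinearMap.smul_apply, LinearEquiv.coe_coe, map_mul, mul_smul,
    LinearMap.id_apply]
  have h := LinearMap.map_smul_of_tower e.toLinearMap (algebraMap R K r') (e.symm x)
  rw [LinearEquiv.coe_coe, LinearEquiv.apply_symm_apply] at h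
  rw [h]

variable {Λ : Type} {ρ : Λ → ℕ} {Δ₁ P₁ : Λ → FGModuleCat.{u} A₁} {Δ₂ P₂ : Λ → FGModuleCat.{u} A₂}
  {F₁ : FGModuleCat.{u} A₁ ⥤ FGModuleCat.{u} B} {F₂ : FGModuleCat.{u} A₂ ⥤ FGModuleCat.{u} B}
  {X₁ : FGModuleCat.{u} A₁} {X₂ : FGModuleCat.{u} A₂}

theorem vanish_of_baseChange_iso (H₁ : RankedHW R ρ Δ₁ P₁) (H₂ : RankedHW R ρ Δ₂ P₂)
    (Q₁ : IsQuotientFunctor R Δ₁ F₁ X₁) (Q₂ : IsQuotientFunctor R Δ₂ F₂ X₂)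
    (h : ∀ a, Nonempty (baseChange R K (F₁.obj (Δ₁ a)) ≅ baseChange R K (F₂.obj (Δ₂ a)))) :
    Vanish ρ (fun a => F₁.obj (Δ₁ a)) (fun a => F₂.obj (Δ₂ a)) := fun a b hab φ => by
  obtain ⟨α, β, r, hr, hαβ⟩ := exists_isogeny K (Q₁.std_torsionFree H₁ b)
    (Q₂.std_torsionFree H₂ b) (h b)
  exact hom_eq_zero_of_isogeny H₁ H₂ Q₁ Q₂ hab hr hαβ φ

end Isogeny

end FockCat

/-! ### The ring of power series and its regular maximal ideal -/

namespace FockCat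

section PowerSeries

variable (𝔽 : Type u) [Field 𝔽] (ℓ : ℕ)

instance : IsDomain (DefRing 𝔽 ℓ) :=
  have : NoZeroDivisors (DefRing 𝔽 ℓ) := inferInstance
  have : Nontrivial (DefRing 𝔽 ℓ) := inferInstance
  NoZeroDivisors.to_isDomain _

theorem algebraMap_residue_surjective : Function.Surjective (algebraMap (DefRing 𝔽 ℓ) 𝔽) :=
  fun a => ⟨MvPowerSeries.C a, MvPowerSeries.constantCoeff_C a⟩

/-- The ideal generated by the first `k` variables. -/
def variableIdeal (k : ℕ) : Ideal (DefRing 𝔽 ℓ) where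
  carrier := {f | ∀ d : Fin ℓ →₀ ℕ, (∀ i : Fin ℓ, (i : ℕ) < k → d i = 0) →
    MvPowerSeries.coeff d f = 0}
  zero_mem' := fun d _ => map_zero _
  add_mem' := fun {f g} hf hg d hd => by rw [map_add, hf d hd, hg d hd, add_zero]
  smul_mem' := fun c f hf d hd => by
    classical
    rw [smul_eq_mul, MvPowerSeries.coeff_mul]
    refine Finset.sum_eq_zero fun x hx => ?_
    rw [hf x.2 fun i hi => ?_, mul_zero]
    have h := DFunLike.congr_fun (Finset.HasAntidiagonal.mem_antidiagonal.mp hx) i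
    rw [hd i hi, Finsupp.add_apply] at h
    omega

theorem mem_variableIdeal {k : ℕ} {f : DefRing 𝔽 ℓ} : f ∈ variableIdeal 𝔽 ℓ k ↔
    ∀ d : Fin ℓ →₀ ℕ, (∀ i : Fin ℓ, (i : ℕ) < k → d i = 0) → MvPowerSeries.coeff d f = 0 := Iff.rfl

/-- Membership is the vanishing of all coefficients at monomials free of the first `k` variables.
Multiplication by the next variable shifts exponents and does not affect this condition on the
earlier variables, so that variable is regular modulo the ideal. -/
theorem isRegularIdeal_variableIdeal (k : ℕ) (hk : k ≤ ℓ) :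
    IsRegularIdeal (variableIdeal 𝔽 ℓ k) := by
  classical
  induction k with
  | zero =>
    have h : variableIdeal 𝔽 ℓ 0 = ⊥ := by
      refine eq_bot_iff.mpr fun f hf => ?_
      exact MvPowerSeries.ext fun d => hf d fun i hi => absurd hi (Nat.not_lt_zero _)
    rw [h]
    exact IsRegularIdeal.bot
  | succ k ih =>
    let z : Fin ℓ := ⟨k, hk⟩
    have hz : ∀ i : Fin ℓ, (i : ℕ) < k → (Finsupp.single z 1 : Fin ℓ →₀ ℕ) i = 0 := fun i hi =>
      Finsupp.single_eq_of_ne fun h => by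
        have h1 : (i : ℕ) = k := by rw [h]
        omega
    refine IsRegularIdeal.step (variableIdeal 𝔽 ℓ k) _ (MvPowerSeries.X z) (fun x hx d hd => ?_)
      (fun x => ⟨fun hx => ?_, ?_⟩) (ih (Nat.le_of_succ_le hk))
    · have h := hx (Finsupp.single z 1 + d) fun i hi => by
        rw [Finsupp.add_apply, hz i hi, hd i hi]
      rwa [MvPowerSeries.X_def, MvPowerSeries.coeff_add_monomial_mul, one_mul] at h
    · obtain ⟨u, hu⟩ : ∃ u : DefRing 𝔽 ℓ, ∀ d, MvPowerSeries.coeff d u =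
          MvPowerSeries.coeff (Finsupp.single z 1 + d) x :=
        ⟨fun d => MvPowerSeries.coeff (Finsupp.single z 1 + d) x, fun d => rfl⟩
      refine ⟨u, fun d hd => ?_⟩
      rw [map_sub, MvPowerSeries.X_def, MvPowerSeries.coeff_monomial_mul]
      split_ifs with h
      · obtain ⟨d', rfl⟩ := exists_add_of_le h
        rw [add_tsub_cancel_left, one_mul, hu, sub_self]
      · rw [sub_zero]
        refine hx d fun i hi => ?_
        rcases Nat.lt_succ_iff_lt_or_eq.mp hi with hi | hi
        · exact hd i hi
        · have hiz : i = z := Fin.ext hi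
          rw [hiz]
          by_contra h0
          exact h (Finsupp.single_le_iff.mpr (Nat.one_le_iff_ne_zero.mpr h0))
    · rintro ⟨u, hu⟩ d hd
      have h := hu d fun i hi => hd i (Nat.lt_succ_of_lt hi)
      rw [map_sub, MvPowerSeries.X_def, MvPowerSeries.coeff_monomial_mul, if_neg, sub_zero] at h
      · exact h
      · intro h1
        have h2 := hd z (Nat.lt_succ_self k)
        have h3 := Finsupp.single_le_iff.mp h1
        omega

theorem isRegularIdeal_ker_residue :
    IsRegularIdeal (RingHom.ker (algebraMap (DefRing 𝔽 ℓ) 𝔽)) := by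
  have h : RingHom.ker (algebraMap (DefRing 𝔽 ℓ) 𝔽) = variableIdeal 𝔽 ℓ ℓ := by
    ext f
    rw [RingHom.mem_ker, mem_variableIdeal]
    refine ⟨fun hf d hd => ?_, fun hf => ?_⟩
    · have h0 : d = 0 := Finsupp.ext fun i => hd i i.2
      rw [h0]
      exact hf
    · exact hf 0 fun i _ => rfl
  rw [h]
  exact isRegularIdeal_variableIdeal 𝔽 ℓ ℓ le_rfl

end PowerSeries

/-! ### An injective rank function refining the order on multipartitions -/

section Order

/-- Scale `w` by the number `m` of labels and break ties by an enumeration with values below `m`; a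
shift by a lower bound makes the result a natural number. -/
theorem exists_rank {Λ : Type} [Finite Λ] (w : Λ → ℤ) :
    ∃ ρ : Λ → ℕ, Function.Injective ρ ∧ ∀ a b, w a < w b → ρ a < ρ b := by
  obtain ⟨m, ⟨ε⟩⟩ := Finite.exists_equiv_fin Λ
  have hlt : ∀ a b, w a < w b → w a * m + (ε a : ℕ) < w b * m + (ε b : ℕ) := fun a b h => by
    have h1 : (w a + 1) * m ≤ w b * m := mul_le_mul_of_nonneg_right h (Int.natCast_nonneg m)
    have h2 := (ε a).2
    have h3 : ((ε a : ℕ) : ℤ) < m := by exact_mod_cast h2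
    have h4 : (0 : ℤ) ≤ (ε b : ℕ) := Int.natCast_nonneg _
    linarith
  obtain ⟨c, hc⟩ : ∃ c : ℤ, ∀ a, c ≤ w a * m + (ε a : ℕ) := by
    obtain ⟨c, hc⟩ := (Set.finite_range fun a => w a * (m : ℤ) + ((ε a : ℕ) : ℤ)).bddBelow
    exact ⟨c, fun a => hc (Set.mem_range_self a)⟩
  refine ⟨fun a => (w a * m + (ε a : ℕ) - c).toNat, fun a b h => ?_, fun a b h => ?_⟩
  · have ha := hc a
    have hb := hc b
    have h1 : w a * m + (ε a : ℕ) = w b * m + (ε b : ℕ) := by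
      have h2 := congrArg (Nat.cast : ℕ → ℤ) h
      simp only [Int.toNat_of_nonneg (sub_nonneg.mpr ha),
        Int.toNat_of_nonneg (sub_nonneg.mpr hb)] at h2
      linarith
    rcases lt_trichotomy (w a) (w b) with h2 | h2 | h2
    · exact absurd h1 (hlt a b h2).ne
    · rw [h2] at h1
      exact ε.injective (Fin.ext (by exact_mod_cast add_left_cancel h1))
    · exact absurd h1.symm (hlt b a h2).ne
  · have ha := hc a
    have h1 := hlt a b h
    change (w a * m + (ε a : ℕ) - c).toNat < (w b * m + (ε b : ℕ) - c).toNat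
    omega

variable {ℓ : ℕ}

instance finite_boxes (t : Fin ℓ → YoungDiagram) : Finite (boxes t) :=
  Finite.of_injective
    (fun b : boxes t => (⟨b.1.1, ⟨b.1.2, b.2⟩⟩ : Σ k : Fin ℓ, {c // c ∈ (t k).cells})) (by
    rintro ⟨⟨k, c⟩, h⟩ ⟨⟨k', c'⟩, h'⟩ hb
    simp only [Sigma.mk.injEq] at hb
    obtain ⟨rfl, h2⟩ := hb
    have h3 := congrArg Subtype.val (eq_of_heq h2)
    exact Subtype.ext (Prod.ext rfl h3))

noncomputable instance fintype_boxes (t : Fin ℓ → YoungDiagram) : Fintype (boxes t) :=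
  Fintype.ofFinite _

theorem mem_boxes_of_le {t : Fin ℓ → YoungDiagram} {k : Fin ℓ} {i j i' j' : ℕ}
    (h : (k, i, j) ∈ boxes t) (hi : i' ≤ i) (hj : j' ≤ j) : (k, i', j') ∈ boxes t :=
  (t k).isLowerSet (show ((i', j') : ℕ × ℕ) ≤ (i, j) from ⟨hi, hj⟩) h

/-- A tuple of diagrams is determined by the numbers of boxes with given content and component. -/
theorem boxes_subset_of_injective (s : Fin ℓ → ℤ) {t t' : Fin ℓ → YoungDiagram}
    {f : boxes t → boxes t'} (hf : Function.Injective f)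
    (hc : ∀ b, content s (f b).1 = content s b.1) (hk : ∀ b, (f b).1.1 = b.1.1) :
    boxes t ⊆ boxes t' := by
  rintro ⟨k, i, j⟩ h
  by_contra hn
  -- The diagonal of `(i, j)` contains `min i j + 1` boxes of `t` up to `(i, j)`. The map `f` stays
  -- on this diagonal, and if `(i, j)` is missing from `t'` then only `min i j` positions remain
  -- there, which contradicts injectivity.
  have hmem : ∀ a : Fin (min i j + 1), (k, i - min i j + a, j - min i j + a) ∈ boxes t :=
    fun a => mem_boxes_of_le h (by have := a.2; omega) (by have := a.2; omega)
  let g : Fin (min i j + 1) → Box ℓ := fun a => (f ⟨_, hmem a⟩).1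
  have hg : ∀ a, g a ∈ boxes t' := fun a => (f ⟨_, hmem a⟩).2
  have hgk : ∀ a, (g a).1 = k := fun a => hk ⟨_, hmem a⟩
  have hgc : ∀ a, ((g a).2.2 : ℤ) - (g a).2.1 = (j : ℤ) - i := fun a => by
    have h1 := hc ⟨_, hmem a⟩
    change ((g a).2.2 : ℤ) - (g a).2.1 + s (g a).1 =
      ((j - min i j + a : ℕ) : ℤ) - ((i - min i j + a : ℕ) : ℤ) + s k at h1
    rw [hgk] at h1
    omega
  have hlt : ∀ a, min (g a).2.1 (g a).2.2 < min i j := fun a => by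
    by_contra h1
    have h2 := hgc a
    refine hn (mem_boxes_of_le (i := (g a).2.1) (j := (g a).2.2) ?_ (by omega) (by omega))
    rw [← hgk a]
    exact hg a
  obtain ⟨a, -, b, -, hab, h1⟩ := Finset.exists_ne_map_eq_of_card_lt_of_maps_to
    (s := (Finset.univ : Finset (Fin (min i j + 1)))) (t := Finset.range (min i j))
    (by rw [Finset.card_range, Finset.card_univ, Fintype.card_fin]; omega)
    (f := fun a => min (g a).2.1 (g a).2.2) (fun a _ => Finset.mem_coe.mpr
      (Finset.mem_range.mpr (hlt a)))
  have ha := hgc a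
  have hb := hgc b
  have h2 : g a = g b := Prod.ext ((hgk a).trans (hgk b).symm)
    (Prod.ext (by omega) (by omega))
  have h3 := congrArg (fun x : boxes t => x.1.2.1) (hf (Subtype.ext h2))
  simp only [] at h3
  exact hab (Fin.ext (by omega))

theorem boxes_injective {t t' : Fin ℓ → YoungDiagram} (h : boxes t = boxes t') : t = t' := by
  funext k
  refine YoungDiagram.ext (Finset.ext fun c => ?_)
  have h1 : ((k, c) : Box ℓ) ∈ boxes t ↔ ((k, c) : Box ℓ) ∈ boxes t' := by rw [h]
  exact h1

/-- The sum of the positions of the boxes in the order of boxes. -/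
noncomputable def weight (s : Fin ℓ → ℤ) (t : Fin ℓ → YoungDiagram) : ℤ :=
  ∑ b : boxes t, (ℓ * content s b.1 + (b.1.1 : ℕ))

/-- Components are smaller than `ℓ`, so `ℓ * content + component` is monotone for the order on
boxes. Equality of the weights makes every matched pair agree in content and component, and these
numbers determine the diagrams. -/
theorem weight_lt {e n : ℕ} (s : Fin ℓ → ℤ) {t t' : MP ℓ n} (h : mpLE e s t t') (hne : t ≠ t') :
    weight s t.1 < weight s t'.1 := by
  obtain ⟨σ, hσ⟩ := h
  have hb : ∀ b : boxes t.1, ℓ * content s b.1 + (b.1.1 : ℕ) ≤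
      ℓ * content s (σ b).1 + ((σ b).1.1 : ℕ) ∧
      (ℓ * content s b.1 + (b.1.1 : ℕ) = ℓ * content s (σ b).1 + ((σ b).1.1 : ℕ) →
        content s (σ b).1 = content s b.1 ∧ (σ b).1.1 = b.1.1) := fun b => by
    have hk : ((b.1.1 : ℕ) : ℤ) < ℓ := by exact_mod_cast b.1.1.2
    have hk' : (0 : ℤ) ≤ ((σ b).1.1 : ℕ) := Int.natCast_nonneg _
    rcases (hσ b).2 with h | ⟨h, h'⟩
    · have h1 : (ℓ : ℤ) * (content s b.1 + 1) ≤ ℓ * content s (σ b).1 :=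
        mul_le_mul_of_nonneg_left h (Int.natCast_nonneg _)
      refine ⟨by linarith, fun h2 => by linarith⟩
    · have h1 : ((b.1.1 : ℕ) : ℤ) ≤ ((σ b).1.1 : ℕ) := by exact_mod_cast h'
      rw [h]
      exact ⟨by linarith, fun h2 => ⟨rfl, Fin.ext (by
        have h3 : ((b.1.1 : ℕ) : ℤ) = ((σ b).1.1 : ℕ) := by linarith
        exact_mod_cast h3.symm)⟩⟩
  have hsum : weight s t'.1 = ∑ b : boxes t.1, (ℓ * content s (σ b).1 + ((σ b).1.1 : ℕ)) :=
    (Fintype.sum_equiv σ _ _ fun _ => rfl).symm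
  rw [hsum]
  refine lt_of_le_of_ne (Finset.sum_le_sum fun b _ => (hb b).1) fun heq => hne (Subtype.ext ?_)
  have h1 := fun b => (hb b).2 ((Finset.sum_eq_sum_iff_of_le fun b _ => (hb b).1).mp heq b
    (Finset.mem_univ b))
  refine boxes_injective (Set.Subset.antisymm
    (boxes_subset_of_injective s σ.injective (fun b => (h1 b).1) fun b => (h1 b).2)
    (boxes_subset_of_injective s σ.symm.injective (fun b => ?_) fun b => ?_))
  · rw [← (h1 (σ.symm b)).1, Equiv.apply_symm_apply]
  · rw [← (h1 (σ.symm b)).2, Equiv.apply_symm_apply]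

theorem IsHighestWeight.rankedHW {R : Type u} [CommRing R] {A : Type u} [Ring A] [Algebra R A]
    {Λ : Type} {le : Λ → Λ → Prop} {Δ P : Λ → FGModuleCat.{u} A} (H : IsHighestWeight R le Δ P)
    {ρ : Λ → ℕ} (hρ : Function.Injective ρ) (hlt : ∀ a b, le a b → a ≠ b → ρ a < ρ b) :
    RankedHW R ρ Δ P where
  rank_injective := hρ
  std_projective := H.std_projective
  std_end := H.std_end
  std_hom := fun a b f hf => by
    by_cases hab : a = b
    · rw [hab]
    · exact (hlt a b (H.std_hom a b f hf) hab).le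
  std_generate := H.std_generate
  proj_projective := H.proj_projective
  proj_cover := fun a => by
    obtain ⟨K, f, g, hs, hK⟩ := H.proj_cover a
    exact ⟨K, f, g, hs, hK.mono fun b hb => hlt a b hb.1 hb.2⟩

end Order

end FockCat

/-! ### Projectivity of the objects defining the quotient functors -/

namespace FockCat

section Projectivity

variable {A B : Type u} [Ring A] [Ring B]

theorem epi_of_surjective {M N : FGModuleCat.{u} A} (f : M ⟶ N)
    (hf : Function.Surjective f.hom.hom) : Epi f :=
  ⟨fun g h e => hom_ext_linear (comp_right_cancel (h := g.hom.hom) (k := h.hom.hom) hf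
    (congrArg (fun k => k.hom.hom) e))⟩

theorem surjective_of_epi {M N : FGModuleCat.{u} A} (f : M ⟶ N) [Epi f] :
    Function.Surjective f.hom.hom := by
  obtain ⟨Q, q, hq, hker⟩ := exists_quotient N (LinearMap.range f.hom.hom)
  have h : f ≫ toHom q = f ≫ toHom 0 := hom_ext_linear (LinearMap.ext fun x => by
    have h1 : f.hom.hom x ∈ LinearMap.ker q := hker ▸ LinearMap.mem_range_self _ x
    exact h1)
  have h1 : q = 0 := congrArg (fun k => k.hom.hom) ((cancel_epi f).mp h)
  intro y
  have h2 : y ∈ LinearMap.ker q := LinearMap.congr_fun h1 y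
  rw [hker] at h2
  exact h2

theorem projective_obj {M : FGModuleCat.{u} A} [Module.Projective A M] : Projective M where
  factors {E X} f g _ := by
    obtain ⟨k, hk⟩ := Module.projective_lifting_property g.hom.hom f.hom.hom (surjective_of_epi g)
    exact ⟨toHom k, hom_ext_linear hk⟩

theorem projective_of_projective_obj {M : FGModuleCat.{u} A} [Projective M] :
    Module.Projective A M := by
  have : Module.Projective A (regObj A) := inferInstanceAs (Module.Projective A A)
  obtain ⟨n, Q, i, p, π, hQ, hπ⟩ := generatedBy_regObj M
  have := hQ.projective
  have : Epi (toHom π) := epi_of_surjective _ hπ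
  exact Module.Projective.of_split (Projective.factorThru (𝟙 M) (toHom π)).hom.hom π
    (congrArg (fun k => k.hom.hom) (Projective.factorThru_comp (𝟙 M) (toHom π)))

/-- `E` is also a left adjoint, so it preserves epimorphisms; hence its left adjoint `F` preserves
projectives. -/
theorem projective_of_biadjoint {F : FGModuleCat.{u} A ⥤ FGModuleCat.{u} B}
    {E : FGModuleCat.{u} B ⥤ FGModuleCat.{u} A} (adj : F ⊣ E) (adj' : E ⊣ F)
    (M : FGModuleCat.{u} A) [Module.Projective A M] : Module.Projective B (F.obj M) := by
  have := Functor.preservesEpimorphisms_of_adjunction adj'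
  have := adj.map_projective M projective_obj
  exact projective_of_projective_obj

theorem projective_pi {ι : Type} [Finite ι] (M : ι → Type u) [∀ i, AddCommGroup (M i)]
    [∀ i, Module A (M i)] [∀ i, Module.Projective A (M i)] : Module.Projective A (∀ i, M i) := by
  classical
  have := Fintype.ofFinite ι
  exact Module.Projective.of_equiv (DFinsupp.linearEquivFunOnFintype (R := A) (M := M))

theorem subsingleton_MP_zero (ℓ : ℕ) : Subsingleton (MP ℓ 0) := by
  have h : ∀ (t : MP ℓ 0) k, t.1 k = ⊥ := fun t k => by
    have h1 := (Finset.sum_eq_zero_iff.mp t.2) k (Finset.mem_univ k)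
    refine YoungDiagram.ext ?_
    exact (Finset.card_eq_zero.mp h1).trans YoungDiagram.cells_bot.symm
  exact ⟨fun t t' => Subtype.ext (funext fun k => (h t k).trans (h t' k).symm)⟩

/-- With a single label the kernel of `P a → Δ a` has nothing to be filtered by. This applies to
degree zero and makes `Δ(∅)` projective. -/
theorem IsHighestWeight.std_projective_of_subsingleton {R : Type u} [CommRing R] [Algebra R A]
    {Λ : Type} [Subsingleton Λ] {le : Λ → Λ → Prop} {Δ P : Λ → FGModuleCat.{u} A}
    (H : IsHighestWeight R le Δ P) (a : Λ) : Module.Projective A (Δ a) := by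
  obtain ⟨K, f, g, hs, hK⟩ := H.proj_cover a
  have := H.proj_projective a
  have := hK.subsingleton fun b hb => hb.2 (Subsingleton.elim _ _)
  have hg : Function.Bijective g := ⟨(injective_iff_map_eq_zero g).mpr fun x hx => by
    obtain ⟨y, rfl⟩ := hs.exists_of_apply_eq_zero hx
    rw [Subsingleton.elim y 0, map_zero], hs.2.1⟩
  exact Module.Projective.of_equiv (LinearEquiv.ofBijective g hg)

end Projectivity

namespace FockCategorification

variable {𝔽 : Type u} [Field 𝔽] {ℓ e : ℕ} {s : Fin ℓ → ℤ} {N : ℕ}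
  (O : FockCategorification 𝔽 ℓ e s N)

instance isNoetherianRing (n : ℕ) : IsNoetherianRing (O.A n) :=
  isNoetherian_of_tower (DefRing 𝔽 ℓ)
    (isNoetherian_of_isNoetherianRing_of_finite (DefRing 𝔽 ℓ) (O.A n))

variable [NeZero e]

theorem projective_Fobj {j : ℕ} (hj : j < N) {M : FGModuleCat.{u} (O.A j)}
    (hM : Module.Projective (O.A j) M) : Module.Projective (O.A (j + 1)) (O.Fobj M) := by
  have : ∀ i : ZMod e, Module.Projective (O.A (j + 1)) ((O.F i j).obj M) := fun i => by
    obtain ⟨adj'⟩ := O.biadjoint i j hj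
    exact projective_of_biadjoint (O.adj i j hj) adj' M
  have : Finite (ZMod e) := inferInstance
  exact projective_pi fun i : ZMod e => (O.F i j).obj M

theorem projective_zeroObj (j : ℕ) : Module.Projective (O.A j) (O.zeroObj j) :=
  inferInstanceAs (Module.Projective (O.A j) PUnit.{u + 1})

theorem projective_iterZero {M : FGModuleCat.{u} (O.A 0)} (hM : Module.Projective (O.A 0) M) :
    ∀ n, n ≤ N → Module.Projective (O.A n) (O.iterZero M n)
  | 0, _ => hM
  | n + 1, hn => O.projective_Fobj hn (projective_iterZero hM n (Nat.le_of_succ_le hn))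

theorem projective_iterOne {M : FGModuleCat.{u} (O.A 1)}
    (hM : 1 ≤ N → Module.Projective (O.A 1) M) :
    ∀ n, n ≤ N → Module.Projective (O.A n) (O.iterOne M n)
  | 0, _ => O.projective_zeroObj 0
  | 1, hn => hM hn
  | n + 2, hn => O.projective_Fobj hn (projective_iterOne hM (n + 1) (Nat.le_of_succ_le hn))

theorem projective_iterTwo {M : FGModuleCat.{u} (O.A 2)}
    (hM : 2 ≤ N → Module.Projective (O.A 2) M) :
    ∀ n, n ≤ N → Module.Projective (O.A n) (O.iterTwo M n)
  | 0, _ => O.projective_zeroObj 0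
  | 1, _ => O.projective_zeroObj 1
  | 2, hn => hM hn
  | n + 3, hn => O.projective_Fobj hn (projective_iterTwo hM (n + 2) (Nat.le_of_succ_le hn))

theorem projective_proj {n : ℕ} (hn : n ≤ N) : Module.Projective (O.A n) (O.proj n) := by
  have := subsingleton_MP_zero ℓ
  exact O.projective_iterZero
    ((O.highestWeight 0 (Nat.zero_le N)).std_projective_of_subsingleton _) n hn

variable [NeZero ℓ]

theorem projective_nuPart {n : ℕ} (hn : n ≤ N) : Module.Projective (O.A n) (O.nuPart n) := by
  by_cases he : e = 2
  · rw [nuPart, if_pos he]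
    exact O.projective_iterTwo (fun h => (O.highestWeight 2 h).proj_projective _) n hn
  · rw [nuPart, if_neg he]
    exact O.projective_zeroObj n

theorem projective_bigProj {n : ℕ} (hn : n ≤ N) : Module.Projective (O.A n) (O.bigProj n) := by
  have := O.projective_proj hn
  have := O.projective_nuPart hn
  have h1 : ∀ t : {t : MP ℓ 1 // IsSingular e s t.1},
      Module.Projective (O.A n) (O.iterOne (O.P 1 t.1) n) := fun t =>
    O.projective_iterOne (fun h => (O.highestWeight 1 h).proj_projective _) n hn
  have := projective_pi (A := O.A n)
    fun t : {t : MP ℓ 1 // IsSingular e s t.1} => O.iterOne (O.P 1 t.1) n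
  exact inferInstanceAs (Module.Projective (O.A n) (O.proj n ×
    (∀ t : {t : MP ℓ 1 // IsSingular e s t.1}, O.iterOne (O.P 1 t.1) n) × O.nuPart n))

theorem exists_retraction (n : ℕ) : ∃ (i : O.proj n →ₗ[O.A n] O.bigProj n)
    (p : O.bigProj n →ₗ[O.A n] O.proj n), p ∘ₗ i = LinearMap.id :=
  ⟨LinearMap.inl (O.A n) (O.proj n)
      ((∀ t : {t : MP ℓ 1 // IsSingular e s t.1}, O.iterOne (O.P 1 t.1) n) × O.nuPart n),
    LinearMap.fst (O.A n) (O.proj n)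
      ((∀ t : {t : MP ℓ 1 // IsSingular e s t.1}, O.iterOne (O.P 1 t.1) n) × O.nuPart n), rfl⟩

theorem isQuotientFunctor_piBar {n : ℕ} (hn : n ≤ N) {ρ : MP ℓ n → ℕ}
    (H : RankedHW (DefRing 𝔽 ℓ) ρ (O.Δ n) (O.P n)) (h : O.FMinusOne n) (h' : O.FZero n) :
    IsQuotientFunctor (DefRing 𝔽 ℓ) (O.Δ n) (O.piBar n) (O.proj n) := by
  have := O.projective_proj hn
  have := O.projective_bigProj hn
  obtain ⟨i, p, hp⟩ := O.exists_retraction n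
  exact H.isQuotientFunctor (algebraMap_residue_surjective 𝔽 ℓ) (isRegularIdeal_ker_residue 𝔽 ℓ)
    (FracField 𝔽 ℓ) hp h.1 h.2 h'

end FockCategorification

/-- If `Hom(Z₁, -)` and `Hom(Z₂, Ψ -)` are isomorphic for a fully faithful functor `Ψ` that hits
`Z₂`, then `Ψ Z₁` and `Z₂` are isomorphic. -/
theorem exists_iso_of_hom_iso {C₁ C₂ : Type*} [Category C₁] [Category C₂] (Ψ : C₁ ⥤ C₂)
    [Ψ.IsEquivalence] {Z₁ : C₁} {Z₂ : C₂} (τ : ∀ V, (Z₁ ⟶ V) ≃ (Z₂ ⟶ Ψ.obj V))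
    (hτ : ∀ {V W} (f : V ⟶ W) (g : Z₁ ⟶ V), τ W (g ≫ f) = τ V g ≫ Ψ.map f) :
    Nonempty (Ψ.obj Z₁ ≅ Z₂) := by
  let i := Ψ.objObjPreimageIso Z₂
  let β := (τ _).symm i.inv
  have h1 : τ Z₁ (𝟙 Z₁) ≫ Ψ.map β = i.inv := by
    rw [← hτ, Category.id_comp, Equiv.apply_symm_apply]
  refine ⟨{ hom := Ψ.map β ≫ i.hom, inv := τ Z₁ (𝟙 Z₁), hom_inv_id := ?_, inv_hom_id := ?_ }⟩
  · obtain ⟨γ, hγ⟩ := Ψ.map_surjective ((Ψ.map β ≫ i.hom) ≫ τ Z₁ (𝟙 Z₁))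
    have h2 : γ = 𝟙 Z₁ := (τ Z₁).injective (by
      rw [← Category.id_comp γ, hτ, hγ, Category.assoc, reassoc_of% h1, Iso.inv_hom_id_assoc])
    rw [← hγ, h2, Ψ.map_id]
  · rw [reassoc_of% h1, Iso.inv_hom_id]

end FockCat

/-! ### The pairing of the two categorifications and the conclusion -/

namespace FockCat

variable {𝔽 : Type u} [Field 𝔽] {ℓ e : ℕ} [NeZero e] [NeZero ℓ] {s : Fin ℓ → ℤ} {N n : ℕ}
  {O₁ O₂ : FockCategorification 𝔽 ℓ e s N}

/-- The functors `piUnder` are represented by the images of `F^n Δ(∅)`, so the intertwining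
isomorphism identifies these images by Yoneda. -/
theorem ExtendedQuotientEquiv.proj_equiv (I : ExtendedQuotientEquiv O₁ O₂ n) :
    Nonempty ((O₁.piBar n ⋙ I.equiv.functor).obj (O₁.proj n) ≃ₗ[O₂.BigEnd n]
      (O₂.piBar n).obj (O₂.proj n)) := by
  obtain ⟨τ⟩ := I.intertwines
  let Z₁ := (O₁.piBar n).obj (O₁.proj n)
  let Z₂ := (O₂.piBar n).obj (O₂.proj n)
  let T := I.equiv.functor ⋙ O₂.piUnder n ⋙
    restrictFG (DefRing 𝔽 ℓ) (AlgHom.op I.identify.toAlgHom)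
  -- Restriction of scalars leaves underlying sets alone, so elements of these modules are exactly
  -- the morphisms out of `Z₁` and `Z₂`.
  let a₁ : ∀ V, (Z₁ ⟶ V) → (O₁.piUnder n).obj V := fun V g => g.hom.hom
  let b₁ : ∀ V, (O₁.piUnder n).obj V → (Z₁ ⟶ V) := fun V x =>
    toHom (show Z₁ →ₗ[O₁.BigEnd n] V from x)
  let a₂ : ∀ V, (Z₂ ⟶ I.equiv.functor.obj V) → T.obj V := fun V g => g.hom.hom
  let b₂ : ∀ V, T.obj V → (Z₂ ⟶ I.equiv.functor.obj V) := fun V x =>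
    toHom (show Z₂ →ₗ[O₂.BigEnd n] I.equiv.functor.obj V from x)
  let τ' : ∀ V, (Z₁ ⟶ V) ≃ (Z₂ ⟶ I.equiv.functor.obj V) := fun V =>
    { toFun := fun g => b₂ V ((τ.hom.app V).hom.hom (a₁ V g))
      invFun := fun g => b₁ V ((τ.inv.app V).hom.hom (a₂ V g))
      left_inv := fun g => congrArg (b₁ V)
        (LinearMap.congr_fun (congrArg (fun k => k.hom.hom) (τ.hom_inv_id_app V)) (a₁ V g))
      right_inv := fun g => congrArg (b₂ V)
        (LinearMap.congr_fun (congrArg (fun k => k.hom.hom) (τ.inv_hom_id_app V)) (a₂ V g)) }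
  obtain ⟨i⟩ := exists_iso_of_hom_iso I.equiv.functor τ' fun {V W} f g => congrArg (b₂ W)
    (LinearMap.congr_fun (congrArg (fun k => k.hom.hom) (τ.hom.naturality f)) (a₁ V g))
  exact ⟨FGModuleCat.isoToLinearEquiv i⟩

theorem ExtendedQuotientEquiv.exists_pairing (hn : n ≤ N)
    (hF₁ : O₁.FMinusOne n) (hF₂ : O₂.FMinusOne n) (hF₁' : O₁.FZero n) (hF₂' : O₂.FZero n)
    (I : ExtendedQuotientEquiv O₁ O₂ n) (hS : I.MatchesStandards) :
    ∃ ρ : MP ℓ n → ℕ, Pairing (DefRing 𝔽 ℓ) ρ (O₁.Δ n) (O₁.P n)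
      (O₁.piBar n ⋙ I.equiv.functor) (O₁.proj n) (O₂.Δ n) (O₂.P n) (O₂.piBar n) (O₂.proj n) := by
  obtain ⟨ρ, hρ, hlt⟩ := exists_rank fun t : MP ℓ n => weight s t.1
  have H₁ := (O₁.highestWeight n hn).rankedHW hρ fun a b h h' => hlt a b (weight_lt s h h')
  have H₂ := (O₂.highestWeight n hn).rankedHW hρ fun a b h h' => hlt a b (weight_lt s h h')
  have Q₁ := (O₁.isQuotientFunctor_piBar hn H₁ hF₁ hF₁').comp_isEquivalence I.equiv.functor
    I.linear
  have Q₂ := O₂.isQuotientFunctor_piBar hn H₂ hF₂ hF₂'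
  -- Here (S) enters, through isogenies only; integral isomorphisms of the standard images are then
  -- deduced with the help of `proj_equiv`.
  have hv₁ := vanish_of_baseChange_iso (FracField 𝔽 ℓ) H₁ H₂ Q₁ Q₂ hS
  have hv₂ := vanish_of_baseChange_iso (FracField 𝔽 ℓ) H₂ H₁ Q₂ Q₁
    fun a => (hS a).map Iso.symm
  obtain ⟨i⟩ := I.proj_equiv
  exact ⟨ρ, H₁, H₂, Q₁, Q₂, hv₁, hv₂, fun a => Q₁.exists_std_equiv H₁ H₂ Q₂ hv₁ hv₂ i a, ⟨i⟩⟩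

end FockCat

theorem mainTheorem2 {𝔽 : Type u} [Field 𝔽] {e ℓ : ℕ} [NeZero e] [NeZero ℓ] (he : 1 < e)
    (s : Fin ℓ → ℤ) (N n : ℕ) (hn : n ≤ N)
    (O₁ O₂ : FockCat.FockCategorification 𝔽 ℓ e s N)
    (hF₁ : O₁.FMinusOne n) (hF₂ : O₂.FMinusOne n)
    (hF₁' : O₁.FZero n) (hF₂' : O₂.FZero n)
    (I : FockCat.ExtendedQuotientEquiv O₁ O₂ n) (hS : I.MatchesStandards) :
    ∃ Φ : FGModuleCat.{u} (O₁.A n) ≌ FGModuleCat.{u} (O₂.A n),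
      FockCat.IsLinearFunctor (FockCat.DefRing 𝔽 ℓ) Φ.functor ∧
      (∀ t : FockCat.MP ℓ n, Nonempty (Φ.functor.obj (O₁.Δ n t) ≅ O₂.Δ n t)) ∧
      Nonempty (Φ.functor ⋙ O₂.piBar n ≅ O₁.piBar n ⋙ I.equiv.functor) ∧
      ∃ (G : FGModuleCat.{u} (O₂.BigEnd n) ⥤ FGModuleCat.{u} (O₂.A n)) (_ : O₂.piBar n ⊣ G),
        Nonempty ((FockCat.stdFiltered (O₁.Δ n)).ι ⋙ Φ.functor ≅
          (FockCat.stdFiltered (O₁.Δ n)).ι ⋙ O₁.piBar n ⋙ I.equiv.functor ⋙ G) := by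
  obtain ⟨ρ, S⟩ := I.exists_pairing hn hF₁ hF₂ hF₁' hF₂' hS
  exact S.exists_equivalence
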